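/- Fix real numbers $m_0>0$, $0<m_1\le m_2$, $\upsilon_0>0$ (gravitational constant $1$). For $\varepsilon>0$ put $\mu_j=m_0+\varepsilon m_j$, $\hat m_j=m_0m_j/(m_0+\varepsilon m_j)$, $a_{j,0}=\mu_j^{1/3}\upsilon_0^{-2/3}$, $\Lambda_{j,0}=\hat m_j\sqrt{\mu_ja_{j,0}}$, and consider the planar planetary three-body Hamiltonian $\mathcal H_K+\mathcal H_P$ with $$\mathcal H_K=\sum_{j=1,2}\Big(\frac{\|\tilde r_j\|^2}{2\hat m_j}-\frac{\mu_j\hat m_j}{\|r_j\|}\Big),\qquad \mathcal H_P=\varepsilon\Big(\frac{\tilde r_1\cdot\tilde r_2}{m_0}-\frac{m_1m_2}{\|r_1-r_2\|}\Big)$$ in Poincaré's variables $\Lambda_j=\hat m_j\sqrt{\mu_ja_j}$, $\lambda_j$, $x_j=\sqrt{\Lambda_j}\sqrt{1-\sqrt{1-e_j^2}}\,e^{i\varpi_j}$, $\tilde x_j=-i\bar x_j$ ($a_j,e_j,\lambda_j,\varpi_j$ being the semi-major axis, eccentricity, mean longitude and longitude of the pericentre of planet $j$), and then in the resonant variables $Z=(\Lambda_1-\Lambda_{1,0},\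 \Lambda_1-\Lambda_{1,0}+\Lambda_2-\Lambda_{2,0})$, $\zeta=(\lambda_1-\lambda_2,\lambda_2)$, $x$, $\tilde x$. It becomes $H=H_K(Z)+H_P(Z,\zeta,x,\tilde x)$ with $$H_K(Z)=-\frac{\hat m_1^3\mu_1^2}{2(\Lambda_{1,0}+Z_1)^2}-\frac{\hat m_2^3\mu_2^2}{2(\Lambda_{2,0}+Z_2-Z_1)^2},$$ and is extended holomorphically to complex arguments. All norms of vectors are supremum norms. For $\hat\Delta,\rho,\sigma>0$ let $\hat{\mathcal K}_{\rho,\sigma}$ be the set of all $(Z,\zeta,x,\tilde x)\in\mathbb C^8$ such that $|Z|\le\rho$, $|\zeta-\theta|\le\sigma$ for some real $\theta=(\theta_1,\theta_2)$ with $\theta_1\in[\hat\Delta,2\pi-\hat\Delta]$, and $|(x,\tilde x)|\le\sqrt{\rho\sigma}$; $\zeta_2$ is taken modulo $2\pi$. Given $\sigma_0>0$ and $\beta$, put $(\rho,\sigma)=\sigma_0(\varepsilon^\beta,1)$, $\hat{\mathcal K}_p=\hat{\mathcal K}_{p\rho,p\sigma}$, and let $\|\cdot\|_p$ be the supremum norm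 on $\hat{\mathcal K}_p$. An overbar on a function denotes its average over $\zeta_2\in[0,2\pi]$. A *first averaging transformation with constant $C$* is a map $\bar\Upsilon:(\dot Z,\dot\zeta,\dot x,\dot{\tilde x})\mapsto(Z,\zeta,x,\tilde x)$ that is analytic, injective, symplectic for $dZ\wedge d\zeta+dx\wedge d\tilde x$ and real at real points on $\hat{\mathcal K}_{1/3}$, with $\hat{\mathcal K}_{1/6}\subseteq\bar\Upsilon(\hat{\mathcal K}_{1/3})\subseteq\hat{\mathcal K}_{1/2}$, such that, with $H_*:=H\circ\bar\Upsilon-H_K-\overline{H}_P$ and $\alpha=(1-2\beta)/5$, $$\|\overline{H}_*\|_{1/3}\le C\varepsilon^{2-\beta},\qquad \|H_*-\overline{H}_*\|_{1/3}\le C\varepsilon\exp(-\varepsilon^{-\alpha}),$$ $$\|\dot Z-Z\|_{1/3}\le C\varepsilon,\qquad \|\dot\zeta-\zeta\|_{1/3}\le C\varepsilon^{1-\beta},\qquad \|(\dot x,\dot{\tilde x})-(x,\tilde x)\|_{1/3}\le C\varepsilon^{1-\beta/2},$$ and $H\circ\bar\Upsilon$ satisfies the D'Alembert rule: it is invariant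 under $(\zeta_2,x,\tilde x)\mapsto(\zeta_2+\theta,e^{i\theta}x,e^{-i\theta}\tilde x)$, $\theta\in\mathbb R$. The averaged Hamiltonian is then $\overline{H}=H_K+\overline{H}_P+\overline{H}_*$. **Theorem (Hamiltonian reduction).** Let $\kappa=m_1/(m_1+m_2)$ and $$\tilde\Psi(I,\varphi,w,\tilde w)=(I_1+\kappa I_2,\ I_2,\ \varphi_1,\ \varphi_2-\kappa\varphi_1,\ w,\ \tilde w).$$ Then $\tilde\Psi$ is symplectic and $\hat{\mathcal K}_{1/18}\subseteq\tilde\Psi(\hat{\mathcal K}_{1/6})\subseteq\hat{\mathcal K}_{1/4}$. Moreover there is $c>0$, depending only on $m_0,m_1,m_2,\upsilon_0$, such that for all $\hat\Delta>0$, $0<\sigma_0\le c\hat\Delta$ and $1/7<\beta<1/2$: there is a constant $C_1$ such that for all sufficiently small $\varepsilon>0$ a first averaging transformation with constant $C_1$ exists; and for every $C_1>0$ there are $C,\varepsilon_0>0$ such that, for all $0<\varepsilon<\varepsilon_0$ and every first averaging transformation with constant $C_1$, one has on $\hat{\mathcal K}_{1/6}$ $$\overline{H}\circ\tilde\Psi-H_K(0)=\tilde{H}_1(I_1,\varphi_1)+H_2(I_2)+\tilde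 Q(\varphi_1,w,\tilde w)+\tilde R(I,\varphi_1,w,\tilde w),$$ $$\tilde H_1=\upsilon_0\big(-AI_1^2+\varepsilon B\mathcal F(\varphi_1)\big),\qquad H_2=\upsilon_0\big(I_2-EI_2^2\big),$$ $$\tilde Q=i\varepsilon\upsilon_0D\Big(\frac{\tilde{\mathcal A}(\varphi_1)}{m_1}w_1\tilde w_1+\frac{\tilde{\mathcal B}(\varphi_1)}{\sqrt{m_1m_2}}w_1\tilde w_2+\frac{\tilde{\mathcal B}^{c}(\varphi_1)}{\sqrt{m_1m_2}}\tilde w_1w_2+\frac{\tilde{\mathcal A}(\varphi_1)}{m_2}w_2\tilde w_2\Big),$$ $$\tilde R=\tilde R_0(I,\varphi_1)+\sum_{j,k\in\{1,2\}}\tilde R_{(j,k)}(I,\varphi_1,w,\tilde w)\,w_j\tilde w_k,$$ with $\tilde R_0,\tilde R_{(j,k)}$ analytic on $\hat{\mathcal K}_{1/6}$, where, with $\mathcal D(\varphi)=\sqrt{2-2\cos\varphi}$, $$\mathcal F=\tfrac23\big(\cos\varphi-\mathcal D^{-1}\big),\qquad \tilde{\mathcal A}=\tfrac{\mathcal D^{-5}}{4}\big(5\cos2\varphi-13+8\cos\varphi\big)-\cos\varphi,$$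 $$\tilde{\mathcal B}=e^{-2i\varphi}-\tfrac{\mathcal D^{-5}}8\big(e^{-3i\varphi}+16e^{-2i\varphi}-26e^{-i\varphi}+9e^{i\varphi}\big),$$ $\tilde{\mathcal B}^{c}(\varphi)=\overline{\tilde{\mathcal B}(\overline{\varphi})}$ (here the bars are complex conjugation), and $$A=\tfrac32\upsilon_0^{1/3}m_0^{-2/3}\Big(\frac1{m_1}+\frac1{m_2}\Big),\quad B=\tfrac32\upsilon_0^{-1/3}m_0^{2/3}D,\quad D=\frac{m_1m_2}{m_0},\quad E=\tfrac32\upsilon_0^{1/3}m_0^{-2/3}(m_1+m_2)^{-1}.$$ The remainder satisfies $\|\tilde R\|_{1/6}\le C\varepsilon^{3\beta}$ and, if $\beta>1/3$, also $\|\tilde R_{(j,k)}\|_{1/6}\le C\varepsilon^{2-2\beta}$ for all $j,k\in\{1,2\}$. -/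

import Mathlib

open Complex Filter Set

noncomputable section

namespace Coorbital

/-- Complex vectors with two entries (entry `0` belongs to the first planet, entry `1` to the
second one); the norm is the supremum norm. -/
abbrev Vec : Type := Fin 2 → ℂ

/-- Complexified phase space, with points `(Z, ζ, x, x̃)`; the norm is the supremum norm. -/
abbrev Phase : Type := Vec × Vec × Vec × Vec

/-! ### Masses and exact resonance -/

/-- `μ_j = m₀ + ε m_j`. -/
def mu (m₀ : ℝ) (m : Fin 2 → ℝ) (ε : ℝ) (j : Fin 2) : ℝ := m₀ + ε * m j

/-- Reduced mass `m₀ m_j / (m₀ + ε m_j)`. -/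
def mhat (m₀ : ℝ) (m : Fin 2 → ℝ) (ε : ℝ) (j : Fin 2) : ℝ := m₀ * m j / (m₀ + ε * m j)

/-- Exact-resonant semi-major axis `a_{j,0} = μ_j^{1/3} υ₀^{-2/3}`. -/
def aRes (m₀ : ℝ) (m : Fin 2 → ℝ) (υ₀ ε : ℝ) (j : Fin 2) : ℝ :=
  mu m₀ m ε j ^ (1 / 3 : ℝ) * υ₀ ^ (-(2 / 3) : ℝ)

/-- Exact-resonant action `Λ_{j,0} = m̂_j √(μ_j a_{j,0})`. -/
def LamRes (m₀ : ℝ) (m : Fin 2 → ℝ) (υ₀ ε : ℝ) (j : Fin 2) : ℝ :=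
  mhat m₀ m ε j * √(mu m₀ m ε j * aRes m₀ m υ₀ ε j)

/-! ### Poincaré's complex variables -/

/-- The eccentric longitude `F = E + ϖ`, as a function of the mean longitude `lam`, of
`z = e exp(iϖ)` and of `zb` (equal to `e exp(-iϖ)` at real points): the limit of the fixed-point
iteration for Kepler's equation `F = lam + e sin (F - ϖ)`. -/
def eccLongitude (lam z zb : ℂ) : ℂ :=
  limUnder atTop fun n : ℕ =>
    (fun F : ℂ => lam + (zb * exp (I * F) - z * exp (-(I * F))) / (2 * I))^[n] lam

/-- The (complexified) map from the Poincaré variables `(Λ, λ, x, x̃)` of one planet of reduced mass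
`mh`, attracted by a fixed centre of mass `μ`, to its momentum and position `(r̃, r)` on the
osculating Kepler ellipse.
At real points `x̃ = -i x̄`, so that `q = |x|² / Λ = 1 - √(1 - e²)`, `η = √(1 - e²)`,
`z = e exp(iϖ)`, `zb` is the conjugate of `z`, `u = r_x + i r_y` is the position
`a (cos E - e + i η sin E) exp(iϖ)`, `v` is its conjugate, and `du`, `dv` are the derivatives
of `u`, `v` along the Kepler motion (mean motion `n = μ² mh³ / Λ³`). -/
def poincare (mh μ : ℝ) (Λ lam x xt : ℂ) : Vec × Vec :=
  let q : ℂ := I * x * xt / Λ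
  let η : ℂ := 1 - q
  let s : ℂ := (2 - q) ^ (1 / 2 : ℂ) / Λ ^ (1 / 2 : ℂ)
  let z : ℂ := x * s
  let zb : ℂ := I * xt * s
  let F : ℂ := eccLongitude lam z zb
  let a : ℂ := Λ ^ 2 / ((mh : ℂ) ^ 2 * μ)
  let n : ℂ := (μ : ℂ) ^ 2 * (mh : ℂ) ^ 3 / Λ ^ 3
  let Fdot : ℂ := n / (1 - (zb * exp (I * F) + z * exp (-(I * F))) / 2)
  let u : ℂ := a * ((1 + η) / 2 * exp (I * F) + z ^ 2 / (2 * (1 + η)) * exp (-(I * F)) - z)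
  let v : ℂ := a * ((1 + η) / 2 * exp (-(I * F)) + zb ^ 2 / (2 * (1 + η)) * exp (I * F) - zb)
  let du : ℂ :=
    a * Fdot * (I * ((1 + η) / 2 * exp (I * F) - z ^ 2 / (2 * (1 + η)) * exp (-(I * F))))
  let dv : ℂ :=
    a * Fdot * (I * (zb ^ 2 / (2 * (1 + η)) * exp (I * F) - (1 + η) / 2 * exp (-(I * F))))
  (![mh * ((du + dv) / 2), mh * ((du - dv) / (2 * I))], ![(u + v) / 2, (u - v) / (2 * I)])

/-! ### The planetary Hamiltonian near the 1:1 resonance -/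

/-- The perturbation `ε (r̃₁ · r̃₂ / m₀ - m₁ m₂ / ‖r₁ - r₂‖)` in heliocentric coordinates, extended
to complex vectors (`‖r‖` becomes the principal square root of `r · r`). -/
def perturbation (m₀ : ℝ) (m : Fin 2 → ℝ) (ε : ℝ) (rt r : Fin 2 → Vec) : ℂ :=
  ε * ((rt 0 ⬝ᵥ rt 1) / m₀ - m 0 * m 1 / ((r 0 - r 1) ⬝ᵥ (r 0 - r 1)) ^ (1 / 2 : ℂ))

/-- Actions `(Λ₁, Λ₂)` in terms of `Z = (Λ₁ - Λ_{1,0}, Λ₁ - Λ_{1,0} + Λ₂ - Λ_{2,0})`. -/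
def lamAction (m₀ : ℝ) (m : Fin 2 → ℝ) (υ₀ ε : ℝ) (Z : Vec) : Vec :=
  ![LamRes m₀ m υ₀ ε 0 + Z 0, LamRes m₀ m υ₀ ε 1 + Z 1 - Z 0]

/-- Mean longitudes `(λ₁, λ₂)` in terms of `ζ = (λ₁ - λ₂, λ₂)`. -/
def meanLongitude (ζ : Vec) : Vec := ![ζ 0 + ζ 1, ζ 1]

/-- The Keplerian part `H_K(Z)`. -/
def HK (m₀ : ℝ) (m : Fin 2 → ℝ) (υ₀ ε : ℝ) (Z : Vec) : ℂ :=
  -∑ j, (mhat m₀ m ε j : ℂ) ^ 3 * (mu m₀ m ε j : ℂ) ^ 2 / (2 * lamAction m₀ m υ₀ ε Z j ^ 2)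

/-- The perturbation `H_P(Z, ζ, x, x̃)` in resonant Poincaré variables. -/
def HP (m₀ : ℝ) (m : Fin 2 → ℝ) (υ₀ ε : ℝ) (p : Phase) : ℂ :=
  let pos : Fin 2 → Vec × Vec := fun j =>
    poincare (mhat m₀ m ε j) (mu m₀ m ε j) (lamAction m₀ m υ₀ ε p.1 j) (meanLongitude p.2.1 j)
      (p.2.2.1 j) (p.2.2.2 j)
  perturbation m₀ m ε (fun j => (pos j).1) (fun j => (pos j).2)

/-- The planetary Hamiltonian `H = H_K + H_P`. -/
def Ham (m₀ : ℝ) (m : Fin 2 → ℝ) (υ₀ ε : ℝ) (p : Phase) : ℂ :=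
  HK m₀ m υ₀ ε p.1 + HP m₀ m υ₀ ε p

/-! ### Complex domains -/

/-- The collisionless real angles: `ζ₁ ∈ [Δ, 2π - Δ]` and `ζ₂` arbitrary (`ζ₂` is an angle, and
everything below is `2π`-periodic in it). -/
def collisionless (Δ : ℝ) : Set (Fin 2 → ℝ) := {θ | Δ ≤ θ 0 ∧ θ 0 ≤ 2 * Real.pi - Δ}

/-- The complex domain of widths `ρ` (actions), `σ` (angles) and `√(ρσ)` (eccentricities). -/
def domain (Δ ρ σ : ℝ) : Set Phase :=
  {p | ‖p.1‖ ≤ ρ ∧ (∃ θ ∈ collisionless Δ, ‖p.2.1 - fun j => (θ j : ℂ)‖ ≤ σ) ∧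
    ‖p.2.2‖ ≤ √(ρ * σ)}

/-- The domain of relative width `q`, for `(ρ, σ) = σ₀ (ε^β, 1)`. -/
def domainAt (Δ σ₀ β ε q : ℝ) : Set Phase := domain Δ (q * (σ₀ * ε ^ β)) (q * σ₀)

/-! ### Canonical transformations, averages, D'Alembert rule -/

/-- The symplectic form `dZ ∧ dζ + dx ∧ dx̃`. -/
def sympl (u v : Phase) : ℂ :=
  u.1 ⬝ᵥ v.2.1 - v.1 ⬝ᵥ u.2.1 + u.2.2.1 ⬝ᵥ v.2.2.2 - v.2.2.1 ⬝ᵥ u.2.2.2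

/-- Real points: `Z`, `ζ` real and `x̃ = -i x̄`. -/
def IsRealPoint (p : Phase) : Prop :=
  (∀ j, (p.1 j).im = 0) ∧ (∀ j, (p.2.1 j).im = 0) ∧
    ∀ j, p.2.2.2 j = -I * (starRingEnd ℂ) (p.2.2.1 j)

/-- Translation of the fast angle `ζ₂`. -/
def shiftFast (t : ℂ) (p : Phase) : Phase := (p.1, ![p.2.1 0, p.2.1 1 + t], p.2.2)

/-- `Υ` is an injective analytic symplectic map on `K`, real at real points, and it commutes with
the `2π`-translation of `ζ₂` (so that it is defined for `ζ₂` in the circle). -/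
structure IsCanonicalOn (Υ : Phase → Phase) (K : Set Phase) : Prop where
  analytic : AnalyticOnNhd ℂ Υ K
  injOn : InjOn Υ K
  symplectic : ∀ p ∈ K, ∀ u v : Phase,
    sympl (fderiv ℂ Υ p u) (fderiv ℂ Υ p v) = sympl u v
  real : ∀ p ∈ K, IsRealPoint p → IsRealPoint (Υ p)
  periodic : ∀ p ∈ K, Υ (shiftFast (2 * Real.pi) p) = shiftFast (2 * Real.pi) (Υ p)

/-- Average over the fast angle `ζ₂`. -/
def avg (f : Phase → ℂ) (p : Phase) : ℂ :=
  1 / (2 * Real.pi) * ∫ t in (0 : ℝ)..2 * Real.pi, f (p.1, ![p.2.1 0, (t : ℂ)], p.2.2)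

/-- The D'Alembert rule: only the monomials
`x₁^{p₁} x₂^{p₂} x̃₁^{p̃₁} x̃₂^{p̃₂} exp(i k ζ₂)` with `k + p₁ + p₂ - p̃₁ - p̃₂ = 0` occur, that is,
`f` is invariant under the flow `(ζ₂ + θ, exp(iθ) x, exp(-iθ) x̃)` of `Z₂ + i x₁ x̃₁ + i x₂ x̃₂`. -/
def DAlembertOn (f : Phase → ℂ) (K : Set Phase) : Prop :=
  ∀ p ∈ K, ∀ θ : ℝ,
    f (p.1, ![p.2.1 0, p.2.1 1 + θ], exp (I * θ) • p.2.2.1, exp (-(I * θ)) • p.2.2.2) = f p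

/-- The remainder `H_* = H ∘ Υ - H_K - avg H_P`. -/
def Hstar (m₀ : ℝ) (m : Fin 2 → ℝ) (υ₀ ε : ℝ) (Υ : Phase → Phase) (p : Phase) : ℂ :=
  Ham m₀ m υ₀ ε (Υ p) - HK m₀ m υ₀ ε p.1 - avg (HP m₀ m υ₀ ε) p

/-- The averaged Hamiltonian `H_K + avg H_P + avg H_*`. -/
def Hbar (m₀ : ℝ) (m : Fin 2 → ℝ) (υ₀ ε : ℝ) (Υ : Phase → Phase) (p : Phase) : ℂ :=
  HK m₀ m υ₀ ε p.1 + avg (HP m₀ m υ₀ ε) p + avg (Hstar m₀ m υ₀ ε Υ) p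

/-- `Υ` is a first averaging transformation, with constant `C` in the estimates: it is canonical,
it removes the fast angle up to an exponentially small remainder, and it preserves the
D'Alembert rule. -/
structure IsFirstAveraging (m₀ : ℝ) (m : Fin 2 → ℝ) (υ₀ Δ σ₀ β ε C : ℝ)
    (Υ : Phase → Phase) : Prop where
  canonical : IsCanonicalOn Υ (domainAt Δ σ₀ β ε (1 / 3))
  image_subset : Υ '' domainAt Δ σ₀ β ε (1 / 3) ⊆ domainAt Δ σ₀ β ε (1 / 2)
  subset_image : domainAt Δ σ₀ β ε (1 / 6) ⊆ Υ '' domainAt Δ σ₀ β ε (1 / 3)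
  avg_le : ∀ p ∈ domainAt Δ σ₀ β ε (1 / 3),
    ‖avg (Hstar m₀ m υ₀ ε Υ) p‖ ≤ C * ε ^ (2 - β)
  osc_le : ∀ p ∈ domainAt Δ σ₀ β ε (1 / 3),
    ‖Hstar m₀ m υ₀ ε Υ p - avg (Hstar m₀ m υ₀ ε Υ) p‖
      ≤ C * (ε * Real.exp (-(1 / ε ^ ((1 - 2 * β) / 5))))
  action_le : ∀ p ∈ domainAt Δ σ₀ β ε (1 / 3), ‖p.1 - (Υ p).1‖ ≤ C * ε
  angle_le : ∀ p ∈ domainAt Δ σ₀ β ε (1 / 3), ‖p.2.1 - (Υ p).2.1‖ ≤ C * ε ^ (1 - β)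
  ecc_le : ∀ p ∈ domainAt Δ σ₀ β ε (1 / 3), ‖p.2.2 - (Υ p).2.2‖ ≤ C * ε ^ (1 - β / 2)
  dalembert : DAlembertOn (fun p => Ham m₀ m υ₀ ε (Υ p)) (domainAt Δ σ₀ β ε (1 / 3))

/-! ### The reduced Hamiltonian -/

/-- `κ = m₁ / (m₁ + m₂)`. -/
def kappa (m : Fin 2 → ℝ) : ℝ := m 0 / (m 0 + m 1)

/-- The linear change of variables
`(I, φ, w, w̃) ↦ (I₁ + κ I₂, I₂, φ₁, φ₂ - κ φ₁, w, w̃)`. -/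
def Psi (m : Fin 2 → ℝ) (p : Phase) : Phase :=
  (![p.1 0 + kappa m * p.1 1, p.1 1], ![p.2.1 0, p.2.1 1 - kappa m * p.2.1 0], p.2.2)

/-- The constant `A`. -/
def constA (m₀ : ℝ) (m : Fin 2 → ℝ) (υ₀ : ℝ) : ℝ :=
  3 / 2 * υ₀ ^ (1 / 3 : ℝ) * m₀ ^ (-(2 / 3) : ℝ) * (1 / m 0 + 1 / m 1)

/-- The constant `D`. -/
def constD (m₀ : ℝ) (m : Fin 2 → ℝ) : ℝ := m 0 * m 1 / m₀

/-- The constant `B`. -/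
def constB (m₀ : ℝ) (m : Fin 2 → ℝ) (υ₀ : ℝ) : ℝ :=
  3 / 2 * υ₀ ^ (-(1 / 3) : ℝ) * m₀ ^ (2 / 3 : ℝ) * constD m₀ m

/-- The constant `E`. -/
def constE (m₀ : ℝ) (m : Fin 2 → ℝ) (υ₀ : ℝ) : ℝ :=
  3 / 2 * υ₀ ^ (1 / 3 : ℝ) * m₀ ^ (-(2 / 3) : ℝ) * (m 0 + m 1)⁻¹

/-- `𝒟(φ) = √(2 - 2 cos φ)` (principal square root). -/
def distD (φ : ℂ) : ℂ := (2 - 2 * cos φ) ^ (1 / 2 : ℂ)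

/-- `ℱ(φ) = (2/3) (cos φ - 𝒟(φ)⁻¹)`. -/
def funF (φ : ℂ) : ℂ := 2 / 3 * (cos φ - (distD φ)⁻¹)

/-- The coefficient `Ã(φ)`. -/
def funA (φ : ℂ) : ℂ :=
  (distD φ ^ 5)⁻¹ / 4 * (5 * cos (2 * φ) - 13 + 8 * cos φ) - cos φ

/-- The coefficient `B̃(φ)`. -/
def funB (φ : ℂ) : ℂ :=
  exp (-2 * I * φ) - (distD φ ^ 5)⁻¹ / 8 *
    (exp (-3 * I * φ) + 16 * exp (-2 * I * φ) - 26 * exp (-(I * φ)) + 9 * exp (I * φ))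

/-- The complex conjugate of `B̃`, extended holomorphically from real to complex angles. -/
def funBconj (φ : ℂ) : ℂ := (starRingEnd ℂ) (funB ((starRingEnd ℂ) φ))

/-- `H̃₁(I₁, φ₁) = υ₀ (-A I₁² + ε B ℱ(φ₁))`. -/
def H1 (m₀ : ℝ) (m : Fin 2 → ℝ) (υ₀ ε : ℝ) (I₁ φ₁ : ℂ) : ℂ :=
  υ₀ * (-constA m₀ m υ₀ * I₁ ^ 2 + ε * constB m₀ m υ₀ * funF φ₁)

/-- `H₂(I₂) = υ₀ (I₂ - E I₂²)`. -/
def H2 (m₀ : ℝ) (m : Fin 2 → ℝ) (υ₀ : ℝ) (I₂ : ℂ) : ℂ :=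
  υ₀ * (I₂ - constE m₀ m υ₀ * I₂ ^ 2)

/-- The quadratic form `Q̃(φ₁, w, w̃)` in the eccentricity variables. -/
def Qform (m₀ : ℝ) (m : Fin 2 → ℝ) (υ₀ ε : ℝ) (φ₁ : ℂ) (w wt : Vec) : ℂ :=
  I * ε * υ₀ * constD m₀ m *
    (funA φ₁ / m 0 * w 0 * wt 0 + funB φ₁ / (√(m 0 * m 1) : ℝ) * w 0 * wt 1
      + funBconj φ₁ / (√(m 0 * m 1) : ℝ) * wt 0 * w 1 + funA φ₁ / m 1 * w 1 * wt 1)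

end Coorbital

end

/-! Scaling. Measuring the actions in units of τ = ε^β and the eccentricities in units of √τ turns
the domains into neighbourhoods (`zone`) of fixed radius of the real circular configurations. It
multiplies the symplectic form by τ and turns H into a constant plus τ (υ₀ Z₂ + k + h)
(`Ham_scale`). Here k does not depend on the fast angle and is O(ε^β + ε^(1-β)), while h has zero
fast average and is O(ε^(1-β)).

Existence of the averaging transformation. One step (`exists_averaging_step`) is the implicit
midpoint map of a Hamiltonian χ with υ₀ ∂χ/∂ζ₂ = -f. Midpoint maps are exactly symplectic, and since
υ₀ Z₂ is linear its variation is exactly -f at the midpoint. What remains is the displacement times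
derivatives of k, of the averaged part g and of f. If each step gives up a width d/N, the
oscillation still shrinks by a factor e at each of N steps, provided that N (ε^β + ε^(1-β)) is small
(`exists_normalForm`). With N of the order of ε^(-α) this needs α < β, which for α = (1-2β)/5 is the
condition β > 1/7. The bracket of k with χ has zero average because χ is centred
(`fastAvg_bracket`); hence the averaged remainder is quadratic in ε^(1-β), which is ε^(2-β) in the
original units. The midpoint equation has a unique solution, so that the construction commutes with
every symmetry of the Hamiltonian: rotations give the D'Alembert rule, the anti-holomorphic
involution gives reality.

Analytic input. Kepler's equation is solved by a contraction, and the perturbation is analytic near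
circular configurations, also in a complexified mass ratio. Compactness modulo rotations gives
uniform bounds (`exists_tube`). Maps defined implicitly and integrals with parameters are analytic
by Goursat's theorem in several variables (`analyticAt_of_eventually_differentiableAt`).

Reduction. For an arbitrary first averaging transformation, the averaged perturbation and the
averaged remainder are functions invariant under rotations of the eccentricities alone. Such a
function is its value at zero eccentricity plus a sum of terms c_jk x_j x̃_k
(`eq_add_sum_mixedCoef`). The Kepler part is expanded to second order in the actions, and Ψ
completes the square. The averaged perturbation is replaced by its value and its mixed second
derivatives at circular orbits, zero actions and zero mass ratio, computed with jets
(`mixedJet_pert`); the error is O(ε^(1+β)), for the coefficients because parity makes it quadratic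
in the eccentricities. The averaged H_* gives ε^(2-β), and ε^(2-2β) in its coefficients after
division by two eccentricities. The cubic Kepler terms give ε^(3β), which dominates ε^(1+β) and
ε^(2-β) because β < 1/2; and ε^(1+β) is absorbed by ε^(2-2β) once β > 1/3. -/

namespace Coorbital

open Metric Topology

/-! ### Cauchy estimates for Fréchet derivatives. -/

section Cauchy

variable {E F : Type*} [NormedAddCommGroup E] [NormedSpace ℂ E] [NormedAddCommGroup F]
  [NormedSpace ℂ F]

/-- Cauchy's estimate for the Fréchet derivative. -/
theorem norm_fderiv_le_of_closedBall {f : E → F} {x : E} {r M : ℝ} (hr : 0 < r)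
    (hd : ∀ y ∈ closedBall x r, DifferentiableAt ℂ f y)
    (hM : ∀ y ∈ closedBall x r, ‖f y‖ ≤ M) : ‖fderiv ℂ f x‖ ≤ M / r := by
  have hM0 : 0 ≤ M := (norm_nonneg _).trans (hM x (mem_closedBall_self hr.le))
  refine ContinuousLinearMap.opNorm_le_bound _ (by positivity) fun v => ?_
  rcases eq_or_ne v 0 with rfl | hv
  · simp
  have hv' : 0 < ‖v‖ := norm_pos_iff.2 hv
  -- The complex line through `x` in the direction `v` stays in the ball for parameters up to `r /
  -- ‖v‖`, so the one-variable Cauchy estimate on that disc already has the right constant.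
  have hmem : ∀ l ∈ closedBall (0 : ℂ) (r / ‖v‖), x + l • v ∈ closedBall x r := by
    intro l hl
    rw [mem_closedBall_zero_iff, le_div_iff₀ hv'] at hl
    simpa [norm_smul] using hl
  have hline : ∀ l : ℂ, HasDerivAt (fun l : ℂ => x + l • v) v l := by
    intro l
    simpa using ((hasDerivAt_id l).smul_const v).const_add x
  have hdl : ∀ l ∈ closedBall (0 : ℂ) (r / ‖v‖),
      DifferentiableAt ℂ (fun l : ℂ => f (x + l • v)) l := fun l hl =>
    (hd _ (hmem l hl)).comp l (hline l).differentiableAt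
  have hder : deriv (fun l : ℂ => f (x + l • v)) 0 = fderiv ℂ f x v := by
    have h0 : HasFDerivAt f (fderiv ℂ f x) (x + (0 : ℂ) • v) := by
      simpa using (hd x (mem_closedBall_self hr.le)).hasFDerivAt
    exact (h0.comp_hasDerivAt (0 : ℂ) (hline 0)).deriv
  rw [← hder]
  have := Complex.norm_deriv_le_of_forall_mem_sphere_norm_le (f := fun l : ℂ => f (x + l • v))
    (c := 0) (R := r / ‖v‖) (C := M) (by positivity)
    (DifferentiableOn.diffContOnCl (by
      intro l hl
      exact (hdl l (closure_ball_subset_closedBall hl)).differentiableWithinAt))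
    (fun l hl => hM _ (hmem l (sphere_subset_closedBall hl)))
  calc _ ≤ _ := this
    _ = _ := by field_simp

/-- The derivative of a bounded holomorphic function is Lipschitz continuous. -/
theorem norm_fderiv_sub_le_of_closedBall {f : E → F} {x₀ : E} {r M : ℝ} (hr : 0 < r)
    (hd : ∀ y ∈ closedBall x₀ (3 * r), DifferentiableAt ℂ f y)
    (hM : ∀ y ∈ closedBall x₀ (3 * r), ‖f y‖ ≤ M) {p q : E} (hp : p ∈ closedBall x₀ r)
    (hq : q ∈ closedBall x₀ r) :
    ‖fderiv ℂ f q - fderiv ℂ f p‖ ≤ M / r ^ 2 * ‖q - p‖ := by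
  have h2 : ∀ y ∈ closedBall x₀ (2 * r), ‖fderiv ℂ f y‖ ≤ M / r := by
    intro y hy
    have : closedBall y r ⊆ closedBall x₀ (3 * r) := by
      refine closedBall_subset_closedBall' ?_
      rw [mem_closedBall] at hy; linarith
    exact norm_fderiv_le_of_closedBall hr (fun z hz => hd z (this hz)) fun z hz => hM z (this hz)
  have h23 : closedBall x₀ (2 * r) ⊆ closedBall x₀ (3 * r) :=
    closedBall_subset_closedBall (by linarith)
  -- The increment of the derivative is the derivative of y ↦ f (y + (q - p)) - f y, a holomorphic
  -- function that is small because `f` is Lipschitz. Cauchy's estimate applies to it directly and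
  -- second derivatives are avoided. The radius is spent three times: for `p` and `q`, for `y`
  -- around `p`, and for the bound on `fderiv`.
  have hlip : ∀ y ∈ closedBall p r, ‖f (y + (q - p)) - f y‖ ≤ M / r * ‖q - p‖ := by
    intro y hy
    let _ : NormedSpace ℝ E := NormedSpace.restrictScalars ℝ ℂ E
    have h1 : y ∈ closedBall x₀ (2 * r) := by
      rw [mem_closedBall] at *
      linarith [dist_triangle y p x₀]
    have h3 : y + (q - p) ∈ closedBall x₀ (2 * r) := by
      rw [mem_closedBall, dist_eq_norm] at *
      calc ‖y + (q - p) - x₀‖ = ‖(y - p) + (q - x₀)‖ := by congr 1; abel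
        _ ≤ _ := norm_add_le _ _
        _ ≤ _ := by linarith
    simpa using (convex_closedBall x₀ (2 * r)).norm_image_sub_le_of_norm_fderiv_le (𝕜 := ℂ)
      (fun z hz => hd z (h23 hz)) h2 h1 h3
  have hdd : ∀ y ∈ closedBall p r, DifferentiableAt ℂ (fun y => f (y + (q - p)) - f y) y := by
    intro y hy
    have h1 : y ∈ closedBall x₀ (3 * r) := by
      rw [mem_closedBall] at *
      linarith [dist_triangle y p x₀]
    have h3 : y + (q - p) ∈ closedBall x₀ (3 * r) := by
      rw [mem_closedBall, dist_eq_norm] at *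
      calc ‖y + (q - p) - x₀‖ = ‖(y - p) + (q - x₀)‖ := by congr 1; abel
        _ ≤ _ := norm_add_le _ _
        _ ≤ _ := by linarith
    exact ((hd _ h3).comp y (by fun_prop)).sub (hd _ h1)
  have hmono : closedBall x₀ r ⊆ closedBall x₀ (3 * r) :=
    closedBall_subset_closedBall (by linarith)
  have heq : fderiv ℂ (fun y => f (y + (q - p)) - f y) p = fderiv ℂ f q - fderiv ℂ f p := by
    have hq' : DifferentiableAt ℂ f (p + (q - p)) := by simpa using hd q (hmono hq)
    rw [fderiv_fun_sub (by exact hq'.comp p (by fun_prop)) (hd p (hmono hp)),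
      fderiv_comp_add_right]
    simp
  rw [← heq]
  calc _ ≤ M / r * ‖q - p‖ / r := norm_fderiv_le_of_closedBall hr hdd hlip
    _ = _ := by field_simp

/-- Second order Taylor estimate for bounded holomorphic functions. -/
theorem norm_sub_sub_fderiv_le_of_closedBall {f : E → F} {x₀ : E} {r M : ℝ} (hr : 0 < r)
    (hd : ∀ y ∈ closedBall x₀ (3 * r), DifferentiableAt ℂ f y)
    (hM : ∀ y ∈ closedBall x₀ (3 * r), ‖f y‖ ≤ M) {p q : E} (hp : p ∈ closedBall x₀ r)
    (hq : q ∈ closedBall x₀ r) :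
    ‖f q - f p - fderiv ℂ f p (q - p)‖ ≤ M / r ^ 2 * ‖q - p‖ ^ 2 := by
  let _ : NormedSpace ℝ E := NormedSpace.restrictScalars ℝ ℂ E
  have hM0 : 0 ≤ M := (norm_nonneg _).trans (hM x₀ (mem_closedBall_self (by positivity)))
  have hseg : segment ℝ p q ⊆ closedBall x₀ r := (convex_closedBall x₀ r).segment_subset hp hq
  have hmono : closedBall x₀ r ⊆ closedBall x₀ (3 * r) :=
    closedBall_subset_closedBall (by linarith)
  have := (convex_segment p q).norm_image_sub_le_of_norm_fderiv_le' (𝕜 := ℂ) (f := f)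
    (φ := fderiv ℂ f p) (C := M / r ^ 2 * ‖q - p‖)
    (fun z hz => hd z (hmono (hseg hz)))
    (fun z hz => (norm_fderiv_sub_le_of_closedBall hr hd hM hp (hseg hz)).trans (by
      gcongr
      have := norm_sub_le_of_mem_segment hz
      rwa [norm_sub_rev q p, norm_sub_rev z p, norm_sub_rev p q] at *))
    (left_mem_segment ℝ p q) (right_mem_segment ℝ p q)
  calc _ ≤ _ := this
    _ = _ := by ring

end Cauchy

/-! ### Holomorphic functions of several variables are analytic. -/

section Hartogs

/-- In `E`, Fréchet holomorphic functions with values in Banach spaces are analytic. -/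
def HolomorphicIsAnalytic (E : Type) [NormedAddCommGroup E] [NormedSpace ℂ E] : Prop :=
  ∀ (F : Type) [NormedAddCommGroup F] [NormedSpace ℂ F] [CompleteSpace F] (f : E → F) (x : E),
    (∀ᶠ y in 𝓝 x, DifferentiableAt ℂ f y) → AnalyticAt ℂ f x

theorem HolomorphicIsAnalytic.of_equiv {E E' : Type} [NormedAddCommGroup E] [NormedSpace ℂ E]
    [NormedAddCommGroup E'] [NormedSpace ℂ E'] (e : E ≃L[ℂ] E') (h : HolomorphicIsAnalytic E) :
    HolomorphicIsAnalytic E' := by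
  intro F _ _ _ f x hf
  have h1 : AnalyticAt ℂ (f ∘ e) (e.symm x) := by
    refine h F (f ∘ e) (e.symm x) ?_
    have : Tendsto e (𝓝 (e.symm x)) (𝓝 x) := by
      simpa using e.continuous.tendsto (e.symm x)
    filter_upwards [this.eventually hf] with y hy
    exact hy.comp y e.differentiableAt
  have h2 : AnalyticAt ℂ (fun y => (f ∘ e) (e.symm y)) x :=
    AnalyticAt.comp (g := f ∘ e) h1 ((e.symm : E' →L[ℂ] E).analyticAt x)
  simpa using h2

theorem holomorphicIsAnalytic_of_subsingleton {E : Type} [NormedAddCommGroup E]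
    [NormedSpace ℂ E] [Subsingleton E] : HolomorphicIsAnalytic E := by
  intro F _ _ _ f x _
  have : f = fun _ => f x := by ext y; rw [Subsingleton.elim y x]
  rw [this]; exact analyticAt_const

end Hartogs

/-! ### Induction on the dimension through Cauchy's integral formula. -/

section Hartogs

/-- The pairing of a scalar kernel with a function on a circle, by integration. -/
noncomputable def circlePairing (F : Type) [NormedAddCommGroup F] [NormedSpace ℂ F] (z₀ : ℂ)
    (r : ℝ) :
    C(Icc (0 : ℝ) (2 * Real.pi), ℂ) →L[ℂ] C(Icc (0 : ℝ) (2 * Real.pi), F) →L[ℂ] F :=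
  LinearMap.mkContinuous₂
    (LinearMap.mk₂ ℂ (fun k g => ∫ t in (0 : ℝ)..2 * Real.pi, deriv (circleMap z₀ r) t •
        (k (projIcc 0 (2 * Real.pi) Real.two_pi_pos.le t) •
          g (projIcc 0 (2 * Real.pi) Real.two_pi_pos.le t)))
      (by
        intro k k' g
        rw [← intervalIntegral.integral_add]
        · congr 1; ext t; simp [add_smul]
        all_goals
          refine Continuous.intervalIntegrable ?_ _ _
          simp only [deriv_circleMap]
          fun_prop)
      (by
        intro c k g
        rw [← intervalIntegral.integral_smul]
        congr 1; ext t; simp only [ContinuousMap.smul_apply, smul_eq_mul, smul_smul]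
        congr 1; ring)
      (by
        intro k g g'
        rw [← intervalIntegral.integral_add]
        · congr 1; ext t; simp [smul_add]
        all_goals
          refine Continuous.intervalIntegrable ?_ _ _
          simp only [deriv_circleMap]
          fun_prop)
      (by
        intro c k g
        rw [← intervalIntegral.integral_smul]
        congr 1; ext t; simp only [ContinuousMap.smul_apply, smul_smul]
        congr 1; ring))
    (|r| * (2 * Real.pi)) (by
      intro k g
      have := intervalIntegral.norm_integral_le_of_norm_le_const (a := 0) (b := 2 * Real.pi)
        (C := |r| * (‖k‖ * ‖g‖))
        (f := fun t => deriv (circleMap z₀ r) t •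
        (k (projIcc 0 (2 * Real.pi) Real.two_pi_pos.le t) •
          g (projIcc 0 (2 * Real.pi) Real.two_pi_pos.le t))) (by
          intro t _
          rw [norm_smul, norm_smul]
          gcongr
          · simp
          · exact k.norm_coe_le_norm _
          · exact g.norm_coe_le_norm _)
      rw [sub_zero, abs_of_pos Real.two_pi_pos] at this
      refine this.trans (le_of_eq ?_)
      ring)

theorem circlePairing_apply (F : Type) [NormedAddCommGroup F] [NormedSpace ℂ F] (z₀ : ℂ)
    (r : ℝ) (k : C(Icc (0 : ℝ) (2 * Real.pi), ℂ)) (g : C(Icc (0 : ℝ) (2 * Real.pi), F))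
    (h : ℂ → F) (hkg : ∀ t, k t • g t = h (circleMap z₀ r t)) :
    circlePairing F z₀ r k g = ∮ z in C(z₀, r), h z := by
  change (∫ t in (0 : ℝ)..2 * Real.pi, deriv (circleMap z₀ r) t •
        (k (projIcc 0 (2 * Real.pi) Real.two_pi_pos.le t) •
          g (projIcc 0 (2 * Real.pi) Real.two_pi_pos.le t))) = _
  rw [circleIntegral]
  refine intervalIntegral.integral_congr fun t ht => ?_
  rw [uIcc_of_le Real.two_pi_pos.le] at ht
  simp only [hkg, projIcc_of_mem Real.two_pi_pos.le ht]

/-- Cauchy's formula in the first variable writes f (z, x) as the pairing of the kernel (u - z)⁻¹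
with the slice f (·, x) on a circle. The kernel is analytic in z because inversion is analytic in
the Banach algebra of continuous functions on the circle. The slice is a holomorphic function of x
with values in continuous functions, hence analytic by hypothesis: for this the property has to
range over all Banach targets. -/
theorem HolomorphicIsAnalytic.complex_prod {E : Type} [NormedAddCommGroup E] [NormedSpace ℂ E]
    (h : HolomorphicIsAnalytic E) : HolomorphicIsAnalytic (ℂ × E) := by
  intro F _ _ _ f ⟨z₀, x₀⟩ hf
  have hcont : ContinuousAt f (z₀, x₀) := hf.self_of_nhds.continuousAt
  have hbd : ∀ᶠ y in 𝓝 (z₀, x₀), ‖f y‖ < ‖f (z₀, x₀)‖ + 1 :=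
    hcont.norm.eventually_lt_const (by linarith)
  obtain ⟨R, hR, hRf⟩ := Metric.nhds_basis_closedBall.eventually_iff.1 (hf.and hbd)
  set M := ‖f (z₀, x₀)‖ + 1
  set r := R / 3 with hr
  have hr0 : 0 < r := by positivity
  have h3r : 3 * r = R := by rw [hr]; ring
  have hd : ∀ y ∈ closedBall (z₀, x₀) (3 * r), DifferentiableAt ℂ f y := by
    rw [h3r]; exact fun y hy => (hRf hy).1
  have hM : ∀ y ∈ closedBall (z₀, x₀) (3 * r), ‖f y‖ ≤ M := by
    rw [h3r]; exact fun y hy => (hRf hy).2.le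
  have hmono : closedBall (z₀, x₀) r ⊆ closedBall (z₀, x₀) (3 * r) :=
    closedBall_subset_closedBall (by linarith)
  have hmem : ∀ z ∈ closedBall z₀ r, ∀ x ∈ closedBall x₀ r, (z, x) ∈ closedBall (z₀, x₀) r := by
    intro z hz x hx
    rw [← closedBall_prod_same]
    exact ⟨hz, hx⟩
  let u : C(Icc (0 : ℝ) (2 * Real.pi), ℂ) := ⟨fun t => circleMap z₀ r t, by fun_prop⟩
  have hu : ∀ t, u t ∈ closedBall z₀ r := fun t => circleMap_mem_closedBall z₀ hr0.le _
  -- The default value 0 is met only where the slice is not continuous, hence never over `closedBall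
  -- x₀ r`.
  let g : E → C(Icc (0 : ℝ) (2 * Real.pi), F) := fun x => ContinuousMap.mkD (fun t => f (u t, x)) 0
  have hg : ∀ x ∈ closedBall x₀ r, ∀ t, g x t = f (u t, x) := by
    intro x hx t
    have : Continuous fun t => f (u t, x) := by
      rw [continuous_iff_continuousAt]
      intro t
      exact ContinuousAt.comp (f := fun t => (u t, x))
        (hd _ (hmono (hmem _ (hu t) _ hx))).continuousAt (by fun_prop)
    simp only [g, ContinuousMap.mkD_apply_of_continuous this]
  -- The candidate derivative is the partial derivative in `x`, taken pointwise on the circle. The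
  -- second order Taylor estimate has a constant that does not depend on the point of the circle, so
  -- the expansion holds in the sup norm.
  have hgd : ∀ x ∈ ball x₀ r, DifferentiableAt ℂ g x := by
    intro x hx
    have hx' := ball_subset_closedBall hx
    have hAc : Continuous fun t => fderiv ℂ f (u t, x) ∘L ContinuousLinearMap.inr ℂ ℂ E := by
      have : ContinuousOn (fderiv ℂ f) (closedBall (z₀, x₀) r) := by
        refine (LipschitzOnWith.of_dist_le_mul (K := (M / r ^ 2).toNNReal) ?_).continuousOn
        intro p hp q hq
        rw [dist_eq_norm, dist_eq_norm]
        refine (norm_fderiv_sub_le_of_closedBall hr0 hd hM hq hp).trans ?_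
        gcongr
        exact Real.le_coe_toNNReal _
      have h2 : Continuous fun t => fderiv ℂ f (u t, x) :=
        this.comp_continuous (by fun_prop) fun t => hmem _ (hu t) _ hx'
      fun_prop
    let A : C(Icc (0 : ℝ) (2 * Real.pi), E →L[ℂ] F) := ⟨_, hAc⟩
    let D : E →L[ℂ] C(Icc (0 : ℝ) (2 * Real.pi), F) := LinearMap.mkContinuous
      { toFun := fun v => ⟨fun t => A t v, by fun_prop⟩
        map_add' := by intro v w; ext t; simp
        map_smul' := by intro c v; ext t; simp } ‖A‖ (by
          intro v
          refine (ContinuousMap.norm_le _ (by positivity)).2 fun t => ?_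
          exact ((A t).le_opNorm v).trans (by gcongr; exact A.norm_coe_le_norm t))
    have hgD : HasFDerivAt g D x := by
      refine HasFDerivAt.of_isLittleO ?_
      rw [Asymptotics.isLittleO_iff]
      intro c hc
      have hM0 : 0 < M := by positivity
      have hev : ∀ᶠ x' in 𝓝 x, x' ∈ ball x (c * r ^ 2 / M) := ball_mem_nhds _ (by positivity)
      filter_upwards [hev, isOpen_ball.mem_nhds hx] with x' hx1 hx2
      refine (ContinuousMap.norm_le _ (by positivity)).2 fun t => ?_
      have hx2' := ball_subset_closedBall hx2
      have := norm_sub_sub_fderiv_le_of_closedBall hr0 hd hM (hmem _ (hu t) _ hx')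
        (hmem _ (hu t) _ hx2')
      have e1 : (u t, x') - (u t, x) = ((0 : ℂ), x' - x) := by simp
      have e2 : ‖((0 : ℂ), x' - x)‖ = ‖x' - x‖ := by simp [Prod.norm_def]
      rw [e1, e2] at this
      have e3 : (g x' - g x - D (x' - x)) t
          = f (u t, x') - f (u t, x) - fderiv ℂ f (u t, x) (0, x' - x) := by
        have : D (x' - x) t = fderiv ℂ f (u t, x) (0, x' - x) := rfl
        simp only [ContinuousMap.sub_apply, hg _ hx2', hg _ hx', this]
      rw [e3]
      refine this.trans ?_
      rw [mem_ball, dist_eq_norm] at hx1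
      calc M / r ^ 2 * ‖x' - x‖ ^ 2 = (M / r ^ 2 * ‖x' - x‖) * ‖x' - x‖ := by ring
        _ ≤ (M / r ^ 2 * (c * r ^ 2 / M)) * ‖x' - x‖ := by gcongr
        _ = c * ‖x' - x‖ := by field_simp
    exact hgD.differentiableAt
  have hga : AnalyticAt ℂ g x₀ := h _ g x₀ (by
    filter_upwards [isOpen_ball.mem_nhds (mem_ball_self hr0)] with x hx using hgd x hx)
  have hunit : ∀ z ∈ ball z₀ r, IsUnit (u - algebraMap ℂ _ z) := by
    intro z hz
    rw [ContinuousMap.isUnit_iff_forall_ne_zero]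
    intro t ht
    have : circleMap z₀ r t = z := by simpa [u, sub_eq_zero] using ht
    exact circleMap_ne_mem_ball hz _ this
  have hka : AnalyticAt ℂ (fun z : ℂ => Ring.inverse (u - algebraMap ℂ _ z)) z₀ := by
    obtain ⟨w, hw⟩ := hunit z₀ (mem_ball_self hr0)
    have h1 : AnalyticAt ℂ Ring.inverse (u - algebraMap ℂ _ z₀) := hw ▸ analyticAt_inverse (𝕜 := ℂ) w
    have h2 : AnalyticAt ℂ (fun z : ℂ =>
        u - algebraMap ℂ C(Icc (0 : ℝ) (2 * Real.pi), ℂ) z) z₀ :=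
      analyticAt_const.sub ((algebraMapCLM ℂ C(Icc (0 : ℝ) (2 * Real.pi), ℂ)).analyticAt z₀)
    exact AnalyticAt.comp (g := Ring.inverse) h1 h2
  have hkv : ∀ z ∈ ball z₀ r, ∀ t, Ring.inverse (u - algebraMap ℂ _ z) t
      = (circleMap z₀ r t - z)⁻¹ := by
    intro z hz t
    have h1 := Ring.mul_inverse_cancel _ (hunit z hz)
    have h2 := congrArg (fun k : C(Icc (0 : ℝ) (2 * Real.pi), ℂ) => k t) h1
    refine eq_inv_of_mul_eq_one_right ?_
    simpa [u] using h2
  have hprod : AnalyticAt ℂ (fun p : ℂ × E => (2 * Real.pi * I : ℂ)⁻¹ •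
      circlePairing F z₀ r (Ring.inverse (u - algebraMap ℂ _ p.1)) (g p.2)) (z₀, x₀) := by
    refine AnalyticAt.fun_const_smul ?_
    have hpair : AnalyticAt ℂ (fun p : ℂ × E =>
        (Ring.inverse (u - algebraMap ℂ _ p.1), g p.2)) (z₀, x₀) :=
      AnalyticAt.prod (AnalyticAt.comp (g := fun z : ℂ => Ring.inverse (u - algebraMap ℂ _ z))
        (f := Prod.fst) hka analyticAt_fst)
        (AnalyticAt.comp (g := g) (f := Prod.snd) hga analyticAt_snd)
    exact AnalyticAt.comp (g := fun q : C(Icc (0 : ℝ) (2 * Real.pi), ℂ) ×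
      C(Icc (0 : ℝ) (2 * Real.pi), F) => circlePairing F z₀ r q.1 q.2)
      ((circlePairing F z₀ r).analyticAt_bilinear _) hpair
  refine hprod.congr ?_
  have hnb : ball z₀ r ×ˢ ball x₀ r ∈ 𝓝 (z₀, x₀) :=
    prod_mem_nhds (ball_mem_nhds _ hr0) (ball_mem_nhds _ hr0)
  filter_upwards [hnb] with p hp
  have hp2 := ball_subset_closedBall hp.2
  rw [circlePairing_apply F z₀ r _ _ (fun z => (z - p.1)⁻¹ • f (z, p.2)) (by
    intro t
    rw [hkv _ hp.1, hg _ hp2]; rfl)]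
  have hc : DifferentiableOn ℂ (fun z => f (z, p.2)) (closedBall z₀ r) := by
    intro z hz
    exact (DifferentiableAt.comp (f := fun z => (z, p.2)) z (hd _ (hmono (hmem _ hz _ hp2)))
      (by fun_prop)).differentiableWithinAt
  rw [hc.circleIntegral_sub_inv_smul hp.1, inv_smul_smul₀ (by simp [Real.pi_ne_zero])]

theorem holomorphicIsAnalytic_pi (n : ℕ) : HolomorphicIsAnalytic (Fin n → ℂ) := by
  induction n with
  | zero => exact holomorphicIsAnalytic_of_subsingleton
  | succ n ih => exact ih.complex_prod.of_equiv (Fin.consEquivL ℂ fun _ : Fin (n + 1) => ℂ)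

/-- **Goursat's theorem** in several variables. -/
theorem analyticAt_of_eventually_differentiableAt {E : Type} [NormedAddCommGroup E]
    [NormedSpace ℂ E] [FiniteDimensional ℂ E] {F : Type} [NormedAddCommGroup F] [NormedSpace ℂ F]
    [CompleteSpace F] {f : E → F} {x : E} (hf : ∀ᶠ y in 𝓝 x, DifferentiableAt ℂ f y) :
    AnalyticAt ℂ f x := by
  have e : (Fin (Module.finrank ℂ E) → ℂ) ≃L[ℂ] E :=
    ContinuousLinearEquiv.ofFinrankEq (by simp)
  exact (holomorphicIsAnalytic_pi _).of_equiv e F f x hf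

end Hartogs

/-! ### Analytic dependence of integrals on parameters. -/

section ParametricIntegral

variable {E F : Type} [NormedAddCommGroup E] [NormedSpace ℂ E] [FiniteDimensional ℂ E]
  [NormedAddCommGroup F] [NormedSpace ℂ F] [CompleteSpace F]

/-- Differentiation under the integral sign, for holomorphic integrands. -/
theorem hasFDerivAt_integral_of_analyticAt {G : E × ℂ → F} {a b : ℝ} {p : E}
    (hG : ∀ t ∈ uIcc a b, AnalyticAt ℂ G (p, (t : ℂ))) :
    HasFDerivAt (fun q => ∫ t in a..b, G (q, (t : ℂ)))
      (∫ t in a..b, fderiv ℂ (fun q => G (q, (t : ℂ))) p) p := by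
  have hU : IsOpen {z : E × ℂ | AnalyticAt ℂ G z} := isOpen_analyticAt ℂ G
  have hKc : IsCompact ((fun t : ℝ => (p, (t : ℂ))) '' uIcc a b) :=
    isCompact_uIcc.image (by fun_prop)
  -- The set where `G` is analytic is open and contains a compact segment over `p`, hence a
  -- thickening of it. This gives one radius `δ` valid for all `t`, and by compactness the constant
  -- bound needed for dominated convergence.
  obtain ⟨δ, hδ, hδU⟩ := hKc.exists_cthickening_subset_open hU (by
    rintro _ ⟨t, ht, rfl⟩; exact hG t ht)
  have hball : ∀ t ∈ uIcc a b, ∀ q ∈ closedBall p δ, AnalyticAt ℂ G (q, (t : ℂ)) := by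
    intro t ht q hq
    refine hδU (mem_cthickening_of_dist_le _ (p, (t : ℂ)) δ _ ⟨t, ht, rfl⟩ ?_)
    simpa [Prod.dist_eq] using hq
  have hcomp : IsCompact (closedBall p δ ×ˢ uIcc a b) := by
    have : ProperSpace E := FiniteDimensional.proper ℂ E
    exact (isCompact_closedBall p δ).prod isCompact_uIcc
  have hpart : ∀ t ∈ uIcc a b, ∀ q ∈ closedBall p δ,
      HasFDerivAt (fun q => G (q, (t : ℂ)))
        ((fderiv ℂ G (q, (t : ℂ))) ∘L ContinuousLinearMap.inl ℂ E ℂ) q := by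
    intro t ht q hq
    have h1 : HasFDerivAt (fun q : E => (q, (t : ℂ))) (ContinuousLinearMap.inl ℂ E ℂ) q :=
      hasFDerivAt_prodMk_left q (t : ℂ)
    exact (hball t ht q hq).differentiableAt.hasFDerivAt.comp q h1
  have hcd : ContinuousOn (fun z : E × ℝ => fderiv ℂ G (z.1, (z.2 : ℂ)) ∘L
      ContinuousLinearMap.inl ℂ E ℂ) (closedBall p δ ×ˢ uIcc a b) := by
    intro z hz
    have h1 : ContinuousAt (fderiv ℂ G) (z.1, (z.2 : ℂ)) :=
      (hball z.2 hz.2 z.1 hz.1).fderiv.continuousAt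
    have h2 : ContinuousAt (fun z : E × ℝ => fderiv ℂ G (z.1, (z.2 : ℂ))) z :=
      ContinuousAt.comp (f := fun z : E × ℝ => (z.1, (z.2 : ℂ))) h1 (by fun_prop)
    exact (h2.clm_comp continuousAt_const).continuousWithinAt
  obtain ⟨M, hM⟩ := hcomp.exists_bound_of_continuousOn hcd
  have hct : ∀ q ∈ closedBall p δ, ContinuousOn (fun t : ℝ => G (q, (t : ℂ))) (uIcc a b) := by
    intro q hq t ht
    exact (ContinuousAt.comp (f := fun t : ℝ => (q, (t : ℂ)))
      (hball t ht q hq).continuousAt (by fun_prop)).continuousWithinAt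
  have hfd : ∀ t ∈ uIcc a b, fderiv ℂ (fun q => G (q, (t : ℂ))) p
      = fderiv ℂ G (p, (t : ℂ)) ∘L ContinuousLinearMap.inl ℂ E ℂ := fun t ht =>
    (hpart t ht p (mem_closedBall_self hδ.le)).fderiv
  rw [intervalIntegral.integral_congr hfd]
  refine intervalIntegral.hasFDerivAt_integral_of_dominated_of_fderiv_le (𝕜 := ℂ)
    (F := fun q (t : ℝ) => G (q, (t : ℂ)))
    (F' := fun q (t : ℝ) => fderiv ℂ G (q, (t : ℂ)) ∘L ContinuousLinearMap.inl ℂ E ℂ)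
    (bound := fun _ => M) (closedBall_mem_nhds p hδ) ?_ ?_ ?_ ?_ ?_ ?_
  · filter_upwards [closedBall_mem_nhds p hδ] with q hq
    exact ((hct q hq).mono uIoc_subset_uIcc).aestronglyMeasurable measurableSet_uIoc
  · exact (hct p (mem_closedBall_self hδ.le)).intervalIntegrable
  · have : ContinuousOn (fun t : ℝ => fderiv ℂ G (p, (t : ℂ)) ∘L
        ContinuousLinearMap.inl ℂ E ℂ) (uIoc a b) := by
      refine hcd.comp (f := fun t : ℝ => (p, t)) (by fun_prop) ?_
      intro t ht
      exact ⟨mem_closedBall_self hδ.le, uIoc_subset_uIcc ht⟩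
    exact this.aestronglyMeasurable measurableSet_uIoc
  · filter_upwards with t ht q hq
    exact hM (q, t) ⟨hq, uIoc_subset_uIcc ht⟩
  · exact intervalIntegrable_const
  · filter_upwards with t ht q hq
    exact hpart t (uIoc_subset_uIcc ht) q hq

/-- Integrals of analytic functions depend analytically on parameters. -/
theorem analyticAt_integral {G : E × ℂ → F} {a b : ℝ} {p : E}
    (hG : ∀ t ∈ uIcc a b, AnalyticAt ℂ G (p, (t : ℂ))) :
    AnalyticAt ℂ (fun q => ∫ t in a..b, G (q, (t : ℂ))) p := by
  refine analyticAt_of_eventually_differentiableAt ?_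
  have hU : IsOpen {z : E × ℂ | AnalyticAt ℂ G z} := isOpen_analyticAt ℂ G
  have hKc : IsCompact ((fun t : ℝ => (p, (t : ℂ))) '' uIcc a b) :=
    isCompact_uIcc.image (by fun_prop)
  obtain ⟨δ, hδ, hδU⟩ := hKc.exists_cthickening_subset_open hU (by
    rintro _ ⟨t, ht, rfl⟩; exact hG t ht)
  filter_upwards [closedBall_mem_nhds p hδ] with q hq
  refine (hasFDerivAt_integral_of_analyticAt fun t ht => ?_).differentiableAt
  refine hδU (mem_cthickening_of_dist_le _ (p, (t : ℂ)) δ _ ⟨t, ht, rfl⟩ ?_)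
  simpa [Prod.dist_eq] using hq

end ParametricIntegral

/-! ### Neighbourhoods of the circular collisionless configurations. -/

section Geometry

/-- The direction of the fast angle. -/
def eFast : Phase := (0, ![0, 1], 0)

/-- The real point with angles `θ` and vanishing actions and eccentricities. -/
def baseAngle (θ : Fin 2 → ℝ) : Phase := (0, fun j => (θ j : ℂ), 0)

/-- The `r`-neighbourhood of the circular collisionless configurations. -/
def zone (Δ r : ℝ) : Set Phase := {p | ∃ θ ∈ collisionless Δ, ‖p - baseAngle θ‖ ≤ r}

variable {Δ r s δ : ℝ}

theorem closedBall_subset_zone {p : Phase} (hp : p ∈ zone Δ r) (h : r + δ ≤ s) :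
    closedBall p δ ⊆ zone Δ s := by
  obtain ⟨θ, hθ, hpθ⟩ := hp
  intro q hq
  rw [mem_closedBall, dist_eq_norm] at hq
  refine ⟨θ, hθ, ?_⟩
  calc ‖q - baseAngle θ‖ = ‖(q - p) + (p - baseAngle θ)‖ := by congr 1; abel
    _ ≤ ‖q - p‖ + ‖p - baseAngle θ‖ := norm_add_le _ _
    _ ≤ s := by linarith

theorem mem_zone_of_norm_sub_le {p q : Phase} (hp : p ∈ zone Δ r) (hq : ‖q - p‖ ≤ δ)
    (h : r + δ ≤ s) : q ∈ zone Δ s :=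
  closedBall_subset_zone hp h (by rwa [mem_closedBall, dist_eq_norm])

theorem zone_mono (h : r ≤ s) : zone Δ r ⊆ zone Δ s := fun _ ⟨θ, hθ, hp⟩ => ⟨θ, hθ, hp.trans h⟩

theorem zone_mem_nhds {p : Phase} (hp : p ∈ zone Δ r) (h : r < s) : zone Δ s ∈ 𝓝 p :=
  mem_of_superset (closedBall_mem_nhds p (sub_pos.2 h)) (closedBall_subset_zone hp (by linarith))

/-- The admissible real angles form a convex strip. Convexity converts derivative bounds on a zone
into Lipschitz bounds and keeps segments between its points inside. -/
theorem convex_zone : Convex ℝ (zone Δ r) := by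
  rintro p ⟨θ, hθ, hp⟩ q ⟨θ', hθ', hq⟩ a b ha hb hab
  refine ⟨a • θ + b • θ', ?_, ?_⟩
  · have h1 := hθ.1; have h2 := hθ.2; have h3 := hθ'.1; have h4 := hθ'.2
    constructor
    · simp only [Pi.add_apply, Pi.smul_apply, smul_eq_mul]
      calc Δ = a * Δ + b * Δ := by rw [← add_mul, hab, one_mul]
        _ ≤ _ := by gcongr
    · simp only [Pi.add_apply, Pi.smul_apply, smul_eq_mul]
      calc _ ≤ a * (2 * Real.pi - Δ) + b * (2 * Real.pi - Δ) := by gcongr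
        _ = _ := by rw [← add_mul, hab, one_mul]
  · have : a • p + b • q - baseAngle (a • θ + b • θ')
        = a • (p - baseAngle θ) + b • (q - baseAngle θ') := by
      ext i <;> simp [baseAngle]
      ring
    rw [this]
    calc _ ≤ ‖a • (p - baseAngle θ)‖ + ‖b • (q - baseAngle θ')‖ := norm_add_le _ _
      _ = a * ‖p - baseAngle θ‖ + b * ‖q - baseAngle θ'‖ := by
        rw [norm_smul, norm_smul, Real.norm_of_nonneg ha, Real.norm_of_nonneg hb]
      _ ≤ a * r + b * r := by gcongr
      _ = r := by rw [← add_mul, hab, one_mul]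

/-- `collisionless` does not restrict the second angle, so zones contain whole fast lines; fast
averages can therefore be taken without shrinking the domain. -/
theorem add_fast_mem_zone {p : Phase} (hp : p ∈ zone Δ r) (t : ℝ) :
    p + (t : ℂ) • eFast ∈ zone Δ r := by
  obtain ⟨θ, hθ, hp⟩ := hp
  refine ⟨![θ 0, θ 1 + t], by simpa [collisionless] using hθ, ?_⟩
  convert hp using 2
  ext i
  · simp [baseAngle, eFast]
  · fin_cases i
    · simp [baseAngle, eFast, Matrix.vecHead]
    · simp [baseAngle, eFast, Matrix.vecHead, Matrix.vecTail]
  · simp [baseAngle, eFast]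
  · simp [baseAngle, eFast]

variable {f : Phase → ℂ} {M : ℝ}

theorem norm_fderiv_le_of_zone {F : Type*} [NormedAddCommGroup F] [NormedSpace ℂ F]
    {f : Phase → F} {M : ℝ} (hf : AnalyticOnNhd ℂ f (zone Δ s)) (hM : ∀ p ∈ zone Δ s, ‖f p‖ ≤ M)
    (hδ : 0 < δ) (h : r + δ ≤ s) {p : Phase} (hp : p ∈ zone Δ r) : ‖fderiv ℂ f p‖ ≤ M / δ := by
  have hsub := closedBall_subset_zone hp h
  exact norm_fderiv_le_of_closedBall hδ (fun y hy => (hf y (hsub hy)).differentiableAt)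
    fun y hy => hM y (hsub hy)

theorem norm_sub_le_of_zone {F : Type*} [NormedAddCommGroup F] [NormedSpace ℂ F]
    {f : Phase → F} {K : ℝ} (hf : AnalyticOnNhd ℂ f (zone Δ r))
    (hK : ∀ p ∈ zone Δ r, ‖fderiv ℂ f p‖ ≤ K) {p q : Phase} (hp : p ∈ zone Δ r)
    (hq : q ∈ zone Δ r) : ‖f q - f p‖ ≤ K * ‖q - p‖ :=
  convex_zone.norm_image_sub_le_of_norm_fderiv_le (𝕜 := ℂ)
    (fun z hz => (hf z hz).differentiableAt) hK hp hq

/-- Membership of the unscaled domain, entry by entry. -/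
theorem mem_zone_iff {p : Phase} : p ∈ zone Δ r ↔ ‖p.1‖ ≤ r ∧
    (∃ θ ∈ collisionless Δ, ‖p.2.1 - fun j => (θ j : ℂ)‖ ≤ r) ∧ ‖p.2.2‖ ≤ r := by
  constructor
  · rintro ⟨θ, hθ, h⟩
    simp only [baseAngle, Prod.norm_def, Prod.fst_sub, Prod.snd_sub, sub_zero, sup_le_iff] at h ⊢
    exact ⟨h.1, ⟨θ, hθ, h.2.1⟩, h.2.2⟩
  · rintro ⟨h1, ⟨θ, hθ, h2⟩, h3⟩
    refine ⟨θ, hθ, ?_⟩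
    simp only [baseAngle, Prod.norm_def, Prod.fst_sub, Prod.snd_sub, sub_zero, sup_le_iff] at h3 ⊢
    exact ⟨h1, h2, h3⟩

end Geometry

/-! ### The symplectic form and Hamiltonian vector fields. -/

section Symplectic

theorem sympl_add_left (u u' v : Phase) : sympl (u + u') v = sympl u v + sympl u' v := by
  simp [sympl, add_dotProduct, dotProduct_add]; ring

theorem sympl_smul_left (c : ℂ) (u v : Phase) : sympl (c • u) v = c * sympl u v := by
  simp [sympl, smul_dotProduct, dotProduct_smul]; ring

theorem sympl_antisymm (u v : Phase) : sympl u v = -sympl v u := by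
  simp [sympl]; ring

theorem sympl_add_right (u v v' : Phase) : sympl u (v + v') = sympl u v + sympl u v' := by
  rw [sympl_antisymm, sympl_add_left, sympl_antisymm v, sympl_antisymm v']; ring

theorem sympl_smul_right (c : ℂ) (u v : Phase) : sympl u (c • v) = c * sympl u v := by
  rw [sympl_antisymm, sympl_smul_left, sympl_antisymm v]; ring

/-- The symplectic gradient of a linear form. -/
noncomputable def symplGrad (φ : Phase →L[ℂ] ℂ) : Phase :=
  (fun j => φ (0, Pi.single j 1, 0), fun j => -φ (Pi.single j 1, 0),
    fun j => φ (0, 0, 0, Pi.single j 1), fun j => -φ (0, 0, Pi.single j 1, 0))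

theorem norm_symplGrad_le (φ : Phase →L[ℂ] ℂ) : ‖symplGrad φ‖ ≤ 1 * ‖φ‖ := by
  have key : ∀ v : Phase, ‖v‖ ≤ 1 → ‖φ v‖ ≤ ‖φ‖ := fun v hv =>
    (φ.le_opNorm v).trans (mul_le_of_le_one_right (norm_nonneg _) hv)
  have hs : ∀ j : Fin 2, ‖(Pi.single j 1 : Vec)‖ ≤ 1 := fun j =>
    (pi_norm_le_iff_of_nonneg zero_le_one).2 fun i => by
      rw [Pi.single_apply]; split_ifs <;> simp
  have h0 : (0 : ℝ) ≤ ‖φ‖ := norm_nonneg _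
  simp only [symplGrad, Prod.norm_def, sup_le_iff, one_mul]
  refine ⟨?_, ?_, ?_, ?_⟩ <;> refine (pi_norm_le_iff_of_nonneg h0).2 fun j => ?_
  · exact key _ (by simpa [Prod.norm_def] using hs j)
  · rw [norm_neg]; exact key _ (by simpa [Prod.norm_def] using hs j)
  · exact key _ (by simpa [Prod.norm_def] using hs j)
  · rw [norm_neg]; exact key _ (by simpa [Prod.norm_def] using hs j)

/-- The symplectic gradient, as a continuous linear map. -/
noncomputable def symplGradL : (Phase →L[ℂ] ℂ) →L[ℂ] Phase :=
  LinearMap.mkContinuous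
    { toFun := symplGrad
      map_add' := by intro φ ψ; ext j <;> simp [symplGrad] <;> ring
      map_smul' := by intro c φ; ext j <;> simp [symplGrad] } 1 norm_symplGrad_le

theorem norm_symplGradL_apply_le (φ : Phase →L[ℂ] ℂ) : ‖symplGradL φ‖ ≤ ‖φ‖ :=
  (norm_symplGrad_le φ).trans_eq (one_mul _)

theorem sympl_symplGradL (φ : Phase →L[ℂ] ℂ) (v : Phase) : sympl (symplGradL φ) v = φ v := by
  change sympl (symplGrad φ) v = φ v
  have hv : v = v.1 0 • (Pi.single 0 1, 0) + v.1 1 • (Pi.single 1 1, 0)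
      + (v.2.1 0 • (0, Pi.single 0 1, 0) + v.2.1 1 • (0, Pi.single 1 1, 0))
      + (v.2.2.1 0 • (0, 0, Pi.single 0 1, 0) + v.2.2.1 1 • (0, 0, Pi.single 1 1, 0))
      + (v.2.2.2 0 • (0, 0, 0, Pi.single 0 1) + v.2.2.2 1 • (0, 0, 0, Pi.single 1 1)) := by
    ext j <;> fin_cases j <;> simp
  conv_rhs => rw [hv]
  simp only [map_add, map_smul, smul_eq_mul]
  simp [sympl, symplGrad, dotProduct, Fin.sum_univ_two]
  ring

theorem eq_of_sympl_eq {a b : Phase} (h : ∀ v, sympl a v = sympl b v) : a = b := by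
  ext j
  · have := h (0, Pi.single j 1, 0)
    simpa [sympl] using this
  · have := h (Pi.single j 1, 0)
    simpa [sympl] using this
  · have := h (0, 0, 0, Pi.single j 1)
    simpa [sympl] using this
  · have := h (0, 0, Pi.single j 1, 0)
    simpa [sympl] using this

/-- The action `Z₂` is conjugate to the fast angle: a Hamiltonian displacement changes υ₀ Z₂ by the
fast derivative of the generator. This is the left side of the homological equation. -/
theorem symplGradL_fst_one (φ : Phase →L[ℂ] ℂ) : (symplGradL φ).1 1 = φ eFast := by
  change φ (0, Pi.single 1 1, 0) = _
  congr 1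
  ext j <;> simp [eFast]
  fin_cases j <;> simp

end Symplectic

/-! ### Symmetries and equivariance of Hamiltonian vector fields. -/

/-- A real affine symmetry of the phase space, compatible with the symplectic form up to a real
linear map `val` of the values. -/
structure Symmetry (Δ : ℝ) where
  /-- the linear part -/
  lin : Phase →L[ℝ] Phase
  /-- the translation part -/
  shift : Phase
  /-- the action on values -/
  val : ℂ →L[ℝ] ℂ
  surj : Function.Surjective lin
  sympl_lin : ∀ u v, sympl (lin u) (lin v) = val (sympl u v)
  lin_fast : lin eFast = eFast
  zone_map : ∀ r, ∀ p ∈ zone Δ r, lin p + shift ∈ zone Δ r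

/-- The affine map of a symmetry. -/
noncomputable def Symmetry.map {Δ : ℝ} (S : Symmetry Δ) (p : Phase) : Phase := S.lin p + S.shift

/-- `f` is invariant under the symmetry `S` on the set `K`. -/
def Symmetry.Inv {Δ : ℝ} (S : Symmetry Δ) (f : Phase → ℂ) (K : Set Phase) : Prop :=
  ∀ p ∈ K, f (S.map p) = S.val (f p)

/-- `Υ` commutes with the symmetry `S` on the set `K`. -/
def Symmetry.Equiv {Δ : ℝ} (S : Symmetry Δ) (Υ : Phase → Phase) (K : Set Phase) : Prop :=
  ∀ p ∈ K, Υ (S.map p) = S.map (Υ p)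

theorem Symmetry.map_add_fast {Δ : ℝ} (S : Symmetry Δ) (p : Phase) (t : ℝ) :
    S.map (p + (t : ℂ) • eFast) = S.map p + (t : ℂ) • eFast := by
  have : (t : ℂ) • eFast = t • eFast := by ext <;> simp
  rw [Symmetry.map, Symmetry.map, this, map_add, map_smul, S.lin_fast]; abel

theorem Symmetry.map_mem {Δ r : ℝ} (S : Symmetry Δ) {p : Phase} (hp : p ∈ zone Δ r) :
    S.map p ∈ zone Δ r := S.zone_map r p hp

/-- Equivariance of Hamiltonian vector fields. -/
theorem Symmetry.symplGrad_fderiv {Δ r s : ℝ} (S : Symmetry Δ) {χ : Phase → ℂ} (hrs : r < s)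
    (hχ : AnalyticOnNhd ℂ χ (zone Δ s)) (hS : S.Inv χ (zone Δ s)) {p : Phase}
    (hp : p ∈ zone Δ r) :
    symplGradL (fderiv ℂ χ (S.map p)) = S.lin (symplGradL (fderiv ℂ χ p)) := by
  have hps := zone_mono hrs.le hp
  refine eq_of_sympl_eq fun w => ?_
  obtain ⟨v, rfl⟩ := S.surj w
  rw [sympl_symplGradL, S.sympl_lin, sympl_symplGradL]
  -- A symmetry may be antiholomorphic, so the invariance relation is differentiated along real
  -- lines only.
  have hl : HasDerivAt (fun t : ℝ => p + t • v) v 0 := by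
    simpa using ((hasDerivAt_id (0 : ℝ)).smul_const v).const_add p
  have hl' : HasDerivAt (fun t : ℝ => S.map p + t • S.lin v) (S.lin v) 0 := by
    simpa using ((hasDerivAt_id (0 : ℝ)).smul_const (S.lin v)).const_add (S.map p)
  have h1 : HasDerivAt (fun t : ℝ => S.val (χ (p + t • v))) (S.val (fderiv ℂ χ p v)) 0 := by
    have h0 : HasFDerivAt χ ((fderiv ℂ χ p).restrictScalars ℝ) (p + (0 : ℝ) • v) := by
      simpa using ((hχ p hps).differentiableAt.hasFDerivAt).restrictScalars ℝ
    have := h0.comp_hasDerivAt (0 : ℝ) hl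
    exact S.val.hasFDerivAt.comp_hasDerivAt (0 : ℝ) this
  have h2 : HasDerivAt (fun t : ℝ => χ (S.map p + t • S.lin v))
      (fderiv ℂ χ (S.map p) (S.lin v)) 0 := by
    have h0 : HasFDerivAt χ ((fderiv ℂ χ (S.map p)).restrictScalars ℝ)
        (S.map p + (0 : ℝ) • S.lin v) := by
      simpa using ((hχ _ (S.map_mem hps)).differentiableAt.hasFDerivAt).restrictScalars ℝ
    exact h0.comp_hasDerivAt (0 : ℝ) hl'
  refine h2.unique (h1.congr_of_eventuallyEq ?_)
  have : Tendsto (fun t : ℝ => p + t • v) (𝓝 0) (𝓝 p) := by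
    simpa using hl.continuousAt.tendsto
  filter_upwards [this (zone_mem_nhds hp hrs)] with t ht
  rw [← hS _ ht, Symmetry.map, Symmetry.map, map_add, map_smul]
  congr 1; abel

/-! ### Fast averages, primitives and the homological equation. -/

section Averages

variable {Δ r s M : ℝ} {f g : Phase → ℂ}

/-- Average along the fast angle, as a function of all the variables. -/
noncomputable def fastAvg (f : Phase → ℂ) (p : Phase) : ℂ :=
  1 / (2 * Real.pi) * ∫ t in (0 : ℝ)..2 * Real.pi, f (p + (t : ℂ) • eFast)

/-- A primitive along the fast angle of the oscillating part. -/
noncomputable def fastPrim (f : Phase → ℂ) (p : Phase) : ℂ :=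
  1 / (2 * Real.pi) * ∫ t in (0 : ℝ)..2 * Real.pi, ((t : ℂ) - Real.pi) * f (p + (t : ℂ) • eFast)

/-- Invariance under the real translations of the fast angle. -/
def FastInv (f : Phase → ℂ) (K : Set Phase) : Prop :=
  ∀ p ∈ K, ∀ t : ℝ, f (p + (t : ℂ) • eFast) = f p

/-- Periodicity in the fast angle. -/
def FastPeriodic (f : Phase → ℂ) (K : Set Phase) : Prop :=
  ∀ p ∈ K, f (p + ((2 * Real.pi : ℝ) : ℂ) • eFast) = f p

theorem analyticAt_fast (hf : AnalyticOnNhd ℂ f (zone Δ r)) {p : Phase} (hp : p ∈ zone Δ r)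
    (t : ℝ) : AnalyticAt ℂ (fun z : Phase × ℂ => f (z.1 + z.2 • eFast)) (p, (t : ℂ)) := by
  have h : AnalyticAt ℂ (fun z : Phase × ℂ => z.1 + z.2 • eFast) (p, (t : ℂ)) :=
    analyticAt_fst.add (analyticAt_snd.smul analyticAt_const)
  exact AnalyticAt.comp (g := f) (hf _ (add_fast_mem_zone hp t)) h

theorem continuous_fast (hf : AnalyticOnNhd ℂ f (zone Δ r)) {p : Phase} (hp : p ∈ zone Δ r) :
    Continuous fun t : ℝ => f (p + (t : ℂ) • eFast) := by
  rw [continuous_iff_continuousAt]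
  intro t
  exact ContinuousAt.comp (f := fun t : ℝ => p + (t : ℂ) • eFast)
    (hf _ (add_fast_mem_zone hp t)).continuousAt (by fun_prop)

theorem analyticOnNhd_fastAvg (hf : AnalyticOnNhd ℂ f (zone Δ r)) :
    AnalyticOnNhd ℂ (fastAvg f) (zone Δ r) := fun _ hp =>
  analyticAt_const.mul (analyticAt_integral (G := fun z : Phase × ℂ => f (z.1 + z.2 • eFast))
    fun t _ => analyticAt_fast hf hp t)

theorem analyticOnNhd_fastPrim (hf : AnalyticOnNhd ℂ f (zone Δ r)) :
    AnalyticOnNhd ℂ (fastPrim f) (zone Δ r) := fun _ hp =>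
  analyticAt_const.mul (analyticAt_integral
    (G := fun z : Phase × ℂ => (z.2 - Real.pi) * f (z.1 + z.2 • eFast))
    fun t _ => (analyticAt_snd.sub analyticAt_const).mul (analyticAt_fast hf hp t))

theorem norm_inv_two_pi : ‖(1 / (2 * Real.pi) : ℂ)‖ = 1 / (2 * Real.pi) := by
  rw [norm_div, norm_mul, norm_one, Complex.norm_real, Complex.norm_ofNat,
    Real.norm_of_nonneg Real.pi_pos.le]

theorem norm_fastAvg_le (hM : ∀ p ∈ zone Δ r, ‖f p‖ ≤ M) {p : Phase} (hp : p ∈ zone Δ r) :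
    ‖fastAvg f p‖ ≤ M := by
  have := intervalIntegral.norm_integral_le_of_norm_le_const (a := 0) (b := 2 * Real.pi)
    (f := fun t : ℝ => f (p + (t : ℂ) • eFast)) (C := M)
    fun t _ => hM _ (add_fast_mem_zone hp t)
  rw [sub_zero, abs_of_pos Real.two_pi_pos] at this
  rw [fastAvg, norm_mul, norm_inv_two_pi]
  calc _ ≤ 1 / (2 * Real.pi) * (M * (2 * Real.pi)) := by gcongr
    _ = M := by field_simp

theorem norm_fastPrim_le (hM : ∀ p ∈ zone Δ r, ‖f p‖ ≤ M) {p : Phase} (hp : p ∈ zone Δ r) :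
    ‖fastPrim f p‖ ≤ Real.pi * M := by
  have := intervalIntegral.norm_integral_le_of_norm_le_const (a := 0) (b := 2 * Real.pi)
    (f := fun t : ℝ => ((t : ℂ) - Real.pi) * f (p + (t : ℂ) • eFast)) (C := Real.pi * M)
    fun t ht => by
      rw [norm_mul]
      gcongr
      · rw [← Complex.ofReal_sub, Complex.norm_real, Real.norm_eq_abs, abs_le]
        rw [uIoc_of_le Real.two_pi_pos.le] at ht
        constructor <;> linarith [ht.1, ht.2]
      · exact hM _ (add_fast_mem_zone hp t)
  rw [sub_zero, abs_of_pos Real.two_pi_pos] at this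
  rw [fastPrim, norm_mul, norm_inv_two_pi]
  calc _ ≤ 1 / (2 * Real.pi) * (Real.pi * M * (2 * Real.pi)) := by gcongr
    _ = _ := by field_simp

theorem fastAvg_add (hf : AnalyticOnNhd ℂ f (zone Δ r)) (hg : AnalyticOnNhd ℂ g (zone Δ r))
    {p : Phase} (hp : p ∈ zone Δ r) :
    fastAvg (fun q => f q + g q) p = fastAvg f p + fastAvg g p := by
  rw [fastAvg, intervalIntegral.integral_add ((continuous_fast hf hp).intervalIntegrable _ _)
    ((continuous_fast hg hp).intervalIntegrable _ _), mul_add]; rfl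

theorem fastAvg_sub (hf : AnalyticOnNhd ℂ f (zone Δ r)) (hg : AnalyticOnNhd ℂ g (zone Δ r))
    {p : Phase} (hp : p ∈ zone Δ r) :
    fastAvg (fun q => f q - g q) p = fastAvg f p - fastAvg g p := by
  rw [fastAvg, intervalIntegral.integral_sub ((continuous_fast hf hp).intervalIntegrable _ _)
    ((continuous_fast hg hp).intervalIntegrable _ _), mul_sub]; rfl

theorem fastAvg_const_mul (c : ℂ) (p : Phase) :
    fastAvg (fun q => c * f q) p = c * fastAvg f p := by
  rw [fastAvg, intervalIntegral.integral_const_mul, fastAvg]; ring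

theorem FastInv.fastAvg_eq (hf : FastInv f (zone Δ r)) {p : Phase} (hp : p ∈ zone Δ r) :
    fastAvg f p = f p := by
  rw [fastAvg, intervalIntegral.integral_congr (g := fun _ => f p) fun t _ => hf p hp t]
  rw [intervalIntegral.integral_const, sub_zero, real_smul]
  push_cast
  have : (Real.pi : ℂ) ≠ 0 := by exact_mod_cast Real.pi_ne_zero
  field_simp

theorem FastPeriodic.fastInv_fastAvg (hf : FastPeriodic f (zone Δ r)) :
    FastInv (fastAvg f) (zone Δ r) := by
  intro p hp t
  have hper : Function.Periodic (fun u : ℝ => f (p + (u : ℂ) • eFast)) (2 * Real.pi) := by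
    intro u
    simp only
    rw [← hf _ (add_fast_mem_zone hp u)]
    congr 1
    push_cast
    rw [add_smul, add_assoc]
  have h1 := hper.intervalIntegral_add_eq t 0
  rw [zero_add] at h1
  have h2 := intervalIntegral.integral_comp_add_right (a := 0) (b := 2 * Real.pi)
    (fun u : ℝ => f (p + (u : ℂ) • eFast)) t
  rw [zero_add, add_comm (2 * Real.pi) t] at h2
  rw [fastAvg, fastAvg, ← h1, ← h2]
  congr 1
  refine intervalIntegral.integral_congr fun u _ => ?_
  congr 1
  push_cast
  rw [add_smul]; abel

theorem FastInv.periodic (hf : FastInv f (zone Δ r)) : FastPeriodic f (zone Δ r) :=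
  fun p hp => hf p hp _

theorem hasDerivAt_fast (hf : AnalyticOnNhd ℂ f (zone Δ r)) {p : Phase} (hp : p ∈ zone Δ r)
    (t : ℝ) : HasDerivAt (fun t : ℝ => f (p + (t : ℂ) • eFast))
      (fderiv ℂ f (p + (t : ℂ) • eFast) eFast) t := by
  have hl : HasDerivAt (fun t : ℝ => p + (t : ℂ) • eFast) eFast t := by
    simpa using ((Complex.ofRealCLM.hasDerivAt (x := t)).smul_const eFast).const_add p
  exact ((hf _ (add_fast_mem_zone hp t)).differentiableAt.hasFDerivAt.restrictScalars
    ℝ).comp_hasDerivAt t hl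

theorem FastInv.fderiv_eFast (hf : AnalyticOnNhd ℂ f (zone Δ r)) (h : FastInv f (zone Δ r))
    {p : Phase} (hp : p ∈ zone Δ r) : fderiv ℂ f p eFast = 0 := by
  have h1 := hasDerivAt_fast hf hp 0
  simp only [ofReal_zero, zero_smul, add_zero] at h1
  refine h1.unique ?_
  have : (fun t : ℝ => f (p + (t : ℂ) • eFast)) = fun _ => f p := by
    ext t; exact h p hp t
  rw [this]; exact hasDerivAt_const _ _

/-- Differentiation under the integral followed by integration by parts: the kernel t - π jumps by
2π over a period, so by periodicity the boundary term is 2π f(p), and the remaining integral is the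
average. The same would hold for t - c with any c; the choice c = π keeps the kernel below π in
modulus. -/
theorem fderiv_fastPrim (hf : AnalyticOnNhd ℂ f (zone Δ r)) (h : FastPeriodic f (zone Δ r))
    {p : Phase} (hp : p ∈ zone Δ r) :
    fderiv ℂ (fastPrim f) p eFast = f p - fastAvg f p := by
  have h1 := hasFDerivAt_integral_of_analyticAt (a := 0) (b := 2 * Real.pi) (p := p)
    (G := fun z : Phase × ℂ => (z.2 - Real.pi) * f (z.1 + z.2 • eFast))
    fun t _ => (analyticAt_snd.sub analyticAt_const).mul (analyticAt_fast hf hp t)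
  have h2 : HasFDerivAt (fastPrim f) _ p := h1.const_mul (1 / (2 * Real.pi) : ℂ)
  have h3 : ∀ t : ℝ, fderiv ℂ (fun q => ((t : ℂ) - Real.pi) * f (q + (t : ℂ) • eFast)) p
      = ((t : ℂ) - Real.pi) • fderiv ℂ f (p + (t : ℂ) • eFast) := by
    intro t
    have h4 : HasFDerivAt (fun q => f (q + (t : ℂ) • eFast)) (fderiv ℂ f (p + (t : ℂ) • eFast)) p :=
      HasFDerivAt.comp p (hf _ (add_fast_mem_zone hp t)).differentiableAt.hasFDerivAt
        ((hasFDerivAt_id p).add_const _)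
    exact (h4.const_mul _).fderiv
  have hc : Continuous fun t : ℝ => fderiv ℂ f (p + (t : ℂ) • eFast) := by
    rw [continuous_iff_continuousAt]
    intro t
    exact ContinuousAt.comp (f := fun t : ℝ => p + (t : ℂ) • eFast)
      (hf _ (add_fast_mem_zone hp t)).fderiv.continuousAt (by fun_prop)
  rw [h2.fderiv]
  simp only [h3]
  rw [_root_.smul_apply, ContinuousLinearMap.intervalIntegral_apply
    (Continuous.intervalIntegrable (by fun_prop) _ _)]
  simp only [_root_.smul_apply, smul_eq_mul]
  rw [intervalIntegral.integral_mul_deriv_eq_deriv_mul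
    (u := fun t : ℝ => (t : ℂ) - Real.pi) (u' := fun _ => 1)
    (v := fun t : ℝ => f (p + (t : ℂ) • eFast))
    (fun t _ => by simpa using (Complex.ofRealCLM.hasDerivAt (x := t)).sub_const (Real.pi : ℂ))
    (fun t _ => hasDerivAt_fast hf hp t) intervalIntegrable_const
    (Continuous.intervalIntegrable (by fun_prop) _ _)]
  rw [h p hp]
  have : (Real.pi : ℂ) ≠ 0 := by exact_mod_cast Real.pi_ne_zero
  simp only [one_mul, fastAvg]
  push_cast
  simp only [zero_smul, add_zero]
  field_simp
  ring

/-- A symmetry maps fast lines to fast lines without changing the parameter, and its action on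
values is continuous and real linear, so it passes through the integral. -/
theorem Symmetry.fastAvg_inv (S : Symmetry Δ) (hS : S.Inv f (zone Δ r)) 
    (hf : AnalyticOnNhd ℂ f (zone Δ r)) : S.Inv (fastAvg f) (zone Δ r) := by
  intro p hp
  have h1 : ∀ c : ℝ, ∀ z : ℂ, S.val (c * z) = c * S.val z := fun c z => by
    rw [← real_smul, map_smul, real_smul]
  have h2 : (1 / (2 * Real.pi) : ℂ) = ((1 / (2 * Real.pi) : ℝ) : ℂ) := by push_cast; rfl
  rw [fastAvg, fastAvg, h2, h1, ← ContinuousLinearMap.intervalIntegral_comp_comm S.val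
    ((continuous_fast hf hp).intervalIntegrable _ _)]
  congr 1
  refine intervalIntegral.integral_congr fun t _ => ?_
  rw [← hS _ (add_fast_mem_zone hp t), S.map_add_fast]

theorem Symmetry.fastPrim_inv (S : Symmetry Δ) (hS : S.Inv f (zone Δ r)) 
    (hf : AnalyticOnNhd ℂ f (zone Δ r)) : S.Inv (fastPrim f) (zone Δ r) := by
  intro p hp
  have h1 : ∀ c : ℝ, ∀ z : ℂ, S.val (c * z) = c * S.val z := fun c z => by
    rw [← real_smul, map_smul, real_smul]
  have h2 : (1 / (2 * Real.pi) : ℂ) = ((1 / (2 * Real.pi) : ℝ) : ℂ) := by push_cast; rfl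
  have hc : Continuous fun t : ℝ => ((t : ℂ) - Real.pi) * f (p + (t : ℂ) • eFast) :=
    (Complex.continuous_ofReal.sub continuous_const).mul (continuous_fast hf hp)
  rw [fastPrim, fastPrim, h2, h1, ← ContinuousLinearMap.intervalIntegral_comp_comm S.val
    (hc.intervalIntegrable _ _)]
  congr 1
  refine intervalIntegral.integral_congr fun t _ => ?_
  rw [← ofReal_sub, h1, ← hS _ (add_fast_mem_zone hp t), S.map_add_fast]

/-- The generating Hamiltonian of an averaging step. -/
noncomputable def averagingHam (υ₀ : ℝ) (f : Phase → ℂ) (p : Phase) : ℂ :=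
  -(1 / (υ₀ : ℂ)) * (fastPrim f p - fastAvg (fastPrim f) p)

theorem fastPeriodic_fastPrim (h : FastPeriodic f (zone Δ r)) :
    FastPeriodic (fastPrim f) (zone Δ r) := by
  intro p hp
  rw [fastPrim, fastPrim]
  congr 1
  refine intervalIntegral.integral_congr fun t _ => ?_
  rw [add_right_comm, h _ (add_fast_mem_zone hp t)]

theorem analyticOnNhd_averagingHam (υ₀ : ℝ) (hf : AnalyticOnNhd ℂ f (zone Δ r)) :
    AnalyticOnNhd ℂ (averagingHam υ₀ f) (zone Δ r) := fun p hp =>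
  analyticAt_const.mul ((analyticOnNhd_fastPrim hf p hp).sub
    (analyticOnNhd_fastAvg (analyticOnNhd_fastPrim hf) p hp))

theorem norm_averagingHam_le {υ₀ : ℝ} (hυ₀ : 0 < υ₀) (hM : ∀ p ∈ zone Δ r, ‖f p‖ ≤ M)
    {p : Phase} (hp : p ∈ zone Δ r) : ‖averagingHam υ₀ f p‖ ≤ 2 * Real.pi / υ₀ * M := by
  have h1 := norm_fastPrim_le hM hp
  have h2 := norm_fastAvg_le (fun p hp => norm_fastPrim_le hM hp) hp
  rw [averagingHam, norm_mul, norm_neg, norm_div, norm_one, Complex.norm_real,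
    Real.norm_of_nonneg hυ₀.le]
  calc _ ≤ 1 / υ₀ * (Real.pi * M + Real.pi * M) := by
        gcongr
        exact (norm_sub_le _ _).trans (add_le_add h1 h2)
    _ = _ := by ring

/-- The homological equation: along the Hamiltonian field of this generator the derivative of υ₀ Z₂
is -f. -/
theorem fderiv_averagingHam_eFast {υ₀ : ℝ} (hf : AnalyticOnNhd ℂ f (zone Δ r))
    (h : FastPeriodic f (zone Δ r)) (h0 : ∀ p ∈ zone Δ r, fastAvg f p = 0) {p : Phase}
    (hp : p ∈ zone Δ r) : fderiv ℂ (averagingHam υ₀ f) p eFast = -(1 / (υ₀ : ℂ)) * f p := by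
  have hp1 := analyticOnNhd_fastPrim hf
  have hp2 := analyticOnNhd_fastAvg hp1
  have h1 : HasFDerivAt (averagingHam υ₀ f) _ p :=
    (((hp1 p hp).differentiableAt.hasFDerivAt).sub
      ((hp2 p hp).differentiableAt.hasFDerivAt)).const_mul (-(1 / (υ₀ : ℂ)))
  rw [h1.fderiv, _root_.smul_apply, _root_.sub_apply,
    fderiv_fastPrim hf h hp, h0 p hp,
    FastInv.fderiv_eFast hp2 (fastPeriodic_fastPrim h).fastInv_fastAvg hp]
  simp

/-- Centring the generator plays no role in the homological equation. It serves `fastAvg_bracket`,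
where it removes the first-order effect of the slow part on the average. -/
theorem fastAvg_averagingHam {υ₀ : ℝ} (hf : AnalyticOnNhd ℂ f (zone Δ r))
    (h : FastPeriodic f (zone Δ r)) {p : Phase} (hp : p ∈ zone Δ r) :
    fastAvg (averagingHam υ₀ f) p = 0 := by
  have hp1 := analyticOnNhd_fastPrim hf
  have hp2 := analyticOnNhd_fastAvg hp1
  have h1 : fastAvg (averagingHam υ₀ f) p = -(1 / (υ₀ : ℂ)) *
      fastAvg (fun q => fastPrim f q - fastAvg (fastPrim f) q) p := fastAvg_const_mul _ _
  rw [h1, fastAvg_sub hp1 hp2 hp, (fastPeriodic_fastPrim h).fastInv_fastAvg.fastAvg_eq hp, sub_self,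
    mul_zero]

theorem Symmetry.averagingHam_inv (S : Symmetry Δ) (υ₀ : ℝ) (hS : S.Inv f (zone Δ r)) 
    (hf : AnalyticOnNhd ℂ f (zone Δ r)) : S.Inv (averagingHam υ₀ f) (zone Δ r) := by
  intro p hp
  have hp1 := analyticOnNhd_fastPrim hf
  have h1 : ∀ c : ℝ, ∀ z : ℂ, S.val (c * z) = c * S.val z := fun c z => by
    rw [← real_smul, map_smul, real_smul]
  have h2 : (-(1 / (υ₀ : ℂ)) : ℂ) = ((-(1 / υ₀) : ℝ) : ℂ) := by push_cast; rfl
  rw [averagingHam, averagingHam, h2, h1, map_sub, S.fastPrim_inv hS hf p hp,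
    S.fastAvg_inv (S.fastPrim_inv hS hf) hp1 p hp]

/-- The Poisson bracket of a fast-invariant function with a function of vanishing average has
vanishing average. -/
theorem fastAvg_bracket {k χ : Phase → ℂ} (hrs : r < s) (hχ : AnalyticOnNhd ℂ χ (zone Δ s)) (hki : FastInv k (zone Δ s))
    (h0 : ∀ p ∈ zone Δ s, fastAvg χ p = 0) {p : Phase} (hp : p ∈ zone Δ r) :
    fastAvg (fun q => fderiv ℂ k q (symplGradL (fderiv ℂ χ q))) p = 0 := by
  have hps := zone_mono hrs.le hp
  -- The derivative of `k` is constant along the fast line, so only `fderiv ℂ χ` is averaged, and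
  -- its average is the derivative of the vanishing average of `χ`.
  have hkd : ∀ t : ℝ, fderiv ℂ k (p + (t : ℂ) • eFast) = fderiv ℂ k p := by
    intro t
    rw [← fderiv_comp_add_right]
    refine Filter.EventuallyEq.fderiv_eq ?_
    filter_upwards [zone_mem_nhds hp hrs] with q hq using hki q hq t
  have hc : Continuous fun t : ℝ => fderiv ℂ χ (p + (t : ℂ) • eFast) := by
    rw [continuous_iff_continuousAt]
    intro t
    exact ContinuousAt.comp (f := fun t : ℝ => p + (t : ℂ) • eFast)
      (hχ _ (add_fast_mem_zone hps t)).fderiv.continuousAt (by fun_prop)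
  have hint : ∫ t in (0 : ℝ)..2 * Real.pi, fderiv ℂ χ (p + (t : ℂ) • eFast) = 0 := by
    have h1 := hasFDerivAt_integral_of_analyticAt (a := 0) (b := 2 * Real.pi) (p := p)
      (G := fun z : Phase × ℂ => χ (z.1 + z.2 • eFast)) fun t _ => analyticAt_fast hχ hps t
    simp only [fderiv_comp_add_right] at h1
    refine h1.unique ((hasFDerivAt_const (0 : ℂ) p).congr_of_eventuallyEq ?_)
    filter_upwards [zone_mem_nhds hp hrs] with q hq
    have := h0 q hq
    rw [fastAvg, mul_eq_zero] at this
    rcases this with h | h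
    · simp [Real.pi_ne_zero] at h
    · exact h
  rw [fastAvg]
  simp only [hkd]
  have := ContinuousLinearMap.intervalIntegral_comp_comm (fderiv ℂ k p ∘L symplGradL)
    (hc.intervalIntegrable (μ := MeasureTheory.volume) 0 (2 * Real.pi))
  simp only [ContinuousLinearMap.comp_apply] at this
  rw [this, hint]; simp

end Averages

/-! ### The implicit midpoint map. -/

section Midpoint

variable {Δ r R ξ : ℝ}

/-- The implicit midpoint rule: solution of `m = z + X(m) / 2`. -/
theorem exists_midpoint {X : Phase → Phase} (hX : AnalyticOnNhd ℂ X (zone Δ R))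
    (hξ : ∀ p ∈ zone Δ R, ‖X p‖ ≤ ξ) (hξ0 : 0 ≤ ξ) (hL : ∀ p ∈ zone Δ R, ‖fderiv ℂ X p‖ ≤ 1)
    (hr : r + ξ < R) :
    ∃ m : Phase → Phase, AnalyticOnNhd ℂ m (zone Δ r) ∧
      (∀ z ∈ zone Δ r, ‖m z - z‖ ≤ ξ / 2 ∧ m z = z + (1 / 2 : ℂ) • X (m z)) ∧
      (∀ z ∈ zone Δ r, ∀ᶠ y in 𝓝 z, m y = y + (1 / 2 : ℂ) • X (m y)) ∧
      ∀ z ∈ zone Δ r, ∀ w ∈ zone Δ R, w = z + (1 / 2 : ℂ) • X w → w = m z := by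
  have hhalf : ‖(1 / 2 : ℂ)‖ = 1 / 2 := by norm_num
  have hlip : ∀ w ∈ zone Δ R, ∀ w' ∈ zone Δ R,
      ‖(1 / 2 : ℂ) • X w' - (1 / 2 : ℂ) • X w‖ ≤ 1 / 2 * ‖w' - w‖ := by
    intro w hw w' hw'
    rw [← smul_sub, norm_smul, hhalf]
    have := norm_sub_le_of_zone hX hL hw hw'
    linarith
  -- The factor 1/2 of the midpoint rule makes the fixed-point map a contraction of ratio 1/2 as
  -- soon as the derivative of `X` is at most 1.
  have hex : ∀ z ∈ zone Δ (R - ξ), ∃ w ∈ zone Δ R, w = z + (1 / 2 : ℂ) • X w := by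
    intro z hz
    have hsub : closedBall z ξ ⊆ zone Δ R := closedBall_subset_zone hz (by linarith)
    have hmaps : MapsTo (fun w => z + (1 / 2 : ℂ) • X w) (closedBall z ξ) (closedBall z ξ) := by
      intro w hw
      rw [mem_closedBall, dist_eq_norm, add_sub_cancel_left, norm_smul, hhalf]
      linarith [hξ w (hsub hw)]
    have hcontr : ContractingWith (1 / 2) (hmaps.restrict _ _ _) := by
      refine ⟨by norm_num, LipschitzWith.of_dist_le_mul fun w w' => ?_⟩
      rw [Subtype.dist_eq, Subtype.dist_eq, dist_eq_norm, dist_eq_norm]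
      simp only [MapsTo.val_restrict_apply, add_sub_add_left_eq_sub]
      exact hlip _ (hsub w'.2) _ (hsub w.2)
    obtain ⟨w, hw, hfix, -⟩ := hcontr.exists_fixedPoint' isClosed_closedBall.isComplete hmaps
      (mem_closedBall_self hξ0) (edist_ne_top _ _)
    exact ⟨w, hsub hw, hfix.symm⟩
  choose! m hm hmeq using hex
  have huniq : ∀ z ∈ zone Δ (R - ξ), ∀ w ∈ zone Δ R, w = z + (1 / 2 : ℂ) • X w → w = m z := by
    intro z hz w hw hweq
    have h1 := hlip _ (hm z hz) _ hw
    have h2 : w - m z = (1 / 2 : ℂ) • X w - (1 / 2 : ℂ) • X (m z) := by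
      conv_lhs => rw [hweq, hmeq z hz]
      abel
    rw [← h2] at h1
    have : ‖w - m z‖ ≤ 0 := by linarith [norm_nonneg (w - m z)]
    exact sub_eq_zero.1 (norm_le_zero_iff.1 this)
  have hml : ∀ z ∈ zone Δ (R - ξ), ∀ z' ∈ zone Δ (R - ξ), ‖m z' - m z‖ ≤ 2 * ‖z' - z‖ := by
    intro z hz z' hz'
    have h1 := hlip _ (hm z hz) _ (hm z' hz')
    have h2 : m z' - m z = (z' - z) + ((1 / 2 : ℂ) • X (m z') - (1 / 2 : ℂ) • X (m z)) := by
      conv_lhs => rw [hmeq z hz, hmeq z' hz']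
      abel
    have h3 := norm_add_le (z' - z) ((1 / 2 : ℂ) • X (m z') - (1 / 2 : ℂ) • X (m z))
    rw [← h2] at h3
    linarith
  have hrR : r < R - ξ := by linarith
  refine ⟨m, ?_, ?_, fun z hz => ?_, fun z hz => huniq z (zone_mono hrR.le hz)⟩
  · intro p hp
    -- `m` inverts w ↦ w - X(w)/2, whose derivative is invertible by a Neumann series, and `m` is
    -- Lipschitz. A continuous inverse of a map with invertible derivative is differentiable, and
    -- Goursat's theorem gives analyticity.
    refine analyticAt_of_eventually_differentiableAt ?_
    have hmid : r < (r + (R - ξ)) / 2 := by linarith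
    filter_upwards [zone_mem_nhds hp hmid] with z hz
    have hnb : zone Δ (R - ξ) ∈ 𝓝 z := zone_mem_nhds hz (by linarith)
    have hz' : z ∈ zone Δ (R - ξ) := mem_of_mem_nhds hnb
    have hcont : ContinuousAt m z := by
      have : LipschitzOnWith 2 m (zone Δ (R - ξ)) := LipschitzOnWith.of_dist_le_mul
        fun a ha b hb => by rw [dist_eq_norm, dist_eq_norm]; exact hml b hb a ha
      exact this.continuousOn.continuousAt hnb
    have hA : ‖(1 / 2 : ℂ) • fderiv ℂ X (m z)‖ < 1 := by
      rw [norm_smul, hhalf]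
      linarith [hL _ (hm z hz')]
    have : CompleteSpace (Phase →L[ℂ] Phase) := FiniteDimensional.complete ℂ _
    let e : Phase ≃L[ℂ] Phase := ContinuousLinearEquiv.ofUnit (Units.oneSub _ hA)
    have he : HasFDerivAt (fun w => w - (1 / 2 : ℂ) • X w) (e : Phase →L[ℂ] Phase) (m z) := by
      exact (hasFDerivAt_id (𝕜 := ℂ) (m z)).fun_sub
        (((hX _ (hm z hz')).differentiableAt.hasFDerivAt).fun_const_smul (1 / 2 : ℂ))
    refine (HasFDerivAt.of_local_left_inverse hcont he ?_).differentiableAt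
    filter_upwards [hnb] with y hy
    rw [sub_eq_iff_eq_add]
    exact hmeq y hy
  · intro z hz
    have hz' := zone_mono hrR.le hz
    refine ⟨?_, hmeq z hz'⟩
    have : m z - z = (1 / 2 : ℂ) • X (m z) := by
      conv_lhs => rw [hmeq z hz']
      abel
    rw [this, norm_smul, hhalf]
    linarith [hξ _ (hm z hz')]
  · filter_upwards [zone_mem_nhds hz hrR] with y hy using hmeq y hy

/-- Preservation of the symplectic form by a map at a point. -/
def SymplAt (Υ : Phase → Phase) (p : Phase) : Prop :=
  ∀ u v : Phase, sympl (fderiv ℂ Υ p u) (fderiv ℂ Υ p v) = sympl u v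

/-- The midpoint map of a Hamiltonian vector field is symplectic. -/
theorem symplAt_midpoint {χ : Phase → ℂ} {m : Phase → Phase} {z : Phase}
    (hχ : AnalyticAt ℂ χ (m z)) (hm : AnalyticAt ℂ m z)
    (hmz : ∀ᶠ y in 𝓝 z, m y = y + (1 / 2 : ℂ) • symplGradL (fderiv ℂ χ (m y))) :
    SymplAt (fun y => y + symplGradL (fderiv ℂ χ (m y))) z := by
  have hsymm : IsSymmSndFDerivAt ℂ χ (m z) :=
    (hχ.contDiffAt (n := 2)).isSymmSndFDerivAt (by simp)
  have hX : HasFDerivAt (fun p => symplGradL (fderiv ℂ χ p))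
      (symplGradL ∘L fderiv ℂ (fderiv ℂ χ) (m z)) (m z) :=
    symplGradL.hasFDerivAt.comp (m z) hχ.fderiv.differentiableAt.hasFDerivAt
  set A := symplGradL ∘L fderiv ℂ (fderiv ℂ χ) (m z) with hA
  have hm' := hm.differentiableAt.hasFDerivAt
  set D := fderiv ℂ m z with hD
  have hXm : HasFDerivAt (fun y => symplGradL (fderiv ℂ χ (m y))) (A ∘L D) z :=
    HasFDerivAt.comp (g := fun p => symplGradL (fderiv ℂ χ p)) z hX hm'
  have hΦ : HasFDerivAt (fun y => y + symplGradL (fderiv ℂ χ (m y)))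
      (ContinuousLinearMap.id ℂ Phase + A ∘L D) z := (hasFDerivAt_id z).add hXm
  have hDeq : D = ContinuousLinearMap.id ℂ Phase + (1 / 2 : ℂ) • (A ∘L D) := by
    have h1 : HasFDerivAt (fun y => y + (1 / 2 : ℂ) • symplGradL (fderiv ℂ χ (m y)))
      (ContinuousLinearMap.id ℂ Phase + (1 / 2 : ℂ) • (A ∘L D)) z :=
      (hasFDerivAt_id z).add (hXm.fun_const_smul _)
    exact hm'.unique (h1.congr_of_eventuallyEq hmz)
  -- With A the derivative of the Hamiltonian field at the midpoint and D that of m, a vector u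
  -- equals (1 - A/2) D u, and its image under the derivative of the map is (1 + A/2) D u. The
  -- derivative is thus the Cayley transform of A. Since the Hessian is symmetric, A is skew for the
  -- symplectic form, and Cayley transforms of skew operators preserve the form.
  have hu : ∀ u, u = D u + (-(1 / 2) : ℂ) • A (D u) := by
    intro u
    have := congrArg (fun T : Phase →L[ℂ] Phase => T u) hDeq
    simp only [add_apply, ContinuousLinearMap.id_apply, smul_apply,
      ContinuousLinearMap.comp_apply] at this
    calc u = (u + (1 / 2 : ℂ) • A (D u)) + (-(1 / 2) : ℂ) • A (D u) := by module
      _ = _ := by rw [← this]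
  have hΦu : ∀ u, fderiv ℂ (fun y => y + symplGradL (fderiv ℂ χ (m y))) z u
      = D u + (1 / 2 : ℂ) • A (D u) := by
    intro u
    rw [hΦ.fderiv]
    simp only [add_apply, ContinuousLinearMap.id_apply, ContinuousLinearMap.comp_apply]
    conv_lhs => enter [1]; rw [hu u]
    module
  have hAs : ∀ a b, sympl (A a) b = -sympl a (A b) := by
    intro a b
    rw [sympl_antisymm a, neg_neg, hA, ContinuousLinearMap.comp_apply,
      ContinuousLinearMap.comp_apply, sympl_symplGradL, sympl_symplGradL, hsymm.eq]
  intro u v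
  rw [hΦu, hΦu]
  conv_rhs => rw [hu u, hu v]
  simp only [sympl_add_left, sympl_add_right, sympl_smul_left, sympl_smul_right, hAs]
  ring

end Midpoint

/-! ### One averaging step. -/

section Step

variable {Δ r δ υ₀ φ γ κ ξ : ℝ} {k g f : Phase → ℂ}

/-- Translation of the fast angle by a period, as a symmetry. -/
noncomputable def periodSymm (Δ : ℝ) : Symmetry Δ where
  lin := ContinuousLinearMap.id ℝ Phase
  shift := ((2 * Real.pi : ℝ) : ℂ) • eFast
  val := ContinuousLinearMap.id ℝ ℂ
  surj := Function.surjective_id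
  sympl_lin := by simp
  lin_fast := rfl
  zone_map := fun _ _ hp => add_fast_mem_zone hp _

theorem periodSymm_inv_iff {K : Set Phase} : (periodSymm Δ).Inv f K ↔ FastPeriodic f K := Iff.rfl

/-- One step of the averaging procedure. -/
theorem exists_averaging_step (hυ₀ : 0 < υ₀) (hδ : 0 < δ) (hδ1 : δ ≤ 1)
    (hk : AnalyticOnNhd ℂ k (zone Δ (r + 3 * δ))) (hg : AnalyticOnNhd ℂ g (zone Δ (r + 3 * δ)))
    (hf : AnalyticOnNhd ℂ f (zone Δ (r + 3 * δ))) (hφ : ∀ p ∈ zone Δ (r + 3 * δ), ‖f p‖ ≤ φ)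
    (hγ : ∀ p ∈ zone Δ (r + 3 * δ), ‖g p‖ ≤ γ)
    (hκ : ∀ p ∈ zone Δ (r + 3 * δ), ‖fderiv ℂ k p‖ ≤ κ)
    (hκ' : ∀ p ∈ zone Δ (r + 3 * δ), ∀ q ∈ zone Δ (r + 3 * δ),
      ‖fderiv ℂ k q - fderiv ℂ k p‖ ≤ κ * ‖q - p‖)
    (hki : FastInv k (zone Δ (r + 3 * δ))) (hgi : FastInv g (zone Δ (r + 3 * δ)))
    (hfp : FastPeriodic f (zone Δ (r + 3 * δ))) (hf0 : ∀ p ∈ zone Δ (r + 3 * δ), fastAvg f p = 0)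
    (hφ0 : 0 ≤ φ) (hγ0 : 0 ≤ γ) (hκ0 : 0 ≤ κ)
    (hξ : ξ = 2 * Real.pi / υ₀ * φ / δ) (hsmall : 2 * ξ ≤ δ) :
    ∃ (Φ : Phase → Phase) (f' g' : Phase → ℂ),
      AnalyticOnNhd ℂ Φ (zone Δ r) ∧ (∀ z ∈ zone Δ r, ‖Φ z - z‖ ≤ ξ) ∧
      (∀ z ∈ zone Δ r, SymplAt Φ z) ∧
      AnalyticOnNhd ℂ f' (zone Δ r) ∧ AnalyticOnNhd ℂ g' (zone Δ r) ∧
      FastInv g' (zone Δ r) ∧ (∀ z ∈ zone Δ r, fastAvg f' z = 0) ∧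
      (∀ z ∈ zone Δ r, υ₀ * (Φ z).1 1 + (k (Φ z) + g (Φ z) + f (Φ z))
        = υ₀ * z.1 1 + (k z + g' z + f' z)) ∧
      (∀ z ∈ zone Δ r, ‖f' z‖ ≤ 2 * (ξ * (φ / δ + κ + γ / δ))) ∧
      (∀ z ∈ zone Δ r, ‖g' z - g z‖ ≤ ξ * (φ / δ + γ / δ) + 2 * κ * ξ ^ 2 / δ) ∧
      ∀ S : Symmetry Δ, S.Inv k (zone Δ (r + 3 * δ)) → S.Inv g (zone Δ (r + 3 * δ)) →
        S.Inv f (zone Δ (r + 3 * δ)) →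
        S.Equiv Φ (zone Δ r) ∧ S.Inv g' (zone Δ r) ∧ S.Inv f' (zone Δ r) := by
  have hξ0 : 0 ≤ ξ := by rw [hξ]; positivity
  set χ := averagingHam υ₀ f with hχdef
  have hχ : AnalyticOnNhd ℂ χ (zone Δ (r + 3 * δ)) := analyticOnNhd_averagingHam υ₀ hf
  set X : Phase → Phase := fun p => symplGradL (fderiv ℂ χ p) with hXdef
  have hX : AnalyticOnNhd ℂ X (zone Δ (r + 3 * δ)) := fun p hp =>
    (symplGradL.analyticAt _).comp (hχ p hp).fderiv
  have hXb : ∀ p ∈ zone Δ (r + 2 * δ), ‖X p‖ ≤ ξ := by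
    intro p hp
    refine (norm_symplGradL_apply_le _).trans ?_
    rw [hξ]
    exact norm_fderiv_le_of_zone hχ (fun p hp => norm_averagingHam_le hυ₀ hφ hp) hδ (by linarith) hp
  have m12 : zone Δ (r + δ) ⊆ zone Δ (r + 2 * δ) := zone_mono (by linarith)
  have m23 : zone Δ (r + 2 * δ) ⊆ zone Δ (r + 3 * δ) := zone_mono (by linarith)
  have m13 : zone Δ (r + δ) ⊆ zone Δ (r + 3 * δ) := m12.trans m23
  have m01 : zone Δ r ⊆ zone Δ (r + δ) := zone_mono (by linarith)
  have m03 : zone Δ r ⊆ zone Δ (r + 3 * δ) := m01.trans m13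
  have hDX : ∀ p ∈ zone Δ (r + δ), ‖fderiv ℂ X p‖ ≤ ξ / δ := fun p hp =>
    norm_fderiv_le_of_zone (hX.mono m23) hXb hδ (by linarith) hp
  have hξδ : ξ / δ ≤ 1 := by rw [div_le_one hδ]; linarith
  obtain ⟨m, hm, hmz, hmev, huniq⟩ := exists_midpoint (r := r) (R := r + δ) (hX.mono m13)
    (fun p hp => hXb p (m12 hp)) hξ0 (fun p hp => (hDX p hp).trans hξδ) (by linarith)
  have hm1 : ∀ z ∈ zone Δ r, m z ∈ zone Δ (r + δ) := fun z hz =>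
    mem_zone_of_norm_sub_le hz (hmz z hz).1 (by linarith)
  set Φ : Phase → Phase := fun z => z + X (m z) with hΦdef
  have hΦan : AnalyticOnNhd ℂ Φ (zone Δ r) := fun z hz =>
    analyticAt_id.add (AnalyticAt.comp (g := X) (hX _ (m13 (hm1 z hz))) (hm z hz))
  have hΦξ : ∀ z ∈ zone Δ r, ‖Φ z - z‖ ≤ ξ := by
    intro z hz
    simp only [hΦdef, add_sub_cancel_left]
    exact hXb _ (m12 (hm1 z hz))
  have hΦ1 : ∀ z ∈ zone Δ r, Φ z ∈ zone Δ (r + δ) := fun z hz =>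
    mem_zone_of_norm_sub_le hz (hΦξ z hz) (by linarith)
  have hΦm : ∀ z ∈ zone Δ r, ‖Φ z - m z‖ ≤ ξ := by
    intro z hz
    have : Φ z - m z = (1 / 2 : ℂ) • X (m z) := by
      conv_lhs => enter [2]; rw [(hmz z hz).2]
      simp only [hΦdef]; module
    rw [this, norm_smul]
    have := hXb _ (m12 (hm1 z hz))
    norm_num
    linarith
  -- By the homological equation υ₀ Z₂ loses exactly `f (m z)`, so the transformed energy is υ₀ Z₂ +
  -- k + g + `rest`. All terms of `rest` are differences of `k`, `g` and `f` between nearby points.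
  set rest : Phase → ℂ := fun z => (k (Φ z) + g (Φ z) + f (Φ z)) - (k z + g z) - f (m z)
    with hrest
  have hcompΦ : ∀ h : Phase → ℂ, AnalyticOnNhd ℂ h (zone Δ (r + 3 * δ)) →
      AnalyticOnNhd ℂ (fun z => h (Φ z)) (zone Δ r) := fun h hh z hz =>
    AnalyticAt.comp (g := h) (hh _ (m13 (hΦ1 z hz))) (hΦan z hz)
  have hcompm : ∀ h : Phase → ℂ, AnalyticOnNhd ℂ h (zone Δ (r + 3 * δ)) →
      AnalyticOnNhd ℂ (fun z => h (m z)) (zone Δ r) := fun h hh z hz =>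
    AnalyticAt.comp (g := h) (hh _ (m13 (hm1 z hz))) (hm z hz)
  have hrestan : AnalyticOnNhd ℂ rest (zone Δ r) :=
    ((((hcompΦ k hk).add (hcompΦ g hg)).add (hcompΦ f hf)).sub
      ((hk.mono m03).add (hg.mono m03))).sub (hcompm f hf)
  -- bounds
  have hDf : ∀ p ∈ zone Δ (r + δ), ‖fderiv ℂ f p‖ ≤ φ / δ := fun p hp =>
    norm_fderiv_le_of_zone (hf.mono m23) (fun p hp => hφ p (m23 hp)) hδ (by linarith) hp
  have hDg : ∀ p ∈ zone Δ (r + δ), ‖fderiv ℂ g p‖ ≤ γ / δ := fun p hp =>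
    norm_fderiv_le_of_zone (hg.mono m23) (fun p hp => hγ p (m23 hp)) hδ (by linarith) hp
  have hf1 : ∀ z ∈ zone Δ r, ‖f (Φ z) - f (m z)‖ ≤ φ / δ * ξ := fun z hz =>
    (norm_sub_le_of_zone (hf.mono m13) hDf (hm1 z hz) (hΦ1 z hz)).trans
      (by gcongr; exact hΦm z hz)
  have hg1 : ∀ z ∈ zone Δ r, ‖g (Φ z) - g z‖ ≤ γ / δ * ξ := fun z hz =>
    (norm_sub_le_of_zone (hg.mono m13) hDg (m01 hz) (hΦ1 z hz)).trans
      (by gcongr; exact hΦξ z hz)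
  have hk1 : ∀ z ∈ zone Δ r, ‖k (Φ z) - k z‖ ≤ κ * ξ := fun z hz =>
    (norm_sub_le_of_zone hk hκ (m03 hz) (m13 (hΦ1 z hz))).trans
      (by gcongr; exact hΦξ z hz)
  have hrestb : ∀ z ∈ zone Δ r, ‖rest z‖ ≤ ξ * (φ / δ + κ + γ / δ) := by
    intro z hz
    have e : rest z = (f (Φ z) - f (m z)) + (k (Φ z) - k z) + (g (Φ z) - g z) := by
      simp only [hrest]; ring
    rw [e]
    refine (norm_add₃_le).trans ?_
    linarith [hf1 z hz, hg1 z hz, hk1 z hz]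
  -- `b` is the bracket of `k` with the generator. Its average vanishes, so the averaged part
  -- changes only by the average of `rest - b`, which contains no term of order κ ξ.
  set b : Phase → ℂ := fun q => fderiv ℂ k q (X q) with hb
  have hban : AnalyticOnNhd ℂ b (zone Δ r) := by
    intro z hz
    exact AnalyticAt.comp (g := fun q : (Phase →L[ℂ] ℂ) × Phase => q.1 q.2)
      ((ContinuousLinearMap.id ℂ (Phase →L[ℂ] ℂ)).analyticAt_bilinear _)
      ((hk _ (m03 hz)).fderiv.prod (hX _ (m03 hz)))
  have hb0 : ∀ z ∈ zone Δ r, fastAvg b z = 0 := fun z hz =>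
    fastAvg_bracket (s := r + 3 * δ) (by linarith) hχ hki
      (fun p hp => fastAvg_averagingHam hf hfp hp) hz
  have hrb : ∀ z ∈ zone Δ r, ‖rest z - b z‖ ≤ ξ * (φ / δ + γ / δ) + 2 * κ * ξ ^ 2 / δ := by
    intro z hz
    have h1 : ‖k (Φ z) - k z - fderiv ℂ k z (Φ z - z)‖ ≤ κ * ξ * ξ := by
      have hseg : segment ℝ z (Φ z) ⊆ zone Δ (r + 3 * δ) :=
        convex_zone.segment_subset (m03 hz) (m13 (hΦ1 z hz))
      have := (convex_segment z (Φ z)).norm_image_sub_le_of_norm_fderiv_le' (𝕜 := ℂ) (f := k)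
        (φ := fderiv ℂ k z) (C := κ * ξ) (fun y hy => (hk y (hseg hy)).differentiableAt)
        (fun y hy => (hκ' z (m03 hz) y (hseg hy)).trans (by
          gcongr
          have h := norm_sub_le_of_mem_segment hy
          rw [norm_sub_rev y z]
          rw [norm_sub_rev z y] at *
          refine le_trans ?_ (hΦξ z hz)
          exact h))
        (left_mem_segment ℝ z (Φ z)) (right_mem_segment ℝ z (Φ z))
      exact this.trans (by gcongr; exact hΦξ z hz)
    have h2 : ‖fderiv ℂ k z (X (m z) - X z)‖ ≤ κ * (ξ / δ * ξ) := by
      refine ((fderiv ℂ k z).le_opNorm _).trans ?_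
      gcongr
      · exact hκ z (m03 hz)
      · refine (norm_sub_le_of_zone (hX.mono m13) hDX (m01 hz) (hm1 z hz)).trans ?_
        gcongr
        exact (hmz z hz).1.trans (by linarith)
    have e : rest z - b z = (f (Φ z) - f (m z)) + (g (Φ z) - g z)
        + ((k (Φ z) - k z - fderiv ℂ k z (Φ z - z)) + fderiv ℂ k z (X (m z) - X z)) := by
      simp only [hrest, hb, hΦdef, add_sub_cancel_left, map_sub]; ring
    rw [e]
    refine (norm_add₃_le).trans ?_
    have h3 := (norm_add_le (k (Φ z) - k z - fderiv ℂ k z (Φ z - z))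
      (fderiv ℂ k z (X (m z) - X z))).trans (add_le_add h1 h2)
    have h4 : κ * ξ * ξ + κ * (ξ / δ * ξ) ≤ 2 * κ * ξ ^ 2 / δ := by
      have : κ * ξ * ξ ≤ κ * ξ * ξ / δ := by
        rw [le_div_iff₀ hδ]
        exact mul_le_of_le_one_right (by positivity) hδ1
      calc _ ≤ κ * ξ * ξ / δ + κ * (ξ / δ * ξ) := by gcongr
        _ = _ := by ring
    linarith [hf1 z hz, hg1 z hz]
  -- symmetries
  have hsym : ∀ S : Symmetry Δ, S.Inv k (zone Δ (r + 3 * δ)) → S.Inv g (zone Δ (r + 3 * δ)) →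
        S.Inv f (zone Δ (r + 3 * δ)) → S.Equiv Φ (zone Δ r) ∧ S.Inv rest (zone Δ r) := by
    intro S hSk hSg hSf
    have hXS : ∀ p ∈ zone Δ (r + δ), X (S.map p) = S.lin (X p) := fun p hp =>
      S.symplGrad_fderiv (by linarith) hχ (S.averagingHam_inv υ₀ hSf hf) hp
    have hhalf : ∀ v : Phase, (1 / 2 : ℂ) • v = (1 / 2 : ℝ) • v := by
      intro v; ext <;> simp
    -- The image of a midpoint under a symmetry solves the midpoint equation at the image point, so
    -- uniqueness identifies the two.
    have hmS : ∀ z ∈ zone Δ r, S.map (m z) = m (S.map z) := by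
      intro z hz
      refine huniq _ (S.map_mem hz) _ (S.map_mem (hm1 z hz)) ?_
      rw [hXS _ (hm1 z hz), hhalf, ← map_smul, ← hhalf]
      conv_lhs => rw [(hmz z hz).2]
      rw [Symmetry.map, Symmetry.map, map_add]
      abel
    have hΦS : S.Equiv Φ (zone Δ r) := by
      intro z hz
      simp only [hΦdef]
      rw [← hmS z hz, hXS _ (hm1 z hz), Symmetry.map, Symmetry.map, map_add]
      abel
    refine ⟨hΦS, fun z hz => ?_⟩
    simp only [hrest]
    rw [hΦS z hz, ← hmS z hz, hSk _ (m13 (hΦ1 z hz)), hSg _ (m13 (hΦ1 z hz)),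
      hSf _ (m13 (hΦ1 z hz)), hSk _ (m03 hz), hSg _ (m03 hz), hSf _ (m13 (hm1 z hz))]
    simp only [map_sub, map_add]
  -- Translation by a period is itself one of the symmetries just treated. The new parts come from
  -- splitting `rest` into its average, which joins `g`, and its oscillation.
  have hrestper : FastPeriodic rest (zone Δ r) := periodSymm_inv_iff.1
    (hsym (periodSymm Δ) (periodSymm_inv_iff.2 hki.periodic) (periodSymm_inv_iff.2 hgi.periodic)
      (periodSymm_inv_iff.2 hfp)).2
  have havg := analyticOnNhd_fastAvg hrestan
  refine ⟨Φ, fun z => rest z - fastAvg rest z, fun z => g z + fastAvg rest z, hΦan, hΦξ, ?_,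
    hrestan.sub havg, (hg.mono m03).add havg, ?_, ?_, ?_, ?_, ?_, ?_⟩
  · intro z hz
    exact symplAt_midpoint (hχ _ (m13 (hm1 z hz))) (hm z hz) (hmev z hz)
  · intro z hz t
    beta_reduce
    rw [hgi z (m03 hz) t, hrestper.fastInv_fastAvg z hz t]
  · intro z hz
    rw [fastAvg_sub hrestan havg hz, hrestper.fastInv_fastAvg.fastAvg_eq hz, sub_self]
  · intro z hz
    have h1 : (Φ z).1 1 = z.1 1 + fderiv ℂ χ (m z) eFast := by
      simp only [hΦdef, hXdef, Prod.fst_add, Pi.add_apply, symplGradL_fst_one]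
    rw [h1, fderiv_averagingHam_eFast hf hfp hf0 (m13 (hm1 z hz))]
    simp only [hrest]
    have : (υ₀ : ℂ) ≠ 0 := by exact_mod_cast hυ₀.ne'
    field_simp
    ring
  · intro z hz
    refine (norm_sub_le _ _).trans ?_
    linarith [hrestb z hz, norm_fastAvg_le hrestb hz]
  · intro z hz
    have : g z + fastAvg rest z - g z = fastAvg (fun q => rest q - b q) z := by
      rw [fastAvg_sub hrestan hban hz, hb0 z hz]; ring
    rw [this]
    exact norm_fastAvg_le hrb hz
  · intro S hSk hSg hSf
    obtain ⟨h1, h2⟩ := hsym S hSk hSg hSf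
    have h3 := S.fastAvg_inv h2 hrestan
    refine ⟨h1, fun z hz => ?_, fun z hz => ?_⟩
    · beta_reduce
      rw [hSg z (m03 hz), h3 z hz, map_add]
    · beta_reduce
      rw [h2 z hz, h3 z hz]
      exact (map_sub S.val _ _).symm

end Step

/-! ### Iteration of averaging steps. -/

section NormalForm

/-- `Υ` conjugates `υ₀ Z₂ + k + h` to `υ₀ Z₂ + k + g + f`, with `g` independent of the fast angle
and `f` of vanishing average, on the zone of radius `r`. -/
structure IsNormalForm (Δ υ₀ R : ℝ) (k h : Phase → ℂ) (r ξ φ γ : ℝ) (Υ : Phase → Phase)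
    (f g : Phase → ℂ) : Prop where
  analytic : AnalyticOnNhd ℂ Υ (zone Δ r)
  near : ∀ z ∈ zone Δ r, ‖Υ z - z‖ ≤ ξ
  symplectic : ∀ z ∈ zone Δ r, SymplAt Υ z
  f_analytic : AnalyticOnNhd ℂ f (zone Δ r)
  g_analytic : AnalyticOnNhd ℂ g (zone Δ r)
  g_inv : FastInv g (zone Δ r)
  f_avg : ∀ z ∈ zone Δ r, fastAvg f z = 0
  energy : ∀ z ∈ zone Δ r, υ₀ * (Υ z).1 1 + (k (Υ z) + h (Υ z))
    = υ₀ * z.1 1 + (k z + g z + f z)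
  f_le : ∀ z ∈ zone Δ r, ‖f z‖ ≤ φ
  g_le : ∀ z ∈ zone Δ r, ‖g z‖ ≤ γ
  symm : ∀ S : Symmetry Δ, S.Inv k (zone Δ R) → S.Inv h (zone Δ R) →
    S.Equiv Υ (zone Δ r) ∧ S.Inv g (zone Δ r) ∧ S.Inv f (zone Δ r)

variable {Δ υ₀ R r δ ξ φ γ φ' γ' ξ' κ : ℝ} {k h f g : Phase → ℂ} {Υ : Phase → Phase}

theorem SymplAt.comp {Υ Φ : Phase → Phase} {z : Phase} (hΥ : AnalyticAt ℂ Υ (Φ z))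
    (hΦ : AnalyticAt ℂ Φ z) (h1 : SymplAt Υ (Φ z)) (h2 : SymplAt Φ z) :
    SymplAt (fun y => Υ (Φ y)) z := by
  intro u v
  have : fderiv ℂ (fun y => Υ (Φ y)) z = fderiv ℂ Υ (Φ z) ∘L fderiv ℂ Φ z :=
    fderiv_comp z hΥ.differentiableAt hΦ.differentiableAt
  rw [this, ContinuousLinearMap.comp_apply, ContinuousLinearMap.comp_apply, h1, h2]

theorem IsNormalForm.refl (hh : AnalyticOnNhd ℂ h (zone Δ R))
    (hφ : ∀ p ∈ zone Δ R, ‖h p‖ ≤ φ) (hh0 : ∀ p ∈ zone Δ R, fastAvg h p = 0) :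
    IsNormalForm Δ υ₀ R k h R 0 φ 0 id h 0 where
  analytic := fun _ _ => analyticAt_id
  near := by simp
  symplectic := fun z _ u v => by simp
  f_analytic := hh
  g_analytic := fun _ _ => analyticAt_const
  g_inv := fun _ _ _ => rfl
  f_avg := hh0
  energy := by simp
  f_le := hφ
  g_le := by simp
  symm := fun S _ hS => ⟨fun _ _ => rfl, fun _ _ => (map_zero S.val).symm, hS⟩

/-- The transformation obtained so far is composed with one averaging step for k + g + f; the
displacements add up. The new sizes are required only as upper bounds, which leaves the recursion of
constants to `averaging_step_bounds`. -/
theorem IsNormalForm.step (hυ₀ : 0 < υ₀) (hδ : 0 < δ) (hδ1 : δ ≤ 1)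
    (hk : AnalyticOnNhd ℂ k (zone Δ R))
    (hκ : ∀ p ∈ zone Δ R, ‖fderiv ℂ k p‖ ≤ κ)
    (hκ' : ∀ p ∈ zone Δ R, ∀ q ∈ zone Δ R, ‖fderiv ℂ k q - fderiv ℂ k p‖ ≤ κ * ‖q - p‖)
    (hki : FastInv k (zone Δ R)) (hhp : FastPeriodic h (zone Δ R))
    (hφ0 : 0 ≤ φ) (hγ0 : 0 ≤ γ) (hκ0 : 0 ≤ κ) (hrR : r + 3 * δ ≤ R)
    (H : IsNormalForm Δ υ₀ R k h (r + 3 * δ) ξ φ γ Υ f g)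
    (hsmall : 2 * (2 * Real.pi / υ₀ * φ / δ) ≤ δ)
    (hξ' : ξ + 2 * Real.pi / υ₀ * φ / δ ≤ ξ')
    (hφ' : 2 * (2 * Real.pi / υ₀ * φ / δ * (φ / δ + κ + γ / δ)) ≤ φ')
    (hγ' : γ + (2 * Real.pi / υ₀ * φ / δ * (φ / δ + γ / δ)
      + 2 * κ * (2 * Real.pi / υ₀ * φ / δ) ^ 2 / δ) ≤ γ') :
    ∃ Υ' f' g', IsNormalForm Δ υ₀ R k h r ξ' φ' γ' Υ' f' g' := by
  have hper := H.symm (periodSymm Δ) (periodSymm_inv_iff.2 hki.periodic)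
    (periodSymm_inv_iff.2 hhp)
  have hsub : zone Δ (r + 3 * δ) ⊆ zone Δ R := zone_mono hrR
  have m0 : zone Δ r ⊆ zone Δ (r + 3 * δ) := zone_mono (by linarith)
  obtain ⟨Φ, f', g', hΦ, hΦn, hΦs, hf', hg', hgi', hfa', he, hfl, hgl, hsym⟩ :=
    exists_averaging_step (r := r) (g := g) (f := f) (γ := γ) hυ₀ hδ hδ1 (hk.mono hsub)
      H.g_analytic H.f_analytic
      H.f_le H.g_le (fun p hp => hκ p (hsub hp)) (fun p hp q hq => hκ' p (hsub hp) q (hsub hq))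
      (fun p hp => hki p (hsub hp)) H.g_inv (periodSymm_inv_iff.1 hper.2.2) H.f_avg hφ0 hγ0 hκ0
      rfl hsmall
  have hΦ1 : ∀ z ∈ zone Δ r, Φ z ∈ zone Δ (r + 3 * δ) := fun z hz =>
    mem_zone_of_norm_sub_le hz (hΦn z hz) (by linarith)
  refine ⟨fun z => Υ (Φ z), f', g', ?_⟩
  constructor
  · exact fun z hz => AnalyticAt.comp (g := Υ) (H.analytic _ (hΦ1 z hz)) (hΦ z hz)
  · intro z hz
    calc ‖Υ (Φ z) - z‖ = ‖(Υ (Φ z) - Φ z) + (Φ z - z)‖ := by congr 1; abel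
      _ ≤ _ := norm_add_le _ _
      _ ≤ _ := add_le_add (H.near _ (hΦ1 z hz)) (hΦn z hz)
      _ ≤ ξ' := hξ'
  · exact fun z hz => SymplAt.comp (H.analytic _ (hΦ1 z hz)) (hΦ z hz)
      (H.symplectic _ (hΦ1 z hz)) (hΦs z hz)
  · exact hf'
  · exact hg'
  · exact hgi'
  · exact hfa'
  · intro z hz
    rw [H.energy _ (hΦ1 z hz), he z hz]
  · exact fun z hz => (hfl z hz).trans hφ'
  · intro z hz
    calc ‖g' z‖ = ‖g z + (g' z - g z)‖ := by congr 1; abel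
      _ ≤ _ := norm_add_le _ _
      _ ≤ _ := add_le_add (H.g_le _ (m0 hz)) (hgl z hz)
      _ ≤ γ' := hγ'
  · intro S hSk hSh
    obtain ⟨h1, h2, h3⟩ := H.symm S hSk hSh
    obtain ⟨h4, h5, h6⟩ := hsym S (fun p hp => hSk p (hsub hp)) h2 h3
    refine ⟨fun z hz => ?_, h5, h6⟩
    beta_reduce
    rw [h4 z hz, h1 _ (hΦ1 z hz)]

theorem IsNormalForm.mono {r' : ℝ} (H : IsNormalForm Δ υ₀ R k h r ξ φ γ Υ f g) (hr : r' ≤ r)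
    (hξ : ξ ≤ ξ') (hφ : φ ≤ φ') (hγ : γ ≤ γ') :
    IsNormalForm Δ υ₀ R k h r' ξ' φ' γ' Υ f g where
  analytic := H.analytic.mono (zone_mono hr)
  near z hz := (H.near z (zone_mono hr hz)).trans hξ
  symplectic z hz := H.symplectic z (zone_mono hr hz)
  f_analytic := H.f_analytic.mono (zone_mono hr)
  g_analytic := H.g_analytic.mono (zone_mono hr)
  g_inv z hz := H.g_inv z (zone_mono hr hz)
  f_avg z hz := H.f_avg z (zone_mono hr hz)
  energy z hz := H.energy z (zone_mono hr hz)
  f_le z hz := (H.f_le z (zone_mono hr hz)).trans hφ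
  g_le z hz := (H.g_le z (zone_mono hr hz)).trans hγ
  symm S h1 h2 := by
    obtain ⟨h3, h4, h5⟩ := H.symm S h1 h2
    exact ⟨fun z hz => h3 z (zone_mono hr hz), fun z hz => h4 z (zone_mono hr hz),
      fun z hz => h5 z (zone_mono hr hz)⟩

/-- The inequalities behind an averaging step with loss `δ = d / N`. -/
theorem averaging_step_bounds {c d b a a' ν η κ N q x δ : ℝ} (hc0 : 0 < c) (hd0 : 0 < d)
    (hb0 : 0 < b) (ha1 : 1 ≤ a) (ha'1 : 1 ≤ a') (hν0 : 0 ≤ ν) (hν2 : 2 * c * b * ν ^ 2 ≤ d ^ 2)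
    (hν3 : 2 * c / d * (b * ν ^ 2 / d + ν + 2 * a' * ν ^ 2 / d) ≤ 1 / 3)
    (hν4 : c * b * ν / d * ((b + 2 * a') * ν / d) + 2 * ν / d * (c * b * ν / d) ^ 2 ≤ 1 / 2)
    (hν5 : c * b * ν / d ≤ 1 / 2) (hη : 0 < η) (hκ0 : 0 < κ) (hN0 : 0 < N) (hNκ : N * κ ≤ ν)
    (hNη : N * η ≤ ν) (hq0 : 0 < q) (hq1 : q ≤ 1) (hx : 1 / 3 ≤ x) (hx' : x ≤ 1 / 2)
    (hδ : δ = d / N) :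
    2 * (c * (b * η * κ * q) / δ) ≤ δ ∧
    a * η * (2 - q) + c * (b * η * κ * q) / δ ≤ a * η * (2 - q * x) ∧
    2 * (c * (b * η * κ * q) / δ * (b * η * κ * q / δ + κ + a' * η ^ 2 * (2 - q) / δ))
      ≤ b * η * κ * (q * x) ∧
    a' * η ^ 2 * (2 - q) + (c * (b * η * κ * q) / δ *
      (b * η * κ * q / δ + a' * η ^ 2 * (2 - q) / δ)
      + 2 * κ * (c * (b * η * κ * q) / δ) ^ 2 / δ) ≤ a' * η ^ 2 * (2 - q * x) := by
  have hδ0 : 0 < δ := by rw [hδ]; positivity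
  have ha0 : 0 < a := by linarith
  have ha'0 : 0 < a' := by linarith
  have h2q : 0 ≤ 2 - q := by linarith
  have hξ : c * (b * η * κ * q) / δ ≤ c * b * ν / d * η * q := by
    have : c * (b * η * κ * q) / δ = c * b / d * η * q * (N * κ) := by rw [hδ]; field_simp
    rw [this]
    calc _ ≤ c * b / d * η * q * ν := by gcongr
      _ = _ := by ring
  have hξ0 : 0 ≤ c * (b * η * κ * q) / δ := by positivity
  have hφδ : b * η * κ * q / δ ≤ b * ν / d * η := by
    have : b * η * κ * q / δ = b / d * η * (N * κ) * q := by rw [hδ]; field_simp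
    rw [this]
    calc _ ≤ b / d * η * ν * 1 := by gcongr
      _ = _ := by ring
  have hγδ : a' * η ^ 2 * (2 - q) / δ ≤ 2 * a' * ν / d * η := by
    have : a' * η ^ 2 * (2 - q) / δ = a' / d * η * (N * η) * (2 - q) := by
      rw [hδ]; field_simp
    rw [this]
    calc _ ≤ a' / d * η * ν * 2 := by gcongr; linarith
      _ = _ := by ring
  -- `q` stands for e^(-n) and `x` for e^(-1). The displacement and the averaged part are budgeted
  -- as multiples of 2 - q, so each step may add a multiple of q - q x, which is at least q/2. Every
  -- division by `δ` is a factor `N`, always paired with `η` or `κ` and hence bounded by `ν`.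
  have hqx : q / 2 ≤ q - q * x := by nlinarith
  refine ⟨?_, ?_, ?_, ?_⟩
  · have h1 : 2 * (c * (b * η * κ * q) / δ) = 2 * c * b * (N * η) * (N * κ) * q / d ^ 2 * δ := by
      rw [hδ]; field_simp
    rw [h1]
    refine mul_le_of_le_one_left hδ0.le ?_
    rw [div_le_one (by positivity)]
    calc _ ≤ 2 * c * b * ν * ν * 1 := by gcongr
      _ = 2 * c * b * ν ^ 2 := by ring
      _ ≤ _ := hν2
  · have h1 : c * b * ν / d * η * q ≤ a * η * (q / 2) := by
      calc _ ≤ 1 / 2 * η * q := by gcongr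
        _ = 1 * η * (q / 2) := by ring
        _ ≤ _ := by gcongr
    have h2 : a * η * (q / 2) ≤ a * η * (q - q * x) := by gcongr
    linarith
  · have h1 : 2 * (c * (b * η * κ * q) / δ * (b * η * κ * q / δ + κ + a' * η ^ 2 * (2 - q) / δ))
        = b * η * κ * q * (2 * c / d * (b * (N * η) * (N * κ) * q / d + N * κ
          + a' * (N * η) ^ 2 * (2 - q) / d)) := by
      rw [hδ]; field_simp
    rw [h1]
    have h2 : 2 * c / d * (b * (N * η) * (N * κ) * q / d + N * κ
          + a' * (N * η) ^ 2 * (2 - q) / d) ≤ x := by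
      calc _ ≤ 2 * c / d * (b * ν * ν * 1 / d + ν + a' * ν ^ 2 * 2 / d) := by gcongr; linarith
        _ = 2 * c / d * (b * ν ^ 2 / d + ν + 2 * a' * ν ^ 2 / d) := by ring
        _ ≤ x := hν3.trans hx
    calc _ ≤ b * η * κ * q * x := by gcongr
      _ = _ := by ring
  · have h1 : c * (b * η * κ * q) / δ * (b * η * κ * q / δ + a' * η ^ 2 * (2 - q) / δ)
        ≤ c * b * ν / d * η * q * (b * ν / d * η + 2 * a' * ν / d * η) :=
      mul_le_mul hξ (add_le_add hφδ hγδ) (by positivity) (by positivity)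
    have h2 : 2 * κ * (c * (b * η * κ * q) / δ) ^ 2 / δ
        ≤ 2 * ν / d * (c * b * ν / d) ^ 2 * (η ^ 2 * q) := by
      calc _ = 2 * (N * κ) / d * (c * (b * η * κ * q) / δ) ^ 2 := by
            rw [hδ]; field_simp
        _ ≤ 2 * ν / d * (c * b * ν / d * η * q) ^ 2 := by gcongr
        _ = 2 * ν / d * (c * b * ν / d) ^ 2 * (η ^ 2 * q) * q := by ring
        _ ≤ 2 * ν / d * (c * b * ν / d) ^ 2 * (η ^ 2 * q) * 1 := by gcongr
        _ = _ := by ring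
    have h3 : c * b * ν / d * η * q * (b * ν / d * η + 2 * a' * ν / d * η)
        + 2 * ν / d * (c * b * ν / d) ^ 2 * (η ^ 2 * q) ≤ a' * η ^ 2 * (q / 2) := by
      calc _ = (c * b * ν / d * ((b + 2 * a') * ν / d) + 2 * ν / d * (c * b * ν / d) ^ 2)
            * (η ^ 2 * q) := by ring
        _ ≤ 1 / 2 * (η ^ 2 * q) := by gcongr
        _ = 1 * η ^ 2 * (q / 2) := by ring
        _ ≤ _ := by gcongr
    have h4 : a' * η ^ 2 * (q / 2) ≤ a' * η ^ 2 * (q - q * x) := by gcongr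
    linarith

set_option maxHeartbeats 1000000 in
/-- Averaging up to an exponentially small remainder. -/
theorem exists_normalForm {σ : ℝ} (hυ₀ : 0 < υ₀) (hσ : 0 < σ) :
    ∃ ν > 0, ∃ C > 0, ∀ (Δ η κ : ℝ) (N : ℕ) (k h : Phase → ℂ), 1 ≤ N → 0 < η → η ≤ κ →
      N * κ ≤ ν → AnalyticOnNhd ℂ k (zone Δ (8 / 10 * σ)) →
      AnalyticOnNhd ℂ h (zone Δ (8 / 10 * σ)) →
      (∀ p ∈ zone Δ (8 / 10 * σ), ‖fderiv ℂ k p‖ ≤ κ) →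
      (∀ p ∈ zone Δ (8 / 10 * σ), ∀ q ∈ zone Δ (8 / 10 * σ),
        ‖fderiv ℂ k q - fderiv ℂ k p‖ ≤ κ * ‖q - p‖) →
      FastInv k (zone Δ (8 / 10 * σ)) → FastPeriodic h (zone Δ (8 / 10 * σ)) →
      (∀ p ∈ zone Δ (8 / 10 * σ), fastAvg h p = 0) →
      (∀ p ∈ zone Δ (8 / 10 * σ), ‖h p‖ ≤ η) →
      ∃ Υ f g, IsNormalForm Δ υ₀ (8 / 10 * σ) k h (6 / 10 * σ) (C * η)
        (C * η * Real.exp (-N)) (C * η ^ 2) Υ f g := by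
  -- The first step loses 3d of width and the N following ones lose 3Nδ = 3d together; 3d ≤ σ/10
  -- keeps the total within σ/5, the gap between 8σ/10 and 6σ/10. The bound d ≤ 1 is required by the
  -- step.
  set d := min σ 1 / 30 with hd
  have hd0 : 0 < d := by positivity
  have hdσ : 3 * d ≤ σ / 10 := by
    have := min_le_left σ 1; rw [hd]; linarith
  have hd1 : d ≤ 1 := by
    have := min_le_right σ 1; rw [hd]; linarith
  set c := 2 * Real.pi / υ₀ with hc
  have hc0 : 0 < c := by positivity
  set b := 2 * (c / d) * (1 / d + 1) with hb
  have hb0 : 0 < b := by positivity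
  set a := 1 + c / d with ha
  have ha1 : 1 ≤ a := by rw [ha]; linarith [div_pos hc0 hd0]
  set a' := 1 + (c / d ^ 2 + 2 * c ^ 2 / d ^ 3) with ha'
  have ha'1 : 1 ≤ a' := by rw [ha']; linarith [show 0 < c / d ^ 2 + 2 * c ^ 2 / d ^ 3 by positivity]
  -- All conditions are polynomial in `ν` and vanish at 0, so a small `ν` depending only on `d`,
  -- `c`, `a'` and `b` satisfies them together.
  obtain ⟨ν, hν0, hν1, hν2, hν3, hν4, hν5, hν6⟩ : ∃ ν > 0, ν ≤ 1 ∧ 2 * c * b * ν ^ 2 ≤ d ^ 2 ∧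
      2 * c / d * (b * ν ^ 2 / d + ν + 2 * a' * ν ^ 2 / d) ≤ 1 / 3 ∧
      c * b * ν / d * ((b + 2 * a') * ν / d) + 2 * ν / d * (c * b * ν / d) ^ 2 ≤ 1 / 2 ∧
      c * b * ν / d ≤ 1 / 2 ∧ 2 * c * ν ≤ d ^ 2 := by
    have key : ∀ (F : ℝ → ℝ) (B : ℝ), Continuous F → F 0 = 0 → 0 < B →
        ∀ᶠ ν in 𝓝[>] (0 : ℝ), F ν ≤ B := by
      intro F B hF hF0 hB
      have : ∀ᶠ ν in 𝓝 (0 : ℝ), F ν < B :=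
        hF.continuousAt.eventually_lt_const (by rw [hF0]; exact hB)
      exact (this.filter_mono nhdsWithin_le_nhds).mono fun _ h => h.le
    have e1 := key (fun ν => ν) 1 (by fun_prop) rfl one_pos
    have e2 := key (fun ν => 2 * c * b * ν ^ 2) (d ^ 2) (by fun_prop) (by simp) (by positivity)
    have e3 := key (fun ν => 2 * c / d * (b * ν ^ 2 / d + ν + 2 * a' * ν ^ 2 / d)) (1 / 3)
      (by fun_prop) (by simp) (by positivity)
    have e4 := key (fun ν => c * b * ν / d * ((b + 2 * a') * ν / d)
      + 2 * ν / d * (c * b * ν / d) ^ 2) (1 / 2) (by fun_prop) (by simp) (by positivity)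
    have e5 := key (fun ν => c * b * ν / d) (1 / 2) (by fun_prop) (by simp) (by positivity)
    have e6 := key (fun ν => 2 * c * ν) (d ^ 2) (by fun_prop) (by simp) (by positivity)
    obtain ⟨ν, ⟨⟨⟨⟨⟨h0, h1⟩, h2⟩, h3⟩, h4⟩, h5⟩, h6⟩ :=
      (((((((eventually_mem_nhdsWithin (a := (0 : ℝ)) (s := Ioi 0)).and e1).and e2).and e3).and
        e4).and e5).and e6).exists
    exact ⟨ν, h0, h1, h2, h3, h4, h5, h6⟩
  refine ⟨ν, hν0, 2 * (a + a' + b), by positivity, ?_⟩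
  intro Δ η κ N k h hN hη hηκ hNκ hk hh hκ hκ' hki hhp hh0 hhη
  have hN' : (1 : ℝ) ≤ N := by exact_mod_cast hN
  have hN0 : (0 : ℝ) < N := by linarith
  have hκ0 : 0 < κ := hη.trans_le hηκ
  have hκν : κ ≤ ν := by nlinarith
  have hNη : N * η ≤ ν := (mul_le_mul_of_nonneg_left hηκ hN0.le).trans hNκ
  have hην : η ≤ ν := hηκ.trans hκν
  set δ := d / N with hδ
  have hδ0 : 0 < δ := by positivity
  have hδd : δ ≤ d := div_le_self hd0.le hN'
  -- A first step with the full loss `d` lowers the oscillation from η to O(η κ) without any factor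
  -- N. Only then is the small loss d/N affordable, since N κ ≤ ν; short steps from the start would
  -- make the displacement of order N η.
  have base : ∃ Υ f g, IsNormalForm Δ υ₀ (8 / 10 * σ) k h (8 / 10 * σ - 3 * d) (a * η)
      (b * η * κ) (a' * η ^ 2) Υ f g := by
    have H0 : IsNormalForm Δ υ₀ (8 / 10 * σ) k h (8 / 10 * σ - 3 * d + 3 * d) 0 η 0 id h 0 := by
      rw [sub_add_cancel]; exact IsNormalForm.refl hh hhη hh0
    refine IsNormalForm.step hυ₀ hd0 hd1 hk hκ hκ' hki hhp hη.le le_rfl hκ0.le (by linarith)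
      H0 ?_ ?_ ?_ ?_
    · rw [← hc, ← mul_div_assoc, div_le_iff₀ hd0]
      nlinarith
    · rw [← hc, ha]
      have : c * η / d = c / d * η := by ring
      rw [this]; nlinarith
    · rw [← hc, hb]
      have : η / d + κ + 0 / d ≤ (1 / d + 1) * κ := by
        have : η / d ≤ κ / d := by gcongr
        calc _ ≤ κ / d + κ + 0 / d := by gcongr
          _ = _ := by ring
      calc 2 * (c * η / d * (η / d + κ + 0 / d)) ≤ 2 * (c * η / d * ((1 / d + 1) * κ)) := by gcongr
        _ = _ := by ring
    · rw [← hc, ha']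
      have h1 : κ ≤ 1 := hκν.trans hν1
      calc 0 + (c * η / d * (η / d + 0 / d) + 2 * κ * (c * η / d) ^ 2 / d)
          ≤ 0 + (c * η / d * (η / d + 0 / d) + 2 * 1 * (c * η / d) ^ 2 / d) := by gcongr
        _ = (c / d ^ 2 + 2 * c ^ 2 / d ^ 3) * η ^ 2 := by ring
        _ ≤ _ := mul_le_mul_of_nonneg_right (by linarith) (sq_nonneg η)
  have hexp1 : Real.exp (-1) ≤ 1 / 2 := by
    rw [Real.exp_neg, one_div]
    exact inv_anti₀ two_pos (by have := Real.add_one_le_exp (1 : ℝ); linarith)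
  have hexp1' : 1 / 3 ≤ Real.exp (-1) := by
    rw [Real.exp_neg, one_div]
    exact inv_anti₀ (Real.exp_pos _) (by have := Real.exp_one_lt_d9; linarith)
  -- The oscillation decays like e^(-n), while 2 - e^(-n) controls the accumulated displacement and
  -- averaged part and never exceeds 2.
  have hind : ∀ n : ℕ, n ≤ N → ∃ Υ f g, IsNormalForm Δ υ₀ (8 / 10 * σ) k h
      (8 / 10 * σ - 3 * d - 3 * (n * δ)) (a * η * (2 - Real.exp (-n)))
      (b * η * κ * Real.exp (-n)) (a' * η ^ 2 * (2 - Real.exp (-n))) Υ f g := by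
    intro n
    induction n with
    | zero =>
      intro _
      obtain ⟨Υ, f, g, H⟩ := base
      refine ⟨Υ, f, g, H.mono (by simp) ?_ ?_ ?_⟩ <;> norm_num
    | succ n ih =>
      intro hn
      obtain ⟨Υ, f, g, H⟩ := ih (by omega)
      have hq0 : 0 < Real.exp (-(n : ℝ)) := Real.exp_pos _
      have hq1 : Real.exp (-(n : ℝ)) ≤ 1 := Real.exp_le_one_iff.2 (by simp)
      have hqs : Real.exp (-((n + 1 : ℕ) : ℝ)) = Real.exp (-(n : ℝ)) * Real.exp (-1) := by
        rw [← Real.exp_add]; congr 1; push_cast; ring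
      rw [hqs]
      set q := Real.exp (-(n : ℝ)) with hq
      obtain ⟨b1, b2, b3, b4⟩ := averaging_step_bounds hc0 hd0 hb0 ha1 ha'1 hν0.le hν2 hν3 hν4 hν5 hη
        hκ0 hN0 hNκ hNη hq0 hq1 hexp1' hexp1 hδ
      refine IsNormalForm.step (r := 8 / 10 * σ - 3 * d - 3 * ((n + 1 : ℕ) * δ))
        (ξ := a * η * (2 - q)) (φ := b * η * κ * q) (γ := a' * η ^ 2 * (2 - q)) (f := f) (g := g)
        (Υ := Υ) hυ₀ hδ0
        (hδd.trans hd1) hk hκ hκ' hki hhp (by positivity)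
        (mul_nonneg (by positivity) (by linarith)) hκ0.le ?_ ?_ b1 b2 b3 b4
      · push_cast
        have : 0 ≤ (n : ℝ) * δ := by positivity
        linarith
      · convert H using 1
        push_cast; ring
  obtain ⟨Υ, f, g, H⟩ := hind N le_rfl
  have hq0 : 0 < Real.exp (-(N : ℝ)) := Real.exp_pos _
  have hNδ : (N : ℝ) * δ = d := by rw [hδ]; field_simp
  clear_value δ d c a a' b
  refine ⟨Υ, f, g, H.mono ?_ ?_ ?_ ?_⟩
  · rw [hNδ]; linarith
  · have h1 := mul_pos (show 0 < a by linarith) hη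
    have h2 := mul_pos (show 0 < a' + b by linarith) hη
    have h3 := mul_pos h1 hq0
    nlinarith
  · refine mul_le_mul_of_nonneg_right ?_ hq0.le
    have h1 : b * η * κ ≤ b * η * 1 := mul_le_mul_of_nonneg_left (hκν.trans hν1) (by positivity)
    have h2 := mul_pos (show 0 < a + a' by linarith) hη
    have h3 := mul_pos hb0 hη
    nlinarith
  · have hη2 : 0 < η ^ 2 := by positivity
    have h1 := mul_pos (show 0 < a' by linarith) hη2
    have h2 := mul_pos (show 0 < a + b by linarith) hη2
    have h3 := mul_pos h1 hq0
    nlinarith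

end NormalForm

/-! ### Kepler's equation near circular orbits. -/

section Kepler

/-- The map whose fixed point solves Kepler's equation. -/
noncomputable def keplerMap (lam z zb F : ℂ) : ℂ :=
  lam + (zb * exp (I * F) - z * exp (-(I * F))) / (2 * I)

variable {lam z zb : ℂ} {B : ℝ}

theorem norm_exp_I_mul_le {F : ℂ} (hB : |lam.im| ≤ B) (hF : F ∈ closedBall lam 1) :
    ‖exp (I * F)‖ ≤ Real.exp (B + 1) ∧ ‖exp (-(I * F))‖ ≤ Real.exp (B + 1) := by
  have h1 : |F.im - lam.im| ≤ 1 := by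
    rw [mem_closedBall, dist_eq_norm] at hF
    rw [← sub_im]; exact (abs_im_le_norm _).trans hF
  rw [abs_le] at hB h1
  rw [norm_exp, norm_exp, Real.exp_le_exp, Real.exp_le_exp]
  simp only [mul_re, I_re, I_im, neg_re]
  constructor <;> linarith

theorem hasDerivAt_keplerMap (F : ℂ) : HasDerivAt (keplerMap lam z zb)
    ((zb * exp (I * F) + z * exp (-(I * F))) / 2) F := by
  have h1 : HasDerivAt (fun F : ℂ => exp (I * F)) (exp (I * F) * (I * 1)) F :=
    ((hasDerivAt_id F).const_mul I).cexp
  have h2 : HasDerivAt (fun F : ℂ => exp (-(I * F))) (exp (-(I * F)) * -(I * 1)) F :=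
    ((hasDerivAt_id F).const_mul I).neg.cexp
  have h3 := (((h1.const_mul zb).sub (h2.const_mul z)).div_const (2 * I)).const_add lam
  refine h3.congr_deriv ?_
  field_simp [I_ne_zero]
  ring

/-- The radius of validity of the fixed point iteration. -/
noncomputable def keplerRadius (B : ℝ) : ℝ := (2 * Real.exp (B + 1))⁻¹

theorem keplerRadius_pos : 0 < keplerRadius B := by unfold keplerRadius; positivity

/-- On the unit ball around `lam` both exponentials are at most e^(B+1), and the radius is half the
inverse of that. The bound 1/2 serves twice: it makes the Kepler map preserve the ball and contract
it by 1/2. -/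
theorem norm_kepler_le {F : ℂ} (hB : |lam.im| ≤ B) (hz : ‖z‖ ≤ keplerRadius B)
    (hzb : ‖zb‖ ≤ keplerRadius B) (hF : F ∈ closedBall lam 1) :
    ‖zb * exp (I * F)‖ ≤ 1 / 2 ∧ ‖z * exp (-(I * F))‖ ≤ 1 / 2 := by
  obtain ⟨h1, h2⟩ := norm_exp_I_mul_le hB hF
  have h3 : keplerRadius B * Real.exp (B + 1) = 1 / 2 := by
    unfold keplerRadius; field_simp [(Real.exp_pos (B + 1)).ne']
  have h0 := (keplerRadius_pos (B := B)).le
  rw [norm_mul, norm_mul, ← h3]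
  constructor <;> gcongr

/-- A limit chosen by `limUnder` has no content without convergence; within this radius Banach's
theorem provides it. The value at zero eccentricity, the analyticity and the symmetries of the
eccentric longitude below all come from the uniqueness clause. -/
theorem eccLongitude_spec (hB : |lam.im| ≤ B) (hz : ‖z‖ ≤ keplerRadius B)
    (hzb : ‖zb‖ ≤ keplerRadius B) :
    Tendsto (fun n : ℕ => (keplerMap lam z zb)^[n] lam) atTop (𝓝 (eccLongitude lam z zb)) ∧
    keplerMap lam z zb (eccLongitude lam z zb) = eccLongitude lam z zb ∧
    eccLongitude lam z zb ∈ closedBall lam 1 ∧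
    ∀ G ∈ closedBall lam 1, keplerMap lam z zb G = G → G = eccLongitude lam z zb := by
  have hmaps : MapsTo (keplerMap lam z zb) (closedBall lam 1) (closedBall lam 1) := by
    intro F hF
    obtain ⟨h1, h2⟩ := norm_kepler_le hB hz hzb hF
    rw [mem_closedBall, dist_eq_norm, keplerMap, add_sub_cancel_left, norm_div, norm_mul, norm_I,
      Complex.norm_ofNat]
    have := norm_sub_le (zb * exp (I * F)) (z * exp (-(I * F)))
    rw [div_le_one (by norm_num)]
    linarith
  have hlip : LipschitzOnWith (1 / 2) (keplerMap lam z zb) (closedBall lam 1) := by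
    refine (convex_closedBall lam 1).lipschitzOnWith_of_nnnorm_hasDerivWithin_le
      (fun F _ => (hasDerivAt_keplerMap F).hasDerivWithinAt) fun F hF => ?_
    obtain ⟨h1, h2⟩ := norm_kepler_le hB hz hzb hF
    rw [← NNReal.coe_le_coe, coe_nnnorm, norm_div, Complex.norm_ofNat]
    have := norm_add_le (zb * exp (I * F)) (z * exp (-(I * F)))
    push_cast
    linarith
  have hcon : ContractingWith (1 / 2) (hmaps.restrict _ _ _) :=
    ⟨by rw [← NNReal.coe_lt_coe]; norm_num, hlip.mapsToRestrict hmaps⟩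
  have huniq : ∀ F ∈ closedBall lam 1, ∀ G ∈ closedBall lam 1, keplerMap lam z zb F = F →
      keplerMap lam z zb G = G → F = G := by
    intro F hF G hG h1 h2
    have := hcon.fixedPoint_unique' (x := ⟨F, hF⟩) (y := ⟨G, hG⟩) (Subtype.ext h1) (Subtype.ext h2)
    exact congrArg Subtype.val this
  obtain ⟨y, hy, hfix, hlim, -⟩ := hcon.exists_fixedPoint' isClosed_closedBall.isComplete hmaps
    (mem_closedBall_self zero_le_one) (edist_ne_top lam _)
  have he : eccLongitude lam z zb = y := hlim.limUnder_eq
  rw [he]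
  exact ⟨hlim, hfix, hy, fun G hG h => huniq G hG y hy h hfix⟩

theorem eccLongitude_zero : eccLongitude lam 0 0 = lam :=
  ((eccLongitude_spec le_rfl (by simpa using keplerRadius_pos.le)
    (by simpa using keplerRadius_pos.le)).2.2.2 lam (mem_closedBall_self zero_le_one)
    (by simp [keplerMap])).symm

theorem eventually_kepler (lam₀ : ℂ) : ∀ᶠ q : ℂ × ℂ × ℂ in 𝓝 (lam₀, 0, 0),
    |q.1.im| ≤ |lam₀.im| + 1 ∧ ‖q.2.1‖ ≤ keplerRadius (|lam₀.im| + 1) ∧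
      ‖q.2.2‖ ≤ keplerRadius (|lam₀.im| + 1) := by
  have hc : ∀ (f : ℂ × ℂ × ℂ → ℝ) (c : ℝ), Continuous f → f (lam₀, 0, 0) < c →
      ∀ᶠ q in 𝓝 (lam₀, 0, 0), f q ≤ c := fun f c hf h =>
    (hf.continuousAt.eventually_lt_const h).mono fun _ h => h.le
  refine (hc (fun q => |q.1.im|) _ (by fun_prop) (by simp)).and
    ((hc (fun q => ‖q.2.1‖) _ (by fun_prop) (by simpa using keplerRadius_pos)).and
      (hc (fun q => ‖q.2.2‖) _ (by fun_prop) (by simpa using keplerRadius_pos)))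

/-- Kepler's equation is inverted by the inverse function theorem with the eccentricities carried
along as parameters. The local inverse stays within distance 1 of `lam`, so uniqueness of the fixed
point identifies it with the limit of the iteration. -/
theorem analyticAt_eccLongitude (lam₀ : ℂ) :
    AnalyticAt ℂ (fun q : ℂ × ℂ × ℂ => eccLongitude q.1 q.2.1 q.2.2) (lam₀, 0, 0) := by
  set f : ℂ × ℂ × ℂ → ℂ × ℂ × ℂ := fun q =>
    (q.1 - (q.2.2 * exp (I * q.1) - q.2.1 * exp (-(I * q.1))) / (2 * I), q.2.1, q.2.2) with hf
  have hfa : ContDiff ℂ ⊤ f := by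
    rw [hf]; fun_prop
  let a : ℂ := exp (-(I * lam₀)) / (2 * I)
  let b : ℂ := -exp (I * lam₀) / (2 * I)
  let p1 : ℂ × ℂ × ℂ →L[ℂ] ℂ := .fst ℂ ℂ (ℂ × ℂ)
  let p2 : ℂ × ℂ × ℂ →L[ℂ] ℂ := (ContinuousLinearMap.fst ℂ ℂ ℂ).comp (.snd ℂ ℂ (ℂ × ℂ))
  let p3 : ℂ × ℂ × ℂ →L[ℂ] ℂ := (ContinuousLinearMap.snd ℂ ℂ ℂ).comp (.snd ℂ ℂ (ℂ × ℂ))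
  -- At zero eccentricity the derivative is unipotent, so changing the sign of its off-diagonal part
  -- inverts it.
  let A : ℂ × ℂ × ℂ →L[ℂ] ℂ × ℂ × ℂ := (p1 + (a • p2 + b • p3)).prod (p2.prod p3)
  let A' : ℂ × ℂ × ℂ →L[ℂ] ℂ × ℂ × ℂ := (p1 - (a • p2 + b • p3)).prod (p2.prod p3)
  let e : (ℂ × ℂ × ℂ) ≃L[ℂ] ℂ × ℂ × ℂ := ContinuousLinearEquiv.equivOfInverse A A'
    (fun v => by simp [A, A', p1, p2, p3]) (fun v => by simp [A, A', p1, p2, p3])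
  have hd : HasFDerivAt f (e : ℂ × ℂ × ℂ →L[ℂ] ℂ × ℂ × ℂ) (lam₀, 0, 0) := by
    have h1 : HasFDerivAt (fun q : ℂ × ℂ × ℂ => q.1) p1 (lam₀, 0, 0) := hasFDerivAt_fst
    have h2 : HasFDerivAt (fun q : ℂ × ℂ × ℂ => q.2.1) p2 (lam₀, 0, 0) := p2.hasFDerivAt
    have h3 : HasFDerivAt (fun q : ℂ × ℂ × ℂ => q.2.2) p3 (lam₀, 0, 0) := p3.hasFDerivAt
    have h4 := (h1.const_mul I).cexp
    have h5 := (h1.const_mul I).neg.cexp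
    have h6 := (h1.sub (((h3.mul h4).sub (h2.mul h5)).mul_const (2 * I)⁻¹)).prodMk
      (h2.prodMk h3)
    refine h6.congr_fderiv ?_
    ext <;> simp [e, A, p1, p2, p3, a, b, div_eq_mul_inv] <;> ring
  have hfc : ContDiffAt ℂ ⊤ f (lam₀, 0, 0) := hfa.contDiffAt
  have hf0 : f (lam₀, 0, 0) = (lam₀, 0, 0) := by simp [hf]
  have hloc := hfc.to_localInverse hd (by simp)
  set g := hfc.localInverse hd (by simp) with hg
  rw [hf0] at hloc
  have hright : ∀ᶠ y in 𝓝 (lam₀, (0 : ℂ), (0 : ℂ)), f (g y) = y := by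
    have := (hfc.hasStrictFDerivAt' hd (by simp)).eventually_right_inverse
    rwa [hf0] at this
  have hgc : ContinuousAt g (lam₀, 0, 0) := hloc.continuousAt
  have hg0 : g (lam₀, 0, 0) = (lam₀, 0, 0) := by
    have := (hfc.hasStrictFDerivAt' hd (by simp)).localInverse_apply_image
    rwa [hf0] at this
  have hg1 : AnalyticAt ℂ (fun y => (g y).1) (lam₀, 0, 0) := by
    exact analyticAt_fst.comp_of_eq hloc.analyticAt rfl
  refine hg1.congr ?_
  have hnear : ∀ᶠ y : ℂ × ℂ × ℂ in 𝓝 (lam₀, 0, 0), ‖(g y).1 - y.1‖ < 1 := by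
    have : ContinuousAt (fun y => ‖(g y).1 - y.1‖) (lam₀, 0, 0) :=
      ((continuousAt_fst.comp hgc).sub continuousAt_fst).norm
    exact this.eventually_lt_const (by simp [hg0])
  filter_upwards [hright, hnear, eventually_kepler lam₀] with y h1 h2 ⟨h3, h4, h5⟩
  refine (eccLongitude_spec h3 h4 h5).2.2.2 _ (by rw [mem_closedBall, dist_eq_norm]; exact h2.le) ?_
  have e2 : (g y).2.1 = y.2.1 := congrArg (fun q => q.2.1) h1
  have e3 : (g y).2.2 = y.2.2 := congrArg (fun q => q.2.2) h1
  have e1 : (g y).1 - ((g y).2.2 * exp (I * (g y).1) - (g y).2.1 * exp (-(I * (g y).1))) / (2 * I)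
    = y.1 := congrArg (fun q => q.1) h1
  rw [e2, e3] at e1
  rw [keplerMap, ← e1]; ring

theorem eccLongitude_add (hB : |lam.im| ≤ B) (hz : ‖z‖ ≤ keplerRadius B)
    (hzb : ‖zb‖ ≤ keplerRadius B) (θ : ℝ) :
    eccLongitude (lam + θ) (exp (I * θ) * z) (exp (-(I * θ)) * zb) = eccLongitude lam z zb + θ := by
  have h1 : ‖exp (I * θ)‖ = 1 := by rw [mul_comm, norm_exp_ofReal_mul_I]
  have h2 : ‖exp (-(I * θ))‖ = 1 := by rw [exp_neg, norm_inv, h1, inv_one]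
  have h3 : exp (-(I * θ)) * exp (I * θ) = 1 := by rw [← exp_add]; simp
  obtain ⟨-, k1, k2, -⟩ := eccLongitude_spec hB hz hzb
  refine ((eccLongitude_spec (B := B) (by simpa using hB) (by rw [norm_mul, h1, one_mul]; exact hz)
    (by rw [norm_mul, h2, one_mul]; exact hzb)).2.2.2 _ ?_ ?_).symm
  · rw [mem_closedBall, dist_eq_norm] at k2 ⊢
    rwa [add_sub_add_right_eq_sub]
  · conv_rhs => rw [← k1]
    rw [keplerMap, keplerMap, mul_add, exp_add, neg_add, exp_add]
    have : exp (-(I * θ)) * zb * (exp (I * eccLongitude lam z zb) * exp (I * θ))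
        - exp (I * θ) * z * (exp (-(I * eccLongitude lam z zb)) * exp (-(I * θ)))
        = (exp (-(I * θ)) * exp (I * θ)) * (zb * exp (I * eccLongitude lam z zb)
          - z * exp (-(I * eccLongitude lam z zb))) := by ring
    rw [this, h3]; ring

theorem eccLongitude_conj (hB : |lam.im| ≤ B) (hz : ‖z‖ ≤ keplerRadius B)
    (hzb : ‖zb‖ ≤ keplerRadius B) :
    eccLongitude (starRingEnd ℂ lam) (starRingEnd ℂ zb) (starRingEnd ℂ z)
      = starRingEnd ℂ (eccLongitude lam z zb) := by
  obtain ⟨-, k1, k2, -⟩ := eccLongitude_spec hB hz hzb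
  refine ((eccLongitude_spec (B := B) (by simpa using hB) (by simpa using hzb)
    (by simpa using hz)).2.2.2 _ ?_ ?_).symm
  · rw [mem_closedBall, dist_eq_norm] at k2 ⊢
    rwa [← map_sub, norm_conj]
  · conv_rhs => rw [← k1]
    simp only [keplerMap, map_add, map_sub, map_mul, map_div₀, conj_I, ← exp_conj, map_neg,
      map_ofNat]
    have h1 : -I * starRingEnd ℂ (eccLongitude lam z zb)
      = -(I * starRingEnd ℂ (eccLongitude lam z zb)) := by ring
    rw [h1, neg_neg]
    field_simp [I_ne_zero]
    ring

end Kepler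

/-! ### One planet in Poincaré's variables: symmetries and analyticity. -/

section Planet

/-- `|x|² / Λ = 1 - √(1 - e²)`. -/
noncomputable def kepQ (Λ x xt : ℂ) : ℂ := I * x * xt / Λ

/-- The ratio between the eccentricity vector and Poincaré's variable. -/
noncomputable def kepS (Λ x xt : ℂ) : ℂ := (2 - kepQ Λ x xt) ^ (1 / 2 : ℂ) / Λ ^ (1 / 2 : ℂ)

/-- The eccentric longitude in Poincaré's variables. -/
noncomputable def kepF (Λ lam x xt : ℂ) : ℂ :=
  eccLongitude lam (x * kepS Λ x xt) (I * xt * kepS Λ x xt)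

/-- The semi-major axis. -/
noncomputable def kepA (mh μ Λ : ℂ) : ℂ := Λ ^ 2 / (mh ^ 2 * μ)

/-- The mean motion. -/
noncomputable def kepN (mh μ Λ : ℂ) : ℂ := μ ^ 2 * mh ^ 3 / Λ ^ 3

/-- The derivative of Kepler's equation with respect to the eccentric longitude. -/
noncomputable def kepW (Λ lam x xt : ℂ) : ℂ :=
  1 - (I * xt * kepS Λ x xt * exp (I * kepF Λ lam x xt)
    + x * kepS Λ x xt * exp (-(I * kepF Λ lam x xt))) / 2

/-- The position `r_x + i r_y`, for a unit semi-major axis. -/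
noncomputable def kepU (Λ lam x xt : ℂ) : ℂ :=
  (1 + (1 - kepQ Λ x xt)) / 2 * exp (I * kepF Λ lam x xt)
    + (x * kepS Λ x xt) ^ 2 / (2 * (1 + (1 - kepQ Λ x xt))) * exp (-(I * kepF Λ lam x xt))
    - x * kepS Λ x xt

/-- The position `r_x - i r_y`, for a unit semi-major axis. -/
noncomputable def kepV (Λ lam x xt : ℂ) : ℂ :=
  (1 + (1 - kepQ Λ x xt)) / 2 * exp (-(I * kepF Λ lam x xt))
    + (I * xt * kepS Λ x xt) ^ 2 / (2 * (1 + (1 - kepQ Λ x xt))) * exp (I * kepF Λ lam x xt)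
    - I * xt * kepS Λ x xt

/-- The derivative of `kepU` with respect to the mean longitude. -/
noncomputable def kepDU (Λ lam x xt : ℂ) : ℂ :=
  I * ((1 + (1 - kepQ Λ x xt)) / 2 * exp (I * kepF Λ lam x xt)
    - (x * kepS Λ x xt) ^ 2 / (2 * (1 + (1 - kepQ Λ x xt))) * exp (-(I * kepF Λ lam x xt)))
    / kepW Λ lam x xt

/-- The derivative of `kepV` with respect to the mean longitude. -/
noncomputable def kepDV (Λ lam x xt : ℂ) : ℂ :=
  I * ((I * xt * kepS Λ x xt) ^ 2 / (2 * (1 + (1 - kepQ Λ x xt))) * exp (I * kepF Λ lam x xt)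
    - (1 + (1 - kepQ Λ x xt)) / 2 * exp (-(I * kepF Λ lam x xt))) / kepW Λ lam x xt

/-- The momentum is the product of the reduced mass, the semi-major axis, the mean motion and a
derivative along the unit orbit; this separates the scales of the planet from its geometry. -/
theorem poincare_eq (mh μ : ℝ) (Λ lam x xt : ℂ) :
    poincare mh μ Λ lam x xt =
      (![mh * (kepA mh μ Λ * kepN mh μ Λ * ((kepDU Λ lam x xt + kepDV Λ lam x xt) / 2)),
        mh * (kepA mh μ Λ * kepN mh μ Λ * ((kepDU Λ lam x xt - kepDV Λ lam x xt) / (2 * I)))],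
      ![kepA mh μ Λ * ((kepU Λ lam x xt + kepV Λ lam x xt) / 2),
        kepA mh μ Λ * ((kepU Λ lam x xt - kepV Λ lam x xt) / (2 * I))]) := by
  simp only [poincare, kepDU, kepDV, kepU, kepV, kepW, kepF, kepS, kepQ, kepA, kepN]
  have key : ∀ a b c d : ℂ, a = c → b = d → (![a, b] : Vec) = ![c, d] := by
    rintro _ _ _ _ rfl rfl; rfl
  refine Prod.ext (key _ _ _ _ ?_ ?_) (key _ _ _ _ ?_ ?_) <;> ring

/-- The configurations of a planet where the expansions converge. -/
structure KepGood (B : ℝ) (Λ lam x xt : ℂ) : Prop where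
  lam_mem : Λ ∈ slitPlane
  q_mem : 2 - kepQ Λ x xt ∈ slitPlane
  im_le : |lam.im| ≤ B
  z_le : ‖x * kepS Λ x xt‖ ≤ keplerRadius B
  zb_le : ‖I * xt * kepS Λ x xt‖ ≤ keplerRadius B

variable {B : ℝ} {Λ lam x xt : ℂ}

theorem norm_exp_I_mul_ofReal (θ : ℝ) : ‖exp (I * θ)‖ = 1 := by
  rw [mul_comm, norm_exp_ofReal_mul_I]

theorem norm_exp_neg_I_mul_ofReal (θ : ℝ) : ‖exp (-(I * θ))‖ = 1 := by
  rw [exp_neg, norm_inv, norm_exp_I_mul_ofReal, inv_one]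

theorem kepQ_rotate (θ : ℂ) : kepQ Λ (exp (I * θ) * x) (exp (-(I * θ)) * xt) = kepQ Λ x xt := by
  have h3 : exp (I * θ) * exp (-(I * θ)) = 1 := by rw [← exp_add]; simp
  have : I * (exp (I * θ) * x) * (exp (-(I * θ)) * xt)
    = (exp (I * θ) * exp (-(I * θ))) * (I * x * xt) := by ring
  rw [kepQ, this, h3, one_mul, kepQ]

theorem kepS_rotate (θ : ℂ) : kepS Λ (exp (I * θ) * x) (exp (-(I * θ)) * xt) = kepS Λ x xt := by
  rw [kepS, kepQ_rotate, kepS]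

theorem KepGood.rotate (h : KepGood B Λ lam x xt) (θ : ℝ) :
    KepGood B Λ (lam + θ) (exp (I * θ) * x) (exp (-(I * θ)) * xt) where
  lam_mem := h.lam_mem
  q_mem := by rw [kepQ_rotate]; exact h.q_mem
  im_le := by simpa using h.im_le
  z_le := by
    rw [kepS_rotate, mul_assoc, norm_mul, norm_exp_I_mul_ofReal, one_mul]; exact h.z_le
  zb_le := by
    have : I * (exp (-(I * θ)) * xt) * kepS Λ x xt = exp (-(I * θ)) * (I * xt * kepS Λ x xt) := by
      ring
    rw [kepS_rotate, this, norm_mul, norm_exp_neg_I_mul_ofReal, one_mul]; exact h.zb_le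

theorem KepGood.kepF_rotate (h : KepGood B Λ lam x xt) (θ : ℝ) :
    kepF Λ (lam + θ) (exp (I * θ) * x) (exp (-(I * θ)) * xt) = kepF Λ lam x xt + θ := by
  rw [kepF, kepS_rotate, kepF, ← eccLongitude_add h.im_le h.z_le h.zb_le]
  congr 1 <;> ring

theorem KepGood.rotate_eq (h : KepGood B Λ lam x xt) (θ : ℝ) :
    kepU Λ (lam + θ) (exp (I * θ) * x) (exp (-(I * θ)) * xt) = exp (I * θ) * kepU Λ lam x xt ∧
    kepV Λ (lam + θ) (exp (I * θ) * x) (exp (-(I * θ)) * xt)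
      = exp (-(I * θ)) * kepV Λ lam x xt ∧
    kepDU Λ (lam + θ) (exp (I * θ) * x) (exp (-(I * θ)) * xt)
      = exp (I * θ) * kepDU Λ lam x xt ∧
    kepDV Λ (lam + θ) (exp (I * θ) * x) (exp (-(I * θ)) * xt)
      = exp (-(I * θ)) * kepDV Λ lam x xt := by
  have h3 : exp (I * θ) * exp (-(I * θ)) = 1 := by rw [← exp_add]; simp
  have e1 : exp (I * (kepF Λ lam x xt + θ)) = exp (I * θ) * exp (I * kepF Λ lam x xt) := by
    rw [← exp_add]; congr 1; ring
  have e2 : exp (-(I * (kepF Λ lam x xt + θ))) = exp (-(I * θ)) * exp (-(I * kepF Λ lam x xt)) := by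
    rw [← exp_add]; congr 1; ring
  have hW : kepW Λ (lam + θ) (exp (I * θ) * x) (exp (-(I * θ)) * xt) = kepW Λ lam x xt := by
    rw [kepW, kepS_rotate, h.kepF_rotate, e1, e2, kepW]
    linear_combination (-(I * xt * kepS Λ x xt * exp (I * kepF Λ lam x xt)
      + x * kepS Λ x xt * exp (-(I * kepF Λ lam x xt))) / 2) * h3
  rw [kepDU, kepDV, kepU, kepV, hW, kepQ_rotate, kepS_rotate, h.kepF_rotate, e1, e2]
  set E := exp (I * kepF Λ lam x xt) with hE
  set E' := exp (-(I * kepF Λ lam x xt)) with hE'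
  set s := kepS Λ x xt with hs
  set a := exp (I * θ) with ha
  set b := exp (-(I * θ)) with hb
  set w := (2 * (1 + (1 - kepQ Λ x xt))) with hw
  have k1 : (a * x * s) ^ 2 / w * (b * E') = a * ((x * s) ^ 2 / w * E') := by
    linear_combination (a * (x * s) ^ 2 / w * E') * h3
  have k2 : (I * (b * xt) * s) ^ 2 / w * (a * E) = b * ((I * xt * s) ^ 2 / w * E) := by
    linear_combination (b * (I * xt * s) ^ 2 / w * E) * h3
  rw [k1, k2]
  refine ⟨?_, ?_, ?_, ?_⟩
  · rw [kepU]; ring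
  · rw [kepV]; ring
  · rw [kepDU]; ring
  · rw [kepDV]; ring

theorem conj_two : starRingEnd ℂ (2 : ℂ) = 2 := map_ofNat (starRingEnd ℂ) 2

theorem conj_sqrt {w : ℂ} (hw : w ∈ slitPlane) :
    (starRingEnd ℂ w) ^ (1 / 2 : ℂ) = starRingEnd ℂ (w ^ (1 / 2 : ℂ)) := by
  rw [conj_cpow _ _ (slitPlane_arg_ne_pi hw), map_div₀, map_one, conj_two]

theorem kepQ_conj : kepQ (starRingEnd ℂ Λ) (-I * starRingEnd ℂ xt) (-I * starRingEnd ℂ x)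
    = starRingEnd ℂ (kepQ Λ x xt) := by
  simp only [kepQ, map_div₀, map_mul, conj_I]
  congr 1
  linear_combination (I * starRingEnd ℂ xt * starRingEnd ℂ x) * I_mul_I

theorem KepGood.kepS_conj (h : KepGood B Λ lam x xt) :
    kepS (starRingEnd ℂ Λ) (-I * starRingEnd ℂ xt) (-I * starRingEnd ℂ x)
      = starRingEnd ℂ (kepS Λ x xt) := by
  have : 2 - starRingEnd ℂ (kepQ Λ x xt) = starRingEnd ℂ (2 - kepQ Λ x xt) := by
    rw [map_sub, conj_two]
  rw [kepS, kepQ_conj, this, conj_sqrt h.q_mem, conj_sqrt h.lam_mem, kepS, map_div₀]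

/-- The functions giving r_x + i r_y and r_x - i r_y are conjugate at real points, so off them the
involution exchanges the two. Conjugation commutes with principal square roots off the negative
axis, which `lam_mem` and `q_mem` guarantee. -/
theorem KepGood.conj_eq (h : KepGood B Λ lam x xt) :
    kepU (starRingEnd ℂ Λ) (starRingEnd ℂ lam) (-I * starRingEnd ℂ xt) (-I * starRingEnd ℂ x)
      = starRingEnd ℂ (kepV Λ lam x xt) ∧
    kepV (starRingEnd ℂ Λ) (starRingEnd ℂ lam) (-I * starRingEnd ℂ xt) (-I * starRingEnd ℂ x)
      = starRingEnd ℂ (kepU Λ lam x xt) ∧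
    kepDU (starRingEnd ℂ Λ) (starRingEnd ℂ lam) (-I * starRingEnd ℂ xt) (-I * starRingEnd ℂ x)
      = starRingEnd ℂ (kepDV Λ lam x xt) ∧
    kepDV (starRingEnd ℂ Λ) (starRingEnd ℂ lam) (-I * starRingEnd ℂ xt) (-I * starRingEnd ℂ x)
      = starRingEnd ℂ (kepDU Λ lam x xt) := by
  have z1 : -I * starRingEnd ℂ xt * starRingEnd ℂ (kepS Λ x xt)
      = starRingEnd ℂ (I * xt * kepS Λ x xt) := by simp
  have z2 : I * (-I * starRingEnd ℂ x) * starRingEnd ℂ (kepS Λ x xt)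
      = starRingEnd ℂ (x * kepS Λ x xt) := by
    rw [map_mul]; linear_combination (-starRingEnd ℂ x * starRingEnd ℂ (kepS Λ x xt)) * I_mul_I
  have hF : kepF (starRingEnd ℂ Λ) (starRingEnd ℂ lam) (-I * starRingEnd ℂ xt)
      (-I * starRingEnd ℂ x) = starRingEnd ℂ (kepF Λ lam x xt) := by
    rw [kepF, h.kepS_conj, z1, z2, eccLongitude_conj h.im_le h.z_le h.zb_le, kepF]
  have e1 : exp (I * starRingEnd ℂ (kepF Λ lam x xt))
      = starRingEnd ℂ (exp (-(I * kepF Λ lam x xt))) := by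
    rw [← exp_conj]; simp
  have e2 : exp (-(I * starRingEnd ℂ (kepF Λ lam x xt)))
      = starRingEnd ℂ (exp (I * kepF Λ lam x xt)) := by
    rw [← exp_conj]; simp
  have hW : kepW (starRingEnd ℂ Λ) (starRingEnd ℂ lam) (-I * starRingEnd ℂ xt)
      (-I * starRingEnd ℂ x) = starRingEnd ℂ (kepW Λ lam x xt) := by
    rw [kepW, h.kepS_conj, z1, z2, hF, e1, e2, kepW]
    simp only [map_sub, map_one, map_div₀, map_add, map_mul, map_ofNat]
    ring
  refine ⟨?_, ?_, ?_, ?_⟩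
  · rw [kepU, kepQ_conj, h.kepS_conj, hF, e1, e2, z1, kepV]
    simp only [map_sub, map_one, map_div₀, map_add, map_mul, map_pow, conj_two]
  · rw [kepV, kepQ_conj, h.kepS_conj, hF, e1, e2, z2, kepU]
    simp only [map_sub, map_one, map_div₀, map_add, map_mul, map_pow, conj_two]
  · rw [kepDU, hW, kepQ_conj, h.kepS_conj, hF, e1, e2, z1, kepDV]
    simp only [map_sub, map_one, map_div₀, map_add, map_mul, map_pow, conj_I, conj_two]
    ring
  · rw [kepDV, hW, kepQ_conj, h.kepS_conj, hF, e1, e2, z2, kepDU]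
    simp only [map_sub, map_one, map_div₀, map_add, map_mul, map_pow, conj_I, conj_two]
    ring

theorem kepQ_zero : kepQ Λ 0 0 = 0 := by simp [kepQ]
theorem kepF_zero : kepF Λ lam 0 0 = lam := by simp [kepF, eccLongitude_zero]
theorem kepW_zero : kepW Λ lam 0 0 = 1 := by simp [kepW]
theorem kepU_zero : kepU Λ lam 0 0 = exp (I * lam) := by
  simp [kepU, kepQ_zero, kepF_zero]

theorem kepV_zero : kepV Λ lam 0 0 = exp (-(I * lam)) := by
  simp [kepV, kepQ_zero, kepF_zero]

variable {E : Type*} [NormedAddCommGroup E] [NormedSpace ℂ E] {Λf lf xf xtf : E → ℂ} {p : E}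

theorem analyticAt_kepQ (h1 : AnalyticAt ℂ Λf p) (h3 : AnalyticAt ℂ xf p)
    (h4 : AnalyticAt ℂ xtf p) (h5 : Λf p ≠ 0) :
    AnalyticAt ℂ (fun q => kepQ (Λf q) (xf q) (xtf q)) p :=
  ((analyticAt_const.mul h3).mul h4).fun_div h1 h5

theorem analyticAt_kepS (h1 : AnalyticAt ℂ Λf p) (h3 : AnalyticAt ℂ xf p)
    (h4 : AnalyticAt ℂ xtf p) (h5 : Λf p ∈ slitPlane) (h6 : xf p = 0) (h7 : xtf p = 0) :
    AnalyticAt ℂ (fun q => kepS (Λf q) (xf q) (xtf q)) p := by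
  refine AnalyticAt.fun_div ?_ (h1.cpow analyticAt_const h5) ?_
  · refine (analyticAt_const.fun_sub
      (analyticAt_kepQ h1 h3 h4 (slitPlane_ne_zero h5))).cpow analyticAt_const ?_
    rw [h6, h7, kepQ_zero, sub_zero]
    exact Or.inl (by norm_num)
  · exact (cpow_ne_zero_iff_of_exponent_ne_zero (by norm_num)).2 (slitPlane_ne_zero h5)

theorem analyticAt_kepF (h1 : AnalyticAt ℂ Λf p) (h2 : AnalyticAt ℂ lf p) (h3 : AnalyticAt ℂ xf p)
    (h4 : AnalyticAt ℂ xtf p) (h5 : Λf p ∈ slitPlane) (h6 : xf p = 0) (h7 : xtf p = 0) :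
    AnalyticAt ℂ (fun q => kepF (Λf q) (lf q) (xf q) (xtf q)) p := by
  have hs := analyticAt_kepS h1 h3 h4 h5 h6 h7
  have h8 : AnalyticAt ℂ (fun q => (lf q, xf q * kepS (Λf q) (xf q) (xtf q),
      I * xtf q * kepS (Λf q) (xf q) (xtf q))) p :=
    h2.prod ((h3.mul hs).prod ((analyticAt_const.mul h4).mul hs))
  have h9 := analyticAt_eccLongitude (lf p)
  have h10 : (lf p, (0 : ℂ), (0 : ℂ)) = (lf p, xf p * kepS (Λf p) (xf p) (xtf p),
      I * xtf p * kepS (Λf p) (xf p) (xtf p)) := by rw [h6, h7]; simp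
  rw [h10] at h9
  exact AnalyticAt.comp (f := fun q => (lf q, xf q * kepS (Λf q) (xf q) (xtf q),
      I * xtf q * kepS (Λf q) (xf q) (xtf q))) h9 h8

theorem analyticAt_kep (h1 : AnalyticAt ℂ Λf p) (h2 : AnalyticAt ℂ lf p) (h3 : AnalyticAt ℂ xf p)
    (h4 : AnalyticAt ℂ xtf p) (h5 : Λf p ∈ slitPlane) (h6 : xf p = 0) (h7 : xtf p = 0) :
    AnalyticAt ℂ (fun q => kepU (Λf q) (lf q) (xf q) (xtf q)) p ∧
    AnalyticAt ℂ (fun q => kepV (Λf q) (lf q) (xf q) (xtf q)) p ∧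
    AnalyticAt ℂ (fun q => kepDU (Λf q) (lf q) (xf q) (xtf q)) p ∧
    AnalyticAt ℂ (fun q => kepDV (Λf q) (lf q) (xf q) (xtf q)) p := by
  have hF := analyticAt_kepF h1 h2 h3 h4 h5 h6 h7
  have hs := analyticAt_kepS h1 h3 h4 h5 h6 h7
  have hq := analyticAt_kepQ h1 h3 h4 (slitPlane_ne_zero h5)
  have he : AnalyticAt ℂ (fun q => exp (I * kepF (Λf q) (lf q) (xf q) (xtf q))) p :=
    (analyticAt_const.mul hF).cexp'
  have he' : AnalyticAt ℂ (fun q => exp (-(I * kepF (Λf q) (lf q) (xf q) (xtf q)))) p :=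
    (analyticAt_const.mul hF).neg.cexp'
  have hz : AnalyticAt ℂ (fun q => xf q * kepS (Λf q) (xf q) (xtf q)) p := h3.mul hs
  have hzb : AnalyticAt ℂ (fun q => I * xtf q * kepS (Λf q) (xf q) (xtf q)) p :=
    (analyticAt_const.mul h4).mul hs
  have hη : AnalyticAt ℂ (fun q => 1 + (1 - kepQ (Λf q) (xf q) (xtf q))) p :=
    analyticAt_const.add (analyticAt_const.sub hq)
  have hη0 : 2 * (1 + (1 - kepQ (Λf p) (xf p) (xtf p))) ≠ 0 := by
    rw [h6, h7, kepQ_zero]; norm_num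
  have hη2 := (analyticAt_const (𝕜 := ℂ) (v := (2 : ℂ))).mul hη
  have a1 := (hη.fun_div analyticAt_const (two_ne_zero)).mul he
  have a2 := (hη.fun_div analyticAt_const (two_ne_zero)).mul he'
  have b1 := ((hz.pow 2).fun_div hη2 hη0).mul he'
  have b2 := ((hzb.pow 2).fun_div hη2 hη0).mul he
  have hw : AnalyticAt ℂ (fun q => kepW (Λf q) (lf q) (xf q) (xtf q)) p :=
    analyticAt_const.sub (((hzb.mul he).add (hz.mul he')).fun_div analyticAt_const two_ne_zero)
  have hw0 : kepW (Λf p) (lf p) (xf p) (xtf p) ≠ 0 := by rw [h6, h7, kepW_zero]; exact one_ne_zero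
  exact ⟨(a1.add b1).sub hz, (a2.add b2).sub hzb,
    (analyticAt_const.mul (a1.sub b1)).fun_div hw hw0,
    (analyticAt_const.mul (b2.sub a2)).fun_div hw hw0⟩

theorem eventually_kepGood (h1 : AnalyticAt ℂ Λf p) (h2 : AnalyticAt ℂ lf p)
    (h3 : AnalyticAt ℂ xf p) (h4 : AnalyticAt ℂ xtf p) (h5 : Λf p ∈ slitPlane) (h6 : xf p = 0)
    (h7 : xtf p = 0) (hB : |(lf p).im| < B) :
    ∀ᶠ q in 𝓝 p, KepGood B (Λf q) (lf q) (xf q) (xtf q) := by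
  have hs := analyticAt_kepS h1 h3 h4 h5 h6 h7
  have hq := analyticAt_kepQ h1 h3 h4 (slitPlane_ne_zero h5)
  have e1 := h1.continuousAt.eventually_mem (isOpen_slitPlane.mem_nhds h5)
  have e2 := ((analyticAt_const (v := (2 : ℂ))).sub hq).continuousAt.eventually_mem
    (isOpen_slitPlane.mem_nhds (x := 2 - kepQ (Λf p) (xf p) (xtf p)) (by
      rw [h6, h7, kepQ_zero, sub_zero]; exact Or.inl (by norm_num)))
  have e3 := ((Complex.continuous_im.continuousAt.comp h2.continuousAt).abs).eventually_lt_const hB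
  have e4 := (h3.mul hs).continuousAt.norm.eventually_lt_const
    (u := keplerRadius B) (by simpa [h6] using keplerRadius_pos)
  have e5 := ((analyticAt_const (v := I)).mul h4 |>.mul hs).continuousAt.norm.eventually_lt_const
    (u := keplerRadius B) (by simpa [h7] using keplerRadius_pos)
  filter_upwards [e1, e2, e3, e4, e5] with q k1 k2 k3 k4 k5
  exact ⟨k1, k2, k3.le, k4.le, k5.le⟩

end Planet

/-! ### Rotations and the anti-holomorphic involution. -/

section Symmetries

/-- The linear part of the rotation by `θ`. -/
noncomputable def rotLin (θ : ℝ) : Phase →L[ℂ] Phase :=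
  (ContinuousLinearMap.fst ℂ Vec (Vec × Vec × Vec)).prod
    (((ContinuousLinearMap.fst ℂ Vec (Vec × Vec)).comp (.snd ℂ Vec (Vec × Vec × Vec))).prod
      ((exp (I * θ) • ((ContinuousLinearMap.fst ℂ Vec Vec).comp
        ((ContinuousLinearMap.snd ℂ Vec (Vec × Vec)).comp (.snd ℂ Vec (Vec × Vec × Vec))))).prod
      (exp (-(I * θ)) • ((ContinuousLinearMap.snd ℂ Vec Vec).comp
        ((ContinuousLinearMap.snd ℂ Vec (Vec × Vec)).comp (.snd ℂ Vec (Vec × Vec × Vec)))))))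

theorem rotLin_apply (θ : ℝ) (p : Phase) :
    rotLin θ p = (p.1, p.2.1, exp (I * θ) • p.2.2.1, exp (-(I * θ)) • p.2.2.2) := rfl

/-- The rotation by `θ`. -/
noncomputable def rot (θ : ℝ) (p : Phase) : Phase := rotLin θ p + (θ : ℂ) • eFast

theorem rot_apply (θ : ℝ) (p : Phase) :
    rot θ p = (p.1, ![p.2.1 0, p.2.1 1 + θ], exp (I * θ) • p.2.2.1,
      exp (-(I * θ)) • p.2.2.2) := by
  rw [rot, rotLin_apply]
  ext j
  · simp [eFast]
  · fin_cases j <;> simp [eFast, Matrix.vecHead, Matrix.vecTail]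
  · simp [eFast]
  · simp [eFast]

theorem exp_mul_exp_neg (w : ℂ) : exp w * exp (-w) = 1 := by rw [← exp_add]; simp

theorem rot_rot_neg (θ : ℝ) (p : Phase) : rot θ (rot (-θ) p) = p := by
  have h1 : exp (I * θ) * exp (I * ((-θ : ℝ) : ℂ)) = 1 := by
    rw [← exp_mul_exp_neg (I * θ)]; push_cast; ring_nf
  have h2 : exp (-(I * θ)) * exp (-(I * ((-θ : ℝ) : ℂ))) = 1 := by
    rw [mul_comm, ← exp_mul_exp_neg (I * θ)]; push_cast; ring_nf
  rw [rot_apply, rot_apply]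
  ext j
  · rfl
  · fin_cases j <;> simp
  · simp only [smul_smul, h1, one_smul]
  · simp only [smul_smul, h2, one_smul]

theorem analyticAt_rot (θ : ℝ) (p : Phase) : AnalyticAt ℂ (rot θ) p :=
  ((rotLin θ).analyticAt p).add analyticAt_const

theorem norm_rotLin (θ : ℝ) (p : Phase) : ‖rotLin θ p‖ = ‖p‖ := by
  simp only [rotLin_apply, Prod.norm_def, norm_smul, norm_exp_I_mul_ofReal,
    norm_exp_neg_I_mul_ofReal, one_mul]

theorem sympl_rotLin (θ : ℝ) (u v : Phase) : sympl (rotLin θ u) (rotLin θ v) = sympl u v := by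
  simp only [sympl, rotLin_apply, smul_dotProduct, dotProduct_smul, smul_eq_mul]
  linear_combination (u.2.2.1 ⬝ᵥ v.2.2.2 - v.2.2.1 ⬝ᵥ u.2.2.2) * exp_mul_exp_neg (I * θ)

/-- The rotation by `θ`, as a symmetry. -/
noncomputable def rotSymm (Δ θ : ℝ) : Symmetry Δ where
  lin := (rotLin θ).restrictScalars ℝ
  shift := (θ : ℂ) • eFast
  val := ContinuousLinearMap.id ℝ ℂ
  surj := by
    intro p
    refine ⟨rotLin (-θ) p, ?_⟩
    have := rot_rot_neg θ p
    rw [rot, rot, map_add, map_smul] at this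
    have h1 : rotLin θ eFast = eFast := by rw [rotLin_apply]; ext <;> simp [eFast]
    rw [h1, add_assoc, ← add_smul] at this
    simpa using this
  sympl_lin := sympl_rotLin θ
  lin_fast := by
    change rotLin θ eFast = eFast
    rw [rotLin_apply]; ext <;> simp [eFast]
  zone_map := by
    rintro r p ⟨θ', hθ', hp⟩
    refine add_fast_mem_zone (p := rotLin θ p) ⟨θ', hθ', ?_⟩ θ
    have h1 : rotLin θ (baseAngle θ') = baseAngle θ' := by
      rw [rotLin_apply]; ext <;> simp [baseAngle]
    rw [← h1, ← map_sub, norm_rotLin]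
    exact hp

theorem rotSymm_map (Δ θ : ℝ) (p : Phase) : (rotSymm Δ θ).map p = rot θ p := rfl

/-- Complex conjugation of vectors. -/
noncomputable def conjVec : Vec →L[ℝ] Vec :=
  ContinuousLinearMap.pi fun j => (conjCLE : ℂ →L[ℝ] ℂ).comp (ContinuousLinearMap.proj j)

theorem conjVec_apply (v : Vec) (j : Fin 2) : conjVec v j = starRingEnd ℂ (v j) := rfl

/-- The anti-holomorphic involution whose fixed points are the real points. -/
noncomputable def conjPhase : Phase →L[ℝ] Phase :=
  (conjVec.comp (ContinuousLinearMap.fst ℝ Vec (Vec × Vec × Vec))).prod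
    ((conjVec.comp ((ContinuousLinearMap.fst ℝ Vec (Vec × Vec)).comp
      (.snd ℝ Vec (Vec × Vec × Vec)))).prod
    (((-I) • (conjVec.comp ((ContinuousLinearMap.snd ℝ Vec Vec).comp
      ((ContinuousLinearMap.snd ℝ Vec (Vec × Vec)).comp (.snd ℝ Vec (Vec × Vec × Vec)))))).prod
    ((-I) • (conjVec.comp ((ContinuousLinearMap.fst ℝ Vec Vec).comp
      ((ContinuousLinearMap.snd ℝ Vec (Vec × Vec)).comp (.snd ℝ Vec (Vec × Vec × Vec))))))))

theorem conjPhase_apply (p : Phase) : conjPhase p =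
    (conjVec p.1, conjVec p.2.1, -I • conjVec p.2.2.2, -I • conjVec p.2.2.1) := rfl

theorem conjPhase_conjPhase (p : Phase) : conjPhase (conjPhase p) = p := by
  rw [conjPhase_apply, conjPhase_apply]
  ext j
  · simp [conjVec_apply]
  · simp [conjVec_apply]
  · simp only [Pi.smul_apply, conjVec_apply, smul_eq_mul, map_mul, map_neg, conj_I, conj_conj]
    linear_combination -p.2.2.1 j * I_mul_I
  · simp only [Pi.smul_apply, conjVec_apply, smul_eq_mul, map_mul, map_neg, conj_I, conj_conj]
    linear_combination -p.2.2.2 j * I_mul_I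

theorem isRealPoint_iff (p : Phase) : IsRealPoint p ↔ conjPhase p = p := by
  have hre : ∀ z : ℂ, z.im = 0 ↔ starRingEnd ℂ z = z := fun z => conj_eq_iff_im.symm
  rw [conjPhase_apply]
  constructor
  · rintro ⟨h1, h2, h3⟩
    ext j
    · exact (hre _).1 (h1 j)
    · exact (hre _).1 (h2 j)
    · simp only [Pi.smul_apply, conjVec_apply, smul_eq_mul, h3 j, map_mul, map_neg, conj_I,
        conj_conj]
      linear_combination -p.2.2.1 j * I_mul_I
    · simp only [Pi.smul_apply, conjVec_apply, smul_eq_mul, h3 j]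
  · intro h
    refine ⟨fun j => (hre _).2 ?_, fun j => (hre _).2 ?_, fun j => ?_⟩
    · exact congrFun (congrArg (fun q : Phase => q.1) h) j
    · exact congrFun (congrArg (fun q : Phase => q.2.1) h) j
    · exact (congrFun (congrArg (fun q : Phase => q.2.2.2) h) j).symm

theorem norm_conjVec (v : Vec) : ‖conjVec v‖ = ‖v‖ := by
  simp only [Pi.norm_def, conjVec_apply]
  congr 2
  ext j
  simp

theorem norm_conjPhase (p : Phase) : ‖conjPhase p‖ = ‖p‖ := by
  simp only [conjPhase_apply, Prod.norm_def, norm_smul, norm_neg, norm_I, one_mul, norm_conjVec]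
  rw [max_comm ‖p.2.2.2‖]

theorem sympl_conjPhase (u v : Phase) :
    sympl (conjPhase u) (conjPhase v) = starRingEnd ℂ (sympl u v) := by
  simp only [sympl, conjPhase_apply, dotProduct, Fin.sum_univ_two, Pi.smul_apply, conjVec_apply,
    smul_eq_mul, map_add, map_sub, map_mul]
  linear_combination ((starRingEnd ℂ (u.2.2.2 0) * starRingEnd ℂ (v.2.2.1 0)
    + starRingEnd ℂ (u.2.2.2 1) * starRingEnd ℂ (v.2.2.1 1)
    - starRingEnd ℂ (v.2.2.2 0) * starRingEnd ℂ (u.2.2.1 0)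
    - starRingEnd ℂ (v.2.2.2 1) * starRingEnd ℂ (u.2.2.1 1))) * I_mul_I

/-- The anti-holomorphic involution, as a symmetry. -/
noncomputable def conjSymm (Δ : ℝ) : Symmetry Δ where
  lin := conjPhase
  shift := 0
  val := conjCLE
  surj := fun p => ⟨conjPhase p, conjPhase_conjPhase p⟩
  sympl_lin := sympl_conjPhase
  lin_fast := by
    rw [conjPhase_apply]
    ext j
    · simp [eFast, conjVec_apply]
    · fin_cases j <;> simp [eFast, conjVec_apply]
    · simp [eFast]
    · simp [eFast]
  zone_map := by
    rintro r p ⟨θ', hθ', hp⟩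
    refine ⟨θ', hθ', ?_⟩
    have h1 : conjPhase (baseAngle θ') = baseAngle θ' := by
      rw [conjPhase_apply]; ext <;> simp [baseAngle, conjVec_apply]
    rw [add_zero, ← h1, ← map_sub, norm_conjPhase]
    exact hp

theorem conjSymm_map (Δ : ℝ) (p : Phase) : (conjSymm Δ).map p = conjPhase p := add_zero _

theorem conjSymm_val (Δ : ℝ) (z : ℂ) : (conjSymm Δ).val z = starRingEnd ℂ z := rfl

end Symmetries

/-! ### The perturbation for complex mass ratios, and its symmetries. -/

section Perturbation

variable (m₀ υ₀ : ℝ) (m : Fin 2 → ℝ)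

/-- `μ_j` for a complex mass ratio. -/
noncomputable def muC (e : ℂ) (j : Fin 2) : ℂ := m₀ + e * m j

/-- The reduced masses for a complex mass ratio. -/
noncomputable def mhatC (e : ℂ) (j : Fin 2) : ℂ := m₀ * m j / (m₀ + e * m j)

/-- The resonant actions for a complex mass ratio. -/
noncomputable def lamResC (e : ℂ) (j : Fin 2) : ℂ :=
  mhatC m₀ m e j * (muC m₀ m e j ^ ((2 / 3 : ℝ) : ℂ) * (υ₀ ^ (-(1 / 3) : ℝ) : ℝ))

/-- The actions for a complex mass ratio. -/
noncomputable def lamActC (e : ℂ) (Z : Vec) : Vec :=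
  ![lamResC m₀ υ₀ m e 0 + Z 0, lamResC m₀ υ₀ m e 1 + Z 1 - Z 0]

/-- The positions `r_x + i r_y`. -/
noncomputable def posU (q : ℂ × Phase) (j : Fin 2) : ℂ :=
  kepA (mhatC m₀ m q.1 j) (muC m₀ m q.1 j) (lamActC m₀ υ₀ m q.1 q.2.1 j) *
    kepU (lamActC m₀ υ₀ m q.1 q.2.1 j) (meanLongitude q.2.2.1 j) (q.2.2.2.1 j) (q.2.2.2.2 j)

/-- The positions `r_x - i r_y`. -/
noncomputable def posV (q : ℂ × Phase) (j : Fin 2) : ℂ :=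
  kepA (mhatC m₀ m q.1 j) (muC m₀ m q.1 j) (lamActC m₀ υ₀ m q.1 q.2.1 j) *
    kepV (lamActC m₀ υ₀ m q.1 q.2.1 j) (meanLongitude q.2.2.1 j) (q.2.2.2.1 j) (q.2.2.2.2 j)

/-- The ratio between the momenta and the derivatives of the positions along unit orbits. -/
noncomputable def momFactor (q : ℂ × Phase) (j : Fin 2) : ℂ :=
  mhatC m₀ m q.1 j * (kepA (mhatC m₀ m q.1 j) (muC m₀ m q.1 j) (lamActC m₀ υ₀ m q.1 q.2.1 j) *
    kepN (mhatC m₀ m q.1 j) (muC m₀ m q.1 j) (lamActC m₀ υ₀ m q.1 q.2.1 j))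

/-- The momenta `r̃_x + i r̃_y`. -/
noncomputable def momU (q : ℂ × Phase) (j : Fin 2) : ℂ := momFactor m₀ υ₀ m q j *
  kepDU (lamActC m₀ υ₀ m q.1 q.2.1 j) (meanLongitude q.2.2.1 j) (q.2.2.2.1 j) (q.2.2.2.2 j)

/-- The momenta `r̃_x - i r̃_y`. -/
noncomputable def momV (q : ℂ × Phase) (j : Fin 2) : ℂ := momFactor m₀ υ₀ m q j *
  kepDV (lamActC m₀ υ₀ m q.1 q.2.1 j) (meanLongitude q.2.2.1 j) (q.2.2.2.1 j) (q.2.2.2.2 j)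

/-- The square of the mutual distance. -/
noncomputable def distSq (q : ℂ × Phase) : ℂ :=
  (posU m₀ υ₀ m q 0 - posU m₀ υ₀ m q 1) * (posV m₀ υ₀ m q 0 - posV m₀ υ₀ m q 1)

/-- The perturbation divided by the mass ratio, for a complex mass ratio. -/
noncomputable def pert (q : ℂ × Phase) : ℂ :=
  (momU m₀ υ₀ m q 0 * momV m₀ υ₀ m q 1 + momV m₀ υ₀ m q 0 * momU m₀ υ₀ m q 1) / 2 / m₀
    - m 0 * m 1 / distSq m₀ υ₀ m q ^ (1 / 2 : ℂ)

/-- The configurations where the expansions converge. -/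
structure Good (B : ℝ) (q : ℂ × Phase) : Prop where
  planet : ∀ j, KepGood B (lamActC m₀ υ₀ m q.1 q.2.1 j) (meanLongitude q.2.2.1 j) (q.2.2.2.1 j)
    (q.2.2.2.2 j)
  dist_mem : distSq m₀ υ₀ m q ∈ slitPlane

variable {m₀ υ₀ m} {ε B : ℝ}

theorem mu_pos (hm₀ : 0 < m₀) (hm : ∀ j, 0 < m j) (hε : 0 ≤ ε) (j : Fin 2) : 0 < mu m₀ m ε j := by
  have := mul_nonneg hε (hm j).le
  rw [mu]; linarith

theorem muC_ofReal (j : Fin 2) : muC m₀ m ε j = mu m₀ m ε j := by simp [muC, mu]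

theorem mhatC_ofReal (j : Fin 2) : mhatC m₀ m ε j = mhat m₀ m ε j := by simp [mhatC, mhat]

/-- In this form the resonant action has no square root of a product and extends analytically to
complex mass ratios near 0. -/
theorem LamRes_eq (hm₀ : 0 < m₀) (hm : ∀ j, 0 < m j) (hυ₀ : 0 < υ₀) (hε : 0 ≤ ε) (j : Fin 2) :
    LamRes m₀ m υ₀ ε j = mhat m₀ m ε j * (mu m₀ m ε j ^ (2 / 3 : ℝ) * υ₀ ^ (-(1 / 3) : ℝ)) := by
  have h := mu_pos hm₀ hm hε j
  rw [LamRes, aRes]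
  congr 1
  have h1 : mu m₀ m ε j * (mu m₀ m ε j ^ (1 / 3 : ℝ) * υ₀ ^ (-(2 / 3) : ℝ))
      = (mu m₀ m ε j ^ (2 / 3 : ℝ) * υ₀ ^ (-(1 / 3) : ℝ)) ^ 2 := by
    rw [mul_pow, ← Real.rpow_natCast, ← Real.rpow_natCast, ← Real.rpow_mul h.le,
      ← Real.rpow_mul hυ₀.le, ← mul_assoc]
    congr 1
    · nth_rewrite 1 [← Real.rpow_one (mu m₀ m ε j)]
      rw [← Real.rpow_add h]; norm_num
    · norm_num
  rw [h1, Real.sqrt_sq (by positivity)]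

theorem lamResC_ofReal (hm₀ : 0 < m₀) (hm : ∀ j, 0 < m j) (hυ₀ : 0 < υ₀) (hε : 0 ≤ ε)
    (j : Fin 2) : lamResC m₀ υ₀ m ε j = LamRes m₀ m υ₀ ε j := by
  have h := mu_pos hm₀ hm hε j
  rw [LamRes_eq hm₀ hm hυ₀ hε, lamResC, muC_ofReal, mhatC_ofReal, ← ofReal_cpow h.le]
  push_cast; ring

theorem lamActC_ofReal (hm₀ : 0 < m₀) (hm : ∀ j, 0 < m j) (hυ₀ : 0 < υ₀) (hε : 0 ≤ ε)
    (Z : Vec) : lamActC m₀ υ₀ m ε Z = lamAction m₀ m υ₀ ε Z := by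
  rw [lamActC, lamAction, lamResC_ofReal hm₀ hm hυ₀ hε, lamResC_ofReal hm₀ hm hυ₀ hε]

theorem dotProduct_half (a b c d : ℂ) :
    (![(a + b) / 2, (a - b) / (2 * I)] : Vec) ⬝ᵥ ![(c + d) / 2, (c - d) / (2 * I)]
      = (a * d + b * c) / 2 := by
  simp only [dotProduct, Fin.sum_univ_two, Matrix.cons_val_zero, Matrix.cons_val_one]
  field_simp [I_ne_zero]
  rw [I_sq]
  ring

/-- In the coordinates r_x ± i r_y the scalar product becomes (u v' + v u')/2 and rotations act
diagonally. The function on the right is analytic in the mass ratio as well, so the limit ε → 0 is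
controlled by Cauchy estimates. -/
theorem HP_eq (hm₀ : 0 < m₀) (hm : ∀ j, 0 < m j) (hυ₀ : 0 < υ₀) (hε : 0 ≤ ε) (p : Phase) :
    HP m₀ m υ₀ ε p = ε * pert m₀ υ₀ m (ε, p) := by
  have hrt : ∀ j, (poincare (mhat m₀ m ε j) (mu m₀ m ε j) (lamAction m₀ m υ₀ ε p.1 j)
      (meanLongitude p.2.1 j) (p.2.2.1 j) (p.2.2.2 j)).1
      = ![(momU m₀ υ₀ m (ε, p) j + momV m₀ υ₀ m (ε, p) j) / 2,
        (momU m₀ υ₀ m (ε, p) j - momV m₀ υ₀ m (ε, p) j) / (2 * I)] := by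
    intro j
    rw [poincare_eq, momU, momV, momFactor, muC_ofReal, mhatC_ofReal,
      lamActC_ofReal hm₀ hm hυ₀ hε]
    have key : ∀ a b c d : ℂ, a = c → b = d → (![a, b] : Vec) = ![c, d] := by
      rintro _ _ _ _ rfl rfl; rfl
    refine key _ _ _ _ ?_ ?_ <;> ring
  have hr : ∀ j, (poincare (mhat m₀ m ε j) (mu m₀ m ε j) (lamAction m₀ m υ₀ ε p.1 j)
      (meanLongitude p.2.1 j) (p.2.2.1 j) (p.2.2.2 j)).2
      = ![(posU m₀ υ₀ m (ε, p) j + posV m₀ υ₀ m (ε, p) j) / 2,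
        (posU m₀ υ₀ m (ε, p) j - posV m₀ υ₀ m (ε, p) j) / (2 * I)] := by
    intro j
    rw [poincare_eq, posU, posV, muC_ofReal, mhatC_ofReal, lamActC_ofReal hm₀ hm hυ₀ hε]
    have key : ∀ a b c d : ℂ, a = c → b = d → (![a, b] : Vec) = ![c, d] := by
      rintro _ _ _ _ rfl rfl; rfl
    refine key _ _ _ _ ?_ ?_ <;> ring
  have hsub : (![(posU m₀ υ₀ m (ε, p) 0 + posV m₀ υ₀ m (ε, p) 0) / 2,
        (posU m₀ υ₀ m (ε, p) 0 - posV m₀ υ₀ m (ε, p) 0) / (2 * I)] : Vec)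
      - ![(posU m₀ υ₀ m (ε, p) 1 + posV m₀ υ₀ m (ε, p) 1) / 2,
        (posU m₀ υ₀ m (ε, p) 1 - posV m₀ υ₀ m (ε, p) 1) / (2 * I)]
      = ![((posU m₀ υ₀ m (ε, p) 0 - posU m₀ υ₀ m (ε, p) 1)
          + (posV m₀ υ₀ m (ε, p) 0 - posV m₀ υ₀ m (ε, p) 1)) / 2,
        ((posU m₀ υ₀ m (ε, p) 0 - posU m₀ υ₀ m (ε, p) 1)
          - (posV m₀ υ₀ m (ε, p) 0 - posV m₀ υ₀ m (ε, p) 1)) / (2 * I)] := by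
    ext j
    fin_cases j
    · simp; ring
    · simp; ring
  rw [HP, perturbation]
  simp only [hrt, hr, hsub, dotProduct_half]
  rw [pert, distSq]
  congr 4
  ring

theorem meanLongitude_rot (θ : ℝ) (p : Phase) (j : Fin 2) :
    meanLongitude (rot θ p).2.1 j = meanLongitude p.2.1 j + θ := by
  rw [rot_apply]
  fin_cases j
  · simp [meanLongitude]; ring
  · simp [meanLongitude]

theorem Good.rot {q : ℂ × Phase} (h : Good m₀ υ₀ m B q) (θ : ℝ) :
    Good m₀ υ₀ m B (q.1, rot θ q.2) ∧ pert m₀ υ₀ m (q.1, Coorbital.rot θ q.2) = pert m₀ υ₀ m q := by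
  have hZ : (Coorbital.rot θ q.2).1 = q.2.1 := by rw [rot_apply]
  have hx : ∀ j, (Coorbital.rot θ q.2).2.2.1 j = exp (I * θ) * q.2.2.2.1 j := fun j => by
    rw [rot_apply]; rfl
  have hxt : ∀ j, (Coorbital.rot θ q.2).2.2.2 j = exp (-(I * θ)) * q.2.2.2.2 j := fun j => by
    rw [rot_apply]; rfl
  have hU : ∀ j, posU m₀ υ₀ m (q.1, Coorbital.rot θ q.2) j = exp (I * θ) * posU m₀ υ₀ m q j := by
    intro j
    rw [posU, meanLongitude_rot, hx, hxt, hZ, ((h.planet j).rotate_eq θ).1, posU]; ring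
  have hV : ∀ j, posV m₀ υ₀ m (q.1, Coorbital.rot θ q.2) j
      = exp (-(I * θ)) * posV m₀ υ₀ m q j := by
    intro j
    rw [posV, meanLongitude_rot, hx, hxt, hZ, ((h.planet j).rotate_eq θ).2.1, posV]; ring
  have hM : ∀ j, momFactor m₀ υ₀ m (q.1, Coorbital.rot θ q.2) j = momFactor m₀ υ₀ m q j := by
    intro j
    rw [momFactor, hZ, momFactor]
  have hDU : ∀ j, momU m₀ υ₀ m (q.1, Coorbital.rot θ q.2) j = exp (I * θ) * momU m₀ υ₀ m q j := by
    intro j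
    rw [momU, meanLongitude_rot, hx, hxt, hZ, hM, ((h.planet j).rotate_eq θ).2.2.1, momU]; ring
  have hDV : ∀ j, momV m₀ υ₀ m (q.1, Coorbital.rot θ q.2) j
      = exp (-(I * θ)) * momV m₀ υ₀ m q j := by
    intro j
    rw [momV, meanLongitude_rot, hx, hxt, hZ, hM, ((h.planet j).rotate_eq θ).2.2.2, momV]; ring
  have hD : distSq m₀ υ₀ m (q.1, Coorbital.rot θ q.2) = distSq m₀ υ₀ m q := by
    rw [distSq, hU, hU, hV, hV, distSq]
    linear_combination ((posU m₀ υ₀ m q 0 - posU m₀ υ₀ m q 1)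
      * (posV m₀ υ₀ m q 0 - posV m₀ υ₀ m q 1)) * exp_mul_exp_neg (I * θ)
  refine ⟨⟨fun j => ?_, by rw [hD]; exact h.dist_mem⟩, ?_⟩
  · rw [meanLongitude_rot, hx, hxt, hZ]
    exact (h.planet j).rotate θ
  · rw [pert, hD, hDU, hDU, hDV, hDV, pert]
    linear_combination ((momU m₀ υ₀ m q 0 * momV m₀ υ₀ m q 1
      + momV m₀ υ₀ m q 0 * momU m₀ υ₀ m q 1) / 2 / m₀) * exp_mul_exp_neg (I * θ)

theorem Good.conj (hm₀ : 0 < m₀) (hm : ∀ j, 0 < m j) (hυ₀ : 0 < υ₀) (hε : 0 ≤ ε) {p : Phase}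
    (h : Good m₀ υ₀ m B (ε, p)) :
    pert m₀ υ₀ m (ε, conjPhase p) = starRingEnd ℂ (pert m₀ υ₀ m (ε, p)) := by
  have hmu : ∀ j, muC m₀ m ε j = starRingEnd ℂ (muC m₀ m ε j) := fun j => by
    rw [muC_ofReal, conj_ofReal]
  have hmh : ∀ j, mhatC m₀ m ε j = starRingEnd ℂ (mhatC m₀ m ε j) := fun j => by
    rw [mhatC_ofReal, conj_ofReal]
  have hlam : ∀ j, lamActC m₀ υ₀ m ε (conjPhase p).1 j
      = starRingEnd ℂ (lamActC m₀ υ₀ m ε p.1 j) := by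
    intro j
    rw [lamActC, lamActC, lamResC_ofReal hm₀ hm hυ₀ hε, lamResC_ofReal hm₀ hm hυ₀ hε]
    fin_cases j <;> simp [conjPhase_apply, conjVec_apply]
  have hlon : ∀ j, meanLongitude (conjPhase p).2.1 j = starRingEnd ℂ (meanLongitude p.2.1 j) := by
    intro j
    fin_cases j <;> simp [conjPhase_apply, conjVec_apply, meanLongitude]
  have hx : ∀ j, (conjPhase p).2.2.1 j = -I * starRingEnd ℂ (p.2.2.2 j) := fun j => rfl
  have hxt : ∀ j, (conjPhase p).2.2.2 j = -I * starRingEnd ℂ (p.2.2.1 j) := fun j => rfl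
  have hA : ∀ j, kepA (mhatC m₀ m ε j) (muC m₀ m ε j) (lamActC m₀ υ₀ m ε (conjPhase p).1 j)
      = starRingEnd ℂ (kepA (mhatC m₀ m ε j) (muC m₀ m ε j) (lamActC m₀ υ₀ m ε p.1 j)) := by
    intro j
    simp only [kepA, hlam, map_div₀, map_mul, map_pow, ← hmu, ← hmh]
  have hU : ∀ j, posU m₀ υ₀ m (ε, conjPhase p) j = starRingEnd ℂ (posV m₀ υ₀ m (ε, p) j) := by
    intro j
    simp only [posU, posV, hA, hlon, hx, hxt, map_mul]
    rw [hlam, (h.planet j).conj_eq.1]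
  have hV : ∀ j, posV m₀ υ₀ m (ε, conjPhase p) j = starRingEnd ℂ (posU m₀ υ₀ m (ε, p) j) := by
    intro j
    simp only [posU, posV, hA, hlon, hx, hxt, map_mul]
    rw [hlam, (h.planet j).conj_eq.2.1]
  have hM : ∀ j, momFactor m₀ υ₀ m (ε, conjPhase p) j
      = starRingEnd ℂ (momFactor m₀ υ₀ m (ε, p) j) := by
    intro j
    simp only [momFactor, kepA, map_mul, ← hmh, kepN, hlam, map_div₀, map_pow, ← hmu]
  have hDU : ∀ j, momU m₀ υ₀ m (ε, conjPhase p) j = starRingEnd ℂ (momV m₀ υ₀ m (ε, p) j) := by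
    intro j
    simp only [momU, momV, hM, hlon, hx, hxt, map_mul]
    rw [hlam, (h.planet j).conj_eq.2.2.1]
  have hDV : ∀ j, momV m₀ υ₀ m (ε, conjPhase p) j = starRingEnd ℂ (momU m₀ υ₀ m (ε, p) j) := by
    intro j
    simp only [momU, momV, hM, hlon, hx, hxt, map_mul]
    rw [hlam, (h.planet j).conj_eq.2.2.2]
  have hD : distSq m₀ υ₀ m (ε, conjPhase p) = starRingEnd ℂ (distSq m₀ υ₀ m (ε, p)) := by
    simp only [distSq, hU, hV, map_mul, map_sub]; ring
  rw [pert, hD, conj_sqrt h.dist_mem, hDU, hDU, hDV, hDV, pert]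
  simp only [map_sub, map_div₀, map_add, map_mul, conj_ofReal, conj_two]
  ring

end Perturbation

/-! ### Uniform domain of analyticity near circular orbits. -/

section Region

/-- Write 2 - 2 cos φ = (2 sin (φ/2))². The real part of sin (φ/2) is sin (Re φ/2) cosh (Im φ/2),
positive while Re φ lies strictly between 0 and 2π, and the square of a number with positive real
part avoids the negative axis. The imaginary part is unrestricted, so σ < Δ suffices. -/
theorem mem_slitPlane_two_sub_cos {Δ σ : ℝ} (hσ : σ < Δ) {θ : Fin 2 → ℝ}
    (hθ : θ ∈ collisionless Δ) {ζ : Vec} (hζ : ‖ζ - fun j => (θ j : ℂ)‖ ≤ σ) :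
    2 - 2 * cos (ζ 0) ∈ slitPlane := by
  have h0 : ‖ζ 0 - θ 0‖ ≤ σ := (norm_le_pi_norm (ζ - fun j => (θ j : ℂ)) 0).trans hζ
  have h1 : |(ζ 0).re - θ 0| ≤ σ := by
    have := (abs_re_le_norm (ζ 0 - θ 0)).trans h0
    rwa [sub_re, ofReal_re] at this
  rw [abs_le] at h1
  have hs : 0 < Real.sin ((ζ 0).re / 2) := by
    refine Real.sin_pos_of_pos_of_lt_pi ?_ ?_ <;> linarith [hθ.1, hθ.2]
  have hre : 0 < (sin (ζ 0 / 2)).re := by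
    have h2 : (ζ 0 / 2).re = (ζ 0).re / 2 := by simp
    rw [sin_eq, h2]
    have h3 : (sin (((ζ 0).re / 2 : ℝ) : ℂ) * cosh ((ζ 0 / 2).im : ℂ)
        + cos (((ζ 0).re / 2 : ℝ) : ℂ) * sinh ((ζ 0 / 2).im : ℂ) * I).re
        = Real.sin ((ζ 0).re / 2) * Real.cosh (ζ 0 / 2).im := by
      rw [← ofReal_sin, ← ofReal_cosh, ← ofReal_cos, ← ofReal_sinh]
      simp only [add_re, mul_re, mul_im, ofReal_re, ofReal_im, I_re, I_im]
      ring
    rw [h3]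
    exact mul_pos hs (Real.cosh_pos _)
  have h4 : 2 - 2 * cos (ζ 0) = (2 * sin (ζ 0 / 2)) ^ 2 := by
    have : ζ 0 = 2 * (ζ 0 / 2) := by ring
    conv_lhs => rw [this, cos_two_mul]
    have := sin_sq_add_cos_sq (ζ 0 / 2)
    linear_combination (-4) * this
  rw [h4, mem_slitPlane_iff]
  set w := 2 * sin (ζ 0 / 2) with hw
  have hwre : 0 < w.re := by rw [hw]; simpa using hre
  by_cases him : w.im = 0
  · left
    rw [sq, mul_re, him]
    nlinarith
  · right
    rw [sq, mul_im]
    have := mul_ne_zero hwre.ne' him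
    intro h
    exact this (by linarith [mul_comm w.re w.im])

variable {m₀ υ₀ : ℝ} {m : Fin 2 → ℝ}

/-- The scale of the resonant actions. -/
noncomputable def ell (m₀ υ₀ : ℝ) : ℝ := m₀ ^ (2 / 3 : ℝ) * υ₀ ^ (-(1 / 3) : ℝ)

theorem ell_pos (hm₀ : 0 < m₀) (hυ₀ : 0 < υ₀) : 0 < ell m₀ υ₀ := by unfold ell; positivity

/-- Kepler's third law at the resonance for zero mass ratio; the constants of the reduced
Hamiltonian are brought to their stated form through it. -/
theorem ell_pow_three (hm₀ : 0 < m₀) (hυ₀ : 0 < υ₀) : ell m₀ υ₀ ^ 3 = m₀ ^ 2 / υ₀ := by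
  rw [ell, mul_pow, ← Real.rpow_natCast, ← Real.rpow_natCast, ← Real.rpow_mul hm₀.le,
    ← Real.rpow_mul hυ₀.le]
  norm_num
  rw [Real.rpow_neg_one, div_eq_mul_inv]

theorem muC_zero (j : Fin 2) : muC m₀ m 0 j = m₀ := by simp [muC]

theorem mhatC_zero (hm₀ : 0 < m₀) (j : Fin 2) : mhatC m₀ m 0 j = m j := by
  have : (m₀ : ℂ) ≠ 0 := by exact_mod_cast hm₀.ne'
  simp only [mhatC, zero_mul, add_zero]
  field_simp

theorem lamResC_zero (hm₀ : 0 < m₀) (j : Fin 2) :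
    lamResC m₀ υ₀ m 0 j = ((m j * ell m₀ υ₀ : ℝ) : ℂ) := by
  rw [lamResC, mhatC_zero hm₀, muC_zero, ← ofReal_cpow hm₀.le, ell]
  push_cast; ring

theorem lamActC_zero (hm₀ : 0 < m₀) (j : Fin 2) :
    lamActC m₀ υ₀ m 0 0 j = ((m j * ell m₀ υ₀ : ℝ) : ℂ) := by
  fin_cases j <;> simp [lamActC, lamResC_zero hm₀]

/-- The circular configuration with vanishing masses and angles `ζ`. -/
def basePoint (ζ : Vec) : ℂ × Phase := (0, 0, ζ, 0, 0)

theorem posU_basePoint (hm₀ : 0 < m₀) (ζ : Vec) (j : Fin 2) :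
    posU m₀ υ₀ m (basePoint ζ) j = kepA (m j) m₀ ((m j * ell m₀ υ₀ : ℝ) : ℂ)
      * exp (I * meanLongitude ζ j) := by
  simp only [posU, basePoint, mhatC_zero hm₀, muC_zero, lamActC_zero hm₀, Pi.zero_apply, kepU_zero]

theorem posV_basePoint (hm₀ : 0 < m₀) (ζ : Vec) (j : Fin 2) :
    posV m₀ υ₀ m (basePoint ζ) j = kepA (m j) m₀ ((m j * ell m₀ υ₀ : ℝ) : ℂ)
      * exp (-(I * meanLongitude ζ j)) := by
  simp only [posV, basePoint, mhatC_zero hm₀, muC_zero, lamActC_zero hm₀, Pi.zero_apply, kepV_zero]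

theorem kepA_res (hm₀ : 0 < m₀) (hm : ∀ j, 0 < m j) (j : Fin 2) :
    kepA (m j) m₀ ((m j * ell m₀ υ₀ : ℝ) : ℂ) = ((ell m₀ υ₀ ^ 2 / m₀ : ℝ) : ℂ) := by
  have h1 : (m₀ : ℂ) ≠ 0 := by exact_mod_cast hm₀.ne'
  have h2 : (m j : ℂ) ≠ 0 := by exact_mod_cast (hm j).ne'
  rw [kepA]
  push_cast
  field_simp

theorem kepN_res (hm₀ : 0 < m₀) (hm : ∀ j, 0 < m j) (hυ₀ : 0 < υ₀) (j : Fin 2) :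
    kepN (m j) m₀ ((m j * ell m₀ υ₀ : ℝ) : ℂ) = υ₀ := by
  have h1 : (m₀ : ℂ) ≠ 0 := by exact_mod_cast hm₀.ne'
  have h2 : (m j : ℂ) ≠ 0 := by exact_mod_cast (hm j).ne'
  have h3 : (υ₀ : ℂ) ≠ 0 := by exact_mod_cast hυ₀.ne'
  have h4 : (ell m₀ υ₀ : ℂ) ^ 3 = (m₀ : ℂ) ^ 2 / υ₀ := by
    exact_mod_cast congrArg (fun x : ℝ => (x : ℂ)) (ell_pow_three hm₀ hυ₀)
  rw [kepN]
  push_cast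
  rw [mul_pow, h4]
  field_simp

theorem exp_sub_mul_exp_sub (ζ : Vec) :
    (exp (I * meanLongitude ζ 0) - exp (I * meanLongitude ζ 1))
      * (exp (-(I * meanLongitude ζ 0)) - exp (-(I * meanLongitude ζ 1))) = 2 - 2 * cos (ζ 0) := by
  have h0 : I * meanLongitude ζ 0 = I * ζ 0 + I * ζ 1 := by simp [meanLongitude]; ring
  have h1 : meanLongitude ζ 1 = ζ 1 := by simp [meanLongitude]
  have h2 : 2 * cos (ζ 0) = exp (I * ζ 0) + exp (-(I * ζ 0)) := by
    rw [cos]; ring_nf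
  rw [h0, h1, h2, neg_add, exp_add, exp_add]
  linear_combination (exp (I * ζ 0) * exp (-(I * ζ 0)) - exp (I * ζ 0) - exp (-(I * ζ 0)) + 1) *
    exp_mul_exp_neg (I * ζ 1) + exp_mul_exp_neg (I * ζ 0)

theorem distSq_basePoint (hm₀ : 0 < m₀) (hm : ∀ j, 0 < m j) (ζ : Vec) :
    distSq m₀ υ₀ m (basePoint ζ) = (((ell m₀ υ₀ ^ 2 / m₀) ^ 2 : ℝ) : ℂ) * (2 - 2 * cos (ζ 0)) := by
  rw [distSq, posU_basePoint hm₀, posU_basePoint hm₀, posV_basePoint hm₀, posV_basePoint hm₀,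
    kepA_res hm₀ hm, kepA_res hm₀ hm, ← exp_sub_mul_exp_sub]
  push_cast
  ring

theorem analyticAt_mhatC (hm₀ : 0 < m₀) (ζ : Vec) (j : Fin 2) :
    AnalyticAt ℂ (fun q : ℂ × Phase => mhatC m₀ m q.1 j) (basePoint ζ) :=
  AnalyticAt.fun_div analyticAt_const (analyticAt_const.add (analyticAt_fst.mul analyticAt_const))
    (by simpa [basePoint] using hm₀.ne')

theorem analyticAt_muC (ζ : Vec) (j : Fin 2) :
    AnalyticAt ℂ (fun q : ℂ × Phase => muC m₀ m q.1 j) (basePoint ζ) :=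
  analyticAt_const.add (analyticAt_fst.mul analyticAt_const)

theorem analyticAt_lamResC (hm₀ : 0 < m₀) (ζ : Vec) (j : Fin 2) :
    AnalyticAt ℂ (fun q : ℂ × Phase => lamResC m₀ υ₀ m q.1 j) (basePoint ζ) := by
  refine (analyticAt_mhatC hm₀ ζ j).mul (((analyticAt_muC ζ j).cpow analyticAt_const ?_).mul
    analyticAt_const)
  rw [show (basePoint ζ).1 = 0 from rfl, muC_zero]
  exact Or.inl (by simpa using hm₀)

theorem analyticAt_lamActC (hm₀ : 0 < m₀) (ζ : Vec) (j : Fin 2) :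
    AnalyticAt ℂ (fun q : ℂ × Phase => lamActC m₀ υ₀ m q.1 q.2.1 j) (basePoint ζ) := by
  have hZ : ∀ i : Fin 2, AnalyticAt ℂ (fun q : ℂ × Phase => q.2.1 i) (basePoint ζ) := fun i =>
    ((ContinuousLinearMap.proj (R := ℂ) (φ := fun _ : Fin 2 => ℂ) i).comp
      ((ContinuousLinearMap.fst ℂ Vec (Vec × Vec × Vec)).comp
        (ContinuousLinearMap.snd ℂ ℂ Phase))).analyticAt _
  fin_cases j
  · exact (analyticAt_lamResC hm₀ ζ 0).add (hZ 0)
  · exact ((analyticAt_lamResC hm₀ ζ 1).add (hZ 1)).sub (hZ 0)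

theorem analyticAt_meanLongitude (ζ : Vec) (j : Fin 2) :
    AnalyticAt ℂ (fun q : ℂ × Phase => meanLongitude q.2.2.1 j) (basePoint ζ) := by
  have hZ : ∀ i : Fin 2, AnalyticAt ℂ (fun q : ℂ × Phase => q.2.2.1 i) (basePoint ζ) := fun i =>
    ((ContinuousLinearMap.proj (R := ℂ) (φ := fun _ : Fin 2 => ℂ) i).comp
      (((ContinuousLinearMap.fst ℂ Vec (Vec × Vec)).comp
      (ContinuousLinearMap.snd ℂ Vec (Vec × Vec × Vec))).comp
        (ContinuousLinearMap.snd ℂ ℂ Phase))).analyticAt _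
  fin_cases j
  · exact (hZ 0).add (hZ 1)
  · exact hZ 1

theorem analyticAt_x (q : ℂ × Phase) (j : Fin 2) :
    AnalyticAt ℂ (fun q : ℂ × Phase => q.2.2.2.1 j) q :=
  ((ContinuousLinearMap.proj (R := ℂ) (φ := fun _ : Fin 2 => ℂ) j).comp
    ((ContinuousLinearMap.fst ℂ Vec Vec).comp ((ContinuousLinearMap.snd ℂ Vec (Vec × Vec)).comp
    ((ContinuousLinearMap.snd ℂ Vec (Vec × Vec × Vec)).comp
      (ContinuousLinearMap.snd ℂ ℂ Phase))))).analyticAt _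

theorem analyticAt_xt (q : ℂ × Phase) (j : Fin 2) :
    AnalyticAt ℂ (fun q : ℂ × Phase => q.2.2.2.2 j) q :=
  ((ContinuousLinearMap.proj (R := ℂ) (φ := fun _ : Fin 2 => ℂ) j).comp
    ((ContinuousLinearMap.snd ℂ Vec Vec).comp ((ContinuousLinearMap.snd ℂ Vec (Vec × Vec)).comp
    ((ContinuousLinearMap.snd ℂ Vec (Vec × Vec × Vec)).comp
      (ContinuousLinearMap.snd ℂ ℂ Phase))))).analyticAt _

theorem lamActC_mem_slitPlane (hm₀ : 0 < m₀) (hm : ∀ j, 0 < m j) (hυ₀ : 0 < υ₀) (j : Fin 2) :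
    lamActC m₀ υ₀ m 0 0 j ∈ slitPlane := by
  rw [lamActC_zero hm₀, ofReal_mem_slitPlane]
  exact mul_pos (hm j) (ell_pos hm₀ hυ₀)

theorem analyticAt_pos_mom (hm₀ : 0 < m₀) (hm : ∀ j, 0 < m j) (hυ₀ : 0 < υ₀) (ζ : Vec)
    (j : Fin 2) :
    AnalyticAt ℂ (fun q => posU m₀ υ₀ m q j) (basePoint ζ) ∧
    AnalyticAt ℂ (fun q => posV m₀ υ₀ m q j) (basePoint ζ) ∧
    AnalyticAt ℂ (fun q => momU m₀ υ₀ m q j) (basePoint ζ) ∧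
    AnalyticAt ℂ (fun q => momV m₀ υ₀ m q j) (basePoint ζ) := by
  have h1 : (basePoint ζ).1 = 0 := rfl
  have h2 : (basePoint ζ).2.1 = 0 := rfl
  have hl := analyticAt_lamActC (υ₀ := υ₀) (m := m) hm₀ ζ j
  have hs : lamActC m₀ υ₀ m (basePoint ζ).1 (basePoint ζ).2.1 j ∈ slitPlane :=
    lamActC_mem_slitPlane hm₀ hm hυ₀ j
  have hmh := analyticAt_mhatC (m := m) hm₀ ζ j
  have hmu := analyticAt_muC (m₀ := m₀) (m := m) ζ j
  have hm0 : (m₀ : ℂ) ≠ 0 := by exact_mod_cast hm₀.ne'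
  have hmj : (m j : ℂ) ≠ 0 := by exact_mod_cast (hm j).ne'
  obtain ⟨k1, k2, k3, k4⟩ := analyticAt_kep hl (analyticAt_meanLongitude ζ j) (analyticAt_x _ j)
    (analyticAt_xt _ j) hs rfl rfl
  have hA : AnalyticAt ℂ (fun q : ℂ × Phase => kepA (mhatC m₀ m q.1 j) (muC m₀ m q.1 j)
      (lamActC m₀ υ₀ m q.1 q.2.1 j)) (basePoint ζ) := by
    refine (hl.pow 2).fun_div ((hmh.pow 2).mul hmu) ?_
    change mhatC m₀ m (basePoint ζ).1 j ^ 2 * muC m₀ m (basePoint ζ).1 j ≠ 0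
    rw [h1, mhatC_zero hm₀, muC_zero]
    exact mul_ne_zero (pow_ne_zero _ hmj) hm0
  have hN : AnalyticAt ℂ (fun q : ℂ × Phase => kepN (mhatC m₀ m q.1 j) (muC m₀ m q.1 j)
      (lamActC m₀ υ₀ m q.1 q.2.1 j)) (basePoint ζ) :=
    ((hmu.pow 2).mul (hmh.pow 3)).fun_div (hl.pow 3) (pow_ne_zero _ (slitPlane_ne_zero hs))
  have hM : AnalyticAt ℂ (fun q => momFactor m₀ υ₀ m q j) (basePoint ζ) := hmh.mul (hA.mul hN)
  exact ⟨hA.mul k1, hA.mul k2, hM.mul k3, hM.mul k4⟩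

theorem distSq_mem_slitPlane (hm₀ : 0 < m₀) (hm : ∀ j, 0 < m j) (hυ₀ : 0 < υ₀) {ζ : Vec}
    (hζ : 2 - 2 * cos (ζ 0) ∈ slitPlane) : distSq m₀ υ₀ m (basePoint ζ) ∈ slitPlane := by
  rw [distSq_basePoint hm₀ hm]
  have h : 0 < (ell m₀ υ₀ ^ 2 / m₀) ^ 2 := by have := ell_pos hm₀ hυ₀; positivity
  rw [mem_slitPlane_iff] at hζ ⊢
  rw [re_ofReal_mul, im_ofReal_mul]
  exact hζ.imp (fun h' => mul_pos h h') fun h' => mul_ne_zero h.ne' h'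

theorem analyticAt_distSq (hm₀ : 0 < m₀) (hm : ∀ j, 0 < m j) (hυ₀ : 0 < υ₀) (ζ : Vec) :
    AnalyticAt ℂ (distSq m₀ υ₀ m) (basePoint ζ) := by
  have h := analyticAt_pos_mom hm₀ hm hυ₀ ζ
  exact ((h 0).1.sub (h 1).1).mul ((h 0).2.1.sub (h 1).2.1)

theorem analyticAt_pert (hm₀ : 0 < m₀) (hm : ∀ j, 0 < m j) (hυ₀ : 0 < υ₀) {ζ : Vec}
    (hζ : 2 - 2 * cos (ζ 0) ∈ slitPlane) : AnalyticAt ℂ (pert m₀ υ₀ m) (basePoint ζ) := by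
  have h := analyticAt_pos_mom hm₀ hm hυ₀ ζ
  have hm0 : (m₀ : ℂ) ≠ 0 := by exact_mod_cast hm₀.ne'
  have hd := distSq_mem_slitPlane hm₀ hm hυ₀ hζ
  refine AnalyticAt.sub ?_ (analyticAt_const.fun_div
    ((analyticAt_distSq hm₀ hm hυ₀ ζ).cpow analyticAt_const hd) ?_)
  · exact ((((h 0).2.2.1.mul (h 1).2.2.2).add ((h 0).2.2.2.mul (h 1).2.2.1)).fun_div
      analyticAt_const two_ne_zero).fun_div analyticAt_const hm0
  · exact (cpow_ne_zero_iff_of_exponent_ne_zero (by norm_num)).2 (slitPlane_ne_zero hd)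

theorem eventually_good (hm₀ : 0 < m₀) (hm : ∀ j, 0 < m j) (hυ₀ : 0 < υ₀) {ζ : Vec} {B : ℝ}
    (hζ : 2 - 2 * cos (ζ 0) ∈ slitPlane) (hB : ∀ j, |(meanLongitude ζ j).im| < B) :
    ∀ᶠ q in 𝓝 (basePoint ζ), Good m₀ υ₀ m B q := by
  have h1 : ∀ j, ∀ᶠ q in 𝓝 (basePoint ζ), KepGood B (lamActC m₀ υ₀ m q.1 q.2.1 j)
      (meanLongitude q.2.2.1 j) (q.2.2.2.1 j) (q.2.2.2.2 j) := fun j =>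
    eventually_kepGood (analyticAt_lamActC hm₀ ζ j) (analyticAt_meanLongitude ζ j)
      (analyticAt_x _ j) (analyticAt_xt _ j) (lamActC_mem_slitPlane hm₀ hm hυ₀ j) rfl rfl (hB j)
  have h2 := (analyticAt_distSq hm₀ hm hυ₀ ζ).continuousAt.eventually_mem
    (isOpen_slitPlane.mem_nhds (distSq_mem_slitPlane hm₀ hm hυ₀ hζ))
  filter_upwards [eventually_all.2 h1, h2] with q k1 k2
  exact ⟨k1, k2⟩

/-- The neighbourhood of width `r` in the mass ratio, the actions and the eccentricities, and of
width `σ` in the angles. -/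
def tube (Δ σ r : ℝ) : Set (ℂ × Phase) :=
  {q | ‖q.1‖ ≤ r ∧ ‖q.2.1‖ ≤ r ∧ (∃ θ ∈ collisionless Δ, ‖q.2.2.1 - fun j => (θ j : ℂ)‖ ≤ σ) ∧
    ‖q.2.2.2‖ ≤ r}

/-- The fast angle makes the tube unbounded, but a rotation brings its real part θ 1 to zero. What
remains lies near a compact set of circular configurations at zero mass ratio, where analyticity and
convergence of the expansions are open conditions. Rotation invariance then carries analyticity and
the bound back to the whole tube. -/
theorem exists_tube (hm₀ : 0 < m₀) (hm : ∀ j, 0 < m j) (hυ₀ : 0 < υ₀) {Δ σ : ℝ} (hσ : σ < Δ) :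
    ∃ r > 0, ∃ M > 0, ∀ q ∈ tube Δ σ r, AnalyticAt ℂ (pert m₀ υ₀ m) q ∧
      ‖pert m₀ υ₀ m q‖ ≤ M ∧ Good m₀ υ₀ m (2 * σ + 1) q := by
  let φ : ℝ × Vec → ℂ × Phase := fun w => basePoint (![(w.1 : ℂ), 0] + w.2)
  let S : Set (ℂ × Phase) := φ '' (Icc Δ (2 * Real.pi - Δ) ×ˢ closedBall 0 σ)
  have hφ : Continuous φ := by
    have : Continuous fun w : ℝ × Vec => (![(w.1 : ℂ), 0] + w.2 : Vec) := by
      refine Continuous.add (continuous_pi fun j => ?_) continuous_snd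
      fin_cases j
      · exact Complex.continuous_ofReal.comp continuous_fst
      · exact continuous_const
    exact continuous_const.prodMk (continuous_const.prodMk (this.prodMk continuous_const))
  have hS : IsCompact S := (isCompact_Icc.prod (isCompact_closedBall _ _)).image hφ
  set P : Set (ℂ × Phase) :=
    {q | AnalyticAt ℂ (pert m₀ υ₀ m) q ∧ Good m₀ υ₀ m (2 * σ + 1) q} with hP
  have hSP : S ⊆ interior P := by
    rintro _ ⟨⟨t, w⟩, ⟨ht, hw⟩, rfl⟩
    rw [mem_closedBall, dist_zero_right] at hw
    have hnear : ‖(![(t : ℂ), 0] + w : Vec) - fun j => ((![t, 0] : Fin 2 → ℝ) j : ℂ)‖ ≤ σ := by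
      have : (![(t : ℂ), 0] + w : Vec) - (fun j => ((![t, 0] : Fin 2 → ℝ) j : ℂ)) = w := by
        ext j
        fin_cases j <;> simp [Matrix.vecHead, Matrix.vecTail]
      rwa [this]
    have hslit := mem_slitPlane_two_sub_cos hσ (θ := ![t, 0]) (by simpa [collisionless] using ht)
      hnear
    -- The mean longitude of the first planet is a sum of two angles, so its imaginary part reaches
    -- 2σ; the extra 1 makes the inequality strict.
    have hwj : ∀ j, |(w j).im| ≤ σ := fun j =>
      (abs_im_le_norm _).trans ((norm_le_pi_norm w j).trans hw)
    rw [mem_interior_iff_mem_nhds]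
    refine inter_mem (analyticAt_pert hm₀ hm hυ₀ hslit).eventually_analyticAt
      (eventually_good hm₀ hm hυ₀ hslit fun j => ?_)
    have h0 := abs_le.1 (hwj 0)
    have h1 := abs_le.1 (hwj 1)
    rw [abs_lt]
    fin_cases j
    · simp [meanLongitude]; constructor <;> linarith
    · simp [meanLongitude]; constructor <;> linarith
  obtain ⟨r, hr, hrP⟩ := hS.exists_cthickening_subset_open isOpen_interior hSP
  have hcP : cthickening r S ⊆ P := hrP.trans interior_subset
  obtain ⟨M, hM⟩ := hS.cthickening.exists_bound_of_continuousOn (f := pert m₀ υ₀ m)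
    fun q hq => (hcP hq).1.continuousAt.continuousWithinAt
  refine ⟨r, hr, max M 1, by positivity, ?_⟩
  rintro q ⟨h1, h2, ⟨θ, hθ, h3⟩, h4⟩
  set q' : ℂ × Phase := (q.1, rot (-θ 1) q.2) with hq'
  have hq'S : q' ∈ cthickening r S := by
    set w : Vec := q.2.2.1 - fun j => (θ j : ℂ) with hw
    refine mem_cthickening_of_dist_le q' (φ (θ 0, w)) r S
      ⟨(θ 0, w), ⟨hθ, by simpa using h3⟩, rfl⟩ ?_
    have h5 : (rot (-θ 1) q.2).2.1 = ![(θ 0 : ℂ), 0] + w := by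
      rw [rot_apply, hw]
      ext j
      fin_cases j <;> simp
      ring
    rw [dist_eq_norm]
    simp only [q', φ, basePoint, Prod.norm_def, Prod.fst_sub, Prod.snd_sub, h5, sub_self, norm_zero,
      sub_zero]
    rw [rot_apply]
    simp only [norm_smul, norm_exp_I_mul_ofReal, norm_exp_neg_I_mul_ofReal, one_mul, sup_le_iff]
    rw [Prod.norm_def, sup_le_iff] at h4
    exact ⟨h1, h2, hr.le, h4.1, h4.2⟩
  have hback : (q'.1, rot (θ 1) q'.2) = q := by
    rw [hq', rot_rot_neg]
  obtain ⟨k1, k2⟩ := hcP hq'S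
  have hgood := k2.rot (θ 1)
  rw [hback] at hgood
  refine ⟨?_, ?_, hgood.1⟩
  · have hρ : AnalyticAt ℂ (fun y : ℂ × Phase => (y.1, rot (-θ 1) y.2)) q :=
      analyticAt_fst.prod ((analyticAt_rot (-θ 1) q.2).fun_comp analyticAt_snd)
    refine (AnalyticAt.comp (f := fun y : ℂ × Phase => (y.1, rot (-θ 1) y.2)) (x := q) k1 hρ).congr ?_
    filter_upwards [hρ.continuousAt.eventually_mem (isOpen_interior.mem_nhds (hrP hq'S))] with y hy
    have := ((interior_subset hy).2.rot (θ 1)).2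
    rw [rot_rot_neg] at this
    exact this.symm
  · rw [hgood.2]
    exact (hM _ hq'S).trans (le_max_left _ _)

end Region

/-! ### Scaling of actions and eccentricities. -/

section Scaling

/-- The scaling of the actions by `τ` and of the eccentricities by `√τ`. -/
noncomputable def scale (τ : ℝ) : Phase →L[ℂ] Phase :=
  ((τ : ℂ) • ContinuousLinearMap.fst ℂ Vec (Vec × Vec × Vec)).prod
    (((ContinuousLinearMap.fst ℂ Vec (Vec × Vec)).comp (.snd ℂ Vec (Vec × Vec × Vec))).prod
      (((√τ : ℝ) : ℂ) • ((ContinuousLinearMap.snd ℂ Vec (Vec × Vec)).comp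
        (.snd ℂ Vec (Vec × Vec × Vec)))))

variable {τ : ℝ}

theorem scale_apply (p : Phase) :
    scale τ p = ((τ : ℂ) • p.1, p.2.1, ((√τ : ℝ) : ℂ) • p.2.2) := rfl

theorem scale_inv_scale (hτ : 0 < τ) (p : Phase) : scale τ⁻¹ (scale τ p) = p := by
  have h1 : (τ : ℂ) ≠ 0 := by exact_mod_cast hτ.ne'
  have h2 : ((√τ : ℝ) : ℂ) ≠ 0 := by exact_mod_cast (Real.sqrt_pos.2 hτ).ne'
  rw [scale_apply, scale_apply, Real.sqrt_inv]
  simp only [smul_smul, ofReal_inv, inv_mul_cancel₀ h1, inv_mul_cancel₀ h2, one_smul]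

theorem scale_scale_inv (hτ : 0 < τ) (p : Phase) : scale τ (scale τ⁻¹ p) = p := by
  have := scale_inv_scale (inv_pos.2 hτ) p
  rwa [inv_inv] at this

theorem sympl_scale (hτ : 0 ≤ τ) (u v : Phase) :
    sympl (scale τ u) (scale τ v) = τ * sympl u v := by
  have h : ((√τ : ℝ) : ℂ) * ((√τ : ℝ) : ℂ) = τ := by exact_mod_cast Real.mul_self_sqrt hτ
  simp only [sympl, scale_apply, smul_dotProduct, dotProduct_smul, smul_eq_mul, Prod.smul_fst,
    Prod.smul_snd]
  linear_combination (u.2.2.1 ⬝ᵥ v.2.2.2 - v.2.2.1 ⬝ᵥ u.2.2.2) * h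

/-- The three widths are q σ ε^β, q σ and q σ ε^(β/2). With actions in units of ε^β and
eccentricities in units of its square root, all become q σ, and the domain is a ball-like zone for
the sup norm. -/
theorem mem_domainAt_iff {Δ σ β ε q : ℝ} (hε : 0 < ε) (hσ : 0 < σ) (hq : 0 ≤ q) {p : Phase} :
    p ∈ domainAt Δ σ β ε q ↔ scale (ε ^ β)⁻¹ p ∈ zone Δ (q * σ) := by
  have hτ : 0 < ε ^ β := Real.rpow_pos_of_pos hε β
  have h1 : √(q * (σ * ε ^ β) * (q * σ)) = √(ε ^ β) * (q * σ) := by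
    rw [show q * (σ * ε ^ β) * (q * σ) = ε ^ β * (q * σ) ^ 2 by ring,
      Real.sqrt_mul hτ.le, Real.sqrt_sq (by positivity)]
  rw [mem_zone_iff, domainAt, domain, mem_ofPred_eq, h1, scale_apply]
  simp only [norm_smul, ofReal_inv, norm_inv, Complex.norm_real, Real.sqrt_inv,
    Real.norm_of_nonneg hτ.le, Real.norm_of_nonneg (Real.sqrt_nonneg (ε ^ β))]
  rw [inv_mul_le_iff₀ hτ, inv_mul_le_iff₀ (Real.sqrt_pos.2 hτ),
    show ε ^ β * (q * σ) = q * (σ * ε ^ β) by ring]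

theorem scale_mem_domainAt {Δ σ β ε q : ℝ} (hε : 0 < ε) (hσ : 0 < σ) (hq : 0 ≤ q) {p : Phase}
    (hp : p ∈ zone Δ (q * σ)) : scale (ε ^ β) p ∈ domainAt Δ σ β ε q := by
  rw [mem_domainAt_iff hε hσ hq, scale_inv_scale (Real.rpow_pos_of_pos hε β)]
  exact hp

theorem scale_mem_tube {Δ σ s r : ℝ} (hτ : 0 ≤ τ) (hs : s ≤ σ) (h1 : τ * s ≤ r)
    (h2 : √τ * s ≤ r) {e : ℂ} (he : ‖e‖ ≤ r) {p : Phase} (hp : p ∈ zone Δ s) :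
    (e, scale τ p) ∈ tube Δ σ r := by
  obtain ⟨k1, ⟨θ, hθ, k2⟩, k3⟩ := mem_zone_iff.1 hp
  refine ⟨he, ?_, ⟨θ, hθ, k2.trans hs⟩, ?_⟩
  · change ‖(τ : ℂ) • p.1‖ ≤ r
    rw [norm_smul, Complex.norm_real, Real.norm_of_nonneg hτ]
    exact (mul_le_mul_of_nonneg_left k1 hτ).trans h1
  · change ‖((√τ : ℝ) : ℂ) • p.2.2‖ ≤ r
    rw [norm_smul, Complex.norm_real, Real.norm_of_nonneg (Real.sqrt_nonneg τ)]
    exact (mul_le_mul_of_nonneg_left k3 (Real.sqrt_nonneg τ)).trans h2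

theorem scale_add_fast (p : Phase) (t : ℂ) : scale τ (p + t • eFast) = scale τ p + t • eFast := by
  have : scale τ eFast = eFast := by
    rw [scale_apply]; simp [eFast]
  rw [map_add, map_smul, this]

theorem scale_rot (θ : ℝ) (p : Phase) : scale τ (rot θ p) = rot θ (scale τ p) := by
  rw [rot, rot, scale_add_fast, rotLin_apply, rotLin_apply, scale_apply, scale_apply]
  simp only [Prod.smul_mk, Prod.smul_fst, Prod.smul_snd]
  rw [smul_comm (exp (I * θ)), smul_comm (exp (-(I * θ)))]

theorem conjVec_smul_ofReal (c : ℝ) (v : Vec) : conjVec ((c : ℂ) • v) = (c : ℂ) • conjVec v := by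
  ext j
  simp [conjVec_apply]

theorem scale_conjPhase (p : Phase) : scale τ (conjPhase p) = conjPhase (scale τ p) := by
  rw [conjPhase_apply, conjPhase_apply, scale_apply, scale_apply]
  simp only [Prod.smul_mk, Prod.smul_fst, Prod.smul_snd, conjVec_smul_ofReal]
  rw [smul_comm (-I), smul_comm (-I)]

end Scaling

/-! ### Comparison of the two forms of the fast average. -/

section Flat

/-- The point with the same coordinates but vanishing fast angle. -/
def flat (p : Phase) : Phase := (p.1, ![p.2.1 0, 0], p.2.2)

/-- `avg` overwrites the fast angle, whereas `fastAvg` integrates along the line through the point.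
They agree where the fast angle is zero; elsewhere `FastInv.flat` makes the link. -/
theorem avg_eq (f : Phase → ℂ) (p : Phase) : avg f p = fastAvg f (flat p) := by
  rw [avg, fastAvg]
  congr 1
  refine intervalIntegral.integral_congr fun t _ => ?_
  congr 1
  ext j
  · simp [flat, eFast]
  · fin_cases j <;> simp [flat, eFast]
  · simp [flat, eFast]
  · simp [flat, eFast]

theorem flat_scale (τ : ℝ) (p : Phase) : flat (scale τ p) = scale τ (flat p) := rfl

theorem avg_scale (f : Phase → ℂ) (τ : ℝ) (p : Phase) :
    avg f (scale τ p) = fastAvg (fun q => f (scale τ q)) (flat p) := by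
  rw [avg_eq, flat_scale, fastAvg, fastAvg]
  simp only [scale_add_fast]

variable {Δ r : ℝ}

theorem flat_eq (p : Phase) : flat p = p - p.2.1 1 • eFast := by
  ext j
  · simp [flat, eFast]
  · fin_cases j <;> simp [flat, eFast, Matrix.vecHead, Matrix.vecTail]
  · simp [flat, eFast]
  · simp [flat, eFast]

theorem flat_mem_zone {p : Phase} (hp : p ∈ zone Δ r) : flat p ∈ zone Δ r := by
  obtain ⟨h1, ⟨θ, hθ, h2⟩, h3⟩ := mem_zone_iff.1 hp
  have hr : 0 ≤ r := (norm_nonneg _).trans h1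
  refine mem_zone_iff.2 ⟨h1, ⟨![θ 0, 0], hθ, ?_⟩, h3⟩
  rw [pi_norm_le_iff_of_nonneg hr] at h2 ⊢
  intro j
  fin_cases j
  · simpa [flat] using h2 0
  · simpa [flat] using hr

/-- Only real translations are assumed harmless. They make the derivative along the fast direction
vanish, hence also its multiple by i, and the imaginary part of the fast angle is removed along a
segment that stays in the convex zone. -/
theorem FastInv.flat {f : Phase → ℂ} (hf : AnalyticOnNhd ℂ f (zone Δ r))
    (h : FastInv f (zone Δ r)) {p : Phase} (hp : p ∈ zone Δ r) : f (flat p) = f p := by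
  set p' := p + ((-(p.2.1 1).re : ℝ) : ℂ) • eFast with hp'
  have hp'z : p' ∈ zone Δ r := add_fast_mem_zone hp _
  rw [← h p hp (-(p.2.1 1).re), ← hp']
  have hfl : Coorbital.flat p = p' + (-((p.2.1 1).im * I)) • eFast := by
    rw [flat_eq, hp', add_assoc, ← add_smul, sub_eq_add_neg, ← neg_smul]
    congr 2
    conv_lhs => rw [← re_add_im (p.2.1 1)]
    push_cast; ring
  have hconv := convex_zone.segment_subset hp'z (hfl ▸ flat_mem_zone hp)
  set v : Phase := (-((p.2.1 1).im * I)) • eFast with hv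
  have hder : ∀ s ∈ Icc (0 : ℝ) 1, HasDerivWithinAt (fun s : ℝ => f (p' + s • v)) 0 (Icc 0 1) s := by
    intro s hs
    have hz : p' + s • v ∈ zone Δ r := by
      refine hconv ?_
      rw [segment_eq_image']
      exact ⟨s, hs, by simp⟩
    have hl : HasDerivAt (fun s : ℝ => p' + s • v) v s := by
      simpa using ((hasDerivAt_id s).smul_const v).const_add p'
    have h1 := ((hf _ hz).differentiableAt.hasFDerivAt.restrictScalars ℝ).comp_hasDerivAt s hl
    have h2 : fderiv ℂ f (p' + s • v) v = 0 := by
      rw [hv, map_smul, ← hv, h.fderiv_eFast hf hz, smul_zero]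
    refine (h1.congr_deriv ?_).hasDerivWithinAt
    exact h2
  have := (convex_Icc (0 : ℝ) 1).norm_image_sub_le_of_norm_hasDerivWithin_le (C := 0) hder
    (fun _ _ => by simp) (left_mem_Icc.2 zero_le_one) (right_mem_Icc.2 zero_le_one)
  rw [zero_mul, norm_le_zero_iff, sub_eq_zero] at this
  simpa [hfl] using this

end Flat

/-! ### The Keplerian Hamiltonian near the exact resonance. -/

section Kepler

variable {m₀ υ₀ : ℝ} {m : Fin 2 → ℝ} {ε : ℝ}

theorem mhat_pos (hm₀ : 0 < m₀) (hm : ∀ j, 0 < m j) (hε : 0 ≤ ε) (j : Fin 2) :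
    0 < mhat m₀ m ε j := div_pos (mul_pos hm₀ (hm j)) (mu_pos hm₀ hm hε j)

theorem LamRes_pos (hm₀ : 0 < m₀) (hm : ∀ j, 0 < m j) (hυ₀ : 0 < υ₀) (hε : 0 ≤ ε) (j : Fin 2) :
    0 < LamRes m₀ m υ₀ ε j := by
  have h1 := mu_pos hm₀ hm hε j
  have h2 := mhat_pos hm₀ hm hε j
  rw [LamRes_eq hm₀ hm hυ₀ hε]
  positivity

/-- The resonant actions are tuned so that both mean motions equal υ₀ for every ε. The linear terms
of the Keplerian part therefore combine to υ₀ Z₂ alone. -/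
theorem mhat_pow_mul_mu_pow (hm₀ : 0 < m₀) (hm : ∀ j, 0 < m j) (hυ₀ : 0 < υ₀) (hε : 0 ≤ ε)
    (j : Fin 2) : mhat m₀ m ε j ^ 3 * mu m₀ m ε j ^ 2 = υ₀ * LamRes m₀ m υ₀ ε j ^ 3 := by
  have h := ell_pow_three (mu_pos hm₀ hm hε j) hυ₀
  rw [ell] at h
  rw [LamRes_eq hm₀ hm hυ₀ hε, mul_pow, h]
  field_simp

theorem norm_inv_sq_expansion_le {w : ℂ} (hw : ‖w‖ ≤ 1 / 2) :
    ‖1 / (1 + w) ^ 2 - (1 - 2 * w + 3 * w ^ 2)‖ ≤ 22 * ‖w‖ ^ 3 := by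
  have h1 : 1 / 2 ≤ ‖1 + w‖ := by
    have := norm_sub_le_norm_add (1 : ℂ) w
    rw [norm_one] at this
    linarith
  have h0 : 1 + w ≠ 0 := by
    rw [← norm_pos_iff]; linarith
  have h2 : 1 / (1 + w) ^ 2 - (1 - 2 * w + 3 * w ^ 2) = -(w ^ 3 * (4 + 3 * w)) / (1 + w) ^ 2 := by
    field_simp
    ring
  rw [h2, norm_div, norm_neg, norm_mul, norm_pow, norm_pow, div_le_iff₀ (by positivity)]
  -- The constant 22 is (11/2) / (1/4), from the bounds on the numerator and on the denominator.
  have h3 : ‖4 + 3 * w‖ ≤ 11 / 2 := by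
    calc ‖4 + 3 * w‖ ≤ ‖(4 : ℂ)‖ + ‖3 * w‖ := norm_add_le _ _
      _ = 4 + 3 * ‖w‖ := by rw [norm_mul]; norm_num
      _ ≤ _ := by linarith
  have h4 : 1 / 4 ≤ ‖1 + w‖ ^ 2 := by nlinarith
  have h5 : 0 ≤ ‖w‖ ^ 3 := by positivity
  nlinarith [mul_le_mul_of_nonneg_left h3 h5, mul_le_mul_of_nonneg_left h4 h5]

/-- One term of the Keplerian Hamiltonian. -/
theorem norm_kepler_expansion_le {L : ℝ} (hL : 0 < L) {z : ℂ} (hz : ‖z‖ ≤ L / 2) :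
    ‖(L : ℂ) ^ 3 / (2 * (L + z) ^ 2) - (L / 2 - z + 3 / 2 * z ^ 2 / L)‖ ≤ 11 * ‖z‖ ^ 3 / L ^ 2 := by
  have hL0 : (L : ℂ) ≠ 0 := by exact_mod_cast hL.ne'
  have hw : ‖z / L‖ ≤ 1 / 2 := by
    rw [norm_div, Complex.norm_real, Real.norm_of_nonneg hL.le, div_le_iff₀ hL]; linarith
  have h1 := norm_inv_sq_expansion_le hw
  have h2 : (L : ℂ) ^ 3 / (2 * (L + z) ^ 2) - (L / 2 - z + 3 / 2 * z ^ 2 / L)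
      = L / 2 * (1 / (1 + z / L) ^ 2 - (1 - 2 * (z / L) + 3 * (z / L) ^ 2)) := by
    have : 1 + z / L = (L + z) / L := by field_simp
    rw [this]
    have e1 : (L : ℂ) ^ 3 / (2 * (L + z) ^ 2) = L / 2 * (1 / ((L + z) / L) ^ 2) := by
      rw [div_pow]
      by_cases h : (L : ℂ) + z = 0
      · simp [h]
      · field_simp
    rw [e1]
    field_simp
  rw [h2, norm_mul, norm_div, Complex.norm_real, Real.norm_of_nonneg hL.le, Complex.norm_ofNat]
  calc L / 2 * _ ≤ L / 2 * (22 * ‖z / L‖ ^ 3) := by gcongr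
    _ = 11 * ‖z‖ ^ 3 / L ^ 2 := by
      rw [norm_div, Complex.norm_real, Real.norm_of_nonneg hL.le]; field_simp; ring

theorem HK_eq (hm₀ : 0 < m₀) (hm : ∀ j, 0 < m j) (hυ₀ : 0 < υ₀) (hε : 0 ≤ ε) (Z : Vec) :
    HK m₀ m υ₀ ε Z = -(υ₀ * ((LamRes m₀ m υ₀ ε 0 : ℂ) ^ 3 / (2 * (LamRes m₀ m υ₀ ε 0 + Z 0) ^ 2)
      + (LamRes m₀ m υ₀ ε 1 : ℂ) ^ 3 / (2 * (LamRes m₀ m υ₀ ε 1 + (Z 1 - Z 0)) ^ 2))) := by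
  have h : ∀ j, (mhat m₀ m ε j : ℂ) ^ 3 * (mu m₀ m ε j : ℂ) ^ 2
      = υ₀ * (LamRes m₀ m υ₀ ε j : ℂ) ^ 3 := fun j => by
    exact_mod_cast congrArg (fun x : ℝ => (x : ℂ)) (mhat_pow_mul_mu_pow hm₀ hm hυ₀ hε j)
  rw [HK, Fin.sum_univ_two, h, h]
  simp only [lamAction, Matrix.cons_val_zero, Matrix.cons_val_one]
  rw [add_sub_assoc]
  ring

theorem HK_conj (Z : Vec) : HK m₀ m υ₀ ε (conjVec Z) = starRingEnd ℂ (HK m₀ m υ₀ ε Z) := by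
  rw [HK, HK, Fin.sum_univ_two, Fin.sum_univ_two]
  simp only [lamAction, Matrix.cons_val_zero, Matrix.cons_val_one, map_neg, map_add, map_div₀,
    map_mul, map_pow, conj_ofReal, conjVec_apply, map_sub, conj_two]

/-- Analyticity in a complex mass ratio at 0 gives a first order estimate. It allows the ε-dependent
actions to be replaced by their limits in the quadratic part, at the cost of an error O(ε ‖Z‖²). -/
theorem eventually_LamRes (hm₀ : 0 < m₀) (hm : ∀ j, 0 < m j) (hυ₀ : 0 < υ₀) :
    ∃ r > 0, ∃ C > 0, ∀ ε : ℝ, 0 ≤ ε → ε ≤ r → ∀ j, m j * ell m₀ υ₀ / 2 ≤ LamRes m₀ m υ₀ ε j ∧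
      |1 / LamRes m₀ m υ₀ ε j - 1 / (m j * ell m₀ υ₀)| ≤ C * ε := by
  have hl := ell_pos hm₀ hυ₀
  have key : ∀ j, ∃ C > 0, ∀ᶠ e : ℂ in 𝓝 0, m j * ell m₀ υ₀ / 2 < ‖lamResC m₀ υ₀ m e j‖ ∧
      ‖1 / lamResC m₀ υ₀ m e j - 1 / lamResC m₀ υ₀ m 0 j‖ ≤ C * ‖e‖ := by
    intro j
    have hj := mul_pos (hm j) hl
    have ha : AnalyticAt ℂ (fun e : ℂ => lamResC m₀ υ₀ m e j) 0 :=
      (analyticAt_lamResC hm₀ 0 j).fun_comp_of_eq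
        (f := fun e : ℂ => ((e, 0) : ℂ × Phase)) (analyticAt_id.prod analyticAt_const) rfl
    have h0 : lamResC m₀ υ₀ m 0 j ≠ 0 := by
      rw [lamResC_zero hm₀]; exact_mod_cast hj.ne'
    have hi : AnalyticAt ℂ (fun e : ℂ => 1 / lamResC m₀ υ₀ m e j) 0 :=
      analyticAt_const.fun_div ha h0
    have hO := hi.differentiableAt.hasFDerivAt.isBigO_sub
    obtain ⟨C, hC0, hC⟩ := hO.exists_pos
    refine ⟨C, hC0, ?_⟩
    have h1 := ha.continuousAt.norm.eventually_const_lt (u := m j * ell m₀ υ₀ / 2) (by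
      beta_reduce
      rw [lamResC_zero hm₀, Complex.norm_real, Real.norm_of_nonneg hj.le]; linarith)
    filter_upwards [h1, hC.bound] with e k1 k2
    refine ⟨k1, ?_⟩
    simpa using k2
  obtain ⟨C0, hC0, h0⟩ := key 0
  obtain ⟨C1, hC1, h1⟩ := key 1
  obtain ⟨r, hr, hb⟩ := Metric.eventually_nhds_iff_ball.1 (h0.and h1)
  refine ⟨r / 2, by positivity, max C0 C1, by positivity, fun ε hε hεr j => ?_⟩
  have hmem : (ε : ℂ) ∈ ball (0 : ℂ) r := by
    rw [mem_ball_zero_iff, Complex.norm_real, Real.norm_of_nonneg hε]; linarith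
  have hpos := LamRes_pos hm₀ hm hυ₀ hε j
  have hfin : ∃ C ≤ max C0 C1, m j * ell m₀ υ₀ / 2 < ‖lamResC m₀ υ₀ m ε j‖ ∧
      ‖1 / lamResC m₀ υ₀ m ε j - 1 / lamResC m₀ υ₀ m 0 j‖ ≤ C * ‖(ε : ℂ)‖ := by
    fin_cases j
    · exact ⟨C0, le_max_left _ _, (hb _ hmem).1⟩
    · exact ⟨C1, le_max_right _ _, (hb _ hmem).2⟩
  obtain ⟨C, hC, h2, h3⟩ := hfin
  rw [lamResC_ofReal hm₀ hm hυ₀ hε] at h2 h3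
  rw [lamResC_zero hm₀] at h3
  rw [Complex.norm_real, Real.norm_of_nonneg hpos.le] at h2
  rw [Complex.norm_real, Real.norm_of_nonneg hε] at h3
  refine ⟨h2.le, ?_⟩
  have h4 : (1 : ℂ) / (LamRes m₀ m υ₀ ε j : ℂ) - 1 / ((m j * ell m₀ υ₀ : ℝ) : ℂ)
      = ((1 / LamRes m₀ m υ₀ ε j - 1 / (m j * ell m₀ υ₀) : ℝ) : ℂ) := by push_cast; ring
  rw [h4, Complex.norm_real, Real.norm_eq_abs] at h3
  exact h3.trans (by gcongr)

/-- The expansion of the Keplerian Hamiltonian at the exact resonance. -/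
theorem exists_HK_expansion (hm₀ : 0 < m₀) (hm : ∀ j, 0 < m j) (hυ₀ : 0 < υ₀) :
    ∃ r > 0, ∃ C > 0, ∀ ε : ℝ, 0 ≤ ε → ε ≤ r → ∀ Z : Vec, ‖Z‖ ≤ r →
      AnalyticAt ℂ (HK m₀ m υ₀ ε) Z ∧
      ‖HK m₀ m υ₀ ε Z - HK m₀ m υ₀ ε 0 - υ₀ * Z 1 + 3 / 2 * υ₀ * (Z 0 ^ 2 / (m 0 * ell m₀ υ₀)
        + (Z 1 - Z 0) ^ 2 / (m 1 * ell m₀ υ₀))‖ ≤ C * (‖Z‖ ^ 3 + ε * ‖Z‖ ^ 2) := by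
  obtain ⟨r, hr, C, hC, H⟩ := eventually_LamRes hm₀ hm hυ₀
  have hl := ell_pos hm₀ hυ₀
  have hl0 := mul_pos (hm 0) hl
  have hl1 := mul_pos (hm 1) hl
  set a := min (m 0 * ell m₀ υ₀ / 2) (m 1 * ell m₀ υ₀ / 2) with ha
  have ha0 : 0 < a := by rw [ha]; positivity
  -- The second planet sees `Z 1 - Z 0`, of norm up to 2‖Z‖ ≤ 2a/5, which must stay below half of
  -- its resonant action.
  refine ⟨min r (a / 5), by positivity, υ₀ * (99 / a ^ 2 + 10 * C), by positivity, ?_⟩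
  intro ε hε hεr Z hZ
  set L0 := LamRes m₀ m υ₀ ε 0 with hL0
  set L1 := LamRes m₀ m υ₀ ε 1 with hL1
  obtain ⟨h01, h02⟩ := H ε hε (hεr.trans (min_le_left _ _)) 0
  obtain ⟨h11, h12⟩ := H ε hε (hεr.trans (min_le_left _ _)) 1
  rw [← hL0] at h01 h02
  rw [← hL1] at h11 h12
  have haL0 : a ≤ L0 := (min_le_left _ _).trans h01
  have haL1 : a ≤ L1 := (min_le_right _ _).trans h11
  have hZa : ‖Z‖ ≤ a / 5 := hZ.trans (min_le_right _ _)
  have hZ0 : ‖Z 0‖ ≤ ‖Z‖ := norm_le_pi_norm Z 0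
  have hZ1 : ‖Z 1 - Z 0‖ ≤ 2 * ‖Z‖ :=
    (norm_sub_le _ _).trans (by linarith [norm_le_pi_norm Z 1])
  have hL0p : 0 < L0 := ha0.trans_le haL0
  have hL1p : 0 < L1 := ha0.trans_le haL1
  have hne : ∀ (L : ℝ) (z : ℂ), 0 < L → ‖z‖ < L → (L : ℂ) + z ≠ 0 := by
    intro L z hL hz h
    have : z = -(L : ℂ) := by linear_combination h
    rw [this, norm_neg, Complex.norm_real, Real.norm_of_nonneg hL.le] at hz
    exact lt_irrefl _ hz
  have hne0 := hne L0 (Z 0) hL0p (by linarith)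
  have hne1 := hne L1 (Z 1 - Z 0) hL1p (by linarith)
  constructor
  · have hfun : HK m₀ m υ₀ ε = fun Z : Vec => -(υ₀ * ((L0 : ℂ) ^ 3 / (2 * (L0 + Z 0) ^ 2)
      + (L1 : ℂ) ^ 3 / (2 * (L1 + (Z 1 - Z 0)) ^ 2))) := funext fun Z => HK_eq hm₀ hm hυ₀ hε Z
    have hp : ∀ i : Fin 2, AnalyticAt ℂ (fun Z : Vec => Z i) Z := fun i =>
      (ContinuousLinearMap.proj (R := ℂ) (φ := fun _ : Fin 2 => ℂ) i).analyticAt _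
    rw [hfun]
    refine (analyticAt_const.mul (AnalyticAt.add ?_ ?_)).neg
    · exact analyticAt_const.fun_div (analyticAt_const.mul ((analyticAt_const.add (hp 0)).pow 2))
        (mul_ne_zero two_ne_zero (pow_ne_zero _ hne0))
    · exact analyticAt_const.fun_div
        (analyticAt_const.mul ((analyticAt_const.add ((hp 1).sub (hp 0))).pow 2))
        (mul_ne_zero two_ne_zero (pow_ne_zero _ hne1))
  · have e0 := norm_kepler_expansion_le hL0p (z := Z 0) (by linarith)
    have e1 := norm_kepler_expansion_le hL1p (z := Z 1 - Z 0) (by linarith)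
    set R0 := (L0 : ℂ) ^ 3 / (2 * (L0 + Z 0) ^ 2) - (L0 / 2 - Z 0 + 3 / 2 * Z 0 ^ 2 / L0) with hR0
    set R1 := (L1 : ℂ) ^ 3 / (2 * (L1 + (Z 1 - Z 0)) ^ 2)
      - (L1 / 2 - (Z 1 - Z 0) + 3 / 2 * (Z 1 - Z 0) ^ 2 / L1) with hR1
    have hc0 : (L0 : ℂ) ≠ 0 := by exact_mod_cast hL0p.ne'
    have hc1 : (L1 : ℂ) ≠ 0 := by exact_mod_cast hL1p.ne'
    have hHK0 : HK m₀ m υ₀ ε 0 = -(υ₀ * ((L0 : ℂ) / 2 + L1 / 2)) := by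
      rw [HK_eq hm₀ hm hυ₀ hε]
      simp only [Pi.zero_apply, sub_zero, add_zero]
      rw [← hL0, ← hL1]
      field_simp
    have hmain : HK m₀ m υ₀ ε Z - HK m₀ m υ₀ ε 0 - υ₀ * Z 1
        + 3 / 2 * υ₀ * (Z 0 ^ 2 / (m 0 * ell m₀ υ₀) + (Z 1 - Z 0) ^ 2 / (m 1 * ell m₀ υ₀))
        = -(υ₀ * (R0 + R1)) - 3 / 2 * υ₀ * (Z 0 ^ 2 * (1 / L0 - 1 / (m 0 * ell m₀ υ₀) : ℝ)
          + (Z 1 - Z 0) ^ 2 * (1 / L1 - 1 / (m 1 * ell m₀ υ₀) : ℝ)) := by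
      rw [hHK0, HK_eq hm₀ hm hυ₀ hε, hR0, hR1]
      push_cast
      ring
    rw [hmain]
    have hυ : ‖(υ₀ : ℂ)‖ = υ₀ := by rw [Complex.norm_real, Real.norm_of_nonneg hυ₀.le]
    have b0 : ‖R0‖ ≤ 11 * ‖Z‖ ^ 3 / a ^ 2 := e0.trans (by gcongr)
    have b1 : ‖R1‖ ≤ 88 * ‖Z‖ ^ 3 / a ^ 2 := by
      calc ‖R1‖ ≤ 11 * ‖Z 1 - Z 0‖ ^ 3 / L1 ^ 2 := e1
        _ ≤ 11 * (2 * ‖Z‖) ^ 3 / a ^ 2 := by gcongr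
        _ = _ := by ring
    have c0 : ‖Z 0 ^ 2 * ((1 / L0 - 1 / (m 0 * ell m₀ υ₀) : ℝ) : ℂ)‖ ≤ ‖Z‖ ^ 2 * (C * ε) := by
      rw [norm_mul, norm_pow, Complex.norm_real, Real.norm_eq_abs]
      gcongr
    have c1 : ‖(Z 1 - Z 0) ^ 2 * ((1 / L1 - 1 / (m 1 * ell m₀ υ₀) : ℝ) : ℂ)‖
        ≤ (2 * ‖Z‖) ^ 2 * (C * ε) := by
      rw [norm_mul, norm_pow, Complex.norm_real, Real.norm_eq_abs]
      gcongr
    calc _ ≤ ‖(υ₀ : ℂ) * (R0 + R1)‖ + ‖3 / 2 * (υ₀ : ℂ)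
          * (Z 0 ^ 2 * ((1 / L0 - 1 / (m 0 * ell m₀ υ₀) : ℝ) : ℂ)
          + (Z 1 - Z 0) ^ 2 * ((1 / L1 - 1 / (m 1 * ell m₀ υ₀) : ℝ) : ℂ))‖ := by
          rw [← norm_neg ((υ₀ : ℂ) * (R0 + R1))]; exact norm_sub_le _ _
      _ ≤ υ₀ * (11 * ‖Z‖ ^ 3 / a ^ 2 + 88 * ‖Z‖ ^ 3 / a ^ 2)
          + 3 / 2 * υ₀ * (‖Z‖ ^ 2 * (C * ε) + (2 * ‖Z‖) ^ 2 * (C * ε)) := by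
          rw [norm_mul, norm_mul, norm_mul, hυ, norm_div, Complex.norm_ofNat, Complex.norm_ofNat]
          gcongr
          · exact (norm_add_le _ _).trans (add_le_add b0 b1)
          · exact (norm_add_le _ _).trans (add_le_add c0 c1)
      _ = υ₀ * (99 / a ^ 2) * ‖Z‖ ^ 3 + υ₀ * (15 / 2 * C) * (ε * ‖Z‖ ^ 2) := by ring
      _ ≤ υ₀ * (99 / a ^ 2 + 10 * C) * ‖Z‖ ^ 3 + υ₀ * (99 / a ^ 2 + 10 * C) * (ε * ‖Z‖ ^ 2) := by
          have : 0 < 99 / a ^ 2 := by positivity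
          gcongr <;> linarith
      _ = _ := by ring

end Kepler

/-! ### Injectivity and image of near-identity maps. -/

section NearIdentity

/-- Cauchy's estimate turns closeness to the identity on the larger zone into a Lipschitz constant
of Υ - id at most 1/2 on the smaller one. Injectivity is immediate, and Υ z = y is the fixed-point
equation of the contraction z ↦ y - (Υ z - z). -/
theorem near_identity_spec {Δ σ ξ : ℝ} {Υ : Phase → Phase} (hσ : 0 < σ)
    (hΥ : AnalyticOnNhd ℂ Υ (zone Δ (6 / 10 * σ)))
    (hξ : ∀ z ∈ zone Δ (6 / 10 * σ), ‖Υ z - z‖ ≤ ξ) (hξσ : 100 * ξ ≤ σ) :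
    InjOn Υ (zone Δ (1 / 3 * σ)) ∧ MapsTo Υ (zone Δ (1 / 3 * σ)) (zone Δ (1 / 2 * σ)) ∧
      zone Δ (1 / 6 * σ) ⊆ Υ '' zone Δ (1 / 3 * σ) := by
  have hsub : zone Δ (1 / 3 * σ) ⊆ zone Δ (6 / 10 * σ) := zone_mono (by linarith)
  have hD : AnalyticOnNhd ℂ (fun z => Υ z - z) (zone Δ (6 / 10 * σ)) := fun z hz =>
    (hΥ z hz).sub analyticAt_id
  have hlip : ∀ p ∈ zone Δ (1 / 3 * σ), ∀ q ∈ zone Δ (1 / 3 * σ),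
      ‖(Υ q - q) - (Υ p - p)‖ ≤ 1 / 2 * ‖q - p‖ := by
    intro p hp q hq
    refine norm_sub_le_of_zone (hD.mono hsub) (fun z hz => ?_) hp hq
    refine (norm_fderiv_le_of_zone hD hξ (δ := σ / 10) (by positivity) (by linarith) hz).trans ?_
    rw [div_le_iff₀ (by positivity)]
    linarith
  refine ⟨?_, ?_, ?_⟩
  · intro p hp q hq hpq
    have h := hlip p hp q hq
    have h1 : (Υ q - q) - (Υ p - p) = -(q - p) := by rw [hpq]; abel
    rw [h1, norm_neg] at h
    have : ‖q - p‖ = 0 := le_antisymm (by linarith) (norm_nonneg _)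
    exact (sub_eq_zero.1 (norm_eq_zero.1 this)).symm
  · intro p hp
    exact mem_zone_of_norm_sub_le hp (hξ p (hsub hp)) (by linarith)
  · intro y hy
    have hball : closedBall y (1 / 6 * σ) ⊆ zone Δ (1 / 3 * σ) :=
      closedBall_subset_zone hy (by linarith)
    set T : Phase → Phase := fun z => y - (Υ z - z) with hT
    have hmaps : MapsTo T (closedBall y (1 / 6 * σ)) (closedBall y (1 / 6 * σ)) := by
      intro z hz
      rw [mem_closedBall, dist_eq_norm, hT]
      have : y - (Υ z - z) - y = -(Υ z - z) := by abel
      rw [this, norm_neg]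
      exact (hξ z (hsub (hball hz))).trans (by linarith)
    have hTl : LipschitzOnWith (1 / 2) T (closedBall y (1 / 6 * σ)) := by
      refine LipschitzOnWith.of_dist_le_mul fun z hz w hw => ?_
      rw [dist_eq_norm, dist_eq_norm]
      have : T z - T w = -((Υ z - z) - (Υ w - w)) := by
        simp only [hT]; abel
      rw [this, norm_neg]
      simpa using hlip w (hball hw) z (hball hz)
    have hcon : ContractingWith (1 / 2) (hmaps.restrict _ _ _) :=
      ⟨by rw [← NNReal.coe_lt_coe]; norm_num, hTl.mapsToRestrict hmaps⟩
    obtain ⟨z, hz, hfix, -, -⟩ := hcon.exists_fixedPoint' isClosed_closedBall.isComplete hmaps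
      (mem_closedBall_self (by positivity)) (edist_ne_top y _)
    refine ⟨z, hball hz, ?_⟩
    have h1 : y - (Υ z - z) = z := hfix
    calc Υ z = (Υ z - z) + z := by abel
      _ = (Υ z - z) + (y - (Υ z - z)) := by rw [h1]
      _ = y := by abel

end NearIdentity

/-! ### The scaled Hamiltonian and its sizes. -/

section ScaledHamiltonian

variable {m₀ υ₀ : ℝ} {m : Fin 2 → ℝ} {Δ σ ε τ : ℝ}

theorem exists_HK_quadratic (hm₀ : 0 < m₀) (hm : ∀ j, 0 < m j) (hυ₀ : 0 < υ₀) :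
    ∃ r > 0, ∃ C > 0, ∀ ε : ℝ, 0 ≤ ε → ε ≤ r → ∀ Z : Vec, ‖Z‖ ≤ r →
      AnalyticAt ℂ (HK m₀ m υ₀ ε) Z ∧
      ‖HK m₀ m υ₀ ε Z - HK m₀ m υ₀ ε 0 - υ₀ * Z 1‖ ≤ C * ‖Z‖ ^ 2 := by
  obtain ⟨r, hr, C, hC, H⟩ := exists_HK_expansion hm₀ hm hυ₀
  have hl := ell_pos hm₀ hυ₀
  have hl0 := mul_pos (hm 0) hl
  have hl1 := mul_pos (hm 1) hl
  refine ⟨r, hr, C * (2 * r) + 3 / 2 * υ₀ * (1 / (m 0 * ell m₀ υ₀) + 4 / (m 1 * ell m₀ υ₀)),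
    by positivity, fun ε hε hεr Z hZ => ⟨(H ε hε hεr Z hZ).1, ?_⟩⟩
  have h := (H ε hε hεr Z hZ).2
  set a := HK m₀ m υ₀ ε Z - HK m₀ m υ₀ ε 0 - υ₀ * Z 1
  set b := 3 / 2 * (υ₀ : ℂ) * (Z 0 ^ 2 / (m 0 * ell m₀ υ₀) + (Z 1 - Z 0) ^ 2 / (m 1 * ell m₀ υ₀))
    with hb
  have hZ0 : ‖Z 0‖ ≤ ‖Z‖ := norm_le_pi_norm Z 0
  have hZ1 : ‖Z 1 - Z 0‖ ≤ 2 * ‖Z‖ :=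
    (norm_sub_le _ _).trans (by linarith [norm_le_pi_norm Z 1])
  have hbn : ‖b‖ ≤ 3 / 2 * υ₀ * (1 / (m 0 * ell m₀ υ₀) + 4 / (m 1 * ell m₀ υ₀)) * ‖Z‖ ^ 2 := by
    have hn : ∀ c : ℝ, 0 < c → ‖(c : ℂ)‖ = c := fun c hc => by
      rw [Complex.norm_real, Real.norm_of_nonneg hc.le]
    calc ‖b‖ ≤ 3 / 2 * υ₀ * (‖Z 0‖ ^ 2 / (m 0 * ell m₀ υ₀)
          + ‖Z 1 - Z 0‖ ^ 2 / (m 1 * ell m₀ υ₀)) := by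
          rw [hb, norm_mul, norm_mul, norm_div, Complex.norm_ofNat, Complex.norm_ofNat, hn υ₀ hυ₀]
          gcongr
          refine (norm_add_le _ _).trans_eq ?_
          simp only [norm_div, norm_pow, norm_mul, hn _ (hm 0), hn _ (hm 1), hn _ hl]
      _ ≤ 3 / 2 * υ₀ * (‖Z‖ ^ 2 / (m 0 * ell m₀ υ₀) + (2 * ‖Z‖) ^ 2 / (m 1 * ell m₀ υ₀)) := by
          gcongr
      _ = _ := by ring
  calc ‖a‖ = ‖(a + b) - b‖ := by rw [add_sub_cancel_right]
    _ ≤ ‖a + b‖ + ‖b‖ := norm_sub_le _ _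
    _ ≤ C * (‖Z‖ ^ 3 + ε * ‖Z‖ ^ 2) + _ := add_le_add h hbn
    _ ≤ C * (r * ‖Z‖ ^ 2 + r * ‖Z‖ ^ 2) + _ := by
      gcongr
      calc ‖Z‖ ^ 3 = ‖Z‖ * ‖Z‖ ^ 2 := by ring
        _ ≤ _ := by gcongr
    _ = _ := by ring

variable (m₀ υ₀ m ε τ)

/-- The perturbation in scaled variables. -/
noncomputable def scaledPert (p : Phase) : ℂ := pert m₀ υ₀ m (ε, scale τ p)

/-- The part of the scaled Hamiltonian that does not depend on the fast angle, apart from its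
linear part. -/
noncomputable def scaledSlow (p : Phase) : ℂ :=
  (HK m₀ m υ₀ ε (scale τ p).1 - HK m₀ m υ₀ ε 0 - υ₀ * (scale τ p).1 1) / τ
    + ε / τ * fastAvg (scaledPert m₀ υ₀ m ε τ) p

/-- The oscillating part of the scaled Hamiltonian. -/
noncomputable def scaledOsc (p : Phase) : ℂ :=
  ε / τ * (scaledPert m₀ υ₀ m ε τ p - fastAvg (scaledPert m₀ υ₀ m ε τ) p)

variable {m₀ υ₀ m ε τ}

theorem HK_scale_add (hτ : 0 < τ) (p : Phase) :
    HK m₀ m υ₀ ε (scale τ p).1 + ε * fastAvg (scaledPert m₀ υ₀ m ε τ) p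
      = HK m₀ m υ₀ ε 0 + τ * (υ₀ * p.1 1 + scaledSlow m₀ υ₀ m ε τ p) := by
  have h : (τ : ℂ) ≠ 0 := by exact_mod_cast hτ.ne'
  have h1 : (scale τ p).1 1 = τ * p.1 1 := rfl
  rw [scaledSlow, h1]
  field_simp
  ring

/-- Since the symplectic form is multiplied by τ, dividing the Hamiltonian by τ keeps the dynamics
canonical. The fast frequency υ₀ stays of order one while the other terms become small. -/
theorem Ham_scale (hm₀ : 0 < m₀) (hm : ∀ j, 0 < m j) (hυ₀ : 0 < υ₀) (hε : 0 ≤ ε) (hτ : 0 < τ)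
    (p : Phase) : Ham m₀ m υ₀ ε (scale τ p) = HK m₀ m υ₀ ε 0
      + τ * (υ₀ * p.1 1 + (scaledSlow m₀ υ₀ m ε τ p + scaledOsc m₀ υ₀ m ε τ p)) := by
  have h : (τ : ℂ) ≠ 0 := by exact_mod_cast hτ.ne'
  have h1 := HK_scale_add (m₀ := m₀) (υ₀ := υ₀) (m := m) (ε := ε) hτ p
  rw [Ham, HP_eq hm₀ hm hυ₀ hε, scaledOsc]
  have h2 : pert m₀ υ₀ m (ε, scale τ p) = scaledPert m₀ υ₀ m ε τ p := rfl
  rw [h2]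
  field_simp
  linear_combination h1

theorem avg_HP_scale (hm₀ : 0 < m₀) (hm : ∀ j, 0 < m j) (hυ₀ : 0 < υ₀) (hε : 0 ≤ ε) (p : Phase) :
    avg (HP m₀ m υ₀ ε) (scale τ p) = ε * fastAvg (scaledPert m₀ υ₀ m ε τ) (flat p) := by
  rw [avg_scale, ← fastAvg_const_mul]
  congr 1
  ext q
  rw [HP_eq hm₀ hm hυ₀ hε, scaledPert]

/-- The properties of the scaled perturbation. -/
structure IsScaledPert (Δ σ M : ℝ) (P : Phase → ℂ) : Prop where
  analytic : AnalyticOnNhd ℂ P (zone Δ σ)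
  le : ∀ p ∈ zone Δ σ, ‖P p‖ ≤ M
  rot_inv : ∀ θ, (rotSymm Δ θ).Inv P (zone Δ σ)
  conj_inv : (conjSymm Δ).Inv P (zone Δ σ)

theorem FastPeriodic.of_rot {P : Phase → ℂ} (h : (rotSymm Δ (2 * Real.pi)).Inv P (zone Δ σ)) :
    FastPeriodic P (zone Δ σ) := by
  intro p hp
  have h1 := h p hp
  have h2 : rot (2 * Real.pi) p = p + ((2 * Real.pi : ℝ) : ℂ) • eFast := by
    have e1 : exp (I * ((2 * Real.pi : ℝ) : ℂ)) = 1 := by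
      rw [mul_comm]; push_cast; exact exp_two_pi_mul_I
    rw [rot, rotLin_apply, exp_neg, e1, inv_one, one_smul, one_smul]
  rw [rotSymm_map, h2] at h1
  exact h1

theorem IsScaledPert.periodic {M : ℝ} {P : Phase → ℂ} (h : IsScaledPert Δ σ M P) :
    FastPeriodic P (zone Δ σ) :=
  .of_rot (h.rot_inv _)

/-- `ε` and `τ` are independent below a common threshold. The averaging uses τ = ε^β, and the
expansion of the averaged perturbation uses a fixed τ. -/
theorem exists_isScaledPert (hm₀ : 0 < m₀) (hm : ∀ j, 0 < m j) (hυ₀ : 0 < υ₀) (hσ : 0 < σ)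
    (hσΔ : σ < Δ) : ∃ t > 0, ∃ M > 0, ∀ ε τ : ℝ, 0 ≤ ε → ε ≤ t → 0 < τ → τ ≤ t →
      IsScaledPert Δ σ M (scaledPert m₀ υ₀ m ε τ) := by
  obtain ⟨r, hr, M, hM, H⟩ := exists_tube hm₀ hm hυ₀ hσΔ
  refine ⟨min r (min (r / σ) ((r / σ) ^ 2)), by positivity, M, hM, ?_⟩
  intro ε τ hε hεt hτ hτt
  have h1 : τ * σ ≤ r := by
    rw [← le_div_iff₀ hσ]
    exact hτt.trans ((min_le_right _ _).trans (min_le_left _ _))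
  have h2 : √τ * σ ≤ r := by
    rw [← le_div_iff₀ hσ]
    exact Real.sqrt_le_iff.2 ⟨by positivity, hτt.trans ((min_le_right _ _).trans (min_le_right _ _))⟩
  have htube : ∀ p ∈ zone Δ σ, ((ε : ℂ), scale τ p) ∈ tube Δ σ r := fun p hp =>
    scale_mem_tube hτ.le le_rfl h1 h2 (by
      rw [Complex.norm_real, Real.norm_of_nonneg hε]; exact hεt.trans (min_le_left _ _)) hp
  constructor
  · intro p hp
    exact (H _ (htube p hp)).1.fun_comp (f := fun p : Phase => ((ε : ℂ), scale τ p))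
      (analyticAt_const.prod ((scale τ).analyticAt p))
  · exact fun p hp => (H _ (htube p hp)).2.1
  · intro θ p hp
    rw [rotSymm_map, scaledPert, scale_rot]
    exact ((H _ (htube p hp)).2.2.rot θ).2
  · intro p hp
    rw [conjSymm_map, scaledPert, scale_conjPhase, conjSymm_val]
    exact (H _ (htube p hp)).2.2.conj hm₀ hm hυ₀ hε

/-- The properties of the scaled Hamiltonian. -/
structure IsScaledHam (Δ R κ η : ℝ) (k h : Phase → ℂ) : Prop where
  k_analytic : AnalyticOnNhd ℂ k (zone Δ R)
  h_analytic : AnalyticOnNhd ℂ h (zone Δ R)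
  fderiv_le : ∀ p ∈ zone Δ R, ‖fderiv ℂ k p‖ ≤ κ
  fderiv_lip : ∀ p ∈ zone Δ R, ∀ q ∈ zone Δ R, ‖fderiv ℂ k q - fderiv ℂ k p‖ ≤ κ * ‖q - p‖
  k_inv : FastInv k (zone Δ R)
  h_periodic : FastPeriodic h (zone Δ R)
  h_avg : ∀ p ∈ zone Δ R, fastAvg h p = 0
  h_le : ∀ p ∈ zone Δ R, ‖h p‖ ≤ η
  rot_inv : ∀ θ, (rotSymm Δ θ).Inv k (zone Δ R) ∧ (rotSymm Δ θ).Inv h (zone Δ R)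
  conj_inv : (conjSymm Δ).Inv k (zone Δ R) ∧ (conjSymm Δ).Inv h (zone Δ R)

/-- Without its linear term the Keplerian part is quadratic in the actions, so it contributes τ²/τ;
the perturbation contributes ε/τ. Two Cauchy estimates, from σ to 9σ/10 and then to 8σ/10, bound the
first derivative of the slow part and its Lipschitz constant. -/
theorem exists_isScaledHam (hm₀ : 0 < m₀) (hm : ∀ j, 0 < m j) (hυ₀ : 0 < υ₀) (hσ : 0 < σ)
    (hσΔ : σ < Δ) : ∃ t > 0, ∃ A > 0, ∀ ε τ : ℝ, 0 < ε → ε ≤ t → 0 < τ → τ ≤ t →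
      IsScaledHam Δ (8 / 10 * σ) (A * (τ + ε / τ)) (A * (ε / τ)) (scaledSlow m₀ υ₀ m ε τ)
        (scaledOsc m₀ υ₀ m ε τ) := by
  obtain ⟨t, ht, M, hM, H⟩ := exists_isScaledPert hm₀ hm hυ₀ hσ hσΔ
  obtain ⟨r, hr, C, hC, HK'⟩ := exists_HK_quadratic hm₀ hm hυ₀
  set A := (C * σ ^ 2 + M) * (1 / (σ / 10) + 1 / (σ / 10) ^ 2) + 2 * M with hA
  refine ⟨min t (min r (r / σ)), by positivity, A, by positivity, ?_⟩
  intro ε τ hε hεt hτ hτt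
  have hP := H ε τ hε.le (hεt.trans (min_le_left _ _)) hτ (hτt.trans (min_le_left _ _))
  set P := scaledPert m₀ υ₀ m ε τ with hPdef
  have hPa := analyticOnNhd_fastAvg hP.analytic
  have hετ : 0 < ε / τ := by positivity
  have hcast : ((ε : ℂ) / τ) = ((ε / τ : ℝ) : ℂ) := by push_cast; rfl
  have hZ : ∀ p ∈ zone Δ σ, ‖(scale τ p).1‖ ≤ τ * σ := by
    intro p hp
    change ‖(τ : ℂ) • p.1‖ ≤ _
    rw [norm_smul, Complex.norm_real, Real.norm_of_nonneg hτ.le]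
    exact mul_le_mul_of_nonneg_left (mem_zone_iff.1 hp).1 hτ.le
  have hτσ : τ * σ ≤ r := by
    rw [← le_div_iff₀ hσ]; exact hτt.trans ((min_le_right _ _).trans (min_le_right _ _))
  have hεr : ε ≤ r := hεt.trans ((min_le_right _ _).trans (min_le_left _ _))
  have hkan : AnalyticOnNhd ℂ (scaledSlow m₀ υ₀ m ε τ) (zone Δ σ) := by
    intro p hp
    have hf : AnalyticAt ℂ (fun p : Phase => (scale τ p).1) p :=
      ((ContinuousLinearMap.fst ℂ Vec (Vec × Vec × Vec)).comp (scale τ)).analyticAt p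
    have hf1 : AnalyticAt ℂ (fun p : Phase => (scale τ p).1 1) p :=
      ((ContinuousLinearMap.proj (R := ℂ) (φ := fun _ : Fin 2 => ℂ) 1).comp
        ((ContinuousLinearMap.fst ℂ Vec (Vec × Vec × Vec)).comp (scale τ))).analyticAt p
    have hK : AnalyticAt ℂ (fun p : Phase => HK m₀ m υ₀ ε (scale τ p).1) p :=
      (HK' ε hε.le hεr _ ((hZ p hp).trans hτσ)).1.fun_comp (f := fun p : Phase => (scale τ p).1) hf
    exact (((hK.sub analyticAt_const).sub (analyticAt_const.mul hf1)).fun_div analyticAt_const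
      (by exact_mod_cast hτ.ne')).add (analyticAt_const.mul (hPa p hp))
  have hhan : AnalyticOnNhd ℂ (scaledOsc m₀ υ₀ m ε τ) (zone Δ σ) := fun p hp =>
    analyticAt_const.mul ((hP.analytic p hp).sub (hPa p hp))
  have hkle : ∀ p ∈ zone Δ σ, ‖scaledSlow m₀ υ₀ m ε τ p‖ ≤ (C * σ ^ 2 + M) * (τ + ε / τ) := by
    intro p hp
    have h1 := (HK' ε hε.le hεr _ ((hZ p hp).trans hτσ)).2
    have h2 := norm_fastAvg_le hP.le hp
    rw [scaledSlow]
    refine (norm_add_le _ _).trans ?_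
    rw [norm_div, norm_mul, hcast, Complex.norm_real, Complex.norm_real,
      Real.norm_of_nonneg hτ.le, Real.norm_of_nonneg hετ.le]
    have h3 : ‖HK m₀ m υ₀ ε (scale τ p).1 - HK m₀ m υ₀ ε 0 - υ₀ * (scale τ p).1 1‖ / τ
        ≤ C * σ ^ 2 * τ := by
      rw [div_le_iff₀ hτ]
      calc _ ≤ C * (τ * σ) ^ 2 := h1.trans (by gcongr; exact hZ p hp)
        _ = _ := by ring
    have h4 : ε / τ * ‖fastAvg P p‖ ≤ ε / τ * M := by gcongr
    have h5 : 0 ≤ M * τ := by positivity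
    have h6 : 0 ≤ C * σ ^ 2 * (ε / τ) := by positivity
    nlinarith
  have hτε : 0 < τ + ε / τ := by positivity
  have hd1 : ∀ p ∈ zone Δ (9 / 10 * σ), ‖fderiv ℂ (scaledSlow m₀ υ₀ m ε τ) p‖
      ≤ (C * σ ^ 2 + M) * (τ + ε / τ) / (σ / 10) := fun p hp =>
    norm_fderiv_le_of_zone hkan hkle (by positivity) (by linarith) hp
  have hkan9 : AnalyticOnNhd ℂ (fderiv ℂ (scaledSlow m₀ υ₀ m ε τ)) (zone Δ (9 / 10 * σ)) :=
    hkan.fderiv.mono (zone_mono (by linarith))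
  have hd2 : ∀ p ∈ zone Δ (8 / 10 * σ), ‖fderiv ℂ (fderiv ℂ (scaledSlow m₀ υ₀ m ε τ)) p‖
      ≤ (C * σ ^ 2 + M) * (τ + ε / τ) / (σ / 10) / (σ / 10) := fun p hp =>
    norm_fderiv_le_of_zone hkan9 hd1 (by positivity) (by linarith) hp
  have hA1 : (C * σ ^ 2 + M) * (τ + ε / τ) / (σ / 10) ≤ A * (τ + ε / τ) := by
    rw [mul_div_right_comm]
    refine mul_le_mul_of_nonneg_right ?_ hτε.le
    have : 0 ≤ (C * σ ^ 2 + M) * (1 / (σ / 10) ^ 2) + 2 * M := by positivity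
    have h2 : (C * σ ^ 2 + M) / (σ / 10) = (C * σ ^ 2 + M) * (1 / (σ / 10)) := by ring
    rw [hA, h2]; linarith
  have hA2 : (C * σ ^ 2 + M) * (τ + ε / τ) / (σ / 10) / (σ / 10) ≤ A * (τ + ε / τ) := by
    rw [mul_div_right_comm, mul_div_right_comm]
    refine mul_le_mul_of_nonneg_right ?_ hτε.le
    have : 0 ≤ (C * σ ^ 2 + M) * (1 / (σ / 10)) + 2 * M := by positivity
    have h2 : (C * σ ^ 2 + M) / (σ / 10) / (σ / 10) = (C * σ ^ 2 + M) * (1 / (σ / 10) ^ 2) := by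
      field_simp
    rw [hA, h2]; linarith
  have m8 : zone Δ (8 / 10 * σ) ⊆ zone Δ σ := zone_mono (by linarith)
  have m89 : zone Δ (8 / 10 * σ) ⊆ zone Δ (9 / 10 * σ) := zone_mono (by linarith)
  constructor
  · exact hkan.mono m8
  · exact hhan.mono m8
  · exact fun p hp => (hd1 p (m89 hp)).trans hA1
  · intro p hp q hq
    exact (norm_sub_le_of_zone (hkan9.mono m89) hd2 hp hq).trans
      (mul_le_mul_of_nonneg_right hA2 (norm_nonneg _))
  · intro p hp t
    have h1 : (scale τ (p + (t : ℂ) • eFast)).1 = (scale τ p).1 := by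
      rw [scale_add_fast]; simp [eFast]
    rw [scaledSlow, scaledSlow, h1, hP.periodic.fastInv_fastAvg p (m8 hp) t]
  · intro p hp
    rw [scaledOsc, scaledOsc, ← hPdef, hP.periodic p (m8 hp),
      hP.periodic.fastInv_fastAvg p (m8 hp) (2 * Real.pi)]
  · intro p hp
    have h1 : fastAvg (scaledOsc m₀ υ₀ m ε τ) p = ε / τ * fastAvg (fun q => P q - fastAvg P q) p :=
      fastAvg_const_mul _ _
    rw [h1, fastAvg_sub hP.analytic hPa (m8 hp), hP.periodic.fastInv_fastAvg.fastAvg_eq (m8 hp),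
      sub_self, mul_zero]
  · intro p hp
    have h1 := hP.le p (m8 hp)
    have h2 := norm_fastAvg_le hP.le (m8 hp)
    rw [scaledOsc, norm_mul, hcast, Complex.norm_real, Real.norm_of_nonneg hετ.le, mul_comm]
    refine mul_le_mul_of_nonneg_right ?_ hετ.le
    refine (norm_sub_le _ _).trans ((add_le_add h1 h2).trans ?_)
    have : 0 ≤ (C * σ ^ 2 + M) * (1 / (σ / 10) + 1 / (σ / 10) ^ 2) := by positivity
    rw [hA]; linarith
  · intro θ
    have h0 : (rotSymm Δ θ).Inv (fastAvg P) (zone Δ σ) :=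
      (rotSymm Δ θ).fastAvg_inv (hP.rot_inv θ) hP.analytic
    constructor
    · intro p hp
      have h1 := h0 p (m8 hp)
      rw [rotSymm_map] at h1 ⊢
      have h2 : (scale τ (rot θ p)).1 = (scale τ p).1 := by rw [scale_rot, rot_apply]
      rw [scaledSlow, h2, h1]
      rfl
    · intro p hp
      have h1 := h0 p (m8 hp)
      have h2 := hP.rot_inv θ p (m8 hp)
      rw [rotSymm_map] at h1 h2 ⊢
      rw [scaledOsc, ← hPdef, h1, h2]
      rfl
  · have h0 : (conjSymm Δ).Inv (fastAvg P) (zone Δ σ) :=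
      (conjSymm Δ).fastAvg_inv hP.conj_inv hP.analytic
    constructor
    · intro p hp
      have h1 := h0 p (m8 hp)
      rw [conjSymm_map, conjSymm_val] at h1 ⊢
      have h2 : (scale τ (conjPhase p)).1 = conjVec (scale τ p).1 := by
        rw [scale_conjPhase]; rfl
      have h3 : HK m₀ m υ₀ ε 0 = starRingEnd ℂ (HK m₀ m υ₀ ε 0) := by
        rw [← HK_conj, map_zero]
      rw [scaledSlow, h2, h1, HK_conj, conjVec_apply, scaledSlow, h3]
      simp only [map_add, map_sub, map_mul, map_div₀, conj_ofReal, conj_conj]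
      rw [← h3]
    · intro p hp
      have h1 := h0 p (m8 hp)
      have h2 := hP.conj_inv p (m8 hp)
      rw [conjSymm_map, conjSymm_val] at h1 h2 ⊢
      rw [scaledOsc, ← hPdef, h1, h2, scaledOsc, ← hPdef]
      simp only [map_sub, map_mul, map_div₀, conj_ofReal]

end ScaledHamiltonian

/-! ### Existence of first averaging transformations. -/

section Existence

theorem eventually_rpow_le {a c : ℝ} (ha : 0 < a) (hc : 0 < c) :
    ∀ᶠ ε : ℝ in 𝓝[>] 0, ε ^ a ≤ c := by
  have h : Tendsto (fun ε : ℝ => ε ^ a) (𝓝 0) (𝓝 0) := by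
    have := Real.continuousAt_rpow_const 0 a (Or.inr ha.le)
    rwa [ContinuousAt, Real.zero_rpow ha.ne'] at this
  exact ((h.eventually_lt_const hc).filter_mono nhdsWithin_le_nhds).mono fun _ h => h.le

theorem exists_of_eventually_pos {P : ℝ → Prop} (h : ∀ᶠ ε : ℝ in 𝓝[>] 0, P ε) :
    ∃ ε₀ > 0, ∀ ε, 0 < ε → ε < ε₀ → P ε := by
  obtain ⟨ε₀, h0, hs⟩ := mem_nhdsGT_iff_exists_Ioo_subset.1 h
  exact ⟨ε₀, h0, fun ε h1 h2 => hs ⟨h1, h2⟩⟩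

/-- Smallness of the parameters of the averaging procedure. -/
theorem eventually_small {α β : ℝ} (hα0 : 0 < α) (hαβ : α < β) (hαβ' : α + β < 1) {t A C ν σ : ℝ}
    (ht : 0 < t) (hA : 0 < A) (hC : 0 < C) (hν : 0 < ν) (hσ : 0 < σ) :
    ∀ᶠ ε : ℝ in 𝓝[>] 0, ε ≤ t ∧ ε ^ β ≤ t ∧
      (⌈1 / ε ^ α⌉₊ : ℝ) * (A * (ε ^ β + ε / ε ^ β)) ≤ ν ∧
      100 * (C * (A * (ε / ε ^ β))) ≤ σ := by
  have hβ0 : 0 < β := hα0.trans hαβ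
  have e1 : ∀ᶠ ε : ℝ in 𝓝[>] 0, ε ^ (1 : ℝ) ≤ min t 1 := eventually_rpow_le one_pos (by positivity)
  have e2 := eventually_rpow_le hβ0 ht
  -- With N at most 2 ε^(-α), the products N ε^β and N ε^(1-β) tend to zero exactly because α < β
  -- and α + β < 1.
  have e3 := eventually_rpow_le (sub_pos.2 hαβ) (c := ν / (4 * A)) (by positivity)
  have e4 := eventually_rpow_le (a := 1 - β - α) (by linarith) (c := ν / (4 * A)) (by positivity)
  have e5 := eventually_rpow_le (a := 1 - β) (by linarith) (c := σ / (100 * (C * A)))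
    (by positivity)
  filter_upwards [e1, e2, e3, e4, e5, eventually_mem_nhdsWithin] with ε h1 h2 h3 h4 h5 h0
  have hε : 0 < ε := h0
  rw [Real.rpow_one] at h1
  have hε1 : ε ≤ 1 := h1.trans (min_le_right _ _)
  have hdiv : ε / ε ^ β = ε ^ (1 - β) := by rw [Real.rpow_sub hε, Real.rpow_one]
  refine ⟨h1.trans (min_le_left _ _), h2, ?_, ?_⟩
  · have hα1 : ε ^ α ≤ 1 := Real.rpow_le_one hε.le hε1 hα0.le
    have hα2 : 0 < ε ^ α := Real.rpow_pos_of_pos hε α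
    have hceil : (⌈1 / ε ^ α⌉₊ : ℝ) ≤ 2 / ε ^ α := by
      have h6 := (Nat.ceil_lt_add_one (a := 1 / ε ^ α) (by positivity)).le
      have h7 : 1 ≤ 1 / ε ^ α := by rw [le_div_iff₀ hα2]; linarith
      calc (⌈1 / ε ^ α⌉₊ : ℝ) ≤ 1 / ε ^ α + 1 := h6
        _ ≤ 1 / ε ^ α + 1 / ε ^ α := by linarith
        _ = _ := by ring
    have hβ2 : 0 < ε ^ β := Real.rpow_pos_of_pos hε β
    have k1 : ε ^ β / ε ^ α = ε ^ (β - α) := (Real.rpow_sub hε _ _).symm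
    have k2 : ε / ε ^ β / ε ^ α = ε ^ (1 - β - α) := by
      rw [hdiv, ← Real.rpow_sub hε]
    calc _ ≤ 2 / ε ^ α * (A * (ε ^ β + ε / ε ^ β)) := by gcongr
      _ = 2 * A * (ε ^ β / ε ^ α + ε / ε ^ β / ε ^ α) := by ring
      _ ≤ 2 * A * (ν / (4 * A) + ν / (4 * A)) := by rw [k1, k2]; gcongr
      _ = ν := by field_simp; ring
  · rw [hdiv]
    calc 100 * (C * (A * ε ^ (1 - β))) ≤ 100 * (C * (A * (σ / (100 * (C * A))))) := by gcongr
      _ = σ := by field_simp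

variable {m₀ υ₀ : ℝ} {m : Fin 2 → ℝ} {Δ σ β ε : ℝ}

theorem shiftFast_eq (t : ℂ) (p : Phase) : shiftFast t p = p + t • eFast := by
  rw [shiftFast]
  ext j
  · simp [eFast]
  · fin_cases j <;> simp [eFast, Matrix.vecHead, Matrix.vecTail]
  · simp [eFast]
  · simp [eFast]

/-- A normal form of the scaled Hamiltonian yields a first averaging transformation. -/
theorem isFirstAveraging_of_isNormalForm (hm₀ : 0 < m₀) (hm : ∀ j, 0 < m j) (hυ₀ : 0 < υ₀)
    (hσ : 0 < σ) (hε : 0 < ε) {κ η ξ M C : ℝ} {N : ℕ} {Υ : Phase → Phase} {f g : Phase → ℂ}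
    (hP : IsScaledPert Δ σ M (scaledPert m₀ υ₀ m ε (ε ^ β)))
    (hH : IsScaledHam Δ (8 / 10 * σ) κ η (scaledSlow m₀ υ₀ m ε (ε ^ β))
      (scaledOsc m₀ υ₀ m ε (ε ^ β)))
    (hN : 1 / ε ^ ((1 - 2 * β) / 5) ≤ N)
    (H : IsNormalForm Δ υ₀ (8 / 10 * σ) (scaledSlow m₀ υ₀ m ε (ε ^ β))
      (scaledOsc m₀ υ₀ m ε (ε ^ β)) (6 / 10 * σ) (ξ * ε ^ (1 - β))
      (ξ * ε ^ (1 - β) * Real.exp (-N)) (M * ε ^ (2 - 2 * β)) Υ f g)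
    (hξσ : 100 * (ξ * ε ^ (1 - β)) ≤ σ) (hξC : ξ ≤ C) (hMC : M ≤ C) (hξ0 : 0 ≤ ξ) :
    IsFirstAveraging m₀ m υ₀ Δ σ β ε C
      (fun p => scale (ε ^ β) (Υ (scale (ε ^ β)⁻¹ p))) := by
  have hC0 : 0 ≤ C := hξ0.trans hξC
  set τ := ε ^ β with hτdef
  have hτ : 0 < τ := Real.rpow_pos_of_pos hε β
  set L := scale τ with hL
  set L' := scale τ⁻¹ with hL'
  have hLL' : ∀ p, L (L' p) = p := scale_scale_inv hτ
  have hL'L : ∀ p, L' (L p) = p := scale_inv_scale hτ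
  obtain ⟨hinj, hmaps, hsurj⟩ := near_identity_spec hσ H.analytic H.near hξσ
  have m36 : zone Δ (1 / 3 * σ) ⊆ zone Δ (6 / 10 * σ) := zone_mono (by linarith)
  have m68 : zone Δ (6 / 10 * σ) ⊆ zone Δ (8 / 10 * σ) := zone_mono (by linarith)
  have m81 : zone Δ (8 / 10 * σ) ⊆ zone Δ σ := zone_mono (by linarith)
  have hΥ8 : ∀ z ∈ zone Δ (6 / 10 * σ), Υ z ∈ zone Δ (8 / 10 * σ) := fun z hz =>
    mem_zone_of_norm_sub_le hz (H.near z hz) (by linarith)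
  have hmem : ∀ p, p ∈ domainAt Δ σ β ε (1 / 3) ↔ L' p ∈ zone Δ (1 / 3 * σ) := fun p =>
    mem_domainAt_iff hε hσ (by norm_num)
  set P := scaledPert m₀ υ₀ m ε τ with hPdef
  have hPavg := analyticOnNhd_fastAvg hP.analytic
  have hPinv := hP.periodic.fastInv_fastAvg
  -- Conservation of energy in the normal form says that H_* is τ (g + f) in scaled variables; its
  -- average is τ g, as `g` is independent of the fast angle and `f` has zero average.
  have hstar : ∀ z ∈ zone Δ (6 / 10 * σ),
      Hstar m₀ m υ₀ ε (fun p => L (Υ (L' p))) (L z) = τ * (g z + f z) := by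
    intro z hz
    rw [Hstar, hL'L, Ham_scale hm₀ hm hυ₀ hε.le hτ, H.energy z hz, avg_HP_scale hm₀ hm hυ₀ hε.le,
      hPinv.flat hPavg (m81 (m68 hz))]
    have := HK_scale_add (m₀ := m₀) (υ₀ := υ₀) (m := m) (ε := ε) hτ z
    linear_combination -this
  have havg : ∀ z ∈ zone Δ (6 / 10 * σ),
      avg (Hstar m₀ m υ₀ ε (fun p => L (Υ (L' p)))) (L z) = τ * g z := by
    intro z hz
    have hz' := flat_mem_zone hz
    rw [avg_scale]
    have h1 : fastAvg (fun q => Hstar m₀ m υ₀ ε (fun p => L (Υ (L' p))) (scale τ q)) (flat z)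
        = fastAvg (fun q => τ * (g q + f q)) (flat z) := by
      rw [fastAvg, fastAvg]
      congr 1
      exact intervalIntegral.integral_congr fun t _ => hstar _ (add_fast_mem_zone hz' t)
    rw [h1, fastAvg_const_mul, fastAvg_add H.g_analytic H.f_analytic hz', H.f_avg _ hz', add_zero,
      H.g_inv.fastAvg_eq hz', H.g_inv.flat H.g_analytic hz]
  have hτn : ‖(τ : ℂ)‖ = τ := by rw [Complex.norm_real, Real.norm_of_nonneg hτ.le]
  have hrot : ∀ θ : ℝ, ∀ z ∈ zone Δ (6 / 10 * σ), Υ (rot θ z) = rot θ (Υ z) := by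
    intro θ z hz
    exact (H.symm (rotSymm Δ θ) (hH.rot_inv θ).1 (hH.rot_inv θ).2).1 z hz
  have hconj : ∀ z ∈ zone Δ (6 / 10 * σ), Υ (conjPhase z) = conjPhase (Υ z) := by
    intro z hz
    have := (H.symm (conjSymm Δ) hH.conj_inv.1 hH.conj_inv.2).1 z hz
    rwa [conjSymm_map, conjSymm_map] at this
  have hper : ∀ z ∈ zone Δ (6 / 10 * σ), Υ (z + ((2 * Real.pi : ℝ) : ℂ) • eFast)
      = Υ z + ((2 * Real.pi : ℝ) : ℂ) • eFast := by
    intro z hz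
    have := (H.symm (periodSymm Δ) (periodSymm_inv_iff.2 hH.k_inv.periodic)
      (periodSymm_inv_iff.2 hH.h_periodic)).1 z hz
    exact this
  have han : ∀ p ∈ domainAt Δ σ β ε (1 / 3), AnalyticAt ℂ (fun p => Υ (L' p)) p := fun p hp =>
    (H.analytic _ (m36 ((hmem p).1 hp))).fun_comp (L'.analyticAt p)
  have hnear : ∀ p ∈ domainAt Δ σ β ε (1 / 3), ‖Υ (L' p) - L' p‖ ≤ C * ε ^ (1 - β) := by
    intro p hp
    refine (H.near _ (m36 ((hmem p).1 hp))).trans ?_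
    gcongr
  have hdiff : ∀ p, p - L (Υ (L' p)) = L (L' p - Υ (L' p)) := by
    intro p
    rw [map_sub, hLL']
  constructor
  · constructor
    · exact fun p hp => (L.analyticAt _).fun_comp (han p hp)
    · intro p hp q hq hpq
      have h1 := congrArg L' hpq
      simp only [hL'L] at h1
      have h2 := hinj ((hmem p).1 hp) ((hmem q).1 hq) h1
      rw [← hLL' p, h2, hLL']
    · intro p hp u v
      have hd : fderiv ℂ (fun p => L (Υ (L' p))) p = L ∘L (fderiv ℂ Υ (L' p)) ∘L L' := by
        have h1 : HasFDerivAt Υ (fderiv ℂ Υ (L' p)) (L' p) :=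
          (H.analytic _ (m36 ((hmem p).1 hp))).differentiableAt.hasFDerivAt
        exact (L.hasFDerivAt.comp p (h1.comp p L'.hasFDerivAt)).fderiv
      rw [hd]
      simp only [ContinuousLinearMap.comp_apply]
      -- The scaling is only conformally symplectic, but the factor τ enters once directly and once
      -- through the inverse, and cancels.
      rw [sympl_scale hτ.le, H.symplectic _ (m36 ((hmem p).1 hp)), ← sympl_scale hτ.le, ← hL, hLL',
        hLL']
    · intro p hp hreal
      rw [isRealPoint_iff] at hreal ⊢
      rw [← scale_conjPhase, ← hconj _ (m36 ((hmem p).1 hp)), ← scale_conjPhase, hreal]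
    · intro p hp
      have h2 : (2 * (Real.pi : ℂ)) = ((2 * Real.pi : ℝ) : ℂ) := by push_cast; rfl
      rw [shiftFast_eq, shiftFast_eq, h2, scale_add_fast, hper _ (m36 ((hmem p).1 hp)),
        scale_add_fast]
  · rintro _ ⟨p, hp, rfl⟩
    exact scale_mem_domainAt hε hσ (by norm_num) (hmaps ((hmem p).1 hp))
  · intro y hy
    have hy' := (mem_domainAt_iff hε hσ (by norm_num)).1 hy
    obtain ⟨z, hz, hzy⟩ := hsurj hy'
    refine ⟨L z, scale_mem_domainAt hε hσ (by norm_num) hz, ?_⟩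
    beta_reduce
    rw [hL'L, hzy, hLL']
  · intro p hp
    have hz := m36 ((hmem p).1 hp)
    have h1 := havg _ hz
    rw [hLL'] at h1
    rw [h1, norm_mul, hτn]
    calc τ * ‖g (L' p)‖ ≤ τ * (M * ε ^ (2 - 2 * β)) := by gcongr; exact H.g_le _ hz
      _ = M * (ε ^ β * ε ^ (2 - 2 * β)) := by ring
      _ = M * ε ^ (2 - β) := by rw [← Real.rpow_add hε]; ring_nf
      _ ≤ _ := by gcongr
  · intro p hp
    have hz := m36 ((hmem p).1 hp)
    have h1 := havg _ hz
    have h2 := hstar _ hz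
    rw [hLL'] at h1 h2
    rw [h1, h2, mul_add, add_sub_cancel_left, norm_mul, hτn]
    calc τ * ‖f (L' p)‖ ≤ τ * (ξ * ε ^ (1 - β) * Real.exp (-N)) := by gcongr; exact H.f_le _ hz
      _ = ξ * ((ε ^ β * ε ^ (1 - β)) * Real.exp (-N)) := by ring
      _ = ξ * (ε * Real.exp (-N)) := by rw [← Real.rpow_add hε]; norm_num
      _ ≤ C * (ε * Real.exp (-(1 / ε ^ ((1 - 2 * β) / 5)))) := by
        gcongr
  · intro p hp
    have h1 : (p - L (Υ (L' p))).1 = (τ : ℂ) • (L' p - Υ (L' p)).1 := by rw [hdiff]; rfl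
    change ‖(p - L (Υ (L' p))).1‖ ≤ _
    rw [h1, norm_smul, hτn]
    calc τ * ‖(L' p - Υ (L' p)).1‖ ≤ τ * (C * ε ^ (1 - β)) := by
          gcongr
          refine (norm_fst_le _).trans ?_
          rw [norm_sub_rev]; exact hnear p hp
      _ = C * (ε ^ β * ε ^ (1 - β)) := by ring
      _ = C * ε := by rw [← Real.rpow_add hε]; norm_num
  · intro p hp
    have h1 : (p - L (Υ (L' p))).2.1 = (L' p - Υ (L' p)).2.1 := by rw [hdiff]; rfl
    change ‖(p - L (Υ (L' p))).2.1‖ ≤ _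
    rw [h1]
    refine (norm_fst_le _).trans ((norm_snd_le _).trans ?_)
    rw [norm_sub_rev]; exact hnear p hp
  · intro p hp
    have h1 : (p - L (Υ (L' p))).2.2 = ((√τ : ℝ) : ℂ) • (L' p - Υ (L' p)).2.2 := by
      rw [hdiff]; rfl
    change ‖(p - L (Υ (L' p))).2.2‖ ≤ _
    rw [h1, norm_smul, Complex.norm_real, Real.norm_of_nonneg (Real.sqrt_nonneg _)]
    calc √τ * ‖(L' p - Υ (L' p)).2.2‖ ≤ √τ * (C * ε ^ (1 - β)) := by
          gcongr
          refine (norm_snd_le _).trans ((norm_snd_le _).trans ?_)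
          rw [norm_sub_rev]; exact hnear p hp
      _ = C * (ε ^ (β / 2) * ε ^ (1 - β)) := by
          rw [hτdef, Real.sqrt_eq_rpow, ← Real.rpow_mul hε.le]; ring_nf
      _ = C * ε ^ (1 - β / 2) := by rw [← Real.rpow_add hε]; ring_nf
  · intro p hp θ
    have hz := m36 ((hmem p).1 hp)
    have h1 := rot_apply θ p
    rw [← h1]
    beta_reduce
    rw [scale_rot, hrot θ _ hz, Ham_scale hm₀ hm hυ₀ hε.le hτ, Ham_scale hm₀ hm hυ₀ hε.le hτ]
    have h2 := (hH.rot_inv θ).1 _ (hΥ8 _ hz)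
    have h3 := (hH.rot_inv θ).2 _ (hΥ8 _ hz)
    rw [rotSymm_map] at h2 h3
    rw [h2, h3, rot_apply]
    rfl

theorem exists_isFirstAveraging (hm₀ : 0 < m₀) (hm : ∀ j, 0 < m j) (hυ₀ : 0 < υ₀)
    (hσ : 0 < σ) (hσΔ : σ < Δ) (hβ : 1 / 7 < β) (hβ' : β < 1 / 2) :
    ∃ C > 0, ∃ ε₀ > 0, ∀ ε : ℝ, 0 < ε → ε < ε₀ →
      ∃ Υ : Phase → Phase, IsFirstAveraging m₀ m υ₀ Δ σ β ε C Υ := by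
  obtain ⟨t, ht, M, hM, HP⟩ := exists_isScaledPert hm₀ hm hυ₀ hσ hσΔ
  obtain ⟨t', ht', A, hA, HH⟩ := exists_isScaledHam hm₀ hm hυ₀ hσ hσΔ
  obtain ⟨ν, hν, C, hC, HN⟩ := exists_normalForm hυ₀ hσ
  -- For α = (1 - 2β)/5, positivity of α is β < 1/2 and α < β is β > 1/7; α + β < 1 then holds as
  -- well.
  obtain ⟨ε₀, hε₀, hsmall⟩ := exists_of_eventually_pos
    (eventually_small (α := (1 - 2 * β) / 5) (β := β) (by linarith) (by linarith) (by linarith)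
      (t := min t t') (by positivity) hA hC hν hσ)
  refine ⟨C * A + C * A ^ 2 + M, by positivity, ε₀, hε₀, fun ε hε hεε₀ => ?_⟩
  obtain ⟨h1, h2, h3, h4⟩ := hsmall ε hε hεε₀
  have hτ : 0 < ε ^ β := Real.rpow_pos_of_pos hε β
  have hdiv : ε / ε ^ β = ε ^ (1 - β) := by rw [Real.rpow_sub hε, Real.rpow_one]
  have hP := HP ε (ε ^ β) hε.le (h1.trans (min_le_left _ _)) hτ (h2.trans (min_le_left _ _))
  have hH := HH ε (ε ^ β) hε (h1.trans (min_le_right _ _)) hτ (h2.trans (min_le_right _ _))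
  have hετ : 0 < ε / ε ^ β := by positivity
  have hN1 : 1 ≤ ⌈1 / ε ^ ((1 - 2 * β) / 5)⌉₊ := Nat.ceil_pos.2 (by positivity)
  obtain ⟨Υ, f, g, H⟩ := HN Δ (A * (ε / ε ^ β)) (A * (ε ^ β + ε / ε ^ β)) _ _ _ hN1 (by positivity)
    (by gcongr; linarith) h3 hH.k_analytic hH.h_analytic hH.fderiv_le hH.fderiv_lip hH.k_inv
    hH.h_periodic hH.h_avg hH.h_le
  -- One constant `M` bounds both the scaled perturbation and the averaged part of the normal form,
  -- hence the maximum.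
  refine ⟨_, isFirstAveraging_of_isNormalForm (κ := A * (ε ^ β + ε / ε ^ β)) (η := A * (ε / ε ^ β))
    (ξ := C * A) (M := max (C * A ^ 2) M) (Υ := Υ) (f := f) (g := g) hm₀ hm hυ₀ hσ hε ?_ hH
    (Nat.le_ceil _) ?_ ?_ ?_ ?_ (by positivity)⟩
  · exact ⟨hP.analytic, fun p hp => (hP.le p hp).trans (le_max_right _ _), hP.rot_inv, hP.conj_inv⟩
  · refine H.mono le_rfl ?_ ?_ ?_
    · rw [hdiv, mul_assoc]
    · rw [hdiv, mul_assoc C A]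
    · rw [hdiv]
      have h5 : (A * ε ^ (1 - β)) ^ 2 = A ^ 2 * ε ^ (2 - 2 * β) := by
        rw [mul_pow, ← Real.rpow_natCast (ε ^ (1 - β)), ← Real.rpow_mul hε.le]
        congr 2; push_cast; ring
      rw [h5, ← mul_assoc]
      gcongr
      exact le_max_left _ _
  · rw [hdiv, ← mul_assoc C A] at h4; exact h4
  · have : 0 < C * A ^ 2 := by positivity
    linarith
  · have : 0 < C * A := by positivity
    have h6 : 0 < C * A ^ 2 := by positivity
    rcases max_cases (C * A ^ 2) M with ⟨h, -⟩ | ⟨h, -⟩ <;> rw [h] <;> linarith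

end Existence

/-! ### Expansion in the eccentricities of rotation-invariant functions. -/

section Eccentricity

variable {Δ r s δ M : ℝ} {f : Phase → ℂ}

/-- Derivative with respect to `x_j`. -/
noncomputable def dX (j : Fin 2) (f : Phase → ℂ) (p : Phase) : ℂ :=
  fderiv ℂ f p (0, 0, Pi.single j 1, 0)

/-- Derivative with respect to `x̃_k`. -/
noncomputable def dXt (k : Fin 2) (f : Phase → ℂ) (p : Phase) : ℂ :=
  fderiv ℂ f p (0, 0, 0, Pi.single k 1)

/-- Dilation of the eccentricity variables. -/
def shrink (a b : ℂ) (p : Phase) : Phase := (p.1, p.2.1, a • p.2.2.1, b • p.2.2.2)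

/-- Coefficient of `x_j x̃_k` in the Taylor formula with integral remainder. -/
noncomputable def mixedCoef (j k : Fin 2) (f : Phase → ℂ) (p : Phase) : ℂ :=
  ∫ b in (0 : ℝ)..1, ∫ a in (0 : ℝ)..1, dX j (dXt k f) (shrink a b p)

theorem shrink_one_one (p : Phase) : shrink 1 1 p = p := by simp [shrink]

theorem norm_shrink_snd_le {a b : ℂ} (ha : ‖a‖ ≤ 1) (hb : ‖b‖ ≤ 1) (p : Phase) :
    ‖(shrink a b p).2.2‖ ≤ ‖p.2.2‖ := by
  simp only [shrink, Prod.norm_def, norm_smul]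
  exact max_le_max (mul_le_of_le_one_left (norm_nonneg _) ha)
    (mul_le_of_le_one_left (norm_nonneg _) hb)

theorem shrink_mem_zone {a b : ℂ} (ha : ‖a‖ ≤ 1) (hb : ‖b‖ ≤ 1) {p : Phase}
    (hp : p ∈ zone Δ r) : shrink a b p ∈ zone Δ r := by
  obtain ⟨h1, h2, h3⟩ := mem_zone_iff.1 hp
  exact mem_zone_iff.2 ⟨h1, h2, (norm_shrink_snd_le ha hb p).trans h3⟩

theorem norm_ofReal_le_one_of_mem_uIcc {t : ℝ} (ht : t ∈ uIcc (0 : ℝ) 1) : ‖(t : ℂ)‖ ≤ 1 := by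
  rw [uIcc_of_le zero_le_one] at ht
  rw [Complex.norm_real, Real.norm_of_nonneg ht.1]
  exact ht.2

theorem norm_single_le_one (j : Fin 2) : ‖(Pi.single j 1 : Vec)‖ ≤ 1 :=
  (pi_norm_le_iff_of_nonneg zero_le_one).2 fun i => by
    rw [Pi.single_apply]; split_ifs <;> simp

theorem analyticOnNhd_dX (hf : AnalyticOnNhd ℂ f (zone Δ r)) (j : Fin 2) :
    AnalyticOnNhd ℂ (dX j f) (zone Δ r) := fun p hp =>
  ((ContinuousLinearMap.apply ℂ ℂ ((0, 0, Pi.single j 1, 0) : Phase)).analyticAt _).comp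
    (hf p hp).fderiv

theorem analyticOnNhd_dXt (hf : AnalyticOnNhd ℂ f (zone Δ r)) (j : Fin 2) :
    AnalyticOnNhd ℂ (dXt j f) (zone Δ r) := fun p hp =>
  ((ContinuousLinearMap.apply ℂ ℂ ((0, 0, 0, Pi.single j 1) : Phase)).analyticAt _).comp
    (hf p hp).fderiv

theorem norm_dX_le (hf : AnalyticOnNhd ℂ f (zone Δ s)) (hM : ∀ p ∈ zone Δ s, ‖f p‖ ≤ M)
    (hδ : 0 < δ) (h : r + δ ≤ s) (j : Fin 2) {p : Phase} (hp : p ∈ zone Δ r) :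
    ‖dX j f p‖ ≤ M / δ :=
  (((fderiv ℂ f p).le_opNorm _).trans (mul_le_of_le_one_right (norm_nonneg _)
    (by simpa [Prod.norm_def] using norm_single_le_one j))).trans
    (norm_fderiv_le_of_zone hf hM hδ h hp)

theorem norm_dXt_le (hf : AnalyticOnNhd ℂ f (zone Δ s)) (hM : ∀ p ∈ zone Δ s, ‖f p‖ ≤ M)
    (hδ : 0 < δ) (h : r + δ ≤ s) (j : Fin 2) {p : Phase} (hp : p ∈ zone Δ r) :
    ‖dXt j f p‖ ≤ M / δ :=
  (((fderiv ℂ f p).le_opNorm _).trans (mul_le_of_le_one_right (norm_nonneg _)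
    (by simpa [Prod.norm_def] using norm_single_le_one j))).trans
    (norm_fderiv_le_of_zone hf hM hδ h hp)

theorem norm_dX_dXt_le (hf : AnalyticOnNhd ℂ f (zone Δ s)) (hM : ∀ p ∈ zone Δ s, ‖f p‖ ≤ M)
    (hδ : 0 < δ) (h : r + 2 * δ ≤ s) (j k : Fin 2) {p : Phase} (hp : p ∈ zone Δ r) :
    ‖dX j (dXt k f) p‖ ≤ M / δ / δ := by
  have hsub : zone Δ (r + δ) ⊆ zone Δ s := zone_mono (by linarith)
  exact norm_dX_le ((analyticOnNhd_dXt hf k).mono hsub)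
    (fun q hq => norm_dXt_le hf hM hδ (by linarith) k hq) hδ le_rfl j hp

theorem hasDerivAt_shrink_left (a b : ℝ) (p : Phase) :
    HasDerivAt (fun a : ℝ => shrink a b p) (0, 0, p.2.2.1, 0) a := by
  have h : HasDerivAt (fun t : ℝ => (t : ℂ) • ((0, 0, p.2.2.1, 0) : Phase)
      + ((p.1, p.2.1, 0, (b : ℂ) • p.2.2.2) : Phase)) ((1 : ℂ) • (0, 0, p.2.2.1, 0)) a :=
    ((Complex.ofRealCLM.hasDerivAt (x := a)).smul_const _).add_const _
  rw [one_smul] at h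
  refine h.congr_of_eventuallyEq (Eventually.of_forall fun t => ?_)
  simp [shrink]

theorem hasDerivAt_shrink_right (a : ℂ) (b : ℝ) (p : Phase) :
    HasDerivAt (fun b : ℝ => shrink a b p) (0, 0, 0, p.2.2.2) b := by
  have h : HasDerivAt (fun t : ℝ => (t : ℂ) • ((0, 0, 0, p.2.2.2) : Phase)
      + ((p.1, p.2.1, a • p.2.2.1, 0) : Phase)) ((1 : ℂ) • (0, 0, 0, p.2.2.2)) b :=
    ((Complex.ofRealCLM.hasDerivAt (x := b)).smul_const _).add_const _
  rw [one_smul] at h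
  refine h.congr_of_eventuallyEq (Eventually.of_forall fun t => ?_)
  simp [shrink]

theorem fderiv_x_eq_sum (p : Phase) (v : Vec) :
    fderiv ℂ f p (0, 0, v, 0) = ∑ j, v j * dX j f p := by
  have : ((0, 0, v, 0) : Phase) = ∑ j, v j • ((0, 0, Pi.single j 1, 0) : Phase) := by
    ext i <;> simp [Fin.sum_univ_two]
    fin_cases i <;> simp
  rw [this, map_sum]
  exact Finset.sum_congr rfl fun j _ => by rw [map_smul, smul_eq_mul]; rfl

theorem fderiv_xt_eq_sum (p : Phase) (v : Vec) :
    fderiv ℂ f p (0, 0, 0, v) = ∑ j, v j * dXt j f p := by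
  have : ((0, 0, 0, v) : Phase) = ∑ j, v j • ((0, 0, 0, Pi.single j 1) : Phase) := by
    ext i <;> simp [Fin.sum_univ_two]
    fin_cases i <;> simp
  rw [this, map_sum]
  exact Finset.sum_congr rfl fun j _ => by rw [map_smul, smul_eq_mul]; rfl

theorem analyticAt_shrink (p : Phase) (a b : ℂ) :
    AnalyticAt ℂ (fun z : (Phase × ℂ) × ℂ => shrink z.2 z.1.2 z.1.1) ((p, b), a) := by
  have h0 : AnalyticAt ℂ (fun z : (Phase × ℂ) × ℂ => z.1.1) ((p, b), a) :=
    analyticAt_fst.fun_comp analyticAt_fst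
  have h1 : AnalyticAt ℂ (fun z : (Phase × ℂ) × ℂ => z.1.2) ((p, b), a) :=
    analyticAt_snd.fun_comp analyticAt_fst
  have hL : ∀ {F : Type} [NormedAddCommGroup F] [NormedSpace ℂ F] (L : Phase →L[ℂ] F),
      AnalyticAt ℂ (fun z : (Phase × ℂ) × ℂ => L z.1.1) ((p, b), a) := fun L =>
    (L.analyticAt _).fun_comp h0
  exact (hL (ContinuousLinearMap.fst ℂ _ _)).prod
    ((hL ((ContinuousLinearMap.fst ℂ _ _).comp (ContinuousLinearMap.snd ℂ _ _))).prod
    ((analyticAt_snd.smul (hL ((ContinuousLinearMap.fst ℂ Vec Vec).comp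
      ((ContinuousLinearMap.snd ℂ _ _).comp (ContinuousLinearMap.snd ℂ _ _))))).prod
    (h1.smul (hL ((ContinuousLinearMap.snd ℂ Vec Vec).comp
      ((ContinuousLinearMap.snd ℂ _ _).comp (ContinuousLinearMap.snd ℂ _ _)))))))

theorem analyticAt_comp_shrink {p : Phase} {a b : ℂ} (hf : AnalyticAt ℂ f (shrink a b p)) :
    AnalyticAt ℂ (fun z : (Phase × ℂ) × ℂ => f (shrink z.2 z.1.2 z.1.1)) ((p, b), a) :=
  AnalyticAt.fun_comp (g := f) (f := fun z : (Phase × ℂ) × ℂ => shrink z.2 z.1.2 z.1.1) hf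
    (analyticAt_shrink p a b)

theorem analyticAt_integral_shrink (hf : AnalyticOnNhd ℂ f (zone Δ r)) {p : Phase}
    (hp : p ∈ zone Δ r) {b : ℂ} (hb : ‖b‖ ≤ 1) :
    AnalyticAt ℂ (fun z : Phase × ℂ => ∫ a in (0 : ℝ)..1, f (shrink a z.2 z.1)) (p, b) :=
  analyticAt_integral (G := fun z : (Phase × ℂ) × ℂ => f (shrink z.2 z.1.2 z.1.1))
    fun _ ht => analyticAt_comp_shrink
      (hf _ (shrink_mem_zone (norm_ofReal_le_one_of_mem_uIcc ht) hb hp))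

theorem analyticOnNhd_mixedCoef (hf : AnalyticOnNhd ℂ f (zone Δ r)) (j k : Fin 2) :
    AnalyticOnNhd ℂ (mixedCoef j k f) (zone Δ r) := fun _ hp =>
  analyticAt_integral (G := fun z : Phase × ℂ =>
      ∫ a in (0 : ℝ)..1, dX j (dXt k f) (shrink a z.2 z.1))
    fun _ ht => analyticAt_integral_shrink (analyticOnNhd_dX (analyticOnNhd_dXt hf k) j) hp
      (norm_ofReal_le_one_of_mem_uIcc ht)

theorem continuousOn_shrink_left (hf : AnalyticOnNhd ℂ f (zone Δ r)) {p : Phase}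
    (hp : p ∈ zone Δ r) {b : ℝ} (hb : ‖(b : ℂ)‖ ≤ 1) :
    ContinuousOn (fun a : ℝ => f (shrink a b p)) (uIcc 0 1) := fun t ht =>
  (ContinuousAt.comp (f := fun t : ℝ => shrink t b p)
    (hf _ (shrink_mem_zone (norm_ofReal_le_one_of_mem_uIcc ht) hb hp)).continuousAt
    (hasDerivAt_shrink_left t b p).continuousAt).continuousWithinAt

theorem continuousOn_shrink_right (hf : AnalyticOnNhd ℂ f (zone Δ r)) {p : Phase}
    (hp : p ∈ zone Δ r) {a : ℂ} (ha : ‖a‖ ≤ 1) :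
    ContinuousOn (fun b : ℝ => f (shrink a b p)) (uIcc 0 1) := fun t ht =>
  (ContinuousAt.comp (f := fun t : ℝ => shrink a t p)
    (hf _ (shrink_mem_zone ha (norm_ofReal_le_one_of_mem_uIcc ht) hp)).continuousAt
    (hasDerivAt_shrink_right a t p).continuousAt).continuousWithinAt

theorem continuousOn_integral_shrink (hf : AnalyticOnNhd ℂ f (zone Δ r)) {p : Phase}
    (hp : p ∈ zone Δ r) :
    ContinuousOn (fun b : ℝ => ∫ a in (0 : ℝ)..1, f (shrink a b p)) (uIcc 0 1) := fun t ht =>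
  (ContinuousAt.comp (f := fun t : ℝ => (p, (t : ℂ)))
    (analyticAt_integral_shrink hf hp (norm_ofReal_le_one_of_mem_uIcc ht)).continuousAt
    (by fun_prop)).continuousWithinAt

theorem sub_eq_sum_integral_dX (hf : AnalyticOnNhd ℂ f (zone Δ r)) {p : Phase}
    (hp : p ∈ zone Δ r) {b : ℝ} (hb : ‖(b : ℂ)‖ ≤ 1) :
    f (shrink 1 b p) - f (shrink 0 b p)
      = ∑ j, p.2.2.1 j * ∫ a in (0 : ℝ)..1, dX j f (shrink a b p) := by
  have hd : ∀ t ∈ uIcc (0 : ℝ) 1, HasDerivAt (fun a : ℝ => f (shrink a b p))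
      (∑ j, p.2.2.1 j * dX j f (shrink t b p)) t := by
    intro t ht
    rw [← fderiv_x_eq_sum]
    exact ((hf _ (shrink_mem_zone (norm_ofReal_le_one_of_mem_uIcc ht) hb
      hp)).differentiableAt.hasFDerivAt.restrictScalars ℝ).comp_hasDerivAt t
      (hasDerivAt_shrink_left t b p)
  have hc := fun j => (continuousOn_shrink_left (analyticOnNhd_dX hf j) hp hb).const_mul
    (p.2.2.1 j)
  have h := intervalIntegral.integral_eq_sub_of_hasDerivAt hd
    (continuousOn_finsetSum _ fun j _ => hc j).intervalIntegrable
  rw [intervalIntegral.integral_finsetSum fun j _ => (hc j).intervalIntegrable] at h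
  simp only [intervalIntegral.integral_const_mul, ofReal_one, ofReal_zero] at h
  exact h.symm

theorem sub_eq_sum_integral_dXt (hf : AnalyticOnNhd ℂ f (zone Δ r)) {p : Phase}
    (hp : p ∈ zone Δ r) {a : ℂ} (ha : ‖a‖ ≤ 1) :
    f (shrink a 1 p) - f (shrink a 0 p)
      = ∑ k, p.2.2.2 k * ∫ b in (0 : ℝ)..1, dXt k f (shrink a b p) := by
  have hd : ∀ t ∈ uIcc (0 : ℝ) 1, HasDerivAt (fun b : ℝ => f (shrink a b p))
      (∑ j, p.2.2.2 j * dXt j f (shrink a t p)) t := by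
    intro t ht
    rw [← fderiv_xt_eq_sum]
    exact ((hf _ (shrink_mem_zone ha (norm_ofReal_le_one_of_mem_uIcc ht)
      hp)).differentiableAt.hasFDerivAt.restrictScalars ℝ).comp_hasDerivAt t
      (hasDerivAt_shrink_right a t p)
  have hc := fun j => (continuousOn_shrink_right (analyticOnNhd_dXt hf j) hp ha).const_mul
    (p.2.2.2 j)
  have h := intervalIntegral.integral_eq_sub_of_hasDerivAt hd
    (continuousOn_finsetSum _ fun j _ => hc j).intervalIntegrable
  rw [intervalIntegral.integral_finsetSum fun j _ => (hc j).intervalIntegrable] at h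
  simp only [intervalIntegral.integral_const_mul, ofReal_one, ofReal_zero] at h
  exact h.symm

/-- The fundamental theorem of calculus is applied once in x̃ and once in x. The mixed second
difference kills all terms that depend on only one of the two groups, so only products x_j x̃_k are
produced. -/
theorem mixed_taylor (hf : AnalyticOnNhd ℂ f (zone Δ r)) {p : Phase} (hp : p ∈ zone Δ r) :
    f p - f (shrink 1 0 p) - f (shrink 0 1 p) + f (shrink 0 0 p)
      = ∑ j, ∑ k, mixedCoef j k f p * p.2.2.1 j * p.2.2.2 k := by
  have h1 := sub_eq_sum_integral_dXt hf hp (a := 1) (by simp)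
  have h0 := sub_eq_sum_integral_dXt hf hp (a := 0) (by simp)
  rw [shrink_one_one] at h1
  have hk : ∀ k, ((∫ b in (0 : ℝ)..1, dXt k f (shrink 1 b p))
      - ∫ b in (0 : ℝ)..1, dXt k f (shrink 0 b p)) = ∑ j, p.2.2.1 j * mixedCoef j k f p := by
    intro k
    have hg := analyticOnNhd_dXt hf k
    rw [← intervalIntegral.integral_sub
      (continuousOn_shrink_right hg hp (by simp)).intervalIntegrable
      (continuousOn_shrink_right hg hp (by simp)).intervalIntegrable,
      intervalIntegral.integral_congr fun b hb => sub_eq_sum_integral_dX hg hp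
        (norm_ofReal_le_one_of_mem_uIcc hb),
      intervalIntegral.integral_finsetSum fun j _ =>
        ((continuousOn_integral_shrink (analyticOnNhd_dX hg j) hp).const_mul
          _).intervalIntegrable]
    simp only [intervalIntegral.integral_const_mul]
    rfl
  calc f p - f (shrink 1 0 p) - f (shrink 0 1 p) + f (shrink 0 0 p)
      = (f p - f (shrink 1 0 p)) - (f (shrink 0 1 p) - f (shrink 0 0 p)) := by ring
    _ = ∑ k, p.2.2.2 k * ∑ j, p.2.2.1 j * mixedCoef j k f p := by
      rw [h1, h0, ← Finset.sum_sub_distrib]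
      exact Finset.sum_congr rfl fun k _ => by rw [← mul_sub, hk]
    _ = _ := by simp only [Fin.sum_univ_two]; ring

theorem norm_mixedCoef_sub_le (hf : AnalyticOnNhd ℂ f (zone Δ r)) {p : Phase}
    (hp : p ∈ zone Δ r) {j k : Fin 2} {K : ℂ} {B : ℝ}
    (h : ∀ a b : ℂ, ‖a‖ ≤ 1 → ‖b‖ ≤ 1 → ‖dX j (dXt k f) (shrink a b p) - K‖ ≤ B) :
    ‖mixedCoef j k f p - K‖ ≤ B := by
  have hg := analyticOnNhd_dX (analyticOnNhd_dXt hf k) j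
  have hu : ∀ t : ℝ, t ∈ uIoc (0 : ℝ) 1 → ‖(t : ℂ)‖ ≤ 1 := fun t ht =>
    norm_ofReal_le_one_of_mem_uIcc (uIoc_subset_uIcc ht)
  have hin : ∀ b : ℝ, ‖(b : ℂ)‖ ≤ 1 →
      ‖(∫ a in (0 : ℝ)..1, dX j (dXt k f) (shrink a b p)) - K‖ ≤ B := by
    intro b hb
    have e : (∫ a in (0 : ℝ)..1, dX j (dXt k f) (shrink a b p)) - K
        = ∫ a in (0 : ℝ)..1, (dX j (dXt k f) (shrink a b p) - K) := by
      rw [intervalIntegral.integral_sub (continuousOn_shrink_left hg hp hb).intervalIntegrable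
        intervalIntegrable_const]
      simp
    rw [e]
    simpa using intervalIntegral.norm_integral_le_of_norm_le_const (a := (0 : ℝ)) (b := 1)
      fun t ht => h t b (hu t ht) hb
  have e : mixedCoef j k f p - K
      = ∫ b in (0 : ℝ)..1, ((∫ a in (0 : ℝ)..1, dX j (dXt k f) (shrink a b p)) - K) := by
    rw [intervalIntegral.integral_sub (continuousOn_integral_shrink hg hp).intervalIntegrable
      intervalIntegrable_const]
    simp [mixedCoef]
  rw [e]
  simpa using intervalIntegral.norm_integral_le_of_norm_le_const (a := (0 : ℝ)) (b := 1)
    fun t ht => hin t (hu t ht)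

/-- Invariance under the rotations of the eccentricity variables. -/
def RotInv (f : Phase → ℂ) (K : Set Phase) : Prop :=
  ∀ p ∈ K, ∀ θ : ℝ, f (shrink (exp (I * θ)) (exp (-(I * θ))) p) = f p

/-- With x̃ = 0, rotation invariance makes w ↦ f(w x) constant on the unit circle, and the mean
value property equates this constant with the value at the centre. Invariant functions thus have no
terms in x alone. -/
theorem apply_shrink_left (hf : AnalyticOnNhd ℂ f (zone Δ r)) (h : RotInv f (zone Δ r))
    {p : Phase} (hp : p ∈ zone Δ r) : f (shrink 1 0 p) = f (shrink 0 0 p) := by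
  have hd : DifferentiableOn ℂ (fun w : ℂ => f (shrink w 0 p)) (closedBall 0 1) := by
    intro w hw
    rw [mem_closedBall, dist_zero_right] at hw
    have h1 := analyticAt_comp_shrink (hf _ (shrink_mem_zone hw (b := 0) (by simp) hp))
    have h2 : AnalyticAt ℂ (fun w : ℂ => f (shrink w 0 p)) w :=
      AnalyticAt.fun_comp (f := fun w : ℂ => ((p, (0 : ℂ)), w)) h1
        (analyticAt_const.prod analyticAt_id)
    exact h2.differentiableAt.differentiableWithinAt
  have h1 := DiffContOnCl.circleAverage (f := fun w : ℂ => f (shrink w 0 p)) (c := 0) (R := 1)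
    (by rw [abs_one]; exact (hd.diffContOnCl_ball subset_rfl))
  have h2 := Real.circleAverage_const_on_circle (f := fun w : ℂ => f (shrink w 0 p)) (c := 0) (R := 1)
    (a := f (shrink 1 0 p)) (by
      intro w hw
      rw [abs_one, mem_sphere, dist_zero_right] at hw
      have hw' : w = exp (I * (arg w : ℝ)) := by
        conv_lhs => rw [← norm_mul_exp_arg_mul_I w, hw]
        rw [ofReal_one, one_mul, mul_comm]
      have := h _ (shrink_mem_zone (a := 1) (b := 0) (by simp) (by simp) hp) (arg w)
      rw [← hw'] at this
      rw [← this]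
      simp [shrink])
  exact h2.symm.trans h1

theorem apply_shrink_right (hf : AnalyticOnNhd ℂ f (zone Δ r)) (h : RotInv f (zone Δ r))
    {p : Phase} (hp : p ∈ zone Δ r) : f (shrink 0 1 p) = f (shrink 0 0 p) := by
  have hd : DifferentiableOn ℂ (fun w : ℂ => f (shrink 0 w p)) (closedBall 0 1) := by
    intro w hw
    rw [mem_closedBall, dist_zero_right] at hw
    have h1 := analyticAt_comp_shrink (hf _ (shrink_mem_zone (a := 0) (by simp) hw hp))
    have h2 : AnalyticAt ℂ (fun w : ℂ => f (shrink 0 w p)) w :=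
      AnalyticAt.fun_comp (f := fun w : ℂ => ((p, w), (0 : ℂ))) h1
        ((analyticAt_const.prod analyticAt_id).prod analyticAt_const)
    exact h2.differentiableAt.differentiableWithinAt
  have h1 := DiffContOnCl.circleAverage (f := fun w : ℂ => f (shrink 0 w p)) (c := 0) (R := 1)
    (by rw [abs_one]; exact (hd.diffContOnCl_ball subset_rfl))
  have h2 := Real.circleAverage_const_on_circle (f := fun w : ℂ => f (shrink 0 w p)) (c := 0) (R := 1)
    (a := f (shrink 0 1 p)) (by
      intro w hw
      rw [abs_one, mem_sphere, dist_zero_right] at hw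
      have hw' : w = exp (-(I * (-arg w : ℝ))) := by
        conv_lhs => rw [← norm_mul_exp_arg_mul_I w, hw]
        rw [ofReal_one, one_mul, mul_comm]
        push_cast; ring_nf
      have := h _ (shrink_mem_zone (a := 0) (b := 1) (by simp) (by simp) hp) (-arg w)
      rw [← hw'] at this
      rw [← this]
      simp [shrink])
  exact h2.symm.trans h1

/-- Decomposition of a function satisfying the D'Alembert rule and independent of the fast
angle. -/
theorem eq_add_sum_mixedCoef (hf : AnalyticOnNhd ℂ f (zone Δ r)) (h : RotInv f (zone Δ r))
    {p : Phase} (hp : p ∈ zone Δ r) :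
    f p = f (shrink 0 0 p) + ∑ j, ∑ k, mixedCoef j k f p * p.2.2.1 j * p.2.2.2 k := by
  rw [← mixed_taylor hf hp, apply_shrink_left hf h hp, apply_shrink_right hf h hp]
  ring

theorem RotInv.of_rot (hr : ∀ θ, (rotSymm Δ θ).Inv f (zone Δ r)) (h : FastInv f (zone Δ r)) :
    RotInv f (zone Δ r) := by
  intro p hp θ
  have h1 := hr θ p hp
  have hmem : shrink (exp (I * θ)) (exp (-(I * θ))) p ∈ zone Δ r := by
    refine shrink_mem_zone (norm_exp_I_mul_ofReal θ).le (norm_exp_neg_I_mul_ofReal θ).le hp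
  have h2 : rot θ p = shrink (exp (I * θ)) (exp (-(I * θ))) p + (θ : ℂ) • eFast := by
    rw [rot, rotLin_apply]; rfl
  rw [rotSymm_map, h2, h _ hmem] at h1
  exact h1

/-- The change of sign of the eccentricity variables. -/
noncomputable def negEcc : Phase →L[ℂ] Phase :=
  (ContinuousLinearMap.id ℂ Vec).prodMap ((ContinuousLinearMap.id ℂ Vec).prodMap
    (-ContinuousLinearMap.id ℂ (Vec × Vec)))

theorem negEcc_apply (p : Phase) : negEcc p = (p.1, p.2.1, -p.2.2.1, -p.2.2.2) := rfl

theorem negEcc_eq (p : Phase) : negEcc p = shrink (-1) (-1) p := by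
  simp [negEcc_apply, shrink]

theorem negEcc_mem_zone {p : Phase} (hp : p ∈ zone Δ r) : negEcc p ∈ zone Δ r := by
  rw [negEcc_eq]; exact shrink_mem_zone (by simp) (by simp) hp

theorem RotInv.apply_negEcc (h : RotInv f (zone Δ r)) {p : Phase} (hp : p ∈ zone Δ r) :
    f (negEcc p) = f p := by
  have h1 := h p hp Real.pi
  have e : exp (I * (Real.pi : ℝ)) = -1 := by rw [mul_comm]; exact exp_pi_mul_I
  rw [exp_neg, e] at h1
  rw [negEcc_eq, ← h1]
  norm_num

theorem fderiv_negEcc {c : ℂ} (hrs : r < s) (hf : AnalyticOnNhd ℂ f (zone Δ s))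
    (h : ∀ p ∈ zone Δ s, f (negEcc p) = c * f p) {p : Phase} (hp : p ∈ zone Δ r) (v : Phase) :
    fderiv ℂ f (negEcc p) (negEcc v) = c * fderiv ℂ f p v := by
  have hps := zone_mono hrs.le hp
  have h1 : HasFDerivAt (fun q => f (negEcc q)) ((fderiv ℂ f (negEcc p)).comp negEcc) p :=
    HasFDerivAt.comp p (hf _ (negEcc_mem_zone hps)).differentiableAt.hasFDerivAt
      negEcc.hasFDerivAt
  have h2 : HasFDerivAt (fun q => f (negEcc q)) (c • fderiv ℂ f p) p :=
    ((hf _ hps).differentiableAt.hasFDerivAt.const_mul c).congr_of_eventuallyEq (by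
      filter_upwards [zone_mem_nhds hp hrs] with q hq using h q hq)
  have := congrArg (fun T : Phase →L[ℂ] ℂ => T v) (h1.unique h2)
  simpa using this

/-- Rotation by π changes the sign of all eccentricity variables, so an invariant function is even
in them, and so are its second derivatives. -/
theorem RotInv.dX_dXt_negEcc (hrs : r < s) (hf : AnalyticOnNhd ℂ f (zone Δ s))
    (h : RotInv f (zone Δ s)) (j k : Fin 2) {p : Phase} (hp : p ∈ zone Δ r) :
    dX j (dXt k f) (negEcc p) = dX j (dXt k f) p := by
  obtain ⟨r', hrr', hr's⟩ := exists_between hrs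
  have h1 : ∀ q ∈ zone Δ r', dXt k f (negEcc q) = -1 * dXt k f q := by
    intro q hq
    have := fderiv_negEcc (c := 1) hr's hf
      (fun q hq => by rw [h.apply_negEcc hq, one_mul]) hq (-(0, 0, 0, Pi.single k 1))
    rw [map_neg, map_neg, map_neg, one_mul] at this
    have e : negEcc (0, 0, 0, Pi.single k 1) = -(0, 0, 0, Pi.single k 1) := by
      simp [negEcc_apply]
    rw [e, map_neg, neg_neg] at this
    rw [dXt, this, dXt]; ring
  have := fderiv_negEcc (c := -1) hrr' ((analyticOnNhd_dXt hf k).mono (zone_mono hr's.le)) h1 hp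
    (-(0, 0, Pi.single j 1, 0))
  have e : negEcc (0, 0, Pi.single j 1, 0) = -(0, 0, Pi.single j 1, 0) := by
    simp [negEcc_apply]
  rw [map_neg, e, neg_neg, map_neg] at this
  rw [dX, this, dX]; ring

/-- Adding the Taylor estimates at a point and at its mirror image cancels the linear term. The
error is therefore quadratic in the eccentricities, of order ε^β and not ε^(β/2) on the domains used
later. -/
theorem norm_dX_dXt_sub_shrink_le (hf : AnalyticOnNhd ℂ f (zone Δ s))
    (hM : ∀ p ∈ zone Δ s, ‖f p‖ ≤ M) (h : RotInv f (zone Δ s)) (hδ : 0 < δ)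
    (hr : r + 5 * δ ≤ s) (j k : Fin 2) {p : Phase} (hp : p ∈ zone Δ r) (hx : ‖p.2.2‖ ≤ δ) :
    ‖dX j (dXt k f) p - dX j (dXt k f) (shrink 0 0 p)‖ ≤ M / δ ^ 4 * ‖p.2.2‖ ^ 2 := by
  set N := dX j (dXt k f) with hN
  have hNa : AnalyticOnNhd ℂ N (zone Δ s) := analyticOnNhd_dX (analyticOnNhd_dXt hf k) j
  have h0 : shrink 0 0 p ∈ zone Δ r := shrink_mem_zone (by simp) (by simp) hp
  have hsub : closedBall (shrink 0 0 p) (3 * δ) ⊆ zone Δ (r + 3 * δ) :=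
    closedBall_subset_zone h0 le_rfl
  have hd1 : p - shrink 0 0 p = (0, 0, p.2.2.1, p.2.2.2) := by ext <;> simp [shrink]
  have hd2 : negEcc p - shrink 0 0 p = -(0, 0, p.2.2.1, p.2.2.2) := by
    ext <;> simp [shrink, negEcc_apply]
  have hn : ‖((0, 0, p.2.2.1, p.2.2.2) : Phase)‖ = ‖p.2.2‖ := by
    simp [Prod.norm_def]
  have key := fun q hq => norm_sub_sub_fderiv_le_of_closedBall (f := N) (x₀ := shrink 0 0 p)
    (p := shrink 0 0 p) (q := q) (M := M / δ / δ) hδ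
    (fun y hy => (hNa y (zone_mono (by linarith) (hsub hy))).differentiableAt)
    (fun y hy => norm_dX_dXt_le hf hM hδ (by linarith) j k (hsub hy))
    (mem_closedBall_self hδ.le) hq
  have k1 := key p (by rw [mem_closedBall, dist_eq_norm, hd1, hn]; exact hx)
  have k2 := key (negEcc p) (by rw [mem_closedBall, dist_eq_norm, hd2, norm_neg, hn]; exact hx)
  rw [hd1, hn] at k1
  rw [hd2, norm_neg, hn, map_neg, hN, h.dX_dXt_negEcc (by linarith) hf j k hp, ← hN] at k2
  have e : (2 : ℂ) * (N p - N (shrink 0 0 p))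
      = (N p - N (shrink 0 0 p) - fderiv ℂ N (shrink 0 0 p) (0, 0, p.2.2.1, p.2.2.2))
      + (N p - N (shrink 0 0 p) - -fderiv ℂ N (shrink 0 0 p) (0, 0, p.2.2.1, p.2.2.2)) := by ring
  have h3 : 2 * ‖N p - N (shrink 0 0 p)‖ ≤ 2 * (M / δ / δ / δ ^ 2 * ‖p.2.2‖ ^ 2) := by
    calc _ = ‖(2 : ℂ) * (N p - N (shrink 0 0 p))‖ := by rw [norm_mul, Complex.norm_ofNat]
      _ ≤ _ := by rw [e]; exact (norm_add_le _ _).trans (by linarith)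
  calc _ ≤ M / δ / δ / δ ^ 2 * ‖p.2.2‖ ^ 2 := by linarith
    _ = _ := by field_simp

/-- The circular configuration with vanishing actions and the same angles. -/
def circular (p : Phase) : Phase := (0, p.2.1, 0, 0)

theorem circular_mem_zone (hr : 0 ≤ s) {p : Phase} (hp : p ∈ zone Δ r) (hrs : r ≤ s) :
    circular p ∈ zone Δ s := by
  obtain ⟨h1, ⟨θ, hθ, h2⟩, h3⟩ := mem_zone_iff.1 hp
  exact mem_zone_iff.2 ⟨by simpa [circular] using hr, ⟨θ, hθ, h2.trans hrs⟩,
    by simpa [circular] using hr⟩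

theorem norm_shrink_sub_circular (p : Phase) : ‖shrink 0 0 p - circular p‖ = ‖p.1‖ := by
  simp [shrink, circular, Prod.norm_def]

theorem norm_dX_dXt_sub_circular_le (hf : AnalyticOnNhd ℂ f (zone Δ s))
    (hM : ∀ p ∈ zone Δ s, ‖f p‖ ≤ M) (h : RotInv f (zone Δ s)) (hδ : 0 < δ) (hr0 : 0 ≤ r)
    (hr : r + 5 * δ ≤ s) (j k : Fin 2) {p : Phase} (hp : p ∈ zone Δ r) (hx : ‖p.2.2‖ ≤ δ) :
    ‖dX j (dXt k f) p - dX j (dXt k f) (circular p)‖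
      ≤ M / δ ^ 4 * ‖p.2.2‖ ^ 2 + M / δ ^ 3 * ‖p.1‖ := by
  have h1 := norm_dX_dXt_sub_shrink_le hf hM h hδ hr j k hp hx
  have hNa : AnalyticOnNhd ℂ (dX j (dXt k f)) (zone Δ s) :=
    analyticOnNhd_dX (analyticOnNhd_dXt hf k) j
  have h0 : shrink 0 0 p ∈ zone Δ r := shrink_mem_zone (by simp) (by simp) hp
  have h2 := norm_sub_le_of_zone (r := r) (K := M / δ / δ / δ)
    (hNa.mono (zone_mono (by linarith)))
    (fun q hq => norm_fderiv_le_of_zone (r := r) (s := r + δ)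
      (hNa.mono (zone_mono (by linarith)))
      (fun z hz => norm_dX_dXt_le hf hM hδ (by linarith) j k hz) hδ le_rfl hq)
    (circular_mem_zone hr0 hp le_rfl) h0
  rw [norm_shrink_sub_circular] at h2
  calc _ = ‖(dX j (dXt k f) p - dX j (dXt k f) (shrink 0 0 p))
        + (dX j (dXt k f) (shrink 0 0 p) - dX j (dXt k f) (circular p))‖ := by congr 1; ring
    _ ≤ _ := (norm_add_le _ _).trans (add_le_add h1 (h2.trans_eq (by field_simp)))

theorem dX_dXt_sub {g : Phase → ℂ} (hf : AnalyticOnNhd ℂ f (zone Δ s))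
    (hg : AnalyticOnNhd ℂ g (zone Δ s)) (hrs : r < s) (j k : Fin 2) {p : Phase}
    (hp : p ∈ zone Δ r) : dX j (dXt k fun q => f q - g q) p
      = dX j (dXt k f) p - dX j (dXt k g) p := by
  have h1 : dXt k (fun q => f q - g q) =ᶠ[𝓝 p] fun q => dXt k f q - dXt k g q := by
    filter_upwards [zone_mem_nhds hp hrs] with q hq
    rw [dXt, fderiv_fun_sub (hf q hq).differentiableAt (hg q hq).differentiableAt]
    rfl
  have hps := zone_mono hrs.le hp
  rw [dX, h1.fderiv_eq, fderiv_fun_sub (analyticOnNhd_dXt hf k p hps).differentiableAt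
    (analyticOnNhd_dXt hg k p hps).differentiableAt]
  rfl

end Eccentricity

/-! ### Calculus of mixed second order jets. -/

section Jets

/-- The value and the derivatives `∂₁`, `∂₂`, `∂₁∂₂` of a function of two complex variables at the
origin. -/
structure MixedJet (F : ℂ → ℂ → ℂ) (a b c d : ℂ) : Prop where
  value : F 0 0 = a
  left : HasDerivAt (fun s => F s 0) b 0
  right : ∃ F' : ℂ → ℂ, (∀ᶠ s in 𝓝 0, HasDerivAt (F s) (F' s) 0) ∧ HasDerivAt F' d 0 ∧ F' 0 = c

variable {F G : ℂ → ℂ → ℂ} {a b c d a' b' c' d' : ℂ}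

/-- Uniqueness serves in two ways: it identifies jets computed by rules with Fréchet derivatives,
and it solves for the unknown coefficients of a function given implicitly. -/
theorem MixedJet.unique (h : MixedJet F a b c d) (h' : MixedJet F a' b' c' d') :
    a = a' ∧ b = b' ∧ c = c' ∧ d = d' := by
  obtain ⟨F₁, k1, k2, k3⟩ := h.right
  obtain ⟨F₂, l1, l2, l3⟩ := h'.right
  have e : F₁ =ᶠ[𝓝 0] F₂ := by filter_upwards [k1, l1] with s h1 h2 using h1.unique h2
  exact ⟨h.value.symm.trans h'.value, h.left.unique h'.left,
    k3.symm.trans (e.eq_of_nhds.trans l3), k2.unique (l2.congr_of_eventuallyEq e)⟩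

theorem MixedJet.congr (h : MixedJet F a b c d) (e : ∀ᶠ z : ℂ × ℂ in 𝓝 0, G z.1 z.2 = F z.1 z.2) :
    MixedJet G a b c d := by
  rw [show (0 : ℂ × ℂ) = (0, 0) from rfl, nhds_prod_eq] at e
  have e1 := e.curry
  have e2 : ∀ᶠ s in 𝓝 (0 : ℂ), G s 0 = F s 0 := e1.mono fun s hs => hs.self_of_nhds
  obtain ⟨F', k1, k2, k3⟩ := h.right
  exact ⟨e2.self_of_nhds.trans h.value, h.left.congr_of_eventuallyEq e2, F', by
    filter_upwards [k1, e1] with s h1 h2 using h1.congr_of_eventuallyEq h2, k2, k3⟩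

theorem MixedJet.of_eq (h : MixedJet F a b c d) (ha : a = a') (hb : b = b') (hc : c = c')
    (hd : d = d') : MixedJet F a' b' c' d' := by rwa [← ha, ← hb, ← hc, ← hd]

theorem mixedJet_const (a : ℂ) : MixedJet (fun _ _ => a) a 0 0 0 :=
  ⟨rfl, hasDerivAt_const _ _, fun _ => 0, Eventually.of_forall fun _ => hasDerivAt_const _ _,
    hasDerivAt_const _ _, rfl⟩

theorem mixedJet_left (α : ℂ) : MixedJet (fun s _ => α * s) 0 α 0 0 :=
  ⟨mul_zero _, by simpa using (hasDerivAt_id (0 : ℂ)).const_mul α, fun _ => 0,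
    Eventually.of_forall fun _ => hasDerivAt_const _ _, hasDerivAt_const _ _, rfl⟩

theorem mixedJet_right (β : ℂ) : MixedJet (fun _ u => β * u) 0 0 β 0 :=
  ⟨mul_zero _, hasDerivAt_const _ _, fun _ => β,
    Eventually.of_forall fun _ => by simpa using (hasDerivAt_id (0 : ℂ)).const_mul β,
    hasDerivAt_const _ _, rfl⟩

theorem MixedJet.add (h : MixedJet F a b c d) (h' : MixedJet G a' b' c' d') :
    MixedJet (fun s u => F s u + G s u) (a + a') (b + b') (c + c') (d + d') := by
  obtain ⟨F₁, k1, k2, k3⟩ := h.right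
  obtain ⟨F₂, l1, l2, l3⟩ := h'.right
  refine ⟨by rw [h.value, h'.value], h.left.add h'.left, fun s => F₁ s + F₂ s, ?_, k2.add l2,
    by beta_reduce; rw [k3, l3]⟩
  filter_upwards [k1, l1] with s h1 h2 using h1.add h2

theorem MixedJet.mul (h : MixedJet F a b c d) (h' : MixedJet G a' b' c' d') :
    MixedJet (fun s u => F s u * G s u) (a * a') (b * a' + a * b') (c * a' + a * c')
      (d * a' + c * b' + (b * c' + a * d')) := by
  obtain ⟨F₁, k1, k2, k3⟩ := h.right
  obtain ⟨F₂, l1, l2, l3⟩ := h'.right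
  refine ⟨by rw [h.value, h'.value], ?_, fun s => F₁ s * G s 0 + F s 0 * F₂ s, ?_, ?_,
    by beta_reduce; rw [k3, l3, h.value, h'.value]⟩
  · have := h.left.mul h'.left
    rwa [h.value, h'.value] at this
  · filter_upwards [k1, l1] with s h1 h2 using h1.mul h2
  · have := (k2.mul h'.left).add (h.left.mul l2)
    rwa [h.value, h'.value, k3, l3] at this

/-- The mixed derivative of a composite involves only the first derivatives and the mixed derivative
of the inner function. Pure second derivatives never enter, so jets need not record them. -/
theorem MixedJet.comp {φ φ' : ℂ → ℂ} {φ'' : ℂ} (h : MixedJet F a b c d)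
    (h1 : ∀ᶠ z in 𝓝 a, HasDerivAt φ (φ' z) z) (h2 : HasDerivAt φ' φ'' a) :
    MixedJet (fun s u => φ (F s u)) (φ a) (φ' a * b) (φ' a * c) (φ'' * b * c + φ' a * d) := by
  obtain ⟨F₁, k1, k2, k3⟩ := h.right
  have hc : Tendsto (fun s => F s 0) (𝓝 0) (𝓝 a) := by
    have := h.left.continuousAt.tendsto
    rwa [h.value] at this
  have h2' : HasDerivAt φ' φ'' (F 0 0) := by rwa [h.value]
  refine ⟨by rw [h.value], ?_, fun s => φ' (F s 0) * F₁ s, ?_, ?_, by beta_reduce; rw [k3, h.value]⟩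
  · have h0 : HasDerivAt φ (φ' a) (F 0 0) := by rw [h.value]; exact h1.self_of_nhds
    exact HasDerivAt.comp (h := fun s => F s 0) (0 : ℂ) h0 h.left
  · filter_upwards [k1, hc.eventually h1] with s k l using l.comp 0 k
  · have := (HasDerivAt.comp (h := fun s => F s 0) (0 : ℂ) h2' h.left).mul k2
    simp only [Function.comp_def] at this
    rwa [h.value, k3] at this

theorem MixedJet.const_mul (h : MixedJet F a b c d) (r : ℂ) :
    MixedJet (fun s u => r * F s u) (r * a) (r * b) (r * c) (r * d) :=
  ((mixedJet_const r).mul h).of_eq rfl (by ring) (by ring) (by ring)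

theorem MixedJet.neg (h : MixedJet F a b c d) : MixedJet (fun s u => -F s u) (-a) (-b) (-c) (-d) := by
  simpa using h.const_mul (-1)

theorem MixedJet.sub (h : MixedJet F a b c d) (h' : MixedJet G a' b' c' d') :
    MixedJet (fun s u => F s u - G s u) (a - a') (b - b') (c - c') (d - d') := by
  simpa only [sub_eq_add_neg] using h.add h'.neg

theorem MixedJet.exp (h : MixedJet F a b c d) : MixedJet (fun s u => exp (F s u)) (exp a)
    (exp a * b) (exp a * c) (exp a * b * c + exp a * d) :=
  h.comp (Eventually.of_forall fun z => hasDerivAt_exp z) (hasDerivAt_exp a)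

theorem MixedJet.inv (h : MixedJet F a b c d) (ha : a ≠ 0) : MixedJet (fun s u => (F s u)⁻¹) a⁻¹
    (-(a⁻¹ ^ 2) * b) (-(a⁻¹ ^ 2) * c) (2 * a⁻¹ ^ 3 * b * c + -(a⁻¹ ^ 2) * d) := by
  refine h.comp (φ := fun z => z⁻¹) (φ' := fun z => -(z⁻¹ ^ 2)) ?_ ?_
  · filter_upwards [isOpen_ne.mem_nhds ha] with z hz
    simpa using hasDerivAt_inv hz
  · have := ((hasDerivAt_inv ha).pow 2).neg
    refine this.congr_deriv ?_
    rw [← inv_pow]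
    push_cast
    ring

theorem MixedJet.sqrt (h : MixedJet F a b c d) (ha : a ∈ slitPlane) :
    MixedJet (fun s u => F s u ^ (1 / 2 : ℂ)) (a ^ (1 / 2 : ℂ))
      ((a ^ (1 / 2 : ℂ))⁻¹ / 2 * b) ((a ^ (1 / 2 : ℂ))⁻¹ / 2 * c)
      (-((a ^ (1 / 2 : ℂ))⁻¹ ^ 3 / 4) * b * c + (a ^ (1 / 2 : ℂ))⁻¹ / 2 * d) := by
  have key : ∀ z ∈ slitPlane, HasDerivAt (fun z : ℂ => z ^ (1 / 2 : ℂ))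
      ((z ^ (1 / 2 : ℂ))⁻¹ / 2) z := by
    intro z hz
    have := (hasDerivAt_id z).cpow_const (c := 1 / 2) hz
    refine this.congr_deriv ?_
    rw [← cpow_neg]
    norm_num
    ring
  refine h.comp (φ := fun z => z ^ (1 / 2 : ℂ)) (φ' := fun z => (z ^ (1 / 2 : ℂ))⁻¹ / 2) ?_ ?_
  · filter_upwards [isOpen_slitPlane.mem_nhds ha] with z hz using key z hz
  · have h0 : a ^ (1 / 2 : ℂ) ≠ 0 :=
      (cpow_ne_zero_iff_of_exponent_ne_zero (by norm_num)).2 (slitPlane_ne_zero ha)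
    have := ((key a ha).inv h0).div_const 2
    refine this.congr_deriv ?_
    field_simp
    norm_num

theorem mixedJet_of_analyticAt {E : Type*} [NormedAddCommGroup E] [NormedSpace ℂ E] {g : E → ℂ}
    {p : E} (hg : AnalyticAt ℂ g p) (v w : E) :
    MixedJet (fun s u => g (p + s • v + u • w)) (g p) (fderiv ℂ g p v) (fderiv ℂ g p w)
      (fderiv ℂ (fun q => fderiv ℂ g q w) p v) := by
  have hl : ∀ (q v : E) (t : ℂ), HasDerivAt (fun s : ℂ => q + s • v) v t := fun q v t => by
    simpa using ((hasDerivAt_id t).smul_const v).const_add q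
  refine ⟨by simp, ?_, fun s => fderiv ℂ g (p + s • v) w, ?_, ?_, by simp⟩
  · have h0 : HasFDerivAt g (fderiv ℂ g p) (p + (0 : ℂ) • v) := by
      simpa using hg.differentiableAt.hasFDerivAt
    simpa [Function.comp_def] using h0.comp_hasDerivAt 0 (hl p v 0)
  · have ht : Tendsto (fun s : ℂ => p + s • v) (𝓝 0) (𝓝 p) := by
      have := (hl p v 0).continuousAt.tendsto
      simpa using this
    filter_upwards [ht.eventually hg.eventually_analyticAt] with s hs
    have h0 : HasFDerivAt g (fderiv ℂ g (p + s • v)) (p + s • v + (0 : ℂ) • w) := by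
      simpa using hs.differentiableAt.hasFDerivAt
    exact h0.comp_hasDerivAt 0 (hl _ w 0)
  · have h1 : DifferentiableAt ℂ (fun q => fderiv ℂ g q w) p :=
      (((ContinuousLinearMap.apply ℂ ℂ w).analyticAt _).comp hg.fderiv).differentiableAt
    have h0 : HasFDerivAt (fun q => fderiv ℂ g q w) (fderiv ℂ (fun q => fderiv ℂ g q w) p)
        (p + (0 : ℂ) • v) := by
      simpa using h1.hasFDerivAt
    exact h0.comp_hasDerivAt 0 (hl p v 0)

end Jets

/-! ### Jets of the Keplerian motion at circular orbits. -/

section KeplerJets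

variable {Λ lam α β : ℂ}

theorem kepS_zero_sq : kepS Λ 0 0 ^ 2 = 2 / Λ := by
  have h : ∀ w : ℂ, (w ^ (1 / 2 : ℂ)) ^ 2 = w := fun w => by
    simp
  rw [kepS, kepQ_zero, sub_zero, div_pow, h, h]

theorem mixedJet_kepQ (hΛ : Λ ∈ slitPlane) : MixedJet (fun s u => kepQ Λ (α * s) (β * u))
    0 0 0 (I * (α * kepS Λ 0 0) * (β * kepS Λ 0 0) / 2) := by
  have h := (((mixedJet_left α).mul (mixedJet_right β)).const_mul (I / Λ))
  refine (h.congr (Eventually.of_forall fun z => ?_)).of_eq (by ring) (by ring) (by ring) ?_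
  · simp only [kepQ]; ring
  · have := kepS_zero_sq (Λ := Λ)
    have e : I * (α * kepS Λ 0 0) * (β * kepS Λ 0 0) / 2 = I * α * β / 2 * kepS Λ 0 0 ^ 2 := by ring
    rw [e, this]
    field_simp [slitPlane_ne_zero hΛ]
    ring

/-- This factor is only used multiplied by an eccentricity variable that vanishes at the origin, so
its mixed derivative may remain unspecified. -/
theorem mixedJet_kepS (hΛ : Λ ∈ slitPlane) :
    ∃ d, MixedJet (fun s u => kepS Λ (α * s) (β * u)) (kepS Λ 0 0) 0 0 d := by
  have h := ((((mixedJet_const 2).sub (mixedJet_kepQ (α := α) (β := β) hΛ)).sqrt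
    (by rw [sub_zero]; exact Or.inl (by norm_num))).const_mul ((Λ ^ (1 / 2 : ℂ))⁻¹))
  refine ⟨_, (h.congr (Eventually.of_forall fun z => ?_)).of_eq ?_ (by ring) (by ring) rfl⟩
  · simp only [kepS]; ring
  · rw [kepS, kepQ_zero]; ring

theorem mixedJet_kepZ (hΛ : Λ ∈ slitPlane) :
    MixedJet (fun s u => α * s * kepS Λ (α * s) (β * u)) 0 (α * kepS Λ 0 0) 0 0 := by
  obtain ⟨d, h⟩ := mixedJet_kepS (α := α) (β := β) hΛ
  exact ((mixedJet_left α).mul h).of_eq (by ring) (by ring) (by ring) (by ring)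

theorem mixedJet_kepZb (hΛ : Λ ∈ slitPlane) :
    MixedJet (fun s u => I * (β * u) * kepS Λ (α * s) (β * u)) 0 0 (I * (β * kepS Λ 0 0)) 0 := by
  obtain ⟨d, h⟩ := mixedJet_kepS (α := α) (β := β) hΛ
  exact (((mixedJet_right β).const_mul I).mul h).of_eq (by ring) (by ring) (by ring) (by ring)

/-- Analyticity provides some jet, and substituting it into Kepler's equation gives a second one.
The prefactors z and z̄ vanish at the origin, so equating the two expresses the first derivatives
explicitly and then the mixed one, whose two contributions cancel. -/
theorem mixedJet_kepF (hΛ : Λ ∈ slitPlane) :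
    MixedJet (fun s u => kepF Λ lam (α * s) (β * u)) lam
      (I / 2 * (α * kepS Λ 0 0) * exp (-(I * lam))) (β * kepS Λ 0 0 / 2 * exp (I * lam)) 0 := by
  have hx : AnalyticAt ℂ (fun z : ℂ × ℂ => α * z.1) 0 := analyticAt_const.mul analyticAt_fst
  have hxt : AnalyticAt ℂ (fun z : ℂ × ℂ => β * z.2) 0 := analyticAt_const.mul analyticAt_snd
  have hF := analyticAt_kepF (lf := fun _ => lam) (analyticAt_const (v := Λ)) analyticAt_const hx hxt
    hΛ (by simp) (by simp)
  have hgood := eventually_kepGood (B := |lam.im| + 1) (lf := fun _ => lam)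
    (analyticAt_const (v := Λ)) analyticAt_const hx hxt hΛ (by simp) (by simp) (by linarith)
  have j0 := (mixedJet_of_analyticAt hF (1, 0) (0, 1)).congr
    (G := fun s u => kepF Λ lam (α * s) (β * u)) (Eventually.of_forall fun z => by simp)
  simp only [Prod.fst_zero, Prod.snd_zero, mul_zero, kepF_zero] at j0
  set b := fderiv ℂ (fun z : ℂ × ℂ => kepF Λ lam (α * z.1) (β * z.2)) 0 (1, 0)
  set c := fderiv ℂ (fun z : ℂ × ℂ => kepF Λ lam (α * z.1) (β * z.2)) 0 (0, 1)
  have hz := mixedJet_kepZ (α := α) (β := β) hΛ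
  have hzb := mixedJet_kepZb (α := α) (β := β) hΛ
  have j1 := (mixedJet_const lam).add
    (((hzb.mul (j0.const_mul I).exp).sub (hz.mul (j0.const_mul I).neg.exp)).const_mul (2 * I)⁻¹)
  have j2 := j1.congr (G := fun s u => kepF Λ lam (α * s) (β * u)) (by
    filter_upwards [hgood] with z h
    have := (eccLongitude_spec h.im_le h.z_le h.zb_le).2.1
    rw [keplerMap, div_eq_inv_mul] at this
    exact this.symm)
  obtain ⟨-, e1, e2, e3⟩ := j0.unique j2
  have hI : (2 * I)⁻¹ = -I / 2 := by
    rw [mul_inv, inv_I]; ring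
  have hE := exp_mul_exp_neg (I * lam)
  rw [hI] at e1 e2 e3
  have e1' : b = I / 2 * (α * kepS Λ 0 0) * exp (-(I * lam)) := by rw [e1]; ring
  have e2' : c = β * kepS Λ 0 0 / 2 * exp (I * lam) := by
    rw [e2]; linear_combination (-β * kepS Λ 0 0 / 2 * exp (I * lam)) * I_sq
  refine j0.of_eq rfl e1' e2' ?_
  rw [e3, e1', e2']
  linear_combination (-I ^ 2 / 4 * (α * kepS Λ 0 0) * (β * kepS Λ 0 0)
    * exp (I * lam) * exp (-(I * lam))) * I_sq

theorem mixedJet_expF (hΛ : Λ ∈ slitPlane) :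
    MixedJet (fun s u => exp (I * kepF Λ lam (α * s) (β * u))) (exp (I * lam))
      (-(α * kepS Λ 0 0) / 2) (I / 2 * (β * kepS Λ 0 0) * exp (I * lam) ^ 2)
      (-I / 4 * (α * kepS Λ 0 0) * (β * kepS Λ 0 0) * exp (I * lam)) ∧
    MixedJet (fun s u => exp (-(I * kepF Λ lam (α * s) (β * u)))) (exp (-(I * lam)))
      (α * kepS Λ 0 0 / 2 * exp (-(I * lam)) ^ 2) (-I / 2 * (β * kepS Λ 0 0))
      (-I / 4 * (α * kepS Λ 0 0) * (β * kepS Λ 0 0) * exp (-(I * lam))) := by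
  have h := (mixedJet_kepF (lam := lam) (α := α) (β := β) hΛ).const_mul I
  have hE := exp_mul_exp_neg (I * lam)
  set S := kepS Λ 0 0
  set X := exp (I * lam)
  set Y := exp (-(I * lam))
  constructor
  · refine h.exp.of_eq rfl ?_ (by ring) ?_
    · linear_combination (α * S / 2 * X * Y) * I_sq - (α * S / 2) * hE
    · linear_combination (I * α * S * β * S / 4 * X * X * Y) * I_sq
        - (I * α * S * β * S / 4 * X) * hE
  · refine h.neg.exp.of_eq rfl ?_ ?_ ?_
    · linear_combination (-α * S / 2 * Y ^ 2) * I_sq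
    · linear_combination (-I * β * S / 2) * hE
    · linear_combination (I * α * S * β * S / 4 * X * Y * Y) * I_sq
        - (I * α * S * β * S / 4 * Y) * hE

theorem mixedJet_kepU (hΛ : Λ ∈ slitPlane) :
    MixedJet (fun s u => kepU Λ lam (α * s) (β * u)) (exp (I * lam))
      (-3 / 2 * (α * kepS Λ 0 0)) (I / 2 * (β * kepS Λ 0 0) * exp (I * lam) ^ 2)
      (-I / 2 * (α * kepS Λ 0 0) * (β * kepS Λ 0 0) * exp (I * lam)) := by
  obtain ⟨h1, h2⟩ := mixedJet_expF (lam := lam) (α := α) (β := β) hΛ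
  have hq := mixedJet_kepQ (α := α) (β := β) hΛ
  have hz := mixedJet_kepZ (α := α) (β := β) hΛ
  have hp := (mixedJet_const 1).add ((mixedJet_const 1).sub hq)
  have h := ((((hp.const_mul 2⁻¹).mul h1).add (((hz.mul hz).mul ((hp.const_mul 2).inv
    (by norm_num))).mul h2)).sub hz)
  refine (h.congr (Eventually.of_forall fun z => ?_)).of_eq ?_ ?_ ?_ ?_
  · simp only [kepU]; ring
  all_goals ring

theorem mixedJet_kepV (hΛ : Λ ∈ slitPlane) :
    MixedJet (fun s u => kepV Λ lam (α * s) (β * u)) (exp (-(I * lam)))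
      (α * kepS Λ 0 0 / 2 * exp (-(I * lam)) ^ 2) (-3 * I / 2 * (β * kepS Λ 0 0))
      (-I / 2 * (α * kepS Λ 0 0) * (β * kepS Λ 0 0) * exp (-(I * lam))) := by
  obtain ⟨h1, h2⟩ := mixedJet_expF (lam := lam) (α := α) (β := β) hΛ
  have hq := mixedJet_kepQ (α := α) (β := β) hΛ
  have hz := mixedJet_kepZb (α := α) (β := β) hΛ
  have hp := (mixedJet_const 1).add ((mixedJet_const 1).sub hq)
  have h := ((((hp.const_mul 2⁻¹).mul h2).add (((hz.mul hz).mul ((hp.const_mul 2).inv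
    (by norm_num))).mul h1)).sub hz)
  refine (h.congr (Eventually.of_forall fun z => ?_)).of_eq ?_ ?_ ?_ ?_
  · simp only [kepV]; ring
  all_goals ring

theorem mixedJet_kepW_inv (hΛ : Λ ∈ slitPlane) :
    MixedJet (fun s u => (kepW Λ lam (α * s) (β * u))⁻¹) 1
      (α * kepS Λ 0 0 / 2 * exp (-(I * lam))) (I / 2 * (β * kepS Λ 0 0) * exp (I * lam)) 0 := by
  obtain ⟨h1, h2⟩ := mixedJet_expF (lam := lam) (α := α) (β := β) hΛ
  have hz := mixedJet_kepZ (α := α) (β := β) hΛ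
  have hzb := mixedJet_kepZb (α := α) (β := β) hΛ
  have hE := exp_mul_exp_neg (I * lam)
  have h := ((mixedJet_const 1).sub (((hzb.mul h1).add (hz.mul h2)).const_mul 2⁻¹)).inv (by simp)
  refine (h.congr (Eventually.of_forall fun z => ?_)).of_eq ?_ ?_ ?_ ?_
  · simp only [kepW]; congr 1; ring
  · simp
  · simp; ring
  · simp; ring
  · simp only [zero_mul, mul_zero, add_zero, sub_zero, zero_add, inv_one]
    linear_combination (I / 2 * (α * kepS Λ 0 0) * (β * kepS Λ 0 0)) * hE

theorem mixedJet_kepDU (hΛ : Λ ∈ slitPlane) :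
    MixedJet (fun s u => kepDU Λ lam (α * s) (β * u)) (I * exp (I * lam))
      0 (-(β * kepS Λ 0 0) * exp (I * lam) ^ 2)
      ((α * kepS Λ 0 0) * (β * kepS Λ 0 0) / 2 * exp (I * lam)) := by
  obtain ⟨h1, h2⟩ := mixedJet_expF (lam := lam) (α := α) (β := β) hΛ
  have hq := mixedJet_kepQ (α := α) (β := β) hΛ
  have hz := mixedJet_kepZ (α := α) (β := β) hΛ
  have hw := mixedJet_kepW_inv (lam := lam) (α := α) (β := β) hΛ
  have hE := exp_mul_exp_neg (I * lam)
  have hp := (mixedJet_const 1).add ((mixedJet_const 1).sub hq)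
  have h := ((((hp.const_mul 2⁻¹).mul h1).sub (((hz.mul hz).mul ((hp.const_mul 2).inv
    (by norm_num))).mul h2)).const_mul I).mul hw
  refine (h.congr (Eventually.of_forall fun z => ?_)).of_eq ?_ ?_ ?_ ?_
  · simp only [kepDU]; ring
  · ring
  · linear_combination (I * α * kepS Λ 0 0 / 2) * hE
  · linear_combination (β * kepS Λ 0 0 * exp (I * lam) ^ 2) * I_sq
  · set S := kepS Λ 0 0
    set X := exp (I * lam)
    set Y := exp (-(I * lam))
    linear_combination (-α * S * β * S / 2 * X) * I_sq + (I ^ 2 * α * S * β * S / 4 * X) * hE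

theorem mixedJet_kepDV (hΛ : Λ ∈ slitPlane) :
    MixedJet (fun s u => kepDV Λ lam (α * s) (β * u)) (-(I * exp (-(I * lam))))
      (-I * (α * kepS Λ 0 0) * exp (-(I * lam)) ^ 2) 0
      (-(α * kepS Λ 0 0) * (β * kepS Λ 0 0) / 2 * exp (-(I * lam))) := by
  obtain ⟨h1, h2⟩ := mixedJet_expF (lam := lam) (α := α) (β := β) hΛ
  have hq := mixedJet_kepQ (α := α) (β := β) hΛ
  have hz := mixedJet_kepZb (α := α) (β := β) hΛ
  have hw := mixedJet_kepW_inv (lam := lam) (α := α) (β := β) hΛ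
  have hE := exp_mul_exp_neg (I * lam)
  have hp := (mixedJet_const 1).add ((mixedJet_const 1).sub hq)
  have h := (((((hz.mul hz).mul ((hp.const_mul 2).inv
    (by norm_num))).mul h1).sub ((hp.const_mul 2⁻¹).mul h2)).const_mul I).mul hw
  refine (h.congr (Eventually.of_forall fun z => ?_)).of_eq ?_ ?_ ?_ ?_
  · simp only [kepDV]; ring
  · ring
  · ring
  · linear_combination (-I ^ 2 * β * kepS Λ 0 0 / 2) * hE
  · set S := kepS Λ 0 0
    set X := exp (I * lam)
    set Y := exp (-(I * lam))
    linear_combination (α * S * β * S / 2 * Y) * I_sq - (I ^ 2 * α * S * β * S / 4 * Y) * hE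

end KeplerJets

/-! ### The perturbation to second order in the eccentricities. -/

section SecondOrder

variable {m₀ υ₀ : ℝ} {m : Fin 2 → ℝ}

theorem sqrt_sq_mul {a : ℝ} (ha : 0 < a) (z : ℂ) :
    (((a ^ 2 : ℝ) : ℂ) * z) ^ (1 / 2 : ℂ) = a * z ^ (1 / 2 : ℂ) := by
  rcases eq_or_ne z 0 with rfl | hz
  · rw [mul_zero, zero_cpow (by norm_num), mul_zero]
  have ha2 : ((a ^ 2 : ℝ) : ℂ) ≠ 0 := by exact_mod_cast (pow_pos ha 2).ne'
  rw [cpow_def_of_ne_zero (mul_ne_zero ha2 hz), cpow_def_of_ne_zero hz,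
    log_ofReal_mul (pow_pos ha 2) hz, Real.log_pow, add_mul, exp_add]
  congr 1
  have : ((((2 : ℕ) : ℝ) * Real.log a : ℝ) : ℂ) * (1 / 2) = ((Real.log a : ℝ) : ℂ) := by
    push_cast; ring
  rw [this, ← ofReal_exp, Real.exp_log ha]

theorem ofReal_sqrt {a : ℝ} (ha : 0 ≤ a) : (a : ℂ) ^ (1 / 2 : ℂ) = (√a : ℝ) := by
  rw [Real.sqrt_eq_rpow, ofReal_cpow ha]; norm_num

/-- The algebraic core of the quadratic form. `b`, `c`, `d` are the derivatives of the squared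
distance of unit orbits and `ρ` is its inverse square root, so 3/4 ρ⁵ b c - 1/2 ρ³ d is the mixed
derivative of the inverse distance. Replacing ρ³ by ρ⁵ times the squared distance leaves an identity
linear in ρ⁵ and rational in the remaining variables. -/
theorem mixed_derivative_identity {E₀ E₁ ρ p₀ p₁ r₀ r₁ : ℂ} (h₀ : E₀ ≠ 0) (h₁ : E₁ ≠ 0)
    (hρ : ρ ^ 2 * ((E₀ - E₁) * (E₀⁻¹ - E₁⁻¹)) = 1) {b c d : ℂ}
    (hb : b = (-3 / 2 * p₀ - -3 / 2 * p₁) * (E₀⁻¹ - E₁⁻¹)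
      + (E₀ - E₁) * (p₀ / 2 * E₀⁻¹ ^ 2 - p₁ / 2 * E₁⁻¹ ^ 2))
    (hc : c = (r₀ / 2 * E₀ ^ 2 - r₁ / 2 * E₁ ^ 2) * (E₀⁻¹ - E₁⁻¹)
      + (E₀ - E₁) * (-3 / 2 * r₀ - -3 / 2 * r₁))
    (hd : d = (-1 / 2 * p₀ * r₀ * E₀ - -1 / 2 * p₁ * r₁ * E₁) * (E₀⁻¹ - E₁⁻¹)
      + (r₀ / 2 * E₀ ^ 2 - r₁ / 2 * E₁ ^ 2) * (p₀ / 2 * E₀⁻¹ ^ 2 - p₁ / 2 * E₁⁻¹ ^ 2)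
      + ((-3 / 2 * p₀ - -3 / 2 * p₁) * (-3 / 2 * r₀ - -3 / 2 * r₁)
      + (E₀ - E₁) * (-1 / 2 * p₀ * r₀ * E₀⁻¹ - -1 / 2 * p₁ * r₁ * E₁⁻¹))) :
    2⁻¹ * ((-1 / 2 * p₀ * r₀ * E₀ * E₁⁻¹ + r₀ * E₀ ^ 2 * (p₁ * E₁⁻¹ ^ 2)
      + E₀ * (-1 / 2 * p₁ * r₁ * E₁⁻¹))
      + (-1 / 2 * p₀ * r₀ * E₀⁻¹ * E₁ + p₀ * E₀⁻¹ ^ 2 * (r₁ * E₁ ^ 2)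
      + E₀⁻¹ * (-1 / 2 * p₁ * r₁ * E₁)))
      - (3 / 4 * ρ ^ 5 * b * c - 1 / 2 * ρ ^ 3 * d)
    = 2⁻¹ * ((ρ ^ 5 / 4 * (5 * ((E₀ * E₁⁻¹) ^ 2 + (E₀⁻¹ * E₁) ^ 2) / 2 - 13
        + 4 * (E₀ * E₁⁻¹ + E₀⁻¹ * E₁)) - (E₀ * E₁⁻¹ + E₀⁻¹ * E₁) / 2) * (p₀ * r₀ + p₁ * r₁)
      + ((E₀⁻¹ * E₁) ^ 2 - ρ ^ 5 / 8 * ((E₀⁻¹ * E₁) ^ 3 + 16 * (E₀⁻¹ * E₁) ^ 2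
        - 26 * (E₀⁻¹ * E₁) + 9 * (E₀ * E₁⁻¹))) * (p₀ * r₁)
      + ((E₀ * E₁⁻¹) ^ 2 - ρ ^ 5 / 8 * ((E₀ * E₁⁻¹) ^ 3 + 16 * (E₀ * E₁⁻¹) ^ 2
        - 26 * (E₀ * E₁⁻¹) + 9 * (E₀⁻¹ * E₁))) * (p₁ * r₀)) := by
  have h3 : ρ ^ 3 = ρ ^ 5 * ((E₀ - E₁) * (E₀⁻¹ - E₁⁻¹)) := by linear_combination (-ρ ^ 3) * hρ
  rw [h3, hb, hc, hd]
  field_simp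
  ring

theorem cos_sub_eq (ζ : Vec) : exp (I * meanLongitude ζ 0) * (exp (I * meanLongitude ζ 1))⁻¹
    = exp (I * ζ 0) ∧ (exp (I * meanLongitude ζ 0))⁻¹ * exp (I * meanLongitude ζ 1)
    = exp (-(I * ζ 0)) := by
  have h0 : I * meanLongitude ζ 0 = I * ζ 0 + I * ζ 1 := by simp [meanLongitude]; ring
  have h1 : meanLongitude ζ 1 = ζ 1 := by simp [meanLongitude]
  rw [h0, h1, ← exp_neg, ← exp_neg, ← exp_add, ← exp_add]
  constructor <;> congr 1 <;> ring

/-- Conjugation passes through the principal square root only off the negative axis; there the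
double conjugation disappears and a holomorphic expression is left. -/
theorem funBconj_eq {φ : ℂ} (hφ : 2 - 2 * cos φ ∈ slitPlane) :
    funBconj φ = exp (2 * I * φ) - (distD φ ^ 5)⁻¹ / 8 *
      (exp (3 * I * φ) + 16 * exp (2 * I * φ) - 26 * exp (I * φ) + 9 * exp (-(I * φ))) := by
  have hn : ∀ n : ℕ, [n.AtLeastTwo] → starRingEnd ℂ (OfNat.ofNat n : ℂ) = OfNat.ofNat n :=
    fun n _ => map_ofNat _ n
  have hd : starRingEnd ℂ (distD (starRingEnd ℂ φ)) = distD φ := by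
    have e : 2 - 2 * cos (starRingEnd ℂ φ) = starRingEnd ℂ (2 - 2 * cos φ) := by
      rw [map_sub, map_mul, conj_two, cos_conj]
    rw [distD, e, conj_sqrt hφ, conj_conj, distD]
  simp only [funBconj, funB, map_sub, map_add, map_mul, map_div₀, map_inv₀, map_pow, hd, ← exp_conj,
    map_neg, conj_I, conj_conj, hn, neg_mul, neg_neg, mul_neg]

/-- The mixed second order coefficients of the perturbation at circular configurations. -/
noncomputable def eccCoef (m₀ υ₀ : ℝ) (m : Fin 2 → ℝ) (φ : ℂ) (j k : Fin 2) : ℂ :=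
  I * υ₀ * constD m₀ m * (![![funA φ / m 0, funB φ / (√(m 0 * m 1) : ℝ)],
    ![funBconj φ / (√(m 0 * m 1) : ℝ), funA φ / m 1]] : Matrix (Fin 2) (Fin 2) ℂ) j k

theorem Qform_eq (ε : ℝ) (φ : ℂ) (w wt : Vec) : Qform m₀ m υ₀ ε φ w wt
    = ε * ∑ j, ∑ k, eccCoef m₀ υ₀ m φ j k * w j * wt k := by
  simp [Qform, eccCoef, Fin.sum_univ_two]
  ring

theorem ell_sq_div (hm₀ : 0 < m₀) (hυ₀ : 0 < υ₀) :
    (ell m₀ υ₀ ^ 2 / m₀) ^ 3 * υ₀ ^ 2 = m₀ := by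
  have h := ell_pow_three hm₀ hυ₀
  have : (ell m₀ υ₀ ^ 2 / m₀) ^ 3 = (ell m₀ υ₀ ^ 3) ^ 2 / m₀ ^ 3 := by ring
  rw [this, h]
  field_simp

theorem kepS_res_mul (hm₀ : 0 < m₀) (hm : ∀ j, 0 < m j) (hυ₀ : 0 < υ₀) :
    kepS ((m 0 * ell m₀ υ₀ : ℝ) : ℂ) 0 0 * kepS ((m 1 * ell m₀ υ₀ : ℝ) : ℂ) 0 0
      = 2 / (ell m₀ υ₀ * (√(m 0 * m 1) : ℝ)) := by
  have hl := ell_pos hm₀ hυ₀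
  have h2 : (2 : ℂ) ^ (1 / 2 : ℂ) = (√2 : ℝ) := by
    have := ofReal_sqrt (a := 2) (by norm_num)
    rwa [ofReal_ofNat] at this
  have e : √(m 0 * ell m₀ υ₀) * √(m 1 * ell m₀ υ₀) = ell m₀ υ₀ * √(m 0 * m 1) := by
    rw [← Real.sqrt_mul (by have := hm 0; positivity)]
    have : m 0 * ell m₀ υ₀ * (m 1 * ell m₀ υ₀) = ell m₀ υ₀ ^ 2 * (m 0 * m 1) := by ring
    rw [this, Real.sqrt_mul (by positivity), Real.sqrt_sq hl.le]
  have e2 : √2 * √2 = (2 : ℝ) := Real.mul_self_sqrt (by norm_num)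
  rw [kepS, kepS, kepQ_zero, kepQ_zero, sub_zero, h2,
    ofReal_sqrt (by have := hm 0; positivity), ofReal_sqrt (by have := hm 1; positivity),
    div_mul_div_comm, ← ofReal_mul, ← ofReal_mul, e, e2]
  push_cast
  rfl

/-- At zero mass ratio and zero actions both planets have the same semi-major axis a and mean motion
υ₀. Since a³ υ₀² = m₀, the momentum product and the inverse distance carry the common factor m₁ m₂ /
a, and only unit orbits remain. -/
theorem mixedJet_pert (hm₀ : 0 < m₀) (hm : ∀ j, 0 < m j) (hυ₀ : 0 < υ₀) {ζ : Vec}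
    (hζ : 2 - 2 * cos (ζ 0) ∈ slitPlane) (α β : Vec) : ∃ b c,
    MixedJet (fun s u => pert m₀ υ₀ m (0, 0, ζ, s • α, u • β)) (υ₀ * constB m₀ m υ₀ * funF (ζ 0))
      b c (∑ j, ∑ k, eccCoef m₀ υ₀ m (ζ 0) j k * α j * β k) := by
  have hl := ell_pos hm₀ hυ₀
  set a : ℝ := ell m₀ υ₀ ^ 2 / m₀ with ha
  have ha0 : 0 < a := by positivity
  have hΛ : ∀ j, ((m j * ell m₀ υ₀ : ℝ) : ℂ) ∈ slitPlane := fun j => by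
    rw [ofReal_mem_slitPlane]; exact mul_pos (hm j) hl
  set E : Fin 2 → ℂ := fun j => exp (I * meanLongitude ζ j) with hE
  have hEne : ∀ j, E j ≠ 0 := fun j => exp_ne_zero _
  have hEi : ∀ j, exp (-(I * meanLongitude ζ j)) = (E j)⁻¹ := fun j => exp_neg _
  set p : Fin 2 → ℂ := fun j => α j * kepS ((m j * ell m₀ υ₀ : ℝ) : ℂ) 0 0 with hp
  set r : Fin 2 → ℂ := fun j => I * (β j * kepS ((m j * ell m₀ υ₀ : ℝ) : ℂ) 0 0) with hr
  have jU := fun j => (mixedJet_kepU (lam := meanLongitude ζ j) (α := α j) (β := β j)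
    (hΛ j)).of_eq (a' := E j) (b' := -3 / 2 * p j) (c' := r j / 2 * E j ^ 2) (d' := -1 / 2 * p j * r j * E j)
    rfl rfl (by simp only [hr, hE]; ring) (by simp only [hr, hE, hp]; ring)
  have jV := fun j => (mixedJet_kepV (lam := meanLongitude ζ j) (α := α j) (β := β j)
    (hΛ j)).of_eq (b' := p j / 2 * (E j)⁻¹ ^ 2) (c' := -3 / 2 * r j)
    (d' := -1 / 2 * p j * r j * (E j)⁻¹)
    (hEi j) (by rw [hEi]) (by simp only [hr]; ring) (by rw [hEi]; simp only [hr, hp]; ring)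
  -- The factors -i and i normalise the momenta to start at E and its inverse; their product is 1,
  -- so the products of momenta in the perturbation do not change.
  have jDU := fun j => ((mixedJet_kepDU (lam := meanLongitude ζ j) (α := α j) (β := β j)
    (hΛ j)).const_mul (-I)).of_eq (a' := E j) (b' := 0) (c' := r j * E j ^ 2)
    (d' := -1 / 2 * p j * r j * E j) (by linear_combination (-E j) * I_sq) (by ring)
    (by simp only [hr, hE]; ring) (by simp only [hr, hp, hE]; ring)
  have jDV := fun j => ((mixedJet_kepDV (lam := meanLongitude ζ j) (α := α j) (β := β j)
    (hΛ j)).const_mul I).of_eq (a' := (E j)⁻¹) (b' := p j * (E j)⁻¹ ^ 2) (c' := 0)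
    (d' := -1 / 2 * p j * r j * (E j)⁻¹)
    (by rw [hEi]; linear_combination (-(E j)⁻¹) * I_sq)
    (by rw [hEi]; simp only [hp]; linear_combination (-(α j * kepS ((m j * ell m₀ υ₀ : ℝ) : ℂ) 0 0) * (E j)⁻¹ ^ 2) * I_sq) (by ring)
    (by rw [hEi]; simp only [hr, hp]; ring)
  have jd := ((jU 0).sub (jU 1)).mul ((jV 0).sub (jV 1))
  have hY : (E 0 - E 1) * ((E 0)⁻¹ - (E 1)⁻¹) = 2 - 2 * cos (ζ 0) := by
    rw [← exp_sub_mul_exp_sub, hEi, hEi]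
  have jD := (jd.sqrt (by rw [hY]; exact hζ)).inv (by
    rw [hY]; exact (cpow_ne_zero_iff_of_exponent_ne_zero (by norm_num)).2 (slitPlane_ne_zero hζ))
  have jT := ((((jDU 0).mul (jDV 1)).add ((jDV 0).mul (jDU 1))).const_mul 2⁻¹).sub jD
  have jN := jT.const_mul ((m 0 * m 1 / a : ℝ) : ℂ)
  have hm0C : (m₀ : ℂ) ≠ 0 := by exact_mod_cast hm₀.ne'
  have haC : (a : ℂ) ≠ 0 := by exact_mod_cast ha0.ne'
  have hmC : ∀ j, (m j : ℂ) ≠ 0 := fun j => by exact_mod_cast (hm j).ne'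
  have ha3 : (a : ℂ) ^ 3 * υ₀ ^ 2 = m₀ := by exact_mod_cast ell_sq_div hm₀ hυ₀
  rw [hY] at jN
  have hdist : (2 - 2 * cos (ζ 0)) ^ (1 / 2 : ℂ) = distD (ζ 0) := rfl
  rw [hdist] at jN
  have hD2 : distD (ζ 0) ^ 2 = 2 - 2 * cos (ζ 0) := by
    rw [← hdist]
    simp
  have hD0 : distD (ζ 0) ≠ 0 := by
    intro h
    rw [h] at hD2
    exact slitPlane_ne_zero hζ (by rw [← hD2]; ring)
  obtain ⟨hX, hXi⟩ := cos_sub_eq ζ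
  have hX' : E 0 * (E 1)⁻¹ = exp (I * ζ 0) := hX
  have hXi' : (E 0)⁻¹ * E 1 = exp (-(I * ζ 0)) := hXi
  have hcos : cos (ζ 0) = (exp (I * ζ 0) + exp (-(I * ζ 0))) / 2 := by rw [cos]; ring_nf
  refine ⟨_, _, (jN.congr (Eventually.of_forall fun z => ?_)).of_eq ?_ rfl rfl ?_⟩
  · have hpos : ∀ j, posU m₀ υ₀ m (0, 0, ζ, z.1 • α, z.2 • β) j
        = a * kepU ((m j * ell m₀ υ₀ : ℝ) : ℂ) (meanLongitude ζ j) (α j * z.1) (β j * z.2) ∧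
        posV m₀ υ₀ m (0, 0, ζ, z.1 • α, z.2 • β) j
        = a * kepV ((m j * ell m₀ υ₀ : ℝ) : ℂ) (meanLongitude ζ j) (α j * z.1) (β j * z.2) ∧
        momU m₀ υ₀ m (0, 0, ζ, z.1 • α, z.2 • β) j = m j * a * υ₀ *
          kepDU ((m j * ell m₀ υ₀ : ℝ) : ℂ) (meanLongitude ζ j) (α j * z.1) (β j * z.2) ∧
        momV m₀ υ₀ m (0, 0, ζ, z.1 • α, z.2 • β) j = m j * a * υ₀ *
          kepDV ((m j * ell m₀ υ₀ : ℝ) : ℂ) (meanLongitude ζ j) (α j * z.1) (β j * z.2) := by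
      intro j
      have c1 : (z.1 • α) j = α j * z.1 := by rw [Pi.smul_apply, smul_eq_mul, mul_comm]
      have c2 : (z.2 • β) j = β j * z.2 := by rw [Pi.smul_apply, smul_eq_mul, mul_comm]
      simp only [posU, posV, momU, momV, momFactor, mhatC_zero hm₀, muC_zero, lamActC_zero hm₀,
        kepA_res hm₀ hm, kepN_res hm₀ hm hυ₀, c1, c2, ← ha]
      refine ⟨trivial, trivial, ?_, ?_⟩ <;> ring
    have hds : distSq m₀ υ₀ m (0, 0, ζ, z.1 • α, z.2 • β) = ((a ^ 2 : ℝ) : ℂ) *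
        ((kepU ((m 0 * ell m₀ υ₀ : ℝ) : ℂ) (meanLongitude ζ 0) (α 0 * z.1) (β 0 * z.2)
        - kepU ((m 1 * ell m₀ υ₀ : ℝ) : ℂ) (meanLongitude ζ 1) (α 1 * z.1) (β 1 * z.2))
        * (kepV ((m 0 * ell m₀ υ₀ : ℝ) : ℂ) (meanLongitude ζ 0) (α 0 * z.1) (β 0 * z.2)
        - kepV ((m 1 * ell m₀ υ₀ : ℝ) : ℂ) (meanLongitude ζ 1) (α 1 * z.1) (β 1 * z.2))) := by
      rw [distSq, (hpos 0).1, (hpos 1).1, (hpos 0).2.1, (hpos 1).2.1]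
      push_cast; ring
    rw [pert, hds, sqrt_sq_mul ha0, (hpos 0).2.2.1, (hpos 1).2.2.1, (hpos 0).2.2.2,
      (hpos 1).2.2.2]
    push_cast
    set u0 := kepDU ((m 0 : ℂ) * ell m₀ υ₀) (meanLongitude ζ 0) (α 0 * z.1) (β 0 * z.2)
    set v0 := kepDV ((m 0 : ℂ) * ell m₀ υ₀) (meanLongitude ζ 0) (α 0 * z.1) (β 0 * z.2)
    set u1 := kepDU ((m 1 : ℂ) * ell m₀ υ₀) (meanLongitude ζ 1) (α 1 * z.1) (β 1 * z.2)
    set v1 := kepDV ((m 1 : ℂ) * ell m₀ υ₀) (meanLongitude ζ 1) (α 1 * z.1) (β 1 * z.2)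
    have k : (m 0 : ℂ) * m 1 / a = m 0 * m 1 * a ^ 2 * υ₀ ^ 2 / m₀ := by
      rw [← ha3]
      have : (υ₀ : ℂ) ≠ 0 := by exact_mod_cast hυ₀.ne'
      field_simp
    linear_combination (m 0 * m 1 / a * (2⁻¹ * (u0 * v1 + v0 * u1))) * I_sq
      - 2⁻¹ * (u0 * v1 + v0 * u1) * k
  · have e : ((m 0 * m 1 / a : ℝ) : ℂ) * (3 / 2) = υ₀ * constB m₀ m υ₀ * 1 := by
      rw [constB, constD]
      have h1 : υ₀ ^ (-(1 / 3) : ℝ) * m₀ ^ (2 / 3 : ℝ) = ell m₀ υ₀ := by rw [ell]; ring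
      have h2 := ell_pow_three hm₀ hυ₀
      have h3 : υ₀ * ell m₀ υ₀ * a = m₀ := by
        have : υ₀ * ell m₀ υ₀ * a = υ₀ * ell m₀ υ₀ ^ 3 / m₀ := by rw [ha]; ring
        rw [this, h2]
        field_simp
      have h4 : m 0 * m 1 / a * (3 / 2)
          = υ₀ * (3 / 2 * υ₀ ^ (-(1 / 3) : ℝ) * m₀ ^ (2 / 3 : ℝ) * (m 0 * m 1 / m₀)) := by
        rw [mul_assoc (3 / 2 : ℝ), h1]
        nth_rewrite 2 [← h3]
        field_simp
      have := congrArg (fun t : ℝ => (t : ℂ)) h4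
      push_cast at this ⊢
      rw [mul_one]; exact this
    rw [hX', hXi', funF]
    linear_combination (exp (I * ζ 0) / 2 + exp (-(I * ζ 0)) / 2 - (distD (ζ 0))⁻¹) * (2 / 3) * e
      - υ₀ * constB m₀ m υ₀ * (2 / 3) * hcos
  · have key := mixed_derivative_identity (ρ := (distD (ζ 0))⁻¹) (hEne 0) (hEne 1) (p₀ := p 0)
      (p₁ := p 1) (r₀ := r 0) (r₁ := r 1)
      (by rw [hY, ← hD2]; field_simp) rfl rfl rfl
    have hA : funA (ζ 0) = (distD (ζ 0))⁻¹ ^ 5 / 4 * (5 * ((E 0 * (E 1)⁻¹) ^ 2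
        + ((E 0)⁻¹ * E 1) ^ 2) / 2 - 13 + 4 * (E 0 * (E 1)⁻¹ + (E 0)⁻¹ * E 1))
        - (E 0 * (E 1)⁻¹ + (E 0)⁻¹ * E 1) / 2 := by
      have h2 : cos (2 * ζ 0) = (exp (I * ζ 0) ^ 2 + exp (-(I * ζ 0)) ^ 2) / 2 := by
        rw [cos, ← exp_nat_mul, ← exp_nat_mul]; push_cast; ring_nf
      rw [hX', hXi', funA, h2, hcos, inv_pow]
      ring
    have hB : funB (ζ 0) = ((E 0)⁻¹ * E 1) ^ 2 - (distD (ζ 0))⁻¹ ^ 5 / 8 * (((E 0)⁻¹ * E 1) ^ 3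
        + 16 * ((E 0)⁻¹ * E 1) ^ 2 - 26 * ((E 0)⁻¹ * E 1) + 9 * (E 0 * (E 1)⁻¹)) := by
      rw [hX', hXi', funB, inv_pow, ← exp_nat_mul, ← exp_nat_mul]
      push_cast
      ring_nf
    have hBc : funBconj (ζ 0) = (E 0 * (E 1)⁻¹) ^ 2 - (distD (ζ 0))⁻¹ ^ 5 / 8 *
        ((E 0 * (E 1)⁻¹) ^ 3 + 16 * (E 0 * (E 1)⁻¹) ^ 2 - 26 * (E 0 * (E 1)⁻¹)
        + 9 * ((E 0)⁻¹ * E 1)) := by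
      rw [hX', hXi', funBconj_eq hζ, inv_pow, ← exp_nat_mul, ← exp_nat_mul]
      push_cast
      ring_nf
    rw [← hA, ← hB, ← hBc] at key
    have hlC : (ell m₀ υ₀ : ℂ) ≠ 0 := by exact_mod_cast hl.ne'
    have hs : ∀ j, kepS ((m j * ell m₀ υ₀ : ℝ) : ℂ) 0 0 ^ 2 = 2 / (m j * ell m₀ υ₀) := fun j => by
      rw [kepS_zero_sq]; push_cast; rfl
    have hk : ∀ j, p j * r j = 2 * I / ell m₀ υ₀ * (α j * β j / m j) := by
      intro j
      have : p j * r j = I * (α j * β j) * kepS ((m j * ell m₀ υ₀ : ℝ) : ℂ) 0 0 ^ 2 := by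
        simp only [hp, hr]; ring
      rw [this, hs]
      have := hmC j
      field_simp
    have hs01 := kepS_res_mul hm₀ hm hυ₀
    have h01 : p 0 * r 1 = 2 * I / ell m₀ υ₀ * (α 0 * β 1 / (√(m 0 * m 1) : ℝ)) := by
      have : p 0 * r 1 = I * (α 0 * β 1) * (kepS ((m 0 * ell m₀ υ₀ : ℝ) : ℂ) 0 0
        * kepS ((m 1 * ell m₀ υ₀ : ℝ) : ℂ) 0 0) := by simp only [hp, hr]; ring
      rw [this, hs01, div_mul_eq_div_div]
      ring
    have h10 : p 1 * r 0 = 2 * I / ell m₀ υ₀ * (α 1 * β 0 / (√(m 0 * m 1) : ℝ)) := by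
      have : p 1 * r 0 = I * (α 1 * β 0) * (kepS ((m 0 * ell m₀ υ₀ : ℝ) : ℂ) 0 0
        * kepS ((m 1 * ell m₀ υ₀ : ℝ) : ℂ) 0 0) := by simp only [hp, hr]; ring
      rw [this, hs01, div_mul_eq_div_div]
      ring
    rw [hk, hk, h01, h10] at key
    have hc : ((m 0 * m 1 / a : ℝ) : ℂ) / ell m₀ υ₀ = υ₀ * constD m₀ m := by
      have h2 := ell_pow_three hm₀ hυ₀
      have : m 0 * m 1 / a / ell m₀ υ₀ = υ₀ * constD m₀ m := by
        have : m 0 * m 1 / a / ell m₀ υ₀ = m 0 * m 1 * m₀ / ell m₀ υ₀ ^ 3 := by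
          rw [ha]; field_simp
        rw [this, h2, constD]
        field_simp
      exact_mod_cast this
    have hsum : ∑ j, ∑ k, eccCoef m₀ υ₀ m (ζ 0) j k * α j * β k
        = I * (υ₀ * constD m₀ m) * (funA (ζ 0) * (α 0 * β 0 / m 0 + α 1 * β 1 / m 1)
          + funB (ζ 0) * (α 0 * β 1 / (√(m 0 * m 1) : ℝ))
          + funBconj (ζ 0) * (α 1 * β 0 / (√(m 0 * m 1) : ℝ))) := by
      simp [eccCoef, Fin.sum_univ_two]
      ring
    rw [hsum, ← hc]
    refine Eq.trans ?_ (Eq.trans (congrArg (fun t => ((m 0 * m 1 / a : ℝ) : ℂ) * t) key) ?_)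
    · ring
    · ring

theorem dX_dXt_pert (hm₀ : 0 < m₀) (hm : ∀ j, 0 < m j) (hυ₀ : 0 < υ₀) {ζ : Vec}
    (hζ : 2 - 2 * cos (ζ 0) ∈ slitPlane) (j k : Fin 2) :
    dX j (dXt k fun p => pert m₀ υ₀ m (0, p)) (0, ζ, 0, 0) = eccCoef m₀ υ₀ m (ζ 0) j k := by
  have hg : AnalyticAt ℂ (fun p : Phase => pert m₀ υ₀ m (0, p)) (0, ζ, 0, 0) :=
    AnalyticAt.fun_comp (f := fun p : Phase => ((0 : ℂ), p)) (analyticAt_pert hm₀ hm hυ₀ hζ)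
      (analyticAt_const.prod analyticAt_id)
  have h1 := mixedJet_of_analyticAt hg (0, 0, Pi.single j 1, 0) (0, 0, 0, Pi.single k 1)
  obtain ⟨b, c, h2⟩ := mixedJet_pert hm₀ hm hυ₀ hζ (Pi.single j 1) (Pi.single k 1)
  have h3 := h1.congr (G := fun s u => pert m₀ υ₀ m (0, 0, ζ, s • Pi.single j 1,
    u • Pi.single k 1)) (Eventually.of_forall fun z => by simp)
  have h4 := (h3.unique h2).2.2.2
  rw [dX, show dXt k (fun p => pert m₀ υ₀ m (0, p)) = fun q => fderiv ℂ (fun p => pert m₀ υ₀ m (0, p))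
    q (0, 0, 0, Pi.single k 1) from rfl, h4, Finset.sum_eq_single j, Finset.sum_eq_single k]
  · simp
  · intro i _ hi; simp [hi]
  · simp
  · intro i _ hi; simp [hi]
  · simp

theorem pert_circular (hm₀ : 0 < m₀) (hm : ∀ j, 0 < m j) (hυ₀ : 0 < υ₀) {ζ : Vec}
    (hζ : 2 - 2 * cos (ζ 0) ∈ slitPlane) :
    pert m₀ υ₀ m (0, 0, ζ, 0, 0) = υ₀ * constB m₀ m υ₀ * funF (ζ 0) := by
  obtain ⟨b, c, h2⟩ := mixedJet_pert hm₀ hm hυ₀ hζ 0 0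
  simpa using h2.value

end SecondOrder

/-! ### The averaged perturbation near circular configurations. -/

section SlowPerturbation

variable {m₀ υ₀ : ℝ} {m : Fin 2 → ℝ} {Δ σ r s τ : ℝ} {f : Phase → ℂ}

theorem fderiv_fastAvg_apply (hf : AnalyticOnNhd ℂ f (zone Δ r)) {p : Phase} (hp : p ∈ zone Δ r)
    (v : Phase) : fderiv ℂ (fastAvg f) p v = fastAvg (fun q => fderiv ℂ f q v) p := by
  have h1 := hasFDerivAt_integral_of_analyticAt (a := 0) (b := 2 * Real.pi) (p := p)
    (G := fun z : Phase × ℂ => f (z.1 + z.2 • eFast)) fun t _ => analyticAt_fast hf hp t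
  have h2 : HasFDerivAt (fastAvg f) _ p := h1.const_mul (1 / (2 * Real.pi) : ℂ)
  have h3 : ∀ t : ℝ, fderiv ℂ (fun q => f (q + (t : ℂ) • eFast)) p
      = fderiv ℂ f (p + (t : ℂ) • eFast) := fun t => by
    have h4 : HasFDerivAt (fun q => f (q + (t : ℂ) • eFast)) (fderiv ℂ f (p + (t : ℂ) • eFast)) p :=
      HasFDerivAt.comp p (hf _ (add_fast_mem_zone hp t)).differentiableAt.hasFDerivAt
        ((hasFDerivAt_id p).add_const _)
    exact h4.fderiv
  have hc : Continuous fun t : ℝ => fderiv ℂ f (p + (t : ℂ) • eFast) := by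
    rw [continuous_iff_continuousAt]
    intro t
    exact ContinuousAt.comp (f := fun t : ℝ => p + (t : ℂ) • eFast)
      (hf _ (add_fast_mem_zone hp t)).fderiv.continuousAt (by fun_prop)
  rw [h2.fderiv]
  simp only [h3]
  rw [_root_.smul_apply, ContinuousLinearMap.intervalIntegral_apply (hc.intervalIntegrable _ _)]
  rfl

theorem dX_dXt_fastAvg (hf : AnalyticOnNhd ℂ f (zone Δ s)) (hrs : r < s) (j k : Fin 2) {p : Phase}
    (hp : p ∈ zone Δ r) : dX j (dXt k (fastAvg f)) p = fastAvg (dX j (dXt k f)) p := by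
  have h1 : dXt k (fastAvg f) =ᶠ[𝓝 p] fastAvg (dXt k f) := by
    filter_upwards [zone_mem_nhds hp hrs] with q hq
    exact fderiv_fastAvg_apply hf hq _
  rw [dX, h1.fderiv_eq]
  exact fderiv_fastAvg_apply (analyticOnNhd_dXt hf k) (zone_mono hrs.le hp) _

/-- Each eccentricity derivative brings down √τ. The inverse of this factor reappears when the
coefficients are returned to the original variables. -/
theorem dX_dXt_comp_scale {h : Phase → ℂ} (hτ : 0 ≤ τ) {q : Phase}
    (hh : AnalyticAt ℂ h (scale τ q)) (j k : Fin 2) :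
    dX j (dXt k fun p => h (scale τ p)) q = τ * dX j (dXt k h) (scale τ q) := by
  have hs : (√τ : ℂ) * √τ = τ := by exact_mod_cast Real.mul_self_sqrt hτ
  have key : ∀ (g : Phase → ℂ) (p v : Phase), AnalyticAt ℂ g (scale τ p) →
      fderiv ℂ (fun p => g (scale τ p)) p v = fderiv ℂ g (scale τ p) (scale τ v) := by
    intro g p v hg
    have : HasFDerivAt (fun p => g (scale τ p)) ((fderiv ℂ g (scale τ p)).comp (scale τ)) p :=
      hg.differentiableAt.hasFDerivAt.comp p (scale τ).hasFDerivAt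
    rw [this.fderiv]; rfl
  have e1 : scale τ (0, 0, 0, Pi.single k 1) = (√τ : ℂ) • ((0, 0, 0, Pi.single k 1) : Phase) := by
    rw [scale_apply]; simp
  have e2 : scale τ (0, 0, Pi.single j 1, 0) = (√τ : ℂ) • ((0, 0, Pi.single j 1, 0) : Phase) := by
    rw [scale_apply]; simp
  have h1 : dXt k (fun p => h (scale τ p)) =ᶠ[𝓝 q] fun p => (√τ : ℂ) * dXt k h (scale τ p) := by
    filter_upwards [(scale τ).continuous.continuousAt.eventually hh.eventually_analyticAt] with p hp
    rw [dXt, key h p _ hp, e1, map_smul, smul_eq_mul]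
    rfl
  have hd : AnalyticAt ℂ (dXt k h) (scale τ q) :=
    ((ContinuousLinearMap.apply ℂ ℂ ((0, 0, 0, Pi.single k 1) : Phase)).analyticAt _).comp hh.fderiv
  have hd2 : DifferentiableAt ℂ (fun p => dXt k h (scale τ p)) q :=
    hd.differentiableAt.comp q (scale τ).differentiableAt
  rw [dX, h1.fderiv_eq, fderiv_const_mul hd2, _root_.smul_apply, key _ _ _ hd, e2, map_smul,
    smul_eq_mul, smul_eq_mul, ← mul_assoc, hs]
  rfl

/-- Here the complexified mass ratio pays off: a bound on a disc in the mass ratio gives, by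
Cauchy's estimate, a Lipschitz bound at ε = 0. -/
theorem norm_pert_sub_le {ρ M : ℝ} (hρ : 0 < ρ) {p : Phase} {ε : ℝ} (h0 : 0 ≤ ε) (h1 : ε ≤ ρ / 2)
    (hd : ∀ e : ℂ, ‖e‖ ≤ ρ → AnalyticAt ℂ (pert m₀ υ₀ m) (e, p))
    (hM : ∀ e : ℂ, ‖e‖ ≤ ρ → ‖pert m₀ υ₀ m (e, p)‖ ≤ M) :
    ‖pert m₀ υ₀ m (ε, p) - pert m₀ υ₀ m (0, p)‖ ≤ M / (ρ / 2) * ε := by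
  have hda : ∀ e : ℂ, ‖e‖ ≤ ρ → DifferentiableAt ℂ (fun e => pert m₀ υ₀ m (e, p)) e := fun e he =>
    (AnalyticAt.fun_comp (f := fun e : ℂ => (e, p)) (hd e he)
      (analyticAt_id.prod analyticAt_const)).differentiableAt
  have hsub : ∀ e ∈ closedBall (0 : ℂ) (ρ / 2), ∀ y ∈ closedBall e (ρ / 2), ‖y‖ ≤ ρ := by
    intro e he y hy
    rw [mem_closedBall, dist_zero_right] at he
    rw [mem_closedBall, dist_eq_norm] at hy
    calc ‖y‖ = ‖(y - e) + e‖ := by rw [sub_add_cancel]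
      _ ≤ _ := (norm_add_le _ _).trans (by linarith)
  have h := (convex_closedBall (0 : ℂ) (ρ / 2)).norm_image_sub_le_of_norm_fderiv_le (𝕜 := ℂ)
    (f := fun e => pert m₀ υ₀ m (e, p)) (C := M / (ρ / 2)) (x := 0) (y := (ε : ℂ))
    (fun e he => hda e (hsub e he e (mem_closedBall_self (by positivity))))
    (fun e he => norm_fderiv_le_of_closedBall (by positivity)
      (fun y hy => hda y (hsub e he y hy)) fun y hy => hM y (hsub e he y hy))
    (mem_closedBall_self (by positivity))
    (by rw [mem_closedBall, dist_zero_right, Complex.norm_real, Real.norm_of_nonneg h0]; exact h1)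
  rwa [sub_zero, Complex.norm_real, Real.norm_of_nonneg h0] at h

theorem fastAvg_eq_of_const {p : Phase} {c : ℂ} (h : ∀ t : ℝ, f (p + (t : ℂ) • eFast) = c) :
    fastAvg f p = c := by
  rw [fastAvg, intervalIntegral.integral_congr (g := fun _ => c) fun t _ => h t]
  rw [intervalIntegral.integral_const, sub_zero, real_smul]
  push_cast
  have : (Real.pi : ℂ) ≠ 0 := by exact_mod_cast Real.pi_ne_zero
  field_simp

theorem scale_circular_add_fast (p : Phase) (t : ℝ) :
    scale τ (circular p + (t : ℂ) • eFast) = (0, ![p.2.1 0, p.2.1 1 + t], 0, 0) := by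
  rw [scale_apply]
  ext j
  · simp [circular, eFast]
  · fin_cases j <;> simp [circular, eFast, Matrix.vecHead, Matrix.vecTail]
  · simp [circular, eFast]
  · simp [circular, eFast]

/-- The averaged perturbation near circular configurations: leading terms and errors, with
explicit distances to the circular configurations. -/
structure IsSlowPert (m₀ υ₀ : ℝ) (m : Fin 2 → ℝ) (Δ σ t C ε : ℝ) (f₀ f : Phase → ℂ) : Prop where
  analytic : AnalyticOnNhd ℂ f (zone Δ σ)
  inv : RotInv f (zone Δ σ)
  avg_HP : ∀ p, avg (HP m₀ m υ₀ ε) (scale t p) = ε * f (flat p)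
  shrink_sub_le : ∀ p ∈ zone Δ (σ / 4), ‖f (shrink 0 0 p) - f₀ (circular p)‖ ≤ C * (‖p.1‖ + ε)
  mixedCoef_sub_le : ∀ j k, ∀ p ∈ zone Δ (σ / 4), ‖p.2.2‖ ≤ σ / 10 →
    ‖mixedCoef j k f p - dX j (dXt k f₀) (circular p)‖ ≤ C * (‖p.2.2‖ ^ 2 + ‖p.1‖ + ε)

/-- The averaged perturbation is analytic on a domain that does not shrink with ε. The scale `t` is
therefore a constant and Cauchy estimates lose no power of ε, while the distances to the circular
configuration stay explicit so that ε^β can be inserted later. The scaled functions at mass ratio 0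
carry the leading terms. -/
theorem exists_isSlowPert (hm₀ : 0 < m₀) (hm : ∀ j, 0 < m j) (hυ₀ : 0 < υ₀) (hσ : 0 < σ)
    (hσΔ : σ < Δ) : ∃ t > (0 : ℝ), ∃ C > (0 : ℝ), ∃ f : ℝ → Phase → ℂ,
      (∀ p ∈ zone Δ (σ / 4), f 0 (circular p) = υ₀ * constB m₀ m υ₀ * funF (p.2.1 0) ∧
        ∀ j k, dX j (dXt k (f 0)) (circular p) = t * eccCoef m₀ υ₀ m (p.2.1 0) j k) ∧
      AnalyticOnNhd ℂ (f 0) (zone Δ σ) ∧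
      ∀ ε : ℝ, 0 ≤ ε → ε ≤ t → IsSlowPert m₀ υ₀ m Δ σ t C ε (f 0) (f ε) := by
  obtain ⟨t₁, ht₁, M, hM, H⟩ := exists_isScaledPert hm₀ hm hυ₀ hσ hσΔ
  obtain ⟨ρ, hρ, M', hM', H'⟩ := exists_tube hm₀ hm hυ₀ hσΔ
  set t := min t₁ (min (ρ / 2) (min (ρ / σ) ((ρ / σ) ^ 2))) with ht
  have ht0 : 0 < t := by positivity
  have htt₁ : t ≤ t₁ := min_le_left _ _
  have htρ : t ≤ ρ / 2 := (min_le_right _ _).trans (min_le_left _ _)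
  have h1 : t * σ ≤ ρ := by
    rw [← le_div_iff₀ hσ]
    exact (min_le_right _ _).trans ((min_le_right _ _).trans (min_le_left _ _))
  have h2 : √t * σ ≤ ρ := by
    rw [← le_div_iff₀ hσ]
    exact Real.sqrt_le_iff.2 ⟨by positivity,
      (min_le_right _ _).trans ((min_le_right _ _).trans (min_le_right _ _))⟩
  have htube : ∀ e : ℂ, ‖e‖ ≤ ρ → ∀ p ∈ zone Δ σ, (e, scale t p) ∈ tube Δ σ ρ := fun e he p hp =>
    scale_mem_tube ht0.le le_rfl h1 h2 he hp
  set f : ℝ → Phase → ℂ := fun ε => fastAvg (scaledPert m₀ υ₀ m ε t) with hf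
  have hP := fun ε (h0 : 0 ≤ ε) (h : ε ≤ t) => H ε t h0 (h.trans htt₁) ht0 htt₁
  have hfa : ∀ ε, 0 ≤ ε → ε ≤ t → AnalyticOnNhd ℂ (f ε) (zone Δ σ) := fun ε h0 h =>
    analyticOnNhd_fastAvg (hP ε h0 h).analytic
  have hfM : ∀ ε, 0 ≤ ε → ε ≤ t → ∀ p ∈ zone Δ σ, ‖f ε p‖ ≤ M := fun ε h0 h p hp =>
    norm_fastAvg_le (hP ε h0 h).le hp
  have hfr : ∀ ε, 0 ≤ ε → ε ≤ t → RotInv (f ε) (zone Δ σ) := fun ε h0 h =>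
    RotInv.of_rot (fun θ => (rotSymm Δ θ).fastAvg_inv ((hP ε h0 h).rot_inv θ) (hP ε h0 h).analytic)
      (hP ε h0 h).periodic.fastInv_fastAvg
  have hlip : ∀ ε, 0 ≤ ε → ε ≤ t → ∀ p ∈ zone Δ σ,
      ‖f ε p - f 0 p‖ ≤ M' / (ρ / 2) * ε := by
    intro ε h0 h p hp
    have hPε := (hP ε h0 h).analytic
    have hP0 := (hP 0 le_rfl ht0.le).analytic
    simp only [hf]
    rw [← fastAvg_sub hPε hP0 hp]
    refine norm_fastAvg_le (fun q hq => ?_) hp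
    have := norm_pert_sub_le (m₀ := m₀) (υ₀ := υ₀) (m := m) hρ h0 (h.trans htρ)
      (fun e he => (H' _ (htube e he q hq)).1) fun e he => (H' _ (htube e he q hq)).2.1
    simpa [scaledPert] using this
  have hcirc : ∀ p ∈ zone Δ (σ / 4), ∀ u : ℝ, 2 - 2 * cos ((![p.2.1 0, p.2.1 1 + u] : Vec) 0)
      ∈ slitPlane := by
    intro p hp u
    obtain ⟨-, ⟨θ, hθ, k2⟩, -⟩ := mem_zone_iff.1 hp
    have := mem_slitPlane_two_sub_cos (σ := σ / 4) (by linarith) hθ k2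
    exact this
  set δ := σ / 10 with hδ
  have hδ0 : 0 < δ := by positivity
  set C := M / δ + M / δ ^ 4 + M / δ ^ 3 + M' / (ρ / 2) + M' / (ρ / 2) / δ / δ with hC
  refine ⟨t, ht0, C, by positivity, f, fun p hp => ⟨?_, fun j k => ?_⟩, hfa 0 le_rfl ht0.le,
    fun ε h0 h => ⟨hfa ε h0 h, hfr ε h0 h, fun p => avg_HP_scale hm₀ hm hυ₀ h0 p, ?_, ?_⟩⟩
  · refine fastAvg_eq_of_const fun u => ?_
    rw [scaledPert, scale_circular_add_fast, ofReal_zero, pert_circular hm₀ hm hυ₀ (hcirc p hp u)]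
    rfl
  · have hcz : circular p ∈ zone Δ (σ / 4) := circular_mem_zone (by positivity) hp le_rfl
    simp only [hf]
    rw [dX_dXt_fastAvg (hP 0 le_rfl ht0.le).analytic (by linarith) j k hcz]
    refine fastAvg_eq_of_const fun u => ?_
    have hz := zone_mono (by linarith : σ / 4 ≤ σ) (add_fast_mem_zone hcz u)
    have hga : AnalyticAt ℂ (fun p : Phase => pert m₀ υ₀ m (0, p))
        (scale t (circular p + (u : ℂ) • eFast)) :=
      AnalyticAt.fun_comp (f := fun p : Phase => ((0 : ℂ), p))
        (H' _ (htube 0 (by simpa using hρ.le) _ hz)).1 (analyticAt_const.prod analyticAt_id)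
    have e : scaledPert m₀ υ₀ m 0 t
        = fun q => (fun p : Phase => pert m₀ υ₀ m (0, p)) (scale t q) := by
      ext q; simp [scaledPert]
    rw [e, dX_dXt_comp_scale ht0.le hga, scale_circular_add_fast,
      dX_dXt_pert hm₀ hm hυ₀ (hcirc p hp u)]
    rfl
  · intro p hp
    have hsz : shrink 0 0 p ∈ zone Δ (σ / 4) := shrink_mem_zone (by simp) (by simp) hp
    have hcz : circular p ∈ zone Δ (σ / 4) := circular_mem_zone (by positivity) hp le_rfl
    have k1 := norm_sub_le_of_zone (r := σ / 4) (K := M / δ)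
      ((hfa ε h0 h).mono (zone_mono (by linarith)))
      (fun q hq => norm_fderiv_le_of_zone (hfa ε h0 h) (hfM ε h0 h) hδ0 (by linarith) hq) hcz hsz
    rw [norm_shrink_sub_circular] at k1
    have k2 := hlip ε h0 h _ (zone_mono (by linarith : σ / 4 ≤ σ) hcz)
    have hp1 := norm_nonneg p.1
    calc _ = ‖(f ε (shrink 0 0 p) - f ε (circular p)) + (f ε (circular p) - f 0 (circular p))‖ := by
          congr 1; ring
      _ ≤ M / δ * ‖p.1‖ + M' / (ρ / 2) * ε := (norm_add_le _ _).trans (add_le_add k1 k2)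
      _ ≤ C * ‖p.1‖ + C * ε := by
        gcongr
        · rw [hC]; have : 0 ≤ M / δ ^ 4 + M / δ ^ 3 + M' / (ρ / 2) + M' / (ρ / 2) / δ / δ := by
            positivity
          linarith
        · rw [hC]; have : 0 ≤ M / δ + M / δ ^ 4 + M / δ ^ 3 + M' / (ρ / 2) / δ / δ := by positivity
          linarith
      _ = _ := by ring
  · intro j k p hp hx
    have hcz : circular p ∈ zone Δ (σ / 4) := circular_mem_zone (by positivity) hp le_rfl
    have hp1 := norm_nonneg p.1
    refine norm_mixedCoef_sub_le (hfa ε h0 h) (zone_mono (by linarith) hp) fun a b ha hb => ?_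
    have hx' := norm_shrink_snd_le ha hb p
    have k1 := norm_dX_dXt_sub_circular_le (hfa ε h0 h) (hfM ε h0 h) (hfr ε h0 h) hδ0
      (r := σ / 4) (by positivity) (by linarith) j k (shrink_mem_zone ha hb hp) (hx'.trans hx)
    have k2 := norm_dX_dXt_le (f := fun q => f ε q - f 0 q)
      (fun q hq => (hfa ε h0 h q hq).fun_sub (hfa 0 le_rfl ht0.le q hq)) (hlip ε h0 h) hδ0
      (r := σ / 4) (by linarith) j k hcz
    rw [dX_dXt_sub (hfa ε h0 h) (hfa 0 le_rfl ht0.le) (by linarith) j k hcz] at k2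
    have e : circular (shrink a b p) = circular p := rfl
    have e1 : (shrink a b p).1 = p.1 := rfl
    rw [e, e1] at k1
    calc _ = ‖(dX j (dXt k (f ε)) (shrink a b p) - dX j (dXt k (f ε)) (circular p))
          + (dX j (dXt k (f ε)) (circular p) - dX j (dXt k (f 0)) (circular p))‖ := by
          congr 1; ring
      _ ≤ (M / δ ^ 4 * ‖(shrink a b p).2.2‖ ^ 2 + M / δ ^ 3 * ‖p.1‖)
          + M' / (ρ / 2) * ε / δ / δ := (norm_add_le _ _).trans (add_le_add k1 k2)
      _ ≤ (C * ‖p.2.2‖ ^ 2 + C * ‖p.1‖) + C * ε := by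
        have c1 : M / δ ^ 4 ≤ C := by
          rw [hC]; have : 0 ≤ M / δ + M / δ ^ 3 + M' / (ρ / 2) + M' / (ρ / 2) / δ / δ := by
            positivity
          linarith
        have c2 : M / δ ^ 3 ≤ C := by
          rw [hC]; have : 0 ≤ M / δ + M / δ ^ 4 + M' / (ρ / 2) + M' / (ρ / 2) / δ / δ := by
            positivity
          linarith
        have c3 : M' / (ρ / 2) / δ / δ ≤ C := by
          rw [hC]; have : 0 ≤ M / δ + M / δ ^ 4 + M / δ ^ 3 + M' / (ρ / 2) := by positivity
          linarith
        have c4 : M' / (ρ / 2) * ε / δ / δ = M' / (ρ / 2) / δ / δ * ε := by ring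
        rw [c4]
        gcongr
      _ = _ := by ring

end SlowPerturbation

/-! ### The averaged remainder of an arbitrary averaging transformation. -/

section Remainder

variable {m₀ υ₀ : ℝ} {m : Fin 2 → ℝ} {Δ σ β ε C₁ M : ℝ} {Υ : Phase → Phase}

theorem analyticAt_scale_comp_fst {h : Vec → ℂ} {τ : ℝ} {p : Phase}
    (hh : AnalyticAt ℂ h (scale τ p).1) : AnalyticAt ℂ (fun p : Phase => h (scale τ p).1) p :=
  hh.fun_comp (f := fun p : Phase => (scale τ p).1)
    (((ContinuousLinearMap.fst ℂ Vec (Vec × Vec × Vec)).comp (scale τ)).analyticAt p)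

/-- The averaged remainder of a first averaging transformation, in scaled variables. -/
theorem IsFirstAveraging.exists_averaged_remainder (hm₀ : 0 < m₀) (hm : ∀ j, 0 < m j)
    (hυ₀ : 0 < υ₀) (hσ : 0 < σ) (hε : 0 < ε)
    (hP : IsScaledPert Δ σ M (scaledPert m₀ υ₀ m ε (ε ^ β)))
    (hK : ∀ Z : Vec, ‖Z‖ ≤ ε ^ β * σ → AnalyticAt ℂ (HK m₀ m υ₀ ε) Z)
    (h : IsFirstAveraging m₀ m υ₀ Δ σ β ε C₁ Υ) :
    ∃ S : Phase → ℂ, AnalyticOnNhd ℂ S (zone Δ (1 / 3 * σ)) ∧ RotInv S (zone Δ (1 / 3 * σ)) ∧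
      ∀ p ∈ zone Δ (1 / 3 * σ), ‖S p‖ ≤ C₁ * ε ^ (2 - β) ∧
        avg (Hstar m₀ m υ₀ ε Υ) (scale (ε ^ β) p) = S p := by
  set τ := ε ^ β with hτdef
  have hτ : 0 < τ := Real.rpow_pos_of_pos hε β
  set P := scaledPert m₀ υ₀ m ε τ with hPdef
  have hsub : zone Δ (1 / 3 * σ) ⊆ zone Δ σ := zone_mono (by linarith)
  have hPa := (analyticOnNhd_fastAvg hP.analytic).mono hsub
  have hPi := hP.periodic.fastInv_fastAvg
  have hmem : ∀ p ∈ zone Δ (1 / 3 * σ), scale τ p ∈ domainAt Δ σ β ε (1 / 3) := fun p hp =>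
    scale_mem_domainAt hε hσ (by norm_num) hp
  have hKz : ∀ p ∈ zone Δ σ, AnalyticAt ℂ (HK m₀ m υ₀ ε) (scale τ p).1 := fun p hp => hK _ (by
    change ‖(τ : ℂ) • p.1‖ ≤ _
    rw [norm_smul, Complex.norm_real, Real.norm_of_nonneg hτ.le]
    exact mul_le_mul_of_nonneg_left (mem_zone_iff.1 hp).1 hτ.le)
  have hHam : ∀ q, scale τ⁻¹ q ∈ zone Δ σ → AnalyticAt ℂ (Ham m₀ m υ₀ ε) q := by
    intro q hq
    have e : Ham m₀ m υ₀ ε = fun q => HK m₀ m υ₀ ε q.1 + ε * P (scale τ⁻¹ q) := by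
      ext q
      rw [Ham, HP_eq hm₀ hm hυ₀ hε.le, hPdef, scaledPert, scale_scale_inv hτ]
    have h1 := hKz _ hq
    rw [scale_scale_inv hτ] at h1
    rw [e]
    exact (h1.fun_comp (f := fun p : Phase => p.1) analyticAt_fst).add
      (analyticAt_const.mul ((hP.analytic _ hq).fun_comp (f := fun q : Phase => scale τ⁻¹ q)
        ((scale τ⁻¹).analyticAt q)))
  -- `G` is H_* in scaled variables with `avg` replaced by `fastAvg`; the two agree on the zone. Its
  -- analyticity and invariance use nothing about `Υ` beyond the properties required of a first
  -- averaging transformation, the invariance coming from the D'Alembert rule.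
  set G : Phase → ℂ := fun p => Ham m₀ m υ₀ ε (Υ (scale τ p)) - HK m₀ m υ₀ ε (scale τ p).1
    - ε * fastAvg P p with hG
  have hGa : AnalyticOnNhd ℂ G (zone Δ (1 / 3 * σ)) := by
    intro p hp
    have h1 : AnalyticAt ℂ (fun p => Υ (scale τ p)) p :=
      (h.canonical.analytic _ (hmem p hp)).fun_comp (f := fun p : Phase => scale τ p)
        ((scale τ).analyticAt p)
    have h2 : Υ (scale τ p) ∈ domainAt Δ σ β ε (1 / 2) := h.image_subset ⟨_, hmem p hp, rfl⟩
    have h3 := hHam _ (zone_mono (by linarith) ((mem_domainAt_iff hε hσ (by norm_num)).1 h2))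
    exact ((h3.fun_comp (f := fun p => Υ (scale τ p)) h1).fun_sub
      (analyticAt_scale_comp_fst (hKz p (hsub hp)))).fun_sub (analyticAt_const.mul (hPa p hp))
  have hGr : ∀ θ, (rotSymm Δ θ).Inv G (zone Δ (1 / 3 * σ)) := by
    intro θ p hp
    rw [rotSymm_map]
    change G (rot θ p) = G p
    have h1 := h.dalembert _ (hmem p hp) θ
    beta_reduce at h1
    rw [← rot_apply] at h1
    have h2 : (scale τ (rot θ p)).1 = (scale τ p).1 := by rw [scale_rot, rot_apply]
    have h3 : fastAvg P (rot θ p) = fastAvg P p :=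
      (rotSymm Δ θ).fastAvg_inv (hP.rot_inv θ) hP.analytic p (hsub hp)
    simp only [hG]
    rw [h2, h3, scale_rot, h1]
  have hGp : FastPeriodic G (zone Δ (1 / 3 * σ)) := .of_rot (hGr _)
  have hstar : ∀ p ∈ zone Δ (1 / 3 * σ), Hstar m₀ m υ₀ ε Υ (scale τ p) = G p := by
    intro p hp
    rw [Hstar, avg_HP_scale hm₀ hm hυ₀ hε.le, ← hPdef,
      FastInv.flat (analyticOnNhd_fastAvg hP.analytic) hPi (hsub hp)]
  have havg : ∀ p ∈ zone Δ (1 / 3 * σ),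
      avg (Hstar m₀ m υ₀ ε Υ) (scale τ p) = fastAvg G p := by
    intro p hp
    rw [avg_scale, ← FastInv.flat (analyticOnNhd_fastAvg hGa) hGp.fastInv_fastAvg hp, fastAvg,
      fastAvg]
    congr 1
    exact intervalIntegral.integral_congr fun u _ =>
      hstar _ (add_fast_mem_zone (flat_mem_zone hp) u)
  refine ⟨fastAvg G, analyticOnNhd_fastAvg hGa,
    RotInv.of_rot (fun θ => (rotSymm Δ θ).fastAvg_inv (hGr θ) hGa) hGp.fastInv_fastAvg,
    fun p hp => ⟨?_, havg p hp⟩⟩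
  rw [← havg p hp]
  exact h.avg_le _ (hmem p hp)

end Remainder

/-! ### The linear change of variables. -/

section LinearChange

variable {m : Fin 2 → ℝ}

theorem kappa_mem (hm : 0 < m 0) (hm' : m 0 ≤ m 1) : 0 < kappa m ∧ kappa m ≤ 1 / 2 := by
  rw [kappa]
  have : 0 < m 0 + m 1 := by linarith
  exact ⟨by positivity, by rw [div_le_iff₀ this]; linarith⟩

theorem sympl_Psi (u v : Phase) : sympl (Psi m u) (Psi m v) = sympl u v := by
  simp [sympl, Psi, dotProduct, Fin.sum_univ_two]
  ring

/-- m₁ ≤ m₂ gives κ ≤ 1/2, so the change of variables and its inverse enlarge norms by at most 3/2.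
This sends width 1/6 into exactly 1/4, and 1/18 into 1/12, which is below 1/6. -/
theorem norm_add_kappa_mul_le (hκ : 0 < kappa m ∧ kappa m ≤ 1 / 2) {v : Vec} {B : ℝ}
    (hB : 0 ≤ B) (hv : ‖v‖ ≤ B) : ‖(![v 0 + kappa m * v 1, v 1] : Vec)‖ ≤ 3 / 2 * B ∧
    ‖(![v 0 - kappa m * v 1, v 1] : Vec)‖ ≤ 3 / 2 * B ∧
    ‖(![v 0, v 1 + kappa m * v 0] : Vec)‖ ≤ 3 / 2 * B ∧
    ‖(![v 0, v 1 - kappa m * v 0] : Vec)‖ ≤ 3 / 2 * B := by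
  have h := fun j => (norm_le_pi_norm v j).trans hv
  have hk : ∀ j, ‖(kappa m : ℂ) * v j‖ ≤ 1 / 2 * B := fun j => by
    rw [norm_mul, Complex.norm_real, Real.norm_of_nonneg hκ.1.le]
    exact mul_le_mul hκ.2 (h j) (norm_nonneg _) (by norm_num)
  have h32 : 0 ≤ 3 / 2 * B := by positivity
  have hs : ∀ j, ‖v j‖ ≤ 3 / 2 * B := fun j => (h j).trans (by linarith)
  have ha : ∀ i j, ‖v i + kappa m * v j‖ ≤ 3 / 2 * B := fun i j =>
    (norm_add_le _ _).trans (by linarith [h i, hk j])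
  have hb : ∀ i j, ‖v i - kappa m * v j‖ ≤ 3 / 2 * B := fun i j =>
    (norm_sub_le _ _).trans (by linarith [h i, hk j])
  simp only [pi_norm_le_iff_of_nonneg h32, Fin.forall_fin_two, Matrix.cons_val_zero,
    Matrix.cons_val_one]
  exact ⟨⟨ha 0 1, hs 1⟩, ⟨hb 0 1, hs 1⟩, ⟨hs 0, ha 1 0⟩, ⟨hs 0, hb 1 0⟩⟩

theorem Psi_mem_domainAt (hκ : 0 < kappa m ∧ kappa m ≤ 1 / 2) {Δ σ β ε q q' : ℝ} (hσ : 0 < σ)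
    (hε : 0 < ε) (hq : 0 ≤ q) (hqq : 3 / 2 * q ≤ q') {p : Phase} (hp : p ∈ domainAt Δ σ β ε q) :
    Psi m p ∈ domainAt Δ σ β ε q' ∧
    (![p.1 0 - kappa m * p.1 1, p.1 1], ![p.2.1 0, p.2.1 1 + kappa m * p.2.1 0], p.2.2)
      ∈ domainAt Δ σ β ε q' := by
  obtain ⟨h1, ⟨θ, hθ, h2⟩, h3⟩ := hp
  have hτ : 0 < ε ^ β := Real.rpow_pos_of_pos hε β
  have hx : ‖p.2.2‖ ≤ √(q' * (σ * ε ^ β) * (q' * σ)) := by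
    refine h3.trans (Real.sqrt_le_sqrt ?_)
    have h4 : q ≤ q' := by linarith
    have h5 : 0 ≤ q' := hq.trans h4
    gcongr
  have hr : 3 / 2 * (q * (σ * ε ^ β)) ≤ q' * (σ * ε ^ β) := by
    rw [← mul_assoc]; gcongr
  have hs : 3 / 2 * (q * σ) ≤ q' * σ := by rw [← mul_assoc]; gcongr
  obtain ⟨k1, k2, -, -⟩ := norm_add_kappa_mul_le hκ (by positivity) h1
  obtain ⟨-, -, k3, k4⟩ := norm_add_kappa_mul_le hκ (by positivity) h2
  refine ⟨⟨k1.trans hr, ⟨![θ 0, θ 1 - kappa m * θ 0], hθ, ?_⟩, hx⟩,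
    ⟨k2.trans hr, ⟨![θ 0, θ 1 + kappa m * θ 0], hθ, ?_⟩, hx⟩⟩
  · refine le_of_eq_of_le (congrArg norm ?_) (k4.trans hs)
    ext j
    fin_cases j
    · simp [Psi]
    · simp [Psi]; ring
  · refine le_of_eq_of_le (congrArg norm ?_) (k3.trans hs)
    ext j
    fin_cases j
    · simp
    · simp; ring

theorem Psi_image (hm : 0 < m 0) (hm' : m 0 ≤ m 1) {Δ σ β ε : ℝ} (hσ : 0 < σ) (hε : 0 < ε) :
    domainAt Δ σ β ε (1 / 18) ⊆ Psi m '' domainAt Δ σ β ε (1 / 6) ∧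
    Psi m '' domainAt Δ σ β ε (1 / 6) ⊆ domainAt Δ σ β ε (1 / 4) := by
  have hκ := kappa_mem hm hm'
  constructor
  · intro p hp
    refine ⟨_, (Psi_mem_domainAt hκ hσ hε (by norm_num) (by norm_num) hp).2, ?_⟩
    ext j
    · fin_cases j <;> simp [Psi]
    · fin_cases j <;> simp [Psi]
    · rfl
    · rfl
  · rintro _ ⟨p, hp, rfl⟩
    exact (Psi_mem_domainAt hκ hσ hε (by norm_num) (by norm_num) hp).1

end LinearChange

/-! ### Decomposition of the averaged Hamiltonian. -/

section Reduction

variable {m₀ υ₀ : ℝ} {m : Fin 2 → ℝ} {Δ σ β : ℝ}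

theorem norm_scale_fst {c : ℝ} (hc : 0 ≤ c) (p : Phase) : ‖(scale c p).1‖ = c * ‖p.1‖ := by
  change ‖(c : ℂ) • p.1‖ = _
  rw [norm_smul, Complex.norm_real, Real.norm_of_nonneg hc]

theorem norm_scale_snd (c : ℝ) (p : Phase) : ‖(scale c p).2.2‖ = √c * ‖p.2.2‖ := by
  change ‖((√c : ℝ) : ℂ) • p.2.2‖ = _
  rw [norm_smul, Complex.norm_real, Real.norm_of_nonneg (Real.sqrt_nonneg c)]

theorem shrink_scale (c : ℝ) (a b : ℂ) (p : Phase) :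
    shrink a b (scale c p) = scale c (shrink a b p) := by
  refine Prod.ext rfl (Prod.ext rfl (Prod.ext ?_ ?_))
  · exact smul_comm a _ p.2.2.1
  · exact smul_comm b _ p.2.2.2

theorem analyticAt_circular (p : Phase) : AnalyticAt ℂ circular p :=
  analyticAt_const.prod ((((ContinuousLinearMap.fst ℂ Vec (Vec × Vec)).comp
    (ContinuousLinearMap.snd ℂ Vec (Vec × Vec × Vec))).analyticAt p).prod
    (analyticAt_const.prod analyticAt_const))

/-- The error in the expansion of the Keplerian Hamiltonian at the exact resonance. -/
noncomputable def keplerRem (m₀ υ₀ : ℝ) (m : Fin 2 → ℝ) (ε : ℝ) (Z : Vec) : ℂ :=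
  HK m₀ m υ₀ ε Z - HK m₀ m υ₀ ε 0 - υ₀ * Z 1 + 3 / 2 * υ₀ * (Z 0 ^ 2 / (m 0 * ell m₀ υ₀)
    + (Z 1 - Z 0) ^ 2 / (m 1 * ell m₀ υ₀))

theorem analyticAt_keplerRem {ε : ℝ} {p : Phase} (h : AnalyticAt ℂ (HK m₀ m υ₀ ε) p.1) :
    AnalyticAt ℂ (fun p : Phase => keplerRem m₀ υ₀ m ε p.1) p := by
  have hZ : ∀ j : Fin 2, AnalyticAt ℂ (fun p : Phase => p.1 j) p := fun j =>
    ((ContinuousLinearMap.proj (R := ℂ) (φ := fun _ : Fin 2 => ℂ) j).comp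
      (ContinuousLinearMap.fst ℂ Vec (Vec × Vec × Vec))).analyticAt p
  have h1 : AnalyticAt ℂ (fun p : Phase => HK m₀ m υ₀ ε p.1) p :=
    h.fun_comp (f := fun p : Phase => p.1) analyticAt_fst
  have hd : ∀ {g : Phase → ℂ} (c : ℂ), AnalyticAt ℂ g p → AnalyticAt ℂ (fun p => g p / c) p :=
    fun c hg => by simpa only [div_eq_mul_inv] using hg.fun_mul analyticAt_const
  exact ((h1.sub analyticAt_const).sub (analyticAt_const.mul (hZ 1))).add
    (analyticAt_const.mul ((hd _ ((hZ 0).pow 2)).add (hd _ (((hZ 1).sub (hZ 0)).pow 2))))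

/-- Decomposition of the averaged Hamiltonian. -/
theorem exists_averaged_decomposition (hm₀ : 0 < m₀) (hm : ∀ j, 0 < m j) (hυ₀ : 0 < υ₀)
    (hσ : 0 < σ) (hσΔ : σ < Δ) (hβ : 1 / 7 < β) (hβ' : β < 1 / 2) {C₁ : ℝ} (hC₁ : 0 < C₁) :
    ∃ C > 0, ∃ ε₀ > 0, ∀ ε : ℝ, 0 < ε → ε < ε₀ → ε ≤ 1 ∧ ∀ Υ : Phase → Phase,
      IsFirstAveraging m₀ m υ₀ Δ σ β ε C₁ Υ →
      ∃ (g₀ : Phase → ℂ) (g₂ : Fin 2 → Fin 2 → Phase → ℂ),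
        AnalyticOnNhd ℂ g₀ (domainAt Δ σ β ε (1 / 4)) ∧
        (∀ j k, AnalyticOnNhd ℂ (g₂ j k) (domainAt Δ σ β ε (1 / 4))) ∧
        ∀ q ∈ domainAt Δ σ β ε (1 / 4),
          (flat q = q → Hbar m₀ m υ₀ ε Υ q - HK m₀ m υ₀ ε 0
            = υ₀ * q.1 1 - 3 / 2 * υ₀ * (q.1 0 ^ 2 / (m 0 * ell m₀ υ₀)
              + (q.1 1 - q.1 0) ^ 2 / (m 1 * ell m₀ υ₀))
              + ε * (υ₀ * constB m₀ m υ₀ * funF (q.2.1 0))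
              + Qform m₀ m υ₀ ε (q.2.1 0) q.2.2.1 q.2.2.2
              + (g₀ (shrink 0 0 q) + ∑ j, ∑ k, g₂ j k q * q.2.2.1 j * q.2.2.2 k)) ∧
          ‖g₀ (shrink 0 0 q)‖ ≤ C * ε ^ (3 * β) ∧
          ∀ j k, ‖g₂ j k q‖ ≤ C * (ε ^ (2 - 2 * β) + ε ^ (1 + β)) := by
  obtain ⟨t₁, ht₁, M, hM, hSP⟩ := exists_isScaledPert hm₀ hm hυ₀ hσ hσΔ
  obtain ⟨ρ, hρ, CK, hCK, HKe⟩ := exists_HK_expansion hm₀ hm hυ₀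
  obtain ⟨t, ht, Cf, hCf, f, hf0, hf0a, HF⟩ := exists_isSlowPert hm₀ hm hυ₀ hσ hσΔ
  obtain ⟨ε₀, hε₀, hsmall⟩ := exists_of_eventually_pos
    (P := fun ε => ε ^ β ≤ min t₁ (min (ρ / σ) (t / 10)) ∧ ε ^ (1 : ℝ) ≤ min 1 (min t₁ (min ρ t)))
    ((eventually_rpow_le (by linarith) (by positivity)).and
      (eventually_rpow_le one_pos (by positivity)))
  -- In units of `t` the squared eccentricities and the actions are both O(τ), and ε ≤ τ; `K` adds
  -- the three constants.
  set K := σ ^ 2 / (16 * t) + σ / (4 * t) + 1 with hK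
  have hK0 : 0 < K := by positivity
  -- Two successive Cauchy estimates fit exactly between σ/4 and σ/3.
  set δ := σ / 24 with hδ
  have hδ0 : 0 < δ := by positivity
  set C := CK * ((σ / 4) ^ 3 + (σ / 4) ^ 2) + C₁ + Cf * K + t⁻¹ * (Cf * K) + C₁ / δ / δ with hC
  refine ⟨C, by positivity, ε₀, hε₀, fun ε hε hεε₀ => ?_⟩
  obtain ⟨hs1, hs2⟩ := hsmall ε hε hεε₀
  rw [Real.rpow_one] at hs2
  simp only [le_min_iff] at hs1 hs2
  obtain ⟨hτt₁, hτρ, hτt⟩ := hs1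
  obtain ⟨hε1, hεt₁, hερ, hεt⟩ := hs2
  refine ⟨hε1, fun Υ hΥ => ?_⟩
  set τ := ε ^ β with hτdef
  have hτ : 0 < τ := Real.rpow_pos_of_pos hε β
  have hετ : ε ≤ τ := by
    conv_lhs => rw [← Real.rpow_one ε]
    exact Real.rpow_le_rpow_of_exponent_ge hε hε1 (by linarith)
  rw [le_div_iff₀ hσ] at hτρ
  have hKa : ∀ Z : Vec, ‖Z‖ ≤ τ * σ → AnalyticAt ℂ (HK m₀ m υ₀ ε) Z := fun Z hZ =>
    (HKe ε hε.le hερ Z (hZ.trans hτρ)).1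
  obtain ⟨S, hSa, hSr, hS⟩ := hΥ.exists_averaged_remainder hm₀ hm hυ₀ hσ hε
    (hSP ε τ hε.le hεt₁ hτ hτt₁) hKa
  have hfε := HF ε hε.le hεt
  have hX : ∀ q ∈ domainAt Δ σ β ε (1 / 4), scale τ⁻¹ q ∈ zone Δ (1 / 4 * σ) := fun q hq =>
    (mem_domainAt_iff hε hσ (by norm_num)).1 hq
  have hZ : ∀ q ∈ domainAt Δ σ β ε (1 / 4), ‖q.1‖ ≤ σ / 4 * τ := fun q hq =>
    hq.1.trans_eq (by rw [hτdef]; ring)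
  have hx : ∀ q ∈ domainAt Δ σ β ε (1 / 4), ‖q.2.2‖ ^ 2 ≤ (σ / 4) ^ 2 * τ := fun q hq => by
    have h1 := pow_le_pow_left₀ (norm_nonneg _) hq.2.2 2
    rw [Real.sq_sqrt (by positivity)] at h1
    exact h1.trans_eq (by rw [hτdef]; ring)
  have hY1 : ∀ q ∈ domainAt Δ σ β ε (1 / 4), ‖(scale t⁻¹ q).1‖ ≤ σ / (4 * t) * τ := by
    intro q hq
    rw [norm_scale_fst (by positivity)]
    calc _ ≤ t⁻¹ * (σ / 4 * τ) := by gcongr; exact hZ q hq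
      _ = _ := by field_simp
  have hY2 : ∀ q ∈ domainAt Δ σ β ε (1 / 4),
      ‖(scale t⁻¹ q).2.2‖ ^ 2 ≤ σ ^ 2 / (16 * t) * τ := by
    intro q hq
    rw [norm_scale_snd, mul_pow, Real.sq_sqrt (by positivity)]
    calc _ ≤ t⁻¹ * ((σ / 4) ^ 2 * τ) := by gcongr; exact hx q hq
      _ = _ := by field_simp; ring
  have hY3 : ∀ q ∈ domainAt Δ σ β ε (1 / 4), ‖(scale t⁻¹ q).2.2‖ ≤ σ / 10 := by
    intro q hq
    refine le_of_sq_le_sq ((hY2 q hq).trans ?_) (by positivity)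
    calc σ ^ 2 / (16 * t) * τ ≤ σ ^ 2 / (16 * t) * (t / 10) := by gcongr
      _ = σ ^ 2 / 160 := by field_simp; norm_num
      _ ≤ (σ / 10) ^ 2 := by nlinarith [sq_nonneg σ]
  have hY : ∀ q ∈ domainAt Δ σ β ε (1 / 4), scale t⁻¹ q ∈ zone Δ (σ / 4) := by
    intro q hq
    obtain ⟨θ, hθ, h2⟩ := hq.2.1
    refine mem_zone_iff.2 ⟨(hY1 q hq).trans ?_, ⟨θ, hθ, h2.trans_eq (by ring)⟩,
      (hY3 q hq).trans (by linarith)⟩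
    calc σ / (4 * t) * τ ≤ σ / (4 * t) * t := by gcongr; linarith
      _ = _ := by field_simp
  have hE : ∀ q ∈ domainAt Δ σ β ε (1 / 4),
      ‖(scale t⁻¹ q).2.2‖ ^ 2 + ‖(scale t⁻¹ q).1‖ + ε ≤ K * τ := by
    intro q hq
    rw [hK]
    linarith [hY1 q hq, hY2 q hq]
  have hshrink : ∀ q ∈ domainAt Δ σ β ε (1 / 4), shrink 0 0 q ∈ domainAt Δ σ β ε (1 / 4) :=
    fun q hq => ⟨hq.1, hq.2.1, (norm_shrink_snd_le (by simp) (by simp) q).trans hq.2.2⟩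
  have hsa : ∀ (c : ℝ) (g : Phase → ℂ) (q : Phase), AnalyticAt ℂ g (scale c q) →
      AnalyticAt ℂ (fun q => g (scale c q)) q := fun c g q hg =>
    hg.fun_comp (f := fun q : Phase => scale c q) ((scale c).analyticAt q)
  have hca : ∀ (g : Phase → ℂ) (q : Phase), AnalyticAt ℂ g (circular (scale t⁻¹ q)) →
      AnalyticAt ℂ (fun q => g (circular (scale t⁻¹ q))) q := fun g q hg =>
    hsa t⁻¹ (fun p => g (circular p)) q
      (hg.fun_comp (f := circular) (analyticAt_circular _))
  have m43 : zone Δ (1 / 4 * σ) ⊆ zone Δ (1 / 3 * σ) := zone_mono (by linarith)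
  have m4 : zone Δ (σ / 4) ⊆ zone Δ σ := zone_mono (by linarith)
  have hcirc : ∀ q ∈ domainAt Δ σ β ε (1 / 4), circular (scale t⁻¹ q) ∈ zone Δ σ := fun q hq =>
    m4 (circular_mem_zone (by positivity) (hY q hq) le_rfl)
  -- `g₀` gathers the Kepler error, the averaged H_* and the deviation of the perturbation from its
  -- circular value; it is used only at zero eccentricity. In `g₂` the factors 1/t and 1/τ undo the
  -- scaling of the two eccentricities that each coefficient multiplies.
  refine ⟨fun q => keplerRem m₀ υ₀ m ε q.1 + S (scale τ⁻¹ q)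
      + ε * (f ε (scale t⁻¹ q) - f 0 (circular (scale t⁻¹ q))),
    fun j k q => ε * (t : ℂ)⁻¹ * (mixedCoef j k (f ε) (scale t⁻¹ q)
      - dX j (dXt k (f 0)) (circular (scale t⁻¹ q)))
      + (τ : ℂ)⁻¹ * mixedCoef j k S (scale τ⁻¹ q), ?_, ?_, fun q hq => ⟨?_, ?_, ?_⟩⟩
  · intro q hq
    exact ((analyticAt_keplerRem (hKa _ ((hZ q hq).trans (by nlinarith)))).add
      (hsa _ _ q (hSa _ (m43 (hX q hq))))).add (analyticAt_const.mul
      ((hsa _ _ q (hfε.analytic _ (m4 (hY q hq)))).sub (hca _ q (hf0a _ (hcirc q hq)))))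
  · intro j k q hq
    exact (analyticAt_const.mul ((hsa _ _ q (analyticOnNhd_mixedCoef hfε.analytic j k _
      (m4 (hY q hq)))).sub (hca _ q (analyticOnNhd_dX (analyticOnNhd_dXt hf0a k) j _
      (hcirc q hq))))).add (analyticAt_const.mul
      (hsa _ _ q (analyticOnNhd_mixedCoef hSa j k _ (m43 (hX q hq)))))
  · intro hflat
    have e1 : avg (Hstar m₀ m υ₀ ε Υ) q = S (scale τ⁻¹ q) := by
      have := (hS _ (m43 (hX q hq))).2
      rwa [scale_scale_inv hτ] at this
    have e2 : avg (HP m₀ m υ₀ ε) q = ε * f ε (scale t⁻¹ q) := by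
      have := hfε.avg_HP (scale t⁻¹ q)
      rwa [scale_scale_inv ht, flat_scale, hflat] at this
    have e3 := eq_add_sum_mixedCoef hSa hSr (m43 (hX q hq))
    have e4 := eq_add_sum_mixedCoef hfε.analytic hfε.inv (m4 (hY q hq))
    obtain ⟨e5, e6⟩ := hf0 _ (hY q hq)
    have hsq : ∀ c : ℝ, 0 < c → ((√c⁻¹ : ℝ) : ℂ) * (√c⁻¹ : ℝ) = (c : ℂ)⁻¹ := fun c hc => by
      rw [← ofReal_mul, Real.mul_self_sqrt (by positivity), ofReal_inv]
    have hmul : ∀ c : ℝ, 0 < c → ∀ (a : ℂ) (j k : Fin 2),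
        a * (scale c⁻¹ q).2.2.1 j * (scale c⁻¹ q).2.2.2 k
          = (c : ℂ)⁻¹ * a * q.2.2.1 j * q.2.2.2 k := fun c hc a j k => by
      have k1 : (scale c⁻¹ q).2.2.1 j = (√c⁻¹ : ℝ) * q.2.2.1 j := rfl
      have k2 : (scale c⁻¹ q).2.2.2 k = (√c⁻¹ : ℝ) * q.2.2.2 k := rfl
      rw [k1, k2, ← hsq c hc]
      ring
    simp only [hmul τ hτ, hmul t ht] at e3 e4
    have e7 : (scale t⁻¹ q).2.1 0 = q.2.1 0 := rfl
    rw [e7] at e5 e6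
    have hcs : circular (scale t⁻¹ (shrink 0 0 q)) = circular (scale t⁻¹ q) := rfl
    beta_reduce
    rw [Hbar, e1, e2, e3, e4, Qform_eq, shrink_scale, shrink_scale, hcs, e5]
    have hk : keplerRem m₀ υ₀ m ε (shrink 0 0 q).1 = keplerRem m₀ υ₀ m ε q.1 := rfl
    rw [hk, keplerRem]
    simp only [e6]
    have htC : (t : ℂ) ≠ 0 := by exact_mod_cast ht.ne'
    simp only [Fin.sum_univ_two]
    field_simp
    ring
  · have hq0 := hshrink q hq
    have k1 := (HKe ε hε.le hερ q.1 ((hZ q hq).trans (by nlinarith))).2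
    have k2 := (hS _ (m43 (hX _ hq0))).1
    have k3 := hfε.shrink_sub_le _ (hY q hq)
    have hcs : circular (scale t⁻¹ (shrink 0 0 q)) = circular (scale t⁻¹ q) := rfl
    rw [shrink_scale] at k3
    have h3 : τ ^ 3 = ε ^ (3 * β) := by
      rw [hτdef, ← Real.rpow_natCast, ← Real.rpow_mul hε.le]; congr 1; push_cast; ring
    -- Both 3β ≤ 2 - β and 3β ≤ 1 + β amount to β ≤ 1/2, so the cubic Kepler error dominates.
    have h4 : ε ^ (2 - β) ≤ ε ^ (3 * β) :=
      Real.rpow_le_rpow_of_exponent_ge hε hε1 (by linarith)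
    have h5 : ε * τ ≤ ε ^ (3 * β) := by
      have : ε * τ = ε ^ (1 + β) := by rw [Real.rpow_add hε, Real.rpow_one]
      rw [this]
      exact Real.rpow_le_rpow_of_exponent_ge hε hε1 (by linarith)
    have h0 : 0 < ε ^ (3 * β) := Real.rpow_pos_of_pos hε _
    have b1 : CK * (‖q.1‖ ^ 3 + ε * ‖q.1‖ ^ 2)
        ≤ CK * ((σ / 4) ^ 3 + (σ / 4) ^ 2) * ε ^ (3 * β) := by
      calc _ ≤ CK * ((σ / 4 * τ) ^ 3 + τ * (σ / 4 * τ) ^ 2) := by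
            gcongr <;> exact hZ q hq
        _ = CK * ((σ / 4) ^ 3 + (σ / 4) ^ 2) * τ ^ 3 := by ring
        _ = _ := by rw [h3]
    have b3 : ε * (Cf * (‖(scale t⁻¹ q).1‖ + ε)) ≤ Cf * K * ε ^ (3 * β) := by
      have := hE q hq
      calc _ ≤ ε * (Cf * (K * τ)) := by
            gcongr
            linarith [sq_nonneg ‖(scale t⁻¹ q).2.2‖]
        _ = Cf * K * (ε * τ) := by ring
        _ ≤ _ := by gcongr
    have hrest : 0 ≤ t⁻¹ * (Cf * K) + C₁ / δ / δ := by positivity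
    calc _ ≤ ‖keplerRem m₀ υ₀ m ε q.1‖ + ‖S (scale τ⁻¹ (shrink 0 0 q))‖
          + ‖ε * (f ε (scale t⁻¹ (shrink 0 0 q)) - f 0 (circular (scale t⁻¹ q)))‖ := norm_add₃_le
      _ ≤ CK * ((σ / 4) ^ 3 + (σ / 4) ^ 2) * ε ^ (3 * β) + C₁ * ε ^ (3 * β)
          + Cf * K * ε ^ (3 * β) := by
        refine add_le_add (add_le_add (k1.trans b1) (k2.trans (by gcongr))) ?_
        rw [norm_mul, Complex.norm_real, Real.norm_of_nonneg hε.le]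
        exact (mul_le_mul_of_nonneg_left k3 hε.le).trans b3
      _ ≤ C * ε ^ (3 * β) := by
        rw [hC]
        have := mul_nonneg hrest h0.le
        linarith
  · intro j k
    have k1 := hfε.mixedCoef_sub_le j k _ (hY q hq) (hY3 q hq)
    have k2 : ‖mixedCoef j k S (scale τ⁻¹ q) - 0‖ ≤ C₁ * ε ^ (2 - β) / δ / δ :=
      norm_mixedCoef_sub_le hSa (m43 (hX q hq)) fun a b ha hb => by
        rw [sub_zero]
        exact norm_dX_dXt_le hSa (fun p hp => (hS p hp).1) hδ0 (r := 1 / 4 * σ) (by linarith) j k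
          (shrink_mem_zone ha hb (hX q hq))
    rw [sub_zero] at k2
    -- The perturbation contributes ε times a distance O(τ) to the coefficients; the averaged
    -- remainder contributes ε^(2-β) divided by the product τ of two eccentricity scales.
    have h1 : ε * τ = ε ^ (1 + β) := by rw [Real.rpow_add hε, Real.rpow_one]
    have h2 : τ⁻¹ * ε ^ (2 - β) = ε ^ (2 - 2 * β) := by
      rw [hτdef, ← Real.rpow_neg hε.le, ← Real.rpow_add hε]; congr 1; ring
    have h0 : 0 < ε ^ (2 - 2 * β) := Real.rpow_pos_of_pos hε _
    have h0' : 0 < ε ^ (1 + β) := Real.rpow_pos_of_pos hε _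
    have c1 : t⁻¹ * (Cf * K) ≤ C := by
      rw [hC]
      have : 0 ≤ CK * ((σ / 4) ^ 3 + (σ / 4) ^ 2) + C₁ + Cf * K + C₁ / δ / δ := by positivity
      linarith
    have c2 : C₁ / δ / δ ≤ C := by
      rw [hC]
      have : 0 ≤ CK * ((σ / 4) ^ 3 + (σ / 4) ^ 2) + C₁ + Cf * K + t⁻¹ * (Cf * K) := by positivity
      linarith
    refine (norm_add_le _ _).trans ?_
    rw [norm_mul, norm_mul, norm_mul, norm_inv, norm_inv, Complex.norm_real, Complex.norm_real,
      Complex.norm_real, Real.norm_of_nonneg hε.le, Real.norm_of_nonneg ht.le,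
      Real.norm_of_nonneg hτ.le]
    calc _ ≤ ε * t⁻¹ * (Cf * (K * τ)) + τ⁻¹ * (C₁ * ε ^ (2 - β) / δ / δ) := by
          gcongr
          exact k1.trans (mul_le_mul_of_nonneg_left (hE q hq) hCf.le)
      _ = t⁻¹ * (Cf * K) * (ε * τ) + C₁ / δ / δ * (τ⁻¹ * ε ^ (2 - β)) := by ring
      _ ≤ C * ε ^ (1 + β) + C * ε ^ (2 - 2 * β) := by rw [h1, h2]; gcongr
      _ = _ := by ring

end Reduction

/-! ### The reduced Hamiltonian and its remainder. -/

section ReducedHamiltonian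

variable {m₀ υ₀ : ℝ} {m : Fin 2 → ℝ} {Δ σ β ε : ℝ}

/-- The point `Ψ(J, (φ, φ₂), w, w̃)` with its fast angle set to zero. -/
noncomputable def reducedPoint (m : Fin 2 → ℝ) (J : Vec) (φ : ℂ) (w wt : Vec) : Phase :=
  (![J 0 + kappa m * J 1, J 1], ![φ, 0], w, wt)

theorem flat_Psi (p : Phase) :
    flat (Psi m p) = reducedPoint m p.1 (p.2.1 0) p.2.2.1 p.2.2.2 := rfl

theorem shrink_zero_reducedPoint (J : Vec) (φ : ℂ) (w wt : Vec) :
    shrink 0 0 (reducedPoint m J φ w wt) = reducedPoint m J φ 0 0 := by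
  simp [shrink, reducedPoint]

theorem analyticAt_reducedPoint (m : Fin 2 → ℝ) (p : Phase) :
    AnalyticAt ℂ (fun p : Phase => reducedPoint m p.1 (p.2.1 0) p.2.2.1 p.2.2.2) p := by
  have hJ : ∀ j : Fin 2, AnalyticAt ℂ (fun p : Phase => p.1 j) p := fun j =>
    ((ContinuousLinearMap.proj (R := ℂ) (φ := fun _ : Fin 2 => ℂ) j).comp
      (ContinuousLinearMap.fst ℂ Vec (Vec × Vec × Vec))).analyticAt p
  have hφ : AnalyticAt ℂ (fun p : Phase => p.2.1 0) p :=
    ((ContinuousLinearMap.proj (R := ℂ) (φ := fun _ : Fin 2 => ℂ) 0).comp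
      ((ContinuousLinearMap.fst ℂ Vec (Vec × Vec)).comp
        (ContinuousLinearMap.snd ℂ Vec (Vec × Vec × Vec)))).analyticAt p
  have hx : AnalyticAt ℂ (fun p : Phase => p.2.2) p :=
    ((ContinuousLinearMap.snd ℂ Vec (Vec × Vec)).comp
      (ContinuousLinearMap.snd ℂ Vec (Vec × Vec × Vec))).analyticAt p
  have hpair : ∀ {a b : Phase → ℂ}, AnalyticAt ℂ a p → AnalyticAt ℂ b p →
      AnalyticAt ℂ (fun p => (![a p, b p] : Vec)) p := fun ha hb =>
    AnalyticAt.pi (f := fun j p => (![_, _] : Vec) j) (Fin.forall_fin_two.2 ⟨ha, hb⟩)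
  exact (hpair ((hJ 0).fun_add (analyticAt_const.fun_mul (hJ 1))) (hJ 1)).prod
    ((hpair hφ analyticAt_const).prod hx)

theorem flat_mem_domainAt (hε : 0 < ε) (hσ : 0 < σ) {q : ℝ} (hq : 0 ≤ q) {p : Phase}
    (hp : p ∈ domainAt Δ σ β ε q) : flat p ∈ domainAt Δ σ β ε q := by
  rw [mem_domainAt_iff hε hσ hq] at hp ⊢
  rw [← flat_scale]
  exact flat_mem_zone hp

theorem reducedPoint_mem_domainAt (hm : 0 < m 0) (hm' : m 0 ≤ m 1) (hε : 0 < ε) (hσ : 0 < σ)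
    {p : Phase} (hp : p ∈ domainAt Δ σ β ε (1 / 6)) :
    reducedPoint m p.1 (p.2.1 0) p.2.2.1 p.2.2.2 ∈ domainAt Δ σ β ε (1 / 4) :=
  flat_mem_domainAt hε hσ (by norm_num)
    (Psi_mem_domainAt (kappa_mem hm hm') hσ hε (by norm_num) (by norm_num) hp).1

theorem Hbar_flat (Υ : Phase → Phase) (p : Phase) :
    Hbar m₀ m υ₀ ε Υ (flat p) = Hbar m₀ m υ₀ ε Υ p := rfl

theorem inv_ell (hm₀ : 0 < m₀) (hυ₀ : 0 < υ₀) :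
    (ell m₀ υ₀)⁻¹ = υ₀ ^ (1 / 3 : ℝ) * m₀ ^ (-(2 / 3) : ℝ) := by
  rw [ell, mul_inv, ← Real.rpow_neg hm₀.le, ← Real.rpow_neg hυ₀.le, neg_neg, mul_comm]

/-- Completing the square with `κ = m₁ / (m₁ + m₂)` separates the two actions. -/
theorem kepler_quadratic_eq (hm₀ : 0 < m₀) (hm : 0 < m 0) (hm' : m 0 ≤ m 1) (hυ₀ : 0 < υ₀)
    (a b : ℂ) :
    υ₀ * b - 3 / 2 * υ₀ * ((a + kappa m * b) ^ 2 / (m 0 * ell m₀ υ₀)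
      + (b - (a + kappa m * b)) ^ 2 / (m 1 * ell m₀ υ₀))
      = υ₀ * (-constA m₀ m υ₀ * a ^ 2) + H2 m₀ m υ₀ b := by
  have hm1 : 0 < m 1 := hm.trans_le hm'
  have hl := ell_pos hm₀ hυ₀
  have hA : constA m₀ m υ₀ = 3 / 2 * (ell m₀ υ₀)⁻¹ * (1 / m 0 + 1 / m 1) := by
    rw [constA, inv_ell hm₀ hυ₀]; ring
  have hE : constE m₀ m υ₀ = 3 / 2 * (ell m₀ υ₀)⁻¹ * (m 0 + m 1)⁻¹ := by
    rw [constE, inv_ell hm₀ hυ₀]; ring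
  rw [H2, hA, hE, kappa]
  push_cast
  have h0 : (m 0 : ℂ) ≠ 0 := by exact_mod_cast hm.ne'
  have h1 : (m 1 : ℂ) ≠ 0 := by exact_mod_cast hm1.ne'
  have h2 : (m 0 : ℂ) + m 1 ≠ 0 := by exact_mod_cast (add_pos hm hm1).ne'
  have h3 : (ell m₀ υ₀ : ℂ) ≠ 0 := by exact_mod_cast hl.ne'
  field_simp
  ring

/-- The averaged Hamiltonian ignores the fast angle, so the decomposition is pulled back at points
whose fast angle has been set to zero. This makes the remainder and its coefficients functions of
the actions, the first angle and the eccentricities alone. -/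
theorem exists_reduced_hamiltonian (hm₀ : 0 < m₀) (hm : 0 < m 0) (hm' : m 0 ≤ m 1)
    (hυ₀ : 0 < υ₀) (hσ : 0 < σ) (hσΔ : σ < Δ) (hβ : 1 / 7 < β) (hβ' : β < 1 / 2) {C₁ : ℝ}
    (hC₁ : 0 < C₁) :
    ∃ C > 0, ∃ ε₀ > 0, ∀ ε : ℝ, 0 < ε → ε < ε₀ → ∀ Υ : Phase → Phase,
      IsFirstAveraging m₀ m υ₀ Δ σ β ε C₁ Υ →
      ∃ (R : Vec → ℂ → Vec → Vec → ℂ) (R₀ : Vec → ℂ → ℂ)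
        (R₂ : Fin 2 → Fin 2 → Vec → ℂ → Vec → Vec → ℂ),
        AnalyticOnNhd ℂ (fun p : Phase => R₀ p.1 (p.2.1 0)) (domainAt Δ σ β ε (1 / 6)) ∧
        (∀ j k, AnalyticOnNhd ℂ (fun p : Phase => R₂ j k p.1 (p.2.1 0) p.2.2.1 p.2.2.2)
          (domainAt Δ σ β ε (1 / 6))) ∧
        (∀ J φ w wt, (J, φ, w, wt) ∈ domainAt Δ σ β ε (1 / 6) →
          Hbar m₀ m υ₀ ε Υ (Psi m (J, φ, w, wt)) - HK m₀ m υ₀ ε 0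
            = H1 m₀ m υ₀ ε (J 0) (φ 0) + H2 m₀ m υ₀ (J 1) + Qform m₀ m υ₀ ε (φ 0) w wt
              + R J (φ 0) w wt ∧
          R J (φ 0) w wt = R₀ J (φ 0) + ∑ j, ∑ k, R₂ j k J (φ 0) w wt * w j * wt k ∧
          ‖R J (φ 0) w wt‖ ≤ C * ε ^ (3 * β)) ∧
        (1 / 3 < β → ∀ j k J φ w wt, (J, φ, w, wt) ∈ domainAt Δ σ β ε (1 / 6) →
          ‖R₂ j k J (φ 0) w wt‖ ≤ C * ε ^ (2 - 2 * β)) := by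
  obtain ⟨C, hC, ε₀, hε₀, H⟩ := exists_averaged_decomposition hm₀
    (Fin.forall_fin_two.2 ⟨hm, hm.trans_le hm'⟩) hυ₀ hσ hσΔ hβ hβ' hC₁
  -- `C` pays for the part at zero eccentricity, 8 C (σ/4)² for the four coefficient terms, and 2 C
  -- for the separate bound on the coefficients.
  refine ⟨C + 8 * C * (σ / 4) ^ 2 + 2 * C, by positivity, ε₀, hε₀, fun ε hε hεε₀ Υ hΥ => ?_⟩
  obtain ⟨hε1, H'⟩ := H ε hε hεε₀
  obtain ⟨g₀, g₂, hg₀, hg₂, hdec⟩ := H' Υ hΥ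
  have hmem := fun p (hp : p ∈ domainAt Δ σ β ε (1 / 6)) =>
    reducedPoint_mem_domainAt hm hm' hε hσ hp
  have hshrink : ∀ p ∈ domainAt Δ σ β ε (1 / 6), shrink 0 0 p ∈ domainAt Δ σ β ε (1 / 6) :=
    fun p hp => ⟨hp.1, hp.2.1, (norm_shrink_snd_le (by simp) (by simp) p).trans hp.2.2⟩
  set R₀ : Vec → ℂ → ℂ := fun J φ => g₀ (reducedPoint m J φ 0 0)
  set R₂ : Fin 2 → Fin 2 → Vec → ℂ → Vec → Vec → ℂ := fun j k J φ w wt =>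
    g₂ j k (reducedPoint m J φ w wt)
  have hlow : ∀ e : ℝ, 3 * β ≤ e → ε ^ e ≤ ε ^ (3 * β) := fun e he =>
    Real.rpow_le_rpow_of_exponent_ge hε hε1 he
  refine ⟨fun J φ w wt => R₀ J φ + ∑ j, ∑ k, R₂ j k J φ w wt * w j * wt k, R₀, R₂, ?_, ?_, ?_, ?_⟩
  · intro p hp
    have h1 : AnalyticAt ℂ (fun p : Phase => reducedPoint m p.1 (p.2.1 0) 0 0) p := by
      have hs : AnalyticAt ℂ (shrink 0 0) p :=
        (((ContinuousLinearMap.fst ℂ Vec (Vec × Vec × Vec)).analyticAt p).prod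
          (((ContinuousLinearMap.fst ℂ Vec (Vec × Vec)).comp
            (ContinuousLinearMap.snd ℂ Vec (Vec × Vec × Vec))).analyticAt p |>.prod
            analyticAt_const)).congr (.of_forall fun q => by
              simp [shrink]; rfl)
      have h2 := (analyticAt_reducedPoint m (shrink 0 0 p)).fun_comp hs
      simpa [shrink] using h2
    exact (hg₀ _ (by simpa [shrink] using hmem _ (hshrink p hp))).fun_comp
      (f := fun p : Phase => reducedPoint m p.1 (p.2.1 0) 0 0) h1
  · intro j k p hp
    exact (hg₂ j k _ (hmem p hp)).fun_comp
      (f := fun p : Phase => reducedPoint m p.1 (p.2.1 0) p.2.2.1 p.2.2.2)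
      (analyticAt_reducedPoint m p)
  · intro J φ w wt hp
    obtain ⟨d1, d2, d3⟩ := hdec _ (hmem _ hp)
    dsimp only at d1 d2 d3
    rw [shrink_zero_reducedPoint] at d1 d2
    refine ⟨?_, rfl, ?_⟩
    · rw [← Hbar_flat, flat_Psi]
      refine (d1 rfl).trans ?_
      have := kepler_quadratic_eq hm₀ hm hm' hυ₀ (J 0) (J 1)
      simp only [reducedPoint, Matrix.cons_val_zero, Matrix.cons_val_one] at this ⊢
      rw [this, H1]
      simp only [R₀, R₂, reducedPoint]
      ring
    · have hx : ‖((w, wt) : Vec × Vec)‖ ^ 2 ≤ (σ / 4) ^ 2 * ε ^ β := by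
        have h1 := pow_le_pow_left₀ (norm_nonneg _) (hmem _ hp).2.2 2
        rw [Real.sq_sqrt (by positivity)] at h1
        exact h1.trans_eq (by ring)
      -- The product of two eccentricities contributes ε^β, which raises the exponents of the
      -- coefficients to 2 - β and 1 + 2β; both are at least 3β.
      have h2 : ∀ j k, ‖R₂ j k J (φ 0) w wt * w j * wt k‖
          ≤ 2 * C * (σ / 4) ^ 2 * ε ^ (3 * β) := fun j k => by
        have hw : ‖w j‖ * ‖wt k‖ ≤ (σ / 4) ^ 2 * ε ^ β := by
          refine le_trans ?_ hx
          rw [sq]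
          exact mul_le_mul ((norm_le_pi_norm w j).trans (norm_fst_le (w, wt)))
            ((norm_le_pi_norm wt k).trans (norm_snd_le (w, wt))) (norm_nonneg _) (norm_nonneg _)
        rw [norm_mul, norm_mul, mul_assoc]
        calc _ ≤ C * (ε ^ (2 - 2 * β) + ε ^ (1 + β)) * ((σ / 4) ^ 2 * ε ^ β) :=
              mul_le_mul (d3 j k) hw (by positivity) (by positivity)
          _ = C * (σ / 4) ^ 2 * (ε ^ (2 - 2 * β + β) + ε ^ (1 + β + β)) := by
              rw [Real.rpow_add hε (2 - 2 * β) β, Real.rpow_add hε (1 + β) β]; ring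
          _ ≤ C * (σ / 4) ^ 2 * (ε ^ (3 * β) + ε ^ (3 * β)) := by
              gcongr C * (σ / 4) ^ 2 * (?_ + ?_)
              · exact hlow _ (by linarith)
              · exact hlow _ (by linarith)
          _ = _ := by ring
      have h3 : 0 < ε ^ (3 * β) := Real.rpow_pos_of_pos hε _
      calc _ ≤ ‖R₀ J (φ 0)‖ + ∑ j : Fin 2, ∑ k : Fin 2, ‖R₂ j k J (φ 0) w wt * w j * wt k‖ :=
            (norm_add_le _ _).trans (add_le_add_right ((norm_sum_le _ _).trans
              (Finset.sum_le_sum fun j _ => norm_sum_le _ _)) _)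
        _ ≤ C * ε ^ (3 * β) + ∑ _j : Fin 2, ∑ _k : Fin 2, 2 * C * (σ / 4) ^ 2 * ε ^ (3 * β) :=
            add_le_add d2 (Finset.sum_le_sum fun j _ => Finset.sum_le_sum fun k _ => h2 j k)
        _ ≤ _ := by
            simp only [Fin.sum_univ_two]
            nlinarith [mul_pos hC h3]
  · intro hβ3 j k J φ w wt hp
    -- For β > 1/3 the exponent 1 + β exceeds 2 - 2β, so the averaged H_* dominates the error of the
    -- perturbation.
    have h1 : ε ^ (1 + β) ≤ ε ^ (2 - 2 * β) :=
      Real.rpow_le_rpow_of_exponent_ge hε hε1 (by linarith)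
    have h2 : 0 < ε ^ (2 - 2 * β) := Real.rpow_pos_of_pos hε _
    calc _ ≤ C * (ε ^ (2 - 2 * β) + ε ^ (1 + β)) := (hdec _ (hmem _ hp)).2.2 j k
      _ ≤ C * (ε ^ (2 - 2 * β) + ε ^ (2 - 2 * β)) := by gcongr
      _ = 2 * C * ε ^ (2 - 2 * β) := by ring
      _ ≤ _ := by
          gcongr
          have : 0 ≤ C + 8 * C * (σ / 4) ^ 2 := by positivity
          linarith

end ReducedHamiltonian

end Coorbital

theorem theorem3 (m₀ υ₀ : ℝ) (m : Fin 2 → ℝ) (hm₀ : 0 < m₀) (hm : 0 < m 0) (hm' : m 0 ≤ m 1)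
    (hυ₀ : 0 < υ₀) :
    -- the linear change of variables is symplectic and compatible with the domains
    ((∀ u v : Coorbital.Phase,
        Coorbital.sympl (Coorbital.Psi m u) (Coorbital.Psi m v) = Coorbital.sympl u v) ∧
      ∀ Δ σ₀ β ε : ℝ, 0 < Δ → 0 < σ₀ → 0 < ε →
        Coorbital.domainAt Δ σ₀ β ε (1 / 18)
            ⊆ Coorbital.Psi m '' Coorbital.domainAt Δ σ₀ β ε (1 / 6) ∧
        Coorbital.Psi m '' Coorbital.domainAt Δ σ₀ β ε (1 / 6)
            ⊆ Coorbital.domainAt Δ σ₀ β ε (1 / 4)) ∧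
    ∃ c > 0, ∀ Δ σ₀ β : ℝ, 0 < Δ → 0 < σ₀ → σ₀ ≤ c * Δ → 1 / 7 < β → β < 1 / 2 →
      -- first averaging transformations exist
      (∃ C > 0, ∃ ε₀ > 0, ∀ ε : ℝ, 0 < ε → ε < ε₀ →
        ∃ Υ : Coorbital.Phase → Coorbital.Phase,
          Coorbital.IsFirstAveraging m₀ m υ₀ Δ σ₀ β ε C Υ) ∧
      -- and each of them leads to the reduced Hamiltonian
      (∀ C₁ > 0, ∃ C > 0, ∃ ε₀ > 0, ∀ ε : ℝ, 0 < ε → ε < ε₀ →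
        ∀ Υ : Coorbital.Phase → Coorbital.Phase,
          Coorbital.IsFirstAveraging m₀ m υ₀ Δ σ₀ β ε C₁ Υ →
          ∃ (R : Coorbital.Vec → ℂ → Coorbital.Vec → Coorbital.Vec → ℂ)
            (R₀ : Coorbital.Vec → ℂ → ℂ)
            (R₂ : Fin 2 → Fin 2 → Coorbital.Vec → ℂ → Coorbital.Vec → Coorbital.Vec → ℂ),
            AnalyticOnNhd ℂ (fun p : Coorbital.Phase => R₀ p.1 (p.2.1 0))
              (Coorbital.domainAt Δ σ₀ β ε (1 / 6)) ∧
            (∀ j k, AnalyticOnNhd ℂ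
              (fun p : Coorbital.Phase => R₂ j k p.1 (p.2.1 0) p.2.2.1 p.2.2.2)
              (Coorbital.domainAt Δ σ₀ β ε (1 / 6))) ∧
            (∀ J φ w wt, (J, φ, w, wt) ∈ Coorbital.domainAt Δ σ₀ β ε (1 / 6) →
              Coorbital.Hbar m₀ m υ₀ ε Υ (Coorbital.Psi m (J, φ, w, wt))
                  - Coorbital.HK m₀ m υ₀ ε 0
                = Coorbital.H1 m₀ m υ₀ ε (J 0) (φ 0) + Coorbital.H2 m₀ m υ₀ (J 1)
                  + Coorbital.Qform m₀ m υ₀ ε (φ 0) w wt + R J (φ 0) w wt ∧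
              R J (φ 0) w wt
                = R₀ J (φ 0) + ∑ j, ∑ k, R₂ j k J (φ 0) w wt * w j * wt k ∧
              ‖R J (φ 0) w wt‖ ≤ C * ε ^ (3 * β)) ∧
            (1 / 3 < β → ∀ j k J φ w wt,
              (J, φ, w, wt) ∈ Coorbital.domainAt Δ σ₀ β ε (1 / 6) →
              ‖R₂ j k J (φ 0) w wt‖ ≤ C * ε ^ (2 - 2 * β))) := by
  have hM : ∀ j, 0 < m j := Fin.forall_fin_two.2 ⟨hm, hm.trans_le hm'⟩
  refine ⟨⟨Coorbital.sympl_Psi, fun Δ σ₀ β ε _ hσ hε => Coorbital.Psi_image hm hm' hσ hε⟩,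
    -- Any constant below 1 would do: only σ₀ < Δ is used, to keep the complex angles away from
    -- collision.
    1 / 2, by norm_num, fun Δ σ₀ β hΔ hσ hσΔ hβ hβ' => ?_⟩
  have hlt : σ₀ < Δ := by linarith
  exact ⟨Coorbital.exists_isFirstAveraging hm₀ hM hυ₀ hσ hlt hβ hβ', fun C₁ hC₁ =>
    Coorbital.exists_reduced_hamiltonian hm₀ hm hm' hυ₀ hσ hlt hβ hβ' hC₁⟩
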